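/- **Theorem (Widder's theorem, global version).** Let $(X,d)$ be a separable, locally compact, connected, locally connected metric space, $\mu$ a positive Radon measure on $X$ with full support, and $(\mathcal E,\mathbb D)$ a symmetric, regular, strictly local Dirichlet form on $L^2(X,\mu)$ ("strictly local": $\mathcal E(f,g)=0$ whenever $f,g\in\mathbb D$ have compact supports and $f$ is constant on a neighbourhood of $\operatorname{supp} g$). Let $L\ge 0$ be its generator, $\mathcal E(f,g)=\langle Lf,g\rangle$, and $P_t=e^{-tL}$ its heat semigroup. Regard $\mathbb D$ as a Hilbert space with the inner product $\mathcal E_1(f,g)=\mathcal E(f,g)+\int_X fg\,d\mu$, so that $\mathbb D\subset L^2(X,\mu)\subset\mathbb D^*$, and for an open interval $I\subset\mathbb R$ let $W^{1,2}(I;\mathbb D,\mathbb D^*)$ be the space of $v\in L^2(I;\mathbb D)$ with weak time derivative $v'\in L^2(I;\mathbb D^*)$. For an open interval $I$ and an open set $U\subset X$, a measurable function $u$ on $I\times U$ is a *local weak solution* (of the heat equation $\partial_tu+Lu=0$) if for every compact $K\subset I\times U$ there is $u_K\in W^{1,2}(I;\mathbb D,\mathbb D^*)$ with $u=u_K$ a.e.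 on $K$ and $$\int_I (u_K'(t),\phi(t))_{\mathbb D^*,\mathbb D}\,dt+\int_I\mathcal E(u_K(t),\phi(t))\,dt=0$$ for every $\phi\in W^{1,2}(I;\mathbb D,\mathbb D^*)$ with support in $K$. Here and below, real functions of $(t,x)$ are identified when they agree $dt\otimes\mu$-almost everywhere; in particular "nonnegative" means nonnegative almost everywhere. Assume moreover: 1. (Parabolic Harnack inequality) for all $U\subset X$ open and connected, $K\subset U$ compact and $0<a<b<c<d<T'<\infty$ there is a finite constant $C$ such that every nonnegative local weak solution $u$ on $(0,T')\times U$ satisfies $\operatorname{ess\,sup}_{[a,b]\times K}u\le C\operatorname{ess\,inf}_{[c,d]\times K}u$; 2. (continuous heat kernel) there is a continuous $p:(0,\infty)\times X\times X\to\mathbb R$ such that for all $t>0$ and $f\in L^2(X,\mu)$, $P_tf(x)=\int_X p(t,x,y)f(y)\,\mu(dy)$ for $\mu$-a.e. $x$; 3. for every $f\in C_c(X)$ and **every** $x\in X$, $P_tf(x)=\int_X p(t,x,y)f(y)\,\mu(dy)\to f(x)$ as $t\downarrow0$; 4. there is an increasing sequence of open, precompact, connected, nice sets with union $X$, where an open set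 $U$ is *nice* if for every compact $K\subset U$ there is $\psi:X\to[0,1]$ with $\psi=1$ on $K$, with compact support inside $U$, and with $\psi f\in\mathbb D$ for all $f\in\mathbb D$. For a positive Radon measure $\nu$ on $X$ put $P_t\nu(x)=\int_Xp(t,x,y)\,\nu(dy)\in[0,\infty]$. Let $0<T\le\infty$ and let $u$ be a nonnegative local weak solution on $(0,T)\times X$. Then there exist a unique positive Radon measure $\nu$ on $X$ (possibly infinite) and a unique nonnegative local weak solution $h$ on $(-\infty,T)\times X$ vanishing for $t\le 0$ such that $$u(t,x)=P_t\nu(x)+h(t,x),\qquad t\in(0,T),\ x\in X .$$ Uniqueness of the pair $(\nu,h)$ holds with the last identity required only almost everywhere, and $h$ is unique up to equality almost everywhere. For a suitable representative of $h$ the identity holds at every point of $(0,T)\times X$, with $P_t\nu(x)<\infty$ there, and $h(t,x)=0$ for all $t\le0$ and all $x\in X$. -/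

import Mathlib

open MeasureTheory Filter Topology Set
open scoped ENNReal NNReal ContDiff

namespace Widder

/-- A symmetric Dirichlet form on `L²(X, μ)`: a densely defined, symmetric, nonnegative, closed
bilinear form on which the unit contraction operates. -/
structure DirichletForm {X : Type*} [MeasurableSpace X] (μ : Measure X) where
  /-- The domain of the form. -/
  domain : Submodule ℝ (Lp ℝ 2 μ)
  /-- The form itself. -/
  form : domain →ₗ[ℝ] domain →ₗ[ℝ] ℝ
  dense_domain : Dense (domain : Set (Lp ℝ 2 μ))
  symm : ∀ f g, form f g = form g f
  nonneg : ∀ f, 0 ≤ form f f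
  /-- Closedness: the domain is complete for `form f f + ‖f‖²`. -/
  closed : ∀ f : ℕ → domain,
    (∀ ε > 0, ∃ N, ∀ m ≥ N, ∀ n ≥ N,
      form (f m - f n) (f m - f n) + ‖(f m : Lp ℝ 2 μ) - f n‖ ^ 2 < ε) →
    ∃ g : domain, Tendsto
      (fun n => form (f n - g) (f n - g) + ‖(f n : Lp ℝ 2 μ) - g‖ ^ 2) atTop (𝓝 0)
  /-- Markov property. -/
  markov : ∀ f : domain, ∃ g : domain,
    (∀ᵐ x ∂μ, (g : Lp ℝ 2 μ) x = min (max ((f : Lp ℝ 2 μ) x) 0) 1) ∧ form g g ≤ form f f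

/-- The set of real times `t` with `a < t < b`, where `a` and `b` may be infinite. -/
def timeIoo (a b : EReal) : Set ℝ := {t : ℝ | a < (t : EReal) ∧ (t : EReal) < b}

/-- `P_t ν (x) = ∫ p(t, x, y) ν(dy)`, as an extended nonnegative number. -/
noncomputable def heatMeasure {X : Type*} [MeasurableSpace X] (p : ℝ → X → X → ℝ)
    (ν : Measure X) (t : ℝ) (x : X) : ℝ≥0∞ :=
  ∫⁻ y, ENNReal.ofReal (p t x y) ∂ν

namespace DirichletForm

section Hilbert

variable {X : Type*} [MeasurableSpace X] {μ : Measure X} (E : DirichletForm μ)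

/-- The domain of the form, as a type that carries the inner product
`form f g + ⟨f, g⟩` (and not the one of `L²`). -/
def Dom : Type _ := E.domain

/-- The inner product `form f g + ⟨f, g⟩`. -/
@[reducible] noncomputable def domCore : InnerProductSpace.Core ℝ E.domain where
  inner f g := E.form f g + inner ℝ (f : Lp ℝ 2 μ) (g : Lp ℝ 2 μ)
  conj_inner_symm f g := by
    simp only [conj_trivial]
    rw [E.symm g f, real_inner_comm]
  re_inner_nonneg f := add_nonneg (E.nonneg f) real_inner_self_nonneg
  add_left f g k := by
    simp only [map_add, LinearMap.add_apply, Submodule.coe_add, inner_add_left]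
    ring
  smul_left f g r := by
    simp only [map_smul, LinearMap.smul_apply, Submodule.coe_smul, real_inner_smul_left,
      smul_eq_mul, conj_trivial]
    ring
  definite f hf := by
    have h1 : 0 ≤ E.form f f := E.nonneg f
    have h2 : 0 ≤ inner ℝ (f : Lp ℝ 2 μ) (f : Lp ℝ 2 μ) := real_inner_self_nonneg
    have h3 : E.form f f + inner ℝ (f : Lp ℝ 2 μ) (f : Lp ℝ 2 μ) = 0 := hf
    have h4 : inner ℝ (f : Lp ℝ 2 μ) (f : Lp ℝ 2 μ) = 0 := by linarith
    exact Subtype.ext (inner_self_eq_zero.1 h4)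

noncomputable instance : NormedAddCommGroup E.Dom :=
  @InnerProductSpace.Core.toNormedAddCommGroup ℝ E.domain _ _ _ E.domCore

noncomputable instance : InnerProductSpace ℝ E.Dom :=
  @InnerProductSpace.ofCore ℝ E.domain _ _ _ E.domCore.toCore

/-- The inclusion of the domain in `L²(X, μ)`. -/
noncomputable def toL2 : E.Dom →ₗ[ℝ] Lp ℝ 2 μ where
  toFun f := E.domain.subtype f
  map_add' _ _ := rfl
  map_smul' _ _ := rfl

/-- The form on its domain. -/
noncomputable def energy : E.Dom →ₗ[ℝ] E.Dom →ₗ[ℝ] ℝ :=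
  LinearMap.mk₂ ℝ (fun f g => E.form f g) (fun f g k => E.form.map_add₂ f g k)
    (fun r f g => E.form.map_smul₂ r f g) (fun f g k => (E.form f).map_add g k)
    (fun r f g => (E.form f).map_smul r g)

/-- `f` lies in the domain of the (positive) generator `L` of the form, and `L f = g`. -/
def IsGenerator (f g : Lp ℝ 2 μ) : Prop :=
  ∃ f' : E.Dom, E.toL2 f' = f ∧ ∀ φ : E.Dom, E.energy f' φ = inner ℝ g (E.toL2 φ)

/-- `P` is the strongly continuous semigroup on `L²(X, μ)` whose infinitesimal generator
is `-L`. -/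
structure IsHeatSemigroup (P : ℝ≥0 → Lp ℝ 2 μ →L[ℝ] Lp ℝ 2 μ) : Prop where
  zero : P 0 = ContinuousLinearMap.id ℝ (Lp ℝ 2 μ)
  add : ∀ s t, P (s + t) = (P s).comp (P t)
  tendsto_zero : ∀ f, Tendsto (fun t => P t f) (𝓝 0) (𝓝 f)
  generator : ∀ f g,
    Tendsto (fun t : ℝ≥0 => (t : ℝ)⁻¹ • (f - P t f)) (𝓝[>] 0) (𝓝 g) ↔ E.IsGenerator f g

open Classical in
/-- The heat semigroup of the form, that is, the one strongly continuous semigroup that is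
generated by `-L`. (It exists and is unique because `L` is self-adjoint and nonnegative.) -/
noncomputable def semigroup (t : ℝ≥0) : Lp ℝ 2 μ →L[ℝ] Lp ℝ 2 μ :=
  if h : ∃ P, E.IsHeatSemigroup P then h.choose t else 0

/-- `u` belongs to the vector-valued Sobolev space `W^{1,2}(I; 𝔻, 𝔻*)` over the time
interval `I`, with weak time derivative `u'`. The Hilbert space `𝔻` is `E.Dom`, and `L²` is
embedded in its dual by `f ↦ ⟨f, ·⟩`. -/
structure IsW12 (I : Set ℝ) (u : ℝ → E.Dom) (u' : ℝ → (E.Dom →L[ℝ] ℝ)) : Prop where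
  memLp : MemLp u 2 (volume.restrict I)
  memLp_deriv : MemLp u' 2 (volume.restrict I)
  weak_deriv : ∀ χ : ℝ → ℝ, ContDiff ℝ ∞ χ → HasCompactSupport χ → tsupport χ ⊆ I →
    ∀ f : E.Dom, ∫ t in I, χ t * u' t f
      = - ∫ t in I, deriv χ t * inner ℝ (E.toL2 (u t)) (E.toL2 f)

end Hilbert

variable {X : Type*} [TopologicalSpace X] [MeasurableSpace X] {μ : Measure X}
  (E : DirichletForm μ)

/-- The (class of the) function `φ` lies in the domain. -/
def MemDom (φ : X → ℝ) : Prop := ∃ g : E.Dom, E.toL2 g =ᵐ[μ] φ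

/-- Regularity: the continuous compactly supported functions in the domain are dense in the
domain, and uniformly dense in the continuous compactly supported functions. -/
def IsRegular : Prop :=
  (∀ f : E.Dom, ∀ ε > 0, ∃ g : E.Dom, ∃ φ : X → ℝ,
    Continuous φ ∧ HasCompactSupport φ ∧ E.toL2 g =ᵐ[μ] φ ∧ ‖f - g‖ < ε) ∧
  (∀ φ : X → ℝ, Continuous φ → HasCompactSupport φ → ∀ ε > 0, ∃ ψ : X → ℝ,
    Continuous ψ ∧ HasCompactSupport ψ ∧ E.MemDom ψ ∧ ∀ x, |φ x - ψ x| < ε)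

/-- Strict locality: `form f g = 0` whenever `f, g` are in the domain, have compact supports and
`f` is constant on a neighbourhood of the support of `g`. (For closed `K`, the support of an
`L²` function lies in `K` exactly when the function vanishes a.e. off `K`.) -/
def IsStrictlyLocal : Prop :=
  ∀ f g : E.Dom, ∀ K₁ K₂ V : Set X, ∀ c : ℝ, IsCompact K₁ → IsCompact K₂ → IsOpen V → K₂ ⊆ V →
    (∀ᵐ x ∂μ, x ∉ K₁ → E.toL2 f x = 0) → (∀ᵐ x ∂μ, x ∉ K₂ → E.toL2 g x = 0) →
    (∀ᵐ x ∂μ, x ∈ V → E.toL2 f x = c) → E.energy f g = 0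

/-- `u` is a local weak solution of the heat equation `∂ₜu + Lu = 0` on `I × U`. -/
structure IsLocalWeakSolution (I : Set ℝ) (U : Set X) (u : ℝ × X → ℝ) : Prop where
  aestronglyMeasurable : AEStronglyMeasurable u ((volume.restrict I).prod (μ.restrict U))
  exists_local : ∀ K : Set (ℝ × X), IsCompact K → K ⊆ I ×ˢ U →
    ∃ (v : ℝ → E.Dom) (v' : ℝ → (E.Dom →L[ℝ] ℝ)), E.IsW12 I v v' ∧
      (∀ᵐ t ∂volume.restrict I, ∀ᵐ x ∂μ, (t, x) ∈ K → u (t, x) = E.toL2 (v t) x) ∧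
      ∀ (φ : ℝ → E.Dom) (φ' : ℝ → (E.Dom →L[ℝ] ℝ)), E.IsW12 I φ φ' →
        (∀ᵐ t ∂volume.restrict I, ∀ᵐ x ∂μ, (t, x) ∉ K → E.toL2 (φ t) x = 0) →
        (∫ t in I, v' t (φ t)) + ∫ t in I, E.energy (v t) (φ t) = 0

/-- The (local) parabolic Harnack inequality. -/
def ParabolicHarnack : Prop :=
  ∀ U K : Set X, IsOpen U → IsConnected U → IsCompact K → K ⊆ U →
    ∀ a b c d T : ℝ, 0 < a → a < b → b < c → c < d → d < T →
      ∃ C : ℝ≥0, ∀ u : ℝ × X → ℝ, E.IsLocalWeakSolution (Ioo 0 T) U u →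
        (∀ᵐ z ∂(volume.restrict (Ioo 0 T)).prod (μ.restrict U), 0 ≤ u z) →
        essSup (fun z => ENNReal.ofReal (u z)) ((volume.restrict (Icc a b)).prod (μ.restrict K))
          ≤ C * essInf (fun z => ENNReal.ofReal (u z))
              ((volume.restrict (Icc c d)).prod (μ.restrict K))

/-- `p` is a continuous heat kernel for the heat semigroup of the form. Only the values `p t x y`
with `t > 0` matter. -/
structure IsContinuousHeatKernel (p : ℝ → X → X → ℝ) : Prop where
  continuousOn :
    ContinuousOn (fun z : ℝ × X × X => p z.1 z.2.1 z.2.2) (Ioi (0 : ℝ) ×ˢ univ)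
  semigroup_eq : ∀ t : ℝ≥0, 0 < t → ∀ f : Lp ℝ 2 μ, ∀ᵐ x ∂μ,
    Integrable (fun y => p t x y * f y) μ ∧ E.semigroup t f x = ∫ y, p t x y * f y ∂μ

/-- `ψ` is a nice cutoff function for `K` inside `U`. -/
structure IsNiceCutoff (ψ : X → ℝ) (K U : Set X) : Prop where
  mem_Icc : ∀ x, ψ x ∈ Icc (0 : ℝ) 1
  eq_one : ∀ x ∈ K, ψ x = 1
  hasCompactSupport : HasCompactSupport ψ
  tsupport_subset : tsupport ψ ⊆ U
  mul_mem : ∀ f : E.Dom, E.MemDom (fun x => ψ x * E.toL2 f x)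

/-- `U` is nice: each of its compact subsets has a nice cutoff function inside `U`. -/
def IsNice (U : Set X) : Prop :=
  ∀ K : Set X, IsCompact K → K ⊆ U → ∃ ψ : X → ℝ, E.IsNiceCutoff ψ K U

/-- `X` has an increasing exhaustion by open, precompact, connected, nice sets. -/
def HasNiceExhaustion : Prop :=
  ∃ U : ℕ → Set X, Monotone U ∧ (⋃ n, U n) = univ ∧
    ∀ n, IsOpen (U n) ∧ IsCompact (closure (U n)) ∧ IsConnected (U n) ∧ E.IsNice (U n)

/-- `u = P_t ν + h` a.e. on `(0, T) × X`, where `ν` is a positive Radon measure and `h` is a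
nonnegative local weak solution on `(-∞, T) × X` that vanishes for `t ≤ 0`. Functions are
taken up to `dt ⊗ μ`-null sets. -/
structure IsWidderDecomposition (p : ℝ → X → X → ℝ) (T : EReal) (u : ℝ × X → ℝ)
    (ν : Measure X) (h : ℝ × X → ℝ) : Prop where
  regular : ν.Regular
  solution : E.IsLocalWeakSolution (timeIoo ⊥ T) univ h
  nonneg : ∀ᵐ z ∂(volume.restrict (timeIoo ⊥ T)).prod μ, 0 ≤ h z
  initial : ∀ᵐ z ∂(volume.restrict (Iic (0 : ℝ))).prod μ, h z = 0
  eq_add : ∀ᵐ z ∂(volume.restrict (timeIoo 0 T)).prod μ,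
    ENNReal.ofReal (u z) = heatMeasure p ν z.1 z.2 + ENNReal.ofReal (h z)

end DirichletForm

end Widder

/-!
Every nonnegative weak solution is the heat flow of an initial measure plus a nonnegative weak
solution that vanishes up to time zero. The proof recovers the measure as a vague limit of the
solution at small times, and obtains the second summand as a limit of differences.

Cut off by a nice function and mollified in time, a weak solution (`IsWeakSolution`,
`IsWeakCurve`) becomes a classical one (`IsWeakCurve.exists_hasDerivAt_mollify`). The heat
semigroup is the limit of the exponentials of the Yosida approximations, and the resolvents with
Dirichlet conditions on an exhaustion converge to the full resolvent. This leads to the comparison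
`IsWeakSolution.semigroup_le`: a nonnegative weak solution dominates the heat flow of every
function that it dominates at an earlier time. The boundary term has the right sign because
potentials with Dirichlet conditions, extended by zero, are subharmonic
(`IsHeatSemigroup.energy_resolvent_add_le`).

*Existence.* `initialMeasure μ u j` has as density the solution mollified in time around
`2 * radius j`. Comparison bounds its mass on compact sets (`IsBoundedSolution.exists_mass_bound`),
so a subsequence converges vaguely to a measure `ν` (`IsBoundedSolution.exists_isInitialLimit`).
Subtracting from the solution the heat flow of its cut-off initial value and extending by zero to
negative times gives `remainder`, again a weak solution, nonnegative by comparison and locally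
bounded by the Harnack inequality (`exists_remainder_le`). By the Caccioppoli inequality
(`IsWeakCurve.lintegral_energy_le`) pointwise limits of locally bounded weak solutions are weak
solutions (`isWeakSolution_of_tendsto`), so `u - P_t ν` is one (`IsInitialLimit.residual_spec`).

*Uniqueness.* A weak solution that vanishes at negative times has initial value zero
(`IsWeakCurve.tendsto_zero`). Hence a decomposition with measure `ν'` expresses the approximate
initial measures through integrals of averaged heat flows (`averageFlow`) against `ν'`, up to an
error that tends to zero. Fatou's lemma gives `ν' ≤ ν` (`IsInitialLimit.le_of_averageFlow_le`).
Conversely, on splitting the integrals into a part near the support of the test function and a part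
far from it, the far part for `ν'` is at most that for `ν`, so the near parts, which converge,
compare the other way (`IsInitialLimit.ge_of_averageFlow_add`). Once the measures agree, so do the
second summands, since the heat flow is finite everywhere (`IsWidderDecomposition.ae_eq`).
-/

set_option linter.unusedSectionVars false

/-! ### Convex combinations of bounded sequences in a Hilbert space -/

section Mazur

variable {H : Type*} [NormedAddCommGroup H] [InnerProductSpace ℝ H]

/-- Bounded sequences in a Hilbert space have convex combinations of their tails that converge
in norm: vectors of almost minimal norm in the convex hulls of the tails form a Cauchy sequence by
the parallelogram law. -/
theorem exists_tendsto_mem_convexHull_tail [CompleteSpace H] (x : ℕ → H) (C : ℝ)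
    (hx : ∀ n, ‖x n‖ ≤ C) :
    ∃ (y : ℕ → H) (z : H), (∀ m, y m ∈ convexHull ℝ (x '' Ici m)) ∧ Tendsto y atTop (𝓝 z) := by
  set S : ℕ → Set H := fun m => convexHull ℝ (x '' Ici m) with hS
  have hne : ∀ m, (S m).Nonempty := fun m =>
    ⟨x m, subset_convexHull ℝ _ ⟨m, mem_Ici.2 le_rfl, rfl⟩⟩
  have hanti : ∀ m n, m ≤ n → S n ⊆ S m := fun m n hmn =>
    convexHull_mono (image_mono (Ici_subset_Ici.2 hmn))
  set d : ℕ → ℝ := fun m => sInf (norm '' S m) with hd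
  have hbdd : ∀ m, BddBelow (norm '' S m) := fun m => ⟨0, by rintro _ ⟨a, -, rfl⟩; exact norm_nonneg a⟩
  have hdle : ∀ m, ∀ a ∈ S m, d m ≤ ‖a‖ := fun m a ha => csInf_le (hbdd m) ⟨a, ha, rfl⟩
  have hdmono : Monotone d := fun m n hmn =>
    csInf_le_csInf (hbdd m) ((hne n).image _) (image_mono (hanti m n hmn))
  have hd0 : ∀ m, 0 ≤ d m := fun m => by
    refine le_csInf ((hne m).image _) ?_
    rintro _ ⟨a, -, rfl⟩; exact norm_nonneg a
  have hdC : ∀ m, d m ≤ C := fun m =>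
    (hdle m (x m) (subset_convexHull ℝ _ ⟨m, mem_Ici.2 le_rfl, rfl⟩)).trans (hx m)
  have hex : ∀ m : ℕ, ∃ a ∈ S m, ‖a‖ < d m + 1 / (m + 1 : ℝ) := fun m => by
    have hpos : (0 : ℝ) < 1 / (m + 1 : ℝ) := by positivity
    obtain ⟨_, ⟨a, ha, rfl⟩, hlt⟩ := exists_lt_of_csInf_lt ((hne m).image norm)
      (show sInf (norm '' S m) < d m + 1 / (m + 1 : ℝ) by linarith)
    exact ⟨a, ha, hlt⟩
  choose y hy hylt using hex
  have hkey : ∀ m n, m ≤ n → ‖y m - y n‖ ^ 2 ≤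
      2 * (d m + 1 / (m + 1 : ℝ)) ^ 2 + 2 * (d n + 1 / (n + 1 : ℝ)) ^ 2 - 4 * d m ^ 2 := by
    intro m n hmn
    have hmid : (1 / 2 : ℝ) • y m + (1 / 2 : ℝ) • y n ∈ S m :=
      (convex_convexHull ℝ _) (hy m) (hanti m n hmn (hy n)) (by norm_num) (by norm_num)
        (by norm_num)
    have h1 := hdle m _ hmid
    rw [← smul_add, norm_smul, Real.norm_of_nonneg (by norm_num : (0 : ℝ) ≤ 1 / 2)] at h1
    have h2 := parallelogram_law_with_norm ℝ (y m) (y n)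
    have h3 : (2 * d m) ^ 2 ≤ ‖y m + y n‖ ^ 2 :=
      pow_le_pow_left₀ (by have := hd0 m; linarith) (by linarith) 2
    have h4 : ‖y m‖ ^ 2 ≤ (d m + 1 / (m + 1 : ℝ)) ^ 2 :=
      pow_le_pow_left₀ (norm_nonneg _) (hylt m).le 2
    have h5 : ‖y n‖ ^ 2 ≤ (d n + 1 / (n + 1 : ℝ)) ^ 2 :=
      pow_le_pow_left₀ (norm_nonneg _) (hylt n).le 2
    nlinarith
  obtain ⟨D, hD⟩ : ∃ D, Tendsto d atTop (𝓝 D) :=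
    ⟨_, tendsto_atTop_ciSup hdmono ⟨C, by rintro _ ⟨m, rfl⟩; exact hdC m⟩⟩
  have hlim1 : Tendsto (fun m : ℕ => d m + 1 / (m + 1 : ℝ)) atTop (𝓝 D) := by
    simpa using hD.add tendsto_one_div_add_atTop_nhds_zero_nat
  have hcau : CauchySeq y := by
    have hprod : Tendsto (fun p : ℕ × ℕ => 2 * (d p.1 + 1 / (p.1 + 1 : ℝ)) ^ 2
        + 2 * (d p.2 + 1 / (p.2 + 1 : ℝ)) ^ 2 - 4 * (d (min p.1 p.2)) ^ 2) atTop (𝓝 0) := by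
      have e1 := (hlim1.comp (tendsto_fst (α := ℕ) (β := ℕ) (f := atTop) (g := atTop)))
      have e2 := (hlim1.comp (tendsto_snd (α := ℕ) (β := ℕ) (f := atTop) (g := atTop)))
      have e3 : Tendsto (fun p : ℕ × ℕ => min p.1 p.2) (atTop ×ˢ atTop) atTop :=
        tendsto_atTop.2 fun b => by
          filter_upwards [(eventually_ge_atTop b).prod_mk (eventually_ge_atTop b)] with p hp
          exact le_min hp.1 hp.2
      have e4 := hD.comp e3
      rw [← prod_atTop_atTop_eq]
      have h6 := (((e1.pow 2).const_mul 2).add ((e2.pow 2).const_mul 2)).sub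
        ((e4.pow 2).const_mul 4)
      have h7 : 2 * D ^ 2 + 2 * D ^ 2 - 4 * D ^ 2 = 0 := by ring
      rw [h7] at h6
      exact h6
    rw [Metric.cauchySeq_iff']
    intro ε hε
    have hev := hprod.eventually (gt_mem_nhds (show (0 : ℝ) < ε ^ 2 by positivity))
    obtain ⟨⟨N₁, N₂⟩, hN⟩ := eventually_atTop.1 hev
    refine ⟨max N₁ N₂, fun n hn => ?_⟩
    have h7 := hN (max N₁ N₂, n) ⟨le_max_left _ _, (le_max_right _ _).trans hn⟩
    have h8 := hkey _ n hn
    rw [dist_comm, dist_eq_norm]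
    simp only [min_eq_left hn] at h7
    exact lt_of_pow_lt_pow_left₀ 2 hε.le (h8.trans_lt h7)
  obtain ⟨z, hz⟩ := cauchySeq_tendsto_of_complete hcau
  exact ⟨y, z, hy, hz⟩

end Mazur

namespace Widder

namespace DirichletForm

/-! ### The Hilbert space of the form -/

section Hilbert

variable {X : Type*} [MeasurableSpace X] {μ : Measure X} (E : DirichletForm μ)

theorem inner_dom (f g : E.Dom) :
    inner ℝ f g = E.energy f g + inner ℝ (E.toL2 f) (E.toL2 g) := rfl

theorem energy_symm (f g : E.Dom) : E.energy f g = E.energy g f := E.symm f g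

theorem energy_nonneg (f : E.Dom) : 0 ≤ E.energy f f := E.nonneg f

theorem norm_sq_dom (f : E.Dom) : ‖f‖ ^ 2 = E.energy f f + ‖E.toL2 f‖ ^ 2 := by
  rw [← real_inner_self_eq_norm_sq, ← real_inner_self_eq_norm_sq, inner_dom]

theorem toL2_injective : Function.Injective E.toL2 := fun _ _ h => Subtype.ext h

variable {E} in
theorem toL2_ext {f g : E.Dom} (h : E.toL2 f =ᵐ[μ] E.toL2 g) : f = g :=
  E.toL2_injective (Lp.ext h)

theorem norm_toL2_le (f : E.Dom) : ‖E.toL2 f‖ ≤ ‖f‖ := by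
  have h := E.norm_sq_dom f
  have h0 := E.energy_nonneg f
  exact le_of_sq_le_sq (by linarith) (norm_nonneg f)

/-- The continuous inclusion of the domain in `L²`. -/
noncomputable def incl : E.Dom →L[ℝ] Lp ℝ 2 μ :=
  E.toL2.mkContinuous 1 fun f => by simpa using E.norm_toL2_le f

@[simp] theorem incl_apply (f : E.Dom) : E.incl f = E.toL2 f := rfl

theorem denseRange_toL2 : DenseRange E.toL2 := by
  have : range E.toL2 = (E.domain : Set (Lp ℝ 2 μ)) := by
    ext f
    constructor
    · rintro ⟨g, rfl⟩
      exact g.2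
    · intro hf
      exact ⟨⟨f, hf⟩, rfl⟩
  rw [DenseRange, this]
  exact E.dense_domain

/-- Cauchy–Schwarz for the form. -/
theorem energy_sq_le (f g : E.Dom) : E.energy f g ^ 2 ≤ E.energy f f * E.energy g g := by
  have h : ∀ t : ℝ, 0 ≤ E.energy g g * (t * t) + 2 * E.energy f g * t + E.energy f f := fun t => by
    have := E.energy_nonneg (f + t • g)
    simp only [map_add, map_smul, LinearMap.add_apply, LinearMap.smul_apply, smul_eq_mul,
      E.energy_symm g f] at this
    linarith
  have := discrim_le_zero h
  rw [discrim] at this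
  nlinarith

theorem abs_energy_le (f g : E.Dom) : |E.energy f g| ≤ ‖f‖ * ‖g‖ := by
  refine abs_le_of_sq_le_sq ?_ (by positivity)
  have h1 := E.energy_sq_le f g
  have h2 := E.norm_sq_dom f
  have h3 := E.norm_sq_dom g
  have h4 := E.energy_nonneg f
  have h5 := E.energy_nonneg g
  calc E.energy f g ^ 2 ≤ E.energy f f * E.energy g g := h1
    _ ≤ ‖f‖ ^ 2 * ‖g‖ ^ 2 := by
        apply mul_le_mul <;> nlinarith [sq_nonneg ‖E.toL2 f‖, sq_nonneg ‖E.toL2 g‖]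
    _ = (‖f‖ * ‖g‖) ^ 2 := by ring

/-- The form as a bounded bilinear map on its domain. -/
noncomputable def energyL : E.Dom →L[ℝ] E.Dom →L[ℝ] ℝ :=
  E.energy.mkContinuous₂ 1 fun f g => by
    rw [one_mul, Real.norm_eq_abs]
    exact E.abs_energy_le f g

@[simp] theorem energyL_apply (f g : E.Dom) : E.energyL f g = E.energy f g := rfl

theorem norm_le_of_ae_abs_le {f g : Lp ℝ 2 μ}
    (h : ∀ᵐ x ∂μ, |f x| ≤ |g x|) : ‖f‖ ≤ ‖g‖ :=
  Lp.norm_le_norm_of_ae_le (by simpa [Real.norm_eq_abs] using h)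

/-- The `L²` inner product as a bounded bilinear map on the domain. -/
noncomputable def ltwoL : E.Dom →L[ℝ] E.Dom →L[ℝ] ℝ :=
  ((innerₗ (Lp ℝ 2 μ)).compl₁₂ E.toL2 E.toL2).mkContinuous₂ 1 fun f g => by
    rw [one_mul]
    exact (norm_inner_le_norm (𝕜 := ℝ) (E.toL2 f) (E.toL2 g)).trans
      (mul_le_mul (E.norm_toL2_le f) (E.norm_toL2_le g) (norm_nonneg _) (norm_nonneg _))

@[simp] theorem ltwoL_apply (f g : E.Dom) :
    E.ltwoL f g = inner ℝ (E.toL2 f) (E.toL2 g) := rfl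

theorem energy_sub_self (f g : E.Dom) :
    E.energy (f - g) (f - g) = E.energy f f - 2 * E.energy f g + E.energy g g := by
  simp only [map_sub, LinearMap.sub_apply, E.energy_symm g f]
  ring

/-- Completeness for the norm of `E₁` is the closedness of the form. -/
instance : CompleteSpace E.Dom := by
  refine Metric.complete_of_cauchySeq_tendsto fun f hf => ?_
  have hnorm : ∀ a b : E.Dom, dist a b ^ 2
      = E.energy (a - b) (a - b) + ‖E.toL2 a - E.toL2 b‖ ^ 2 := fun a b => by
    rw [dist_eq_norm, norm_sq_dom, ← map_sub E.toL2]
  obtain ⟨g, hg⟩ := E.closed f (by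
    intro ε hε
    obtain ⟨N, hN⟩ := Metric.cauchySeq_iff.1 hf (Real.sqrt ε) (Real.sqrt_pos.2 hε)
    refine ⟨N, fun m hm n hn => ?_⟩
    have h1 := hN m hm n hn
    have h2 : dist (f m) (f n) ^ 2 < ε := by
      have := pow_lt_pow_left₀ h1 dist_nonneg two_ne_zero
      rwa [Real.sq_sqrt hε.le] at this
    rw [hnorm] at h2
    exact h2)
  let g' : E.Dom := g
  refine ⟨g', ?_⟩
  rw [tendsto_iff_dist_tendsto_zero]
  have h3 : Tendsto (fun n => dist (f n) g' ^ 2) atTop (𝓝 0) := by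
    refine hg.congr fun n => ?_
    rw [hnorm]
    rfl
  have h4 := h3.sqrt
  simpa [Real.sqrt_sq dist_nonneg] using h4

/-- An `L²` limit of a sequence that is bounded in the domain lies in the domain. -/
theorem exists_toL2_eq_of_tendsto (f : ℕ → E.Dom) (C : ℝ) (hC : ∀ n, ‖f n‖ ≤ C) (g : Lp ℝ 2 μ)
    (hg : Tendsto (fun n => E.toL2 (f n)) atTop (𝓝 g)) : ∃ g' : E.Dom, E.toL2 g' = g := by
  obtain ⟨y, z, hy, hz⟩ := exists_tendsto_mem_convexHull_tail f C hC
  refine ⟨z, ?_⟩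
  have h1 : Tendsto (fun n => E.toL2 (y n)) atTop (𝓝 (E.toL2 z)) :=
    ((E.incl.continuous.tendsto z).comp hz)
  refine tendsto_nhds_unique h1 ?_
  rw [Metric.tendsto_atTop] at hg ⊢
  intro ε hε
  obtain ⟨N, hN⟩ := hg ε hε
  refine ⟨N, fun n hn => ?_⟩
  have hsub : convexHull ℝ (f '' Ici n) ⊆ E.toL2 ⁻¹' (Metric.ball g ε) := by
    refine convexHull_min ?_ ((convex_ball g ε).linear_preimage E.toL2)
    rintro _ ⟨k, hk, rfl⟩
    exact hN k (hn.trans hk)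
  exact hsub (hy n)

end Hilbert

/-! ### Multiplication by cutoff functions -/

section Cutoff

variable {X : Type*} [TopologicalSpace X] [MeasurableSpace X] {μ : Measure X}
  {E : DirichletForm μ} {ψ : X → ℝ} {A U : Set X}

/-- Multiplication by a nice cutoff function, as a linear map of the domain. -/
noncomputable def IsNiceCutoff.mulₗ (h : E.IsNiceCutoff ψ A U) : E.Dom →ₗ[ℝ] E.Dom where
  toFun f := (h.mul_mem f).choose
  map_add' f g := by
    refine toL2_ext ((h.mul_mem (f + g)).choose_spec.trans ?_)
    have e := Lp.coeFn_add (E.toL2 (h.mul_mem f).choose) (E.toL2 (h.mul_mem g).choose)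
    rw [← map_add] at e
    refine EventuallyEq.trans ?_ e.symm
    have e' := Lp.coeFn_add (E.toL2 f) (E.toL2 g)
    rw [← map_add] at e'
    filter_upwards [(h.mul_mem f).choose_spec, (h.mul_mem g).choose_spec, e'] with x h1 h2 h3
    rw [Pi.add_apply, h1, h2, h3, Pi.add_apply]
    ring
  map_smul' r f := by
    refine toL2_ext ((h.mul_mem (r • f)).choose_spec.trans ?_)
    have e := Lp.coeFn_smul r (E.toL2 (h.mul_mem f).choose)
    rw [← map_smul] at e
    refine EventuallyEq.trans ?_ e.symm
    have e' := Lp.coeFn_smul r (E.toL2 f)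
    rw [← map_smul] at e'
    filter_upwards [(h.mul_mem f).choose_spec, e'] with x h1 h3
    rw [Pi.smul_apply, h1, h3, Pi.smul_apply, smul_eq_mul, smul_eq_mul]
    ring

theorem IsNiceCutoff.mulₗ_ae (h : E.IsNiceCutoff ψ A U) (f : E.Dom) :
    E.toL2 (h.mulₗ f) =ᵐ[μ] fun x => ψ x * E.toL2 f x := (h.mul_mem f).choose_spec

theorem IsNiceCutoff.norm_toL2_mulₗ_le (h : E.IsNiceCutoff ψ A U) (f : E.Dom) :
    ‖E.toL2 (h.mulₗ f)‖ ≤ ‖E.toL2 f‖ := by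
  refine norm_le_of_ae_abs_le ?_
  filter_upwards [h.mulₗ_ae f] with x hx
  rw [hx, abs_mul]
  have := h.mem_Icc x
  have h1 : |ψ x| ≤ 1 := abs_le.2 ⟨by linarith [this.1], this.2⟩
  nlinarith [abs_nonneg (E.toL2 f x)]

/-- Multiplication by a nice cutoff function is bounded on the domain, by the closed graph
theorem. -/
noncomputable def IsNiceCutoff.mul (h : E.IsNiceCutoff ψ A U) : E.Dom →L[ℝ] E.Dom where
  toLinearMap := h.mulₗ
  cont := by
    refine h.mulₗ.continuous_of_seq_closed_graph fun u x y hu hy => ?_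
    apply E.toL2_injective
    have h1 : Tendsto (fun n => E.toL2 (h.mulₗ (u n))) atTop (𝓝 (E.toL2 y)) :=
      (E.incl.continuous.tendsto y).comp hy
    refine tendsto_nhds_unique h1 ?_
    rw [tendsto_iff_norm_sub_tendsto_zero]
    have h2 : Tendsto (fun n => ‖E.toL2 (u n) - E.toL2 x‖) atTop (𝓝 0) :=
      tendsto_iff_norm_sub_tendsto_zero.1 ((E.incl.continuous.tendsto x).comp hu)
    refine squeeze_zero (fun _ => norm_nonneg _) (fun n => ?_) h2
    rw [← map_sub, ← map_sub, ← map_sub]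
    exact h.norm_toL2_mulₗ_le _

theorem IsNiceCutoff.mul_ae (h : E.IsNiceCutoff ψ A U) (f : E.Dom) :
    E.toL2 (h.mul f) =ᵐ[μ] fun x => ψ x * E.toL2 f x := h.mulₗ_ae f

end Cutoff

end DirichletForm

/-! ### Convergence in `L²` -/

section Ltwo

variable {X : Type*} [MeasurableSpace X] {μ : Measure X}

theorem exists_subseq_tendsto_ae {f : ℕ → Lp ℝ 2 μ} {g : Lp ℝ 2 μ}
    (h : Tendsto f atTop (𝓝 g)) :
    ∃ ns : ℕ → ℕ, StrictMono ns ∧ ∀ᵐ x ∂μ, Tendsto (fun i => f (ns i) x) atTop (𝓝 (g x)) :=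
  (tendstoInMeasure_of_tendsto_Lp h).exists_seq_tendsto_ae

/-- Pointwise closed conditions define closed subsets of `L²`. -/
theorem isClosed_setOf_ae_mem (C : X → Set ℝ) (hC : ∀ x, IsClosed (C x)) :
    IsClosed {f : Lp ℝ 2 μ | ∀ᵐ x ∂μ, f x ∈ C x} := by
  refine IsSeqClosed.isClosed fun f g hf hg => ?_
  obtain ⟨ns, -, hns⟩ := exists_subseq_tendsto_ae hg
  filter_upwards [hns, ae_all_iff.2 hf] with x h1 h2
  exact (hC x).mem_of_tendsto h1 (Eventually.of_forall fun i => h2 _)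

theorem norm_sq_eq_integral (f : Lp ℝ 2 μ) : ‖f‖ ^ 2 = ∫ x, f x ^ 2 ∂μ := by
  rw [← real_inner_self_eq_norm_sq, L2.inner_def]
  refine integral_congr_ae (Eventually.of_forall fun x => ?_)
  simp [sq]

theorem integrable_sq (f : Lp ℝ 2 μ) : Integrable (fun x => f x ^ 2) μ :=
  (Lp.memLp f).integrable_sq

theorem integrable_mul (f g : Lp ℝ 2 μ) : Integrable (fun x => f x * g x) μ :=
  (Lp.memLp f).integrable_mul (Lp.memLp g)

theorem inner_eq_integral (f g : Lp ℝ 2 μ) : inner ℝ f g = ∫ x, f x * g x ∂μ := by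
  rw [L2.inner_def]
  refine integral_congr_ae (Eventually.of_forall fun x => ?_)
  simp [mul_comm]

theorem inner_nonneg_of_ae {f g : Lp ℝ 2 μ} (hf : ∀ᵐ x ∂μ, 0 ≤ f x) (hg : ∀ᵐ x ∂μ, 0 ≤ g x) :
    0 ≤ inner ℝ f g := by
  rw [inner_eq_integral]
  refine integral_nonneg_of_ae ?_
  filter_upwards [hf, hg] with x h1 h2
  exact mul_nonneg h1 h2

theorem inner_le_inner_of_ae {f g h : Lp ℝ 2 μ} (hfg : ∀ᵐ x ∂μ, f x ≤ g x)
    (hh : ∀ᵐ x ∂μ, 0 ≤ h x) : (inner ℝ f h : ℝ) ≤ inner ℝ g h := by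
  rw [inner_eq_integral, inner_eq_integral]
  refine integral_mono_ae (integrable_mul f h) (integrable_mul g h) ?_
  filter_upwards [hfg, hh] with x h1 h2
  exact mul_le_mul_of_nonneg_right h1 h2

theorem inner_congr_ae {f g f' g' : Lp ℝ 2 μ} (h : ∀ᵐ x ∂μ, f x * g x = f' x * g' x) :
    (inner ℝ f g : ℝ) = inner ℝ f' g' := by
  rw [inner_eq_integral, inner_eq_integral]
  exact integral_congr_ae h

/-- Dominated convergence in `L²`. -/
theorem tendsto_Lp_of_dominated {f : ℕ → Lp ℝ 2 μ} {g G : Lp ℝ 2 μ}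
    (hb : ∀ n, ∀ᵐ x ∂μ, |f n x| ≤ |G x|)
    (hl : ∀ᵐ x ∂μ, Tendsto (fun n => f n x) atTop (𝓝 (g x))) : Tendsto f atTop (𝓝 g) := by
  rw [tendsto_iff_norm_sub_tendsto_zero]
  have hgb : ∀ᵐ x ∂μ, |g x| ≤ |G x| := by
    filter_upwards [hl, ae_all_iff.2 hb] with x h1 h2
    exact le_of_tendsto h1.abs (Eventually.of_forall h2)
  have h1 : Tendsto (fun n => ∫ x, (f n - g : Lp ℝ 2 μ) x ^ 2 ∂μ) atTop (𝓝 (∫ _, (0 : ℝ) ∂μ)) := by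
    refine tendsto_integral_of_dominated_convergence (fun x => 4 * G x ^ 2)
      (fun n => (integrable_sq _).aestronglyMeasurable) ((integrable_sq G).const_mul 4) ?_ ?_
    · intro n
      filter_upwards [hb n, hgb, Lp.coeFn_sub (f n) g] with x h1 h2 h3
      rw [h3, Pi.sub_apply, Real.norm_eq_abs, abs_of_nonneg (sq_nonneg _), ← sq_abs (G x)]
      rw [abs_le] at h1 h2
      nlinarith
    · filter_upwards [hl, ae_all_iff.2 fun n => Lp.coeFn_sub (f n) g] with x h1 h2
      have h3 : Tendsto (fun n => (f n x - g x) ^ 2) atTop (𝓝 ((g x - g x) ^ 2)) :=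
        (h1.sub_const _).pow 2
      simp only [sub_self, ne_eq, OfNat.ofNat_ne_zero, not_false_eq_true, zero_pow] at h3
      refine h3.congr fun n => ?_
      rw [h2 n, Pi.sub_apply]
  rw [integral_zero] at h1
  have h2 := h1.sqrt
  simp only [Real.sqrt_zero] at h2
  refine h2.congr fun n => ?_
  rw [← norm_sq_eq_integral, Real.sqrt_sq (norm_nonneg _)]

end Ltwo

namespace DirichletForm

section Resolvent

variable {X : Type*} [MeasurableSpace X] {μ : Measure X} (E : DirichletForm μ)

/-! ### Resolvents of the form with Dirichlet conditions -/

/-- The functions in the domain that vanish almost everywhere outside `F`. -/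
def supported (F : Set X) : Submodule ℝ E.Dom where
  carrier := {f | ∀ᵐ x ∂μ, x ∉ F → E.toL2 f x = 0}
  add_mem' {f g} hf hg := by
    have e := Lp.coeFn_add (E.toL2 f) (E.toL2 g)
    rw [← map_add] at e
    filter_upwards [hf, hg, e] with x h1 h2 h3 h4
    rw [h3, Pi.add_apply, h1 h4, h2 h4, add_zero]
  zero_mem' := by
    have e := Lp.coeFn_zero ℝ 2 μ
    rw [← map_zero E.toL2] at e
    filter_upwards [e] with x h1 _
    rw [h1, Pi.zero_apply]
  smul_mem' r f hf := by
    have e := Lp.coeFn_smul r (E.toL2 f)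
    rw [← map_smul] at e
    filter_upwards [hf, e] with x h1 h3 h4
    rw [h3, Pi.smul_apply, h1 h4, smul_zero]

variable {E}

theorem mem_supported {F : Set X} {f : E.Dom} :
    f ∈ E.supported F ↔ ∀ᵐ x ∂μ, x ∉ F → E.toL2 f x = 0 := Iff.rfl

theorem mem_supported_univ (f : E.Dom) : f ∈ E.supported univ :=
  mem_supported.2 (Eventually.of_forall fun x hx => (hx (mem_univ x)).elim)

theorem supported_mono {F G : Set X} (h : F ⊆ G) : E.supported F ≤ E.supported G := fun f hf => by
  filter_upwards [mem_supported.1 hf] with x hx hxG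
  exact hx fun hxF => hxG (h hxF)

theorem isClosed_supported (F : Set X) : IsClosed (E.supported F : Set E.Dom) := by
  have h := (isClosed_setOf_ae_mem (μ := μ) (fun x => {y : ℝ | x ∉ F → y = 0}) fun x => by
    by_cases hx : x ∈ F <;> simp [hx])
  exact h.preimage E.incl.continuous

theorem supported_of_abs_le {F : Set X} {f g : E.Dom} (hf : f ∈ E.supported F)
    (h : ∀ᵐ x ∂μ, |E.toL2 g x| ≤ |E.toL2 f x|) : g ∈ E.supported F := by
  filter_upwards [mem_supported.1 hf, h] with x h1 h2 h3
  rw [h1 h3, abs_zero] at h2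
  exact abs_nonpos_iff.1 h2

theorem exists_resolvent (F : Set X) {l : ℝ} (hl : 0 < l) :
    ∃ R : Lp ℝ 2 μ →L[ℝ] E.Dom, ∀ f, R f ∈ E.supported F ∧ ∀ g ∈ E.supported F,
      E.energy (R f) g + l * inner ℝ (E.toL2 (R f)) (E.toL2 g) = inner ℝ f (E.toL2 g) := by
  have : CompleteSpace (E.supported F) := (isClosed_supported F).completeSpace_coe
  set j : E.supported F →L[ℝ] E.Dom := (E.supported F).subtypeL with hj
  set B : E.supported F →L[ℝ] E.supported F →L[ℝ] ℝ :=
    (E.energyL + l • E.ltwoL).bilinearComp j j with hB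
  have hBapp : ∀ f g, B f g = E.energy f g + l * inner ℝ (E.toL2 f) (E.toL2 g) := fun f g => rfl
  have hco : IsCoercive B := by
    refine ⟨min 1 l, lt_min one_pos hl, fun f => ?_⟩
    rw [hBapp, real_inner_self_eq_norm_sq, mul_assoc, ← sq]
    have h1 : ‖f‖ ^ 2 = E.energy (f : E.Dom) f + ‖E.toL2 f‖ ^ 2 := E.norm_sq_dom f
    have h2 := E.energy_nonneg f
    have h3 := sq_nonneg ‖E.toL2 f‖
    rw [h1]
    nlinarith [min_le_left 1 l, min_le_right 1 l]
  set T := hco.continuousLinearEquivOfBilin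
  refine ⟨j.comp ((T.symm : E.supported F →L[ℝ] E.supported F).comp
    (ContinuousLinearMap.adjoint (E.incl.comp j))), fun f => ⟨Subtype.coe_prop _, fun g hg => ?_⟩⟩
  have h1 := hBapp (T.symm (ContinuousLinearMap.adjoint (E.incl.comp j) f)) ⟨g, hg⟩
  rw [← hco.continuousLinearEquivOfBilin_apply, ContinuousLinearEquiv.apply_symm_apply,
    ContinuousLinearMap.adjoint_inner_left] at h1
  exact h1.symm

open Classical in
variable (E) in
/-- The resolvent `(l + L_F)⁻¹`, where `L_F` is the generator of the form restricted to the
functions that vanish outside `F`. It is the zero map for the irrelevant values `l ≤ 0`. -/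
noncomputable def resolvent (F : Set X) (l : ℝ) : Lp ℝ 2 μ →L[ℝ] E.Dom :=
  if h : 0 < l then (exists_resolvent (E := E) F h).choose else 0

variable {F : Set X} {l : ℝ}

theorem resolvent_mem (hl : 0 < l) (f : Lp ℝ 2 μ) : E.resolvent F l f ∈ E.supported F := by
  rw [resolvent, dif_pos hl]
  exact ((exists_resolvent F hl).choose_spec f).1

theorem resolvent_eq (hl : 0 < l) (f : Lp ℝ 2 μ) {g : E.Dom} (hg : g ∈ E.supported F) :
    E.energy (E.resolvent F l f) g + l * inner ℝ (E.toL2 (E.resolvent F l f)) (E.toL2 g)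
      = inner ℝ f (E.toL2 g) := by
  rw [resolvent, dif_pos hl]
  exact ((exists_resolvent F hl).choose_spec f).2 g hg

theorem eq_resolvent (hl : 0 < l) (f : Lp ℝ 2 μ) {h : E.Dom} (hh : h ∈ E.supported F)
    (he : ∀ g ∈ E.supported F,
      E.energy h g + l * inner ℝ (E.toL2 h) (E.toL2 g) = inner ℝ f (E.toL2 g)) :
    h = E.resolvent F l f := by
  set d := h - E.resolvent F l f with hd
  have hdm : d ∈ E.supported F := Submodule.sub_mem _ hh (resolvent_mem hl f)
  have h1 := he d hdm
  have h2 := resolvent_eq hl f hdm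
  have h3 : E.energy d d + l * inner ℝ (E.toL2 d) (E.toL2 d) = 0 := by
    conv_lhs => rw [hd]
    simp only [map_sub, LinearMap.sub_apply, inner_sub_left, inner_sub_right] at h1 h2 ⊢
    simp only [hd, map_sub, inner_sub_right] at h1 h2
    linarith
  have h4 := E.energy_nonneg d
  have h5 : inner ℝ (E.toL2 d) (E.toL2 d) = 0 := by
    have h6 : 0 ≤ inner ℝ (E.toL2 d) (E.toL2 d) := real_inner_self_nonneg
    nlinarith
  have h7 : E.toL2 d = 0 := inner_self_eq_zero.1 h5
  have h8 : d = 0 := E.toL2_injective (by rw [h7, map_zero])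
  exact sub_eq_zero.1 h8

variable (E) in
/-- The bounded operator `l (l + L_F)⁻¹` on `L²`. -/
noncomputable def scaledResolvent (F : Set X) (l : ℝ) : Lp ℝ 2 μ →L[ℝ] Lp ℝ 2 μ :=
  l • E.incl.comp (E.resolvent F l)

theorem scaledResolvent_apply (f : Lp ℝ 2 μ) :
    E.scaledResolvent F l f = l • E.toL2 (E.resolvent F l f) := rfl

theorem scaledResolvent_eq_toL2 (f : Lp ℝ 2 μ) :
    E.scaledResolvent F l f = E.toL2 (l • E.resolvent F l f) := by
  rw [map_smul]; rfl

theorem inner_resolvent_symm (hl : 0 < l) (f g : Lp ℝ 2 μ) :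
    inner ℝ (E.toL2 (E.resolvent F l f)) g = inner ℝ f (E.toL2 (E.resolvent F l g)) := by
  have h1 := resolvent_eq hl f (resolvent_mem (E := E) (F := F) hl g)
  have h2 := resolvent_eq hl g (resolvent_mem (E := E) (F := F) hl f)
  rw [E.energy_symm, real_inner_comm] at h2
  rw [← h1, h2, real_inner_comm]

theorem inner_scaledResolvent_symm (hl : 0 < l) (f g : Lp ℝ 2 μ) :
    inner ℝ (E.scaledResolvent F l f) g = inner ℝ f (E.scaledResolvent F l g) := by
  rw [scaledResolvent_apply, scaledResolvent_apply, real_inner_smul_left, real_inner_smul_right,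
    inner_resolvent_symm hl]

theorem norm_scaledResolvent_le (hl : 0 < l) (f : Lp ℝ 2 μ) :
    ‖E.scaledResolvent F l f‖ ≤ ‖f‖ := by
  have h1 := resolvent_eq hl f (resolvent_mem (E := E) (F := F) hl f)
  set r := E.resolvent F l f
  have h2 := E.energy_nonneg r
  rw [real_inner_self_eq_norm_sq] at h1
  have h3 : inner ℝ f (E.toL2 r) ≤ ‖f‖ * ‖E.toL2 r‖ := real_inner_le_norm _ _
  rw [scaledResolvent_apply, norm_smul, Real.norm_of_nonneg hl.le]
  rcases (norm_nonneg (E.toL2 r)).eq_or_lt with h4 | h4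
  · rw [← h4, mul_zero]
    exact norm_nonneg f
  · exact le_of_mul_le_mul_right (by nlinarith) h4

/-- The resolvent identity. -/
theorem resolvent_sub_resolvent {k : ℝ} (hl : 0 < l) (hk : 0 < k) (f : Lp ℝ 2 μ) :
    E.resolvent F k f = E.resolvent F l (f + (l - k) • E.toL2 (E.resolvent F k f)) := by
  refine eq_resolvent hl _ (resolvent_mem hk f) fun g hg => ?_
  have h1 := resolvent_eq hk f hg
  rw [inner_add_left, real_inner_smul_left, ← h1]
  ring

theorem resolvent_comm {k : ℝ} (hl : 0 < l) (hk : 0 < k) (f : Lp ℝ 2 μ) :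
    E.resolvent F k (E.toL2 (E.resolvent F l f)) = E.resolvent F l (E.toL2 (E.resolvent F k f)) := by
  rcases eq_or_ne l k with rfl | hne
  · rfl
  have h1 := resolvent_sub_resolvent (E := E) (F := F) hl hk f
  have h2 := resolvent_sub_resolvent (E := E) (F := F) hk hl f
  rw [map_add, map_smul] at h1 h2
  have h3 : (l - k) • E.resolvent F l (E.toL2 (E.resolvent F k f))
      = (l - k) • E.resolvent F k (E.toL2 (E.resolvent F l f)) := by
    have e1 : (l - k) • E.resolvent F l (E.toL2 (E.resolvent F k f))
        = E.resolvent F k f - E.resolvent F l f := eq_sub_iff_add_eq'.2 h1.symm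
    have e2 : (k - l) • E.resolvent F k (E.toL2 (E.resolvent F l f))
        = E.resolvent F l f - E.resolvent F k f := eq_sub_iff_add_eq'.2 h2.symm
    rw [e1, ← neg_sub k l, neg_smul, e2, neg_sub]
  exact (smul_right_injective _ (sub_ne_zero.2 hne) h3).symm

/-- The variational characterisation: `l (l + L_F)⁻¹ g` minimises `w ↦ E(w, w) + l ‖w - g‖²`. -/
theorem energy_add_norm_sub_sq (hl : 0 < l) (g : Lp ℝ 2 μ) {w' : E.Dom}
    (hw' : w' ∈ E.supported F) :
    E.energy w' w' + l * ‖E.toL2 w' - g‖ ^ 2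
      = E.energy (l • E.resolvent F l g) (l • E.resolvent F l g)
        + l * ‖E.scaledResolvent F l g - g‖ ^ 2
        + E.energy (w' - l • E.resolvent F l g) (w' - l • E.resolvent F l g)
        + l * ‖E.toL2 w' - E.scaledResolvent F l g‖ ^ 2 := by
  set w := l • E.resolvent F l g with hw
  have hwm : w ∈ E.supported F := Submodule.smul_mem _ _ (resolvent_mem hl g)
  have hdm : w' - w ∈ E.supported F := Submodule.sub_mem _ hw' hwm
  have h1 := resolvent_eq hl g hdm
  have h2 : E.energy w (w' - w) + l * inner ℝ (E.toL2 w - g) (E.toL2 w' - E.toL2 w) = 0 := by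
    rw [← map_sub E.toL2, hw, map_smul, LinearMap.smul_apply, map_smul E.toL2, inner_sub_left,
      real_inner_smul_left, smul_eq_mul, ← h1]
    ring
  have h3 : E.scaledResolvent F l g = E.toL2 w := scaledResolvent_eq_toL2 g
  rw [h3]
  have h4 : E.toL2 w' - g = (E.toL2 w - g) + (E.toL2 w' - E.toL2 w) := by abel
  rw [h4, norm_add_sq_real, energy_sub_self]
  simp only [map_sub] at h2
  have h5 := E.energy_symm w w'
  linear_combination 2 * h2 - 2 * h5

theorem energy_scaledResolvent_le (hl : 0 < l) {g : E.Dom} (hg : g ∈ E.supported F) :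
    l * ‖E.scaledResolvent F l (E.toL2 g) - E.toL2 g‖ ^ 2 ≤ E.energy g g := by
  have h1 := energy_add_norm_sub_sq hl (E.toL2 g) hg
  have h2 := E.energy_nonneg (l • E.resolvent F l (E.toL2 g))
  have h3 := E.energy_nonneg (g - l • E.resolvent F l (E.toL2 g))
  rw [sub_self, norm_zero] at h1
  nlinarith [sq_nonneg ‖E.toL2 g - E.scaledResolvent F l (E.toL2 g)‖]

/-- The scaled resolvents are Markov: the unit contraction of the minimiser is a minimiser. -/
theorem scaledResolvent_mem_Icc (hl : 0 < l) (g : Lp ℝ 2 μ) (hg : ∀ᵐ x ∂μ, g x ∈ Icc (0 : ℝ) 1) :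
    ∀ᵐ x ∂μ, E.scaledResolvent F l g x ∈ Icc (0 : ℝ) 1 := by
  set w : E.Dom := l • E.resolvent F l g with hw
  have hwm : w ∈ E.supported F := Submodule.smul_mem _ _ (resolvent_mem hl g)
  obtain ⟨w₀, hw1, hw2⟩ := E.markov w
  set w' : E.Dom := w₀
  have hw1 : ∀ᵐ x ∂μ, E.toL2 w' x = min (max (E.toL2 w x) 0) 1 := hw1
  have hw2 : E.energy w' w' ≤ E.energy w w := hw2
  have hwm' : w' ∈ E.supported F := by
    refine supported_of_abs_le hwm ?_
    filter_upwards [hw1] with x hx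
    rw [hx, abs_of_nonneg (le_min (le_max_right _ _) zero_le_one)]
    exact (min_le_left _ _).trans (max_le (le_abs_self _) (abs_nonneg _))
  have h1 := energy_add_norm_sub_sq hl g hwm'
  have h3 : E.scaledResolvent F l g = E.toL2 w := scaledResolvent_eq_toL2 g
  have h4 : ‖E.toL2 w' - g‖ ≤ ‖E.toL2 w - g‖ := by
    refine norm_le_of_ae_abs_le ?_
    filter_upwards [hw1, hg, Lp.coeFn_sub (E.toL2 w') g, Lp.coeFn_sub (E.toL2 w) g]
      with x h5 h6 h7 h8
    rw [h7, h8, Pi.sub_apply, Pi.sub_apply, h5]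
    have h9 : g x = min (max (g x) 0) 1 := by rw [max_eq_left h6.1, min_eq_left h6.2]
    conv_lhs => rw [h9]
    exact (abs_min_sub_min_le_max _ _ _ _).trans
      (max_le ((abs_max_sub_max_le_max _ _ _ _).trans (by simp)) (by simp))
  have h5 : ‖E.toL2 w' - g‖ ^ 2 ≤ ‖E.toL2 w - g‖ ^ 2 := pow_le_pow_left₀ (norm_nonneg _) h4 2
  rw [h3] at h1 ⊢
  have h6 := E.energy_nonneg (w' - w)
  have h7 : ‖E.toL2 w' - E.toL2 w‖ ^ 2 ≤ 0 := by
    have : l * ‖E.toL2 w' - E.toL2 w‖ ^ 2 ≤ 0 := by nlinarith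
    exact nonpos_of_mul_nonpos_right this hl
  have h8 : E.toL2 w' = E.toL2 w := by
    rw [← sub_eq_zero, ← norm_eq_zero]
    exact pow_eq_zero_iff two_ne_zero |>.1 (le_antisymm h7 (sq_nonneg _))
  rw [← h8]
  filter_upwards [hw1] with x hx
  rw [hx]
  exact ⟨le_min (le_max_right _ _) zero_le_one, min_le_right _ _⟩

/-- An operator that maps functions with values in `[0, 1]` to such functions is positive. -/
theorem _root_.Widder.nonneg_of_mapsTo_Icc (N : Lp ℝ 2 μ →L[ℝ] Lp ℝ 2 μ)
    (hN : ∀ g : Lp ℝ 2 μ, (∀ᵐ x ∂μ, g x ∈ Icc (0 : ℝ) 1) → ∀ᵐ x ∂μ, 0 ≤ N g x)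
    (g : Lp ℝ 2 μ) (hg : ∀ᵐ x ∂μ, 0 ≤ g x) : ∀ᵐ x ∂μ, 0 ≤ N g x := by
  have hmem : ∀ n : ℕ, MemLp (fun x => min (g x) n) 2 μ := fun n => by
    refine (Lp.memLp g).mono ((Lp.aestronglyMeasurable g).inf aestronglyMeasurable_const) ?_
    filter_upwards [hg] with x hx
    have hn : (0 : ℝ) ≤ n := Nat.cast_nonneg n
    change ‖min (g x) n‖ ≤ _
    rw [Real.norm_of_nonneg (le_min hx hn), Real.norm_of_nonneg hx]
    exact min_le_left _ _
  have hlim : Tendsto (fun n : ℕ => (hmem n).toLp) atTop (𝓝 g) := by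
    refine tendsto_Lp_of_dominated (G := g) (fun n => ?_) ?_
    · filter_upwards [hg, (hmem n).coeFn_toLp] with x hx h1
      have hn : (0 : ℝ) ≤ n := Nat.cast_nonneg n
      rw [h1, abs_of_nonneg (le_min hx hn), abs_of_nonneg hx]
      exact min_le_left _ _
    · filter_upwards [ae_all_iff.2 fun n => (hmem n).coeFn_toLp] with x hx
      refine tendsto_const_nhds.congr' ?_
      obtain ⟨m, hm⟩ := exists_nat_ge (g x)
      filter_upwards [eventually_ge_atTop m] with n hn
      rw [hx n, min_eq_left (hm.trans (by exact_mod_cast hn))]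
  have hcl : IsClosed {f : Lp ℝ 2 μ | ∀ᵐ x ∂μ, f x ∈ Ici (0 : ℝ)} :=
    isClosed_setOf_ae_mem (fun _ => Ici 0) fun _ => isClosed_Ici
  refine hcl.mem_of_tendsto ((N.continuous.tendsto g).comp hlim) ?_
  filter_upwards [eventually_gt_atTop 0] with n hn
  have hn' : (0 : ℝ) < n := Nat.cast_pos.2 hn
  have h1 := hN ((n : ℝ)⁻¹ • (hmem n).toLp) (by
    filter_upwards [hg, (hmem n).coeFn_toLp, Lp.coeFn_smul (n : ℝ)⁻¹ (hmem n).toLp]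
      with x hx h1 h2
    rw [h2, Pi.smul_apply, h1, smul_eq_mul]
    refine ⟨by positivity, ?_⟩
    rw [inv_mul_le_iff₀ hn', mul_one]
    exact min_le_right _ _)
  rw [map_smul] at h1
  filter_upwards [h1, Lp.coeFn_smul (n : ℝ)⁻¹ (N (hmem n).toLp)] with x h2 h3
  rw [h3, Pi.smul_apply, smul_eq_mul] at h2
  exact nonneg_of_mul_nonneg_right h2 (inv_pos.2 hn')

theorem scaledResolvent_nonneg (hl : 0 < l) (g : Lp ℝ 2 μ) (hg : ∀ᵐ x ∂μ, 0 ≤ g x) :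
    ∀ᵐ x ∂μ, 0 ≤ E.scaledResolvent F l g x :=
  nonneg_of_mapsTo_Icc _ (fun g hg => (scaledResolvent_mem_Icc hl g hg).mono fun _ h => h.1) g hg

/-- The resolvents with Dirichlet conditions converge strongly to the resolvent when the domains
exhaust the form domain, as they are Galerkin approximations. -/
theorem tendsto_scaledResolvent {F : ℕ → Set X} (hF : Monotone F)
    (hd : ∀ f : E.Dom, ∀ ε > 0, ∃ n, ∃ g ∈ E.supported (F n), ‖f - g‖ < ε) (hl : 0 < l)
    (f : Lp ℝ 2 μ) :
    Tendsto (fun n => E.scaledResolvent (F n) l f) atTop (𝓝 (E.scaledResolvent univ l f)) := by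
  set r := E.resolvent univ l f with hr
  -- Céa's estimate: the error `r - E.resolvent (F n) l f` is orthogonal to `supported (F n)`
  have key : ∀ n, ∀ g ∈ E.supported (F n),
      l * ‖E.toL2 r - E.toL2 (E.resolvent (F n) l f)‖ ^ 2 ≤ (1 + l) * ‖r - g‖ ^ 2 := by
    intro n g hg
    set q := E.resolvent (F n) l f with hq
    have hqm : q ∈ E.supported (F n) := resolvent_mem hl f
    have hdm : q - g ∈ E.supported (F n) := Submodule.sub_mem _ hqm hg
    have h1 := resolvent_eq hl f hdm
    have h2 := resolvent_eq hl f (mem_supported_univ (q - g))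
    have h3 : E.energy (r - q) (q - g) + l * inner ℝ (E.toL2 (r - q)) (E.toL2 (q - g)) = 0 := by
      rw [map_sub E.energy, LinearMap.sub_apply, map_sub E.toL2 r q, inner_sub_left]
      linarith
    have h4 : r - g = (r - q) + (q - g) := by abel
    have h5 : E.energy (r - g) (r - g) = E.energy (r - q) (r - q)
        + 2 * E.energy (r - q) (q - g) + E.energy (q - g) (q - g) := by
      rw [h4]
      generalize r - q = a
      generalize q - g = b
      simp only [map_add, LinearMap.add_apply, E.energy_symm b a]
      ring
    have h6 : ‖E.toL2 (r - g)‖ ^ 2 = ‖E.toL2 (r - q)‖ ^ 2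
        + 2 * inner ℝ (E.toL2 (r - q)) (E.toL2 (q - g)) + ‖E.toL2 (q - g)‖ ^ 2 := by
      rw [h4, map_add, norm_add_sq_real]
    have h7 := E.norm_sq_dom (r - g)
    have h8 := E.energy_nonneg (r - q)
    have h9 := E.energy_nonneg (q - g)
    have h10 := E.energy_nonneg (r - g)
    rw [← map_sub]
    have h11 : l * ‖E.toL2 (r - q)‖ ^ 2 ≤ E.energy (r - g) (r - g) + l * ‖E.toL2 (r - g)‖ ^ 2 := by
      rw [h5, h6]
      nlinarith [sq_nonneg ‖E.toL2 (q - g)‖]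
    nlinarith [sq_nonneg ‖E.toL2 (r - g)‖]
  have hmain : Tendsto (fun n => E.toL2 (E.resolvent (F n) l f)) atTop (𝓝 (E.toL2 r)) := by
    rw [Metric.tendsto_atTop]
    intro ε hε
    obtain ⟨n, g, hg, hlt⟩ := hd r (ε * Real.sqrt (l / (1 + l))) (by positivity)
    refine ⟨n, fun m hm => ?_⟩
    have h1 := key m g (supported_mono (hF hm) hg)
    rw [dist_comm, dist_eq_norm]
    have h2 : ‖r - g‖ ^ 2 < (ε * Real.sqrt (l / (1 + l))) ^ 2 :=
      pow_lt_pow_left₀ hlt (norm_nonneg _) two_ne_zero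
    rw [mul_pow, Real.sq_sqrt (by positivity)] at h2
    refine lt_of_pow_lt_pow_left₀ 2 hε.le ?_
    have h3 : (1 + l) * ‖r - g‖ ^ 2 < l * ε ^ 2 := by
      calc (1 + l) * ‖r - g‖ ^ 2 < (1 + l) * (ε ^ 2 * (l / (1 + l))) := by gcongr
        _ = l * ε ^ 2 := by field_simp
    exact lt_of_mul_lt_mul_left (h1.trans_lt h3) hl.le
  exact hmain.const_smul l

end Resolvent

end DirichletForm

/-! ### Exponentials of `l (N - 1)` for a contraction `N` -/

section Exponential

variable {H : Type*} [NormedAddCommGroup H] [NormedSpace ℝ H]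

/-- The semigroup `t ↦ exp (t l (N - 1))`: for `N = l (l + L)⁻¹` it is the Yosida approximation of
the semigroup `exp (-t L)`. -/
noncomputable def expSemigroup (N : H →L[ℝ] H) (l t : ℝ) : H →L[ℝ] H :=
  NormedSpace.exp (t • (l • (N - 1)))

variable {N : H →L[ℝ] H} {l : ℝ}

@[simp] theorem expSemigroup_zero : expSemigroup N l 0 = 1 := by
  simp [expSemigroup]

theorem norm_pow_apply_le (hN : ∀ f, ‖N f‖ ≤ ‖f‖) (k : ℕ) (f : H) : ‖(N ^ k) f‖ ≤ ‖f‖ := by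
  induction k with
  | zero => simp
  | succ k ih => rw [pow_succ']; exact (hN _).trans ih

theorem weight_hasSum (t l : ℝ) :
    HasSum (fun k : ℕ => Real.exp (-(t * l)) * ((k.factorial : ℝ)⁻¹ * (t * l) ^ k)) 1 := by
  have h3 := (NormedSpace.exp_series_hasSum_exp' (𝕂 := ℝ) (t * l)).mul_left (Real.exp (-(t * l)))
  rw [← Real.exp_eq_exp_ℝ, ← Real.exp_add, neg_add_cancel, Real.exp_zero] at h3
  exact h3

theorem weight_nonneg {t : ℝ} (ht : 0 ≤ t) (hl : 0 ≤ l) (k : ℕ) :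
    0 ≤ Real.exp (-(t * l)) * ((k.factorial : ℝ)⁻¹ * (t * l) ^ k) := by positivity

variable [CompleteSpace H]

theorem hasDerivAt_expSemigroup (t : ℝ) :
    HasDerivAt (expSemigroup N l) (expSemigroup N l t * (l • (N - 1))) t :=
  hasDerivAt_exp_smul_const (l • (N - 1)) t

omit [CompleteSpace H] in
theorem commute_expSemigroup {B : H →L[ℝ] H} (h : Commute B N) (t : ℝ) :
    Commute B (expSemigroup N l t) :=
  (((h.sub_right (Commute.one_right B)).smul_right l).smul_right t).exp_right

theorem hasSum_expSemigroup (t : ℝ) (f : H) :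
    HasSum (fun k : ℕ => (Real.exp (-(t * l)) * ((k.factorial : ℝ)⁻¹ * (t * l) ^ k)) • (N ^ k) f)
      (expSemigroup N l t f) := by
  have h1 : expSemigroup N l t = Real.exp (-(t * l)) • NormedSpace.exp ((t * l) • N) := by
    have : t • (l • (N - 1)) = (-(t * l)) • (1 : H →L[ℝ] H) + (t * l) • N := by
      rw [smul_sub, smul_sub, smul_smul, smul_smul, neg_smul]; abel
    let _ : NormedAlgebra ℚ (H →L[ℝ] H) := NormedAlgebra.restrictScalars ℚ ℝ _
    rw [expSemigroup, this, NormedSpace.exp_add_of_commute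
      (((Commute.one_left N).smul_left _).smul_right _)]
    have h2 : NormedSpace.exp ((-(t * l)) • (1 : H →L[ℝ] H))
        = Real.exp (-(t * l)) • (1 : H →L[ℝ] H) := by
      rw [← Algebra.algebraMap_eq_smul_one, ← NormedSpace.algebraMap_exp_comm,
        ← Real.exp_eq_exp_ℝ, Algebra.algebraMap_eq_smul_one]
    rw [h2, smul_mul_assoc, one_mul]
  have h3 := NormedSpace.exp_series_hasSum_exp' (𝕂 := ℝ) ((t * l) • N)
  have h4 := (h3.mapL (ContinuousLinearMap.apply ℝ H f)).const_smul (Real.exp (-(t * l)))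
  rw [h1]
  convert h4 using 1
  · ext k
    simp only [ContinuousLinearMap.apply_apply, smul_apply, smul_pow, smul_smul]
  · rfl

theorem norm_expSemigroup_le (hN : ∀ f, ‖N f‖ ≤ ‖f‖) {t : ℝ} (ht : 0 ≤ t) (hl : 0 ≤ l) (f : H) :
    ‖expSemigroup N l t f‖ ≤ ‖f‖ := by
  rw [← (hasSum_expSemigroup t f).tsum_eq]
  refine tsum_of_norm_bounded (a := ‖f‖)
    (by simpa using (weight_hasSum t l).mul_right ‖f‖) fun k => ?_
  rw [norm_smul, Real.norm_of_nonneg (weight_nonneg ht hl k)]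
  exact mul_le_mul_of_nonneg_left (norm_pow_apply_le hN k f) (weight_nonneg ht hl k)

/-- Strong convergence of contractions carries over to the semigroups. -/
theorem tendsto_expSemigroup {N' : ℕ → H →L[ℝ] H} (hN' : ∀ n f, ‖N' n f‖ ≤ ‖f‖)
    (h : ∀ f, Tendsto (fun n => N' n f) atTop (𝓝 (N f))) {t : ℝ} (ht : 0 ≤ t) (hl : 0 ≤ l) (f : H) :
    Tendsto (fun n => expSemigroup (N' n) l t f) atTop (𝓝 (expSemigroup N l t f)) := by
  have hpow : ∀ k : ℕ, Tendsto (fun n => (N' n ^ k) f) atTop (𝓝 ((N ^ k) f)) := by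
    intro k
    induction k with
    | zero => simp
    | succ k ih =>
      have h1 : Tendsto (fun n => N' n ((N' n ^ k) f - (N ^ k) f)) atTop (𝓝 0) := by
        rw [tendsto_zero_iff_norm_tendsto_zero]
        exact squeeze_zero (fun _ => norm_nonneg _) (fun n => hN' n _)
          (tendsto_iff_norm_sub_tendsto_zero.1 ih)
      have h2 := h1.add (h ((N ^ k) f))
      rw [zero_add] at h2
      simp only [pow_succ', mul_apply_eq_comp]
      refine h2.congr fun n => ?_
      rw [map_sub, sub_add_cancel]
  simp only [← fun n => (hasSum_expSemigroup (N := N' n) (l := l) t f).tsum_eq,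
    ← (hasSum_expSemigroup (N := N) (l := l) t f).tsum_eq]
  refine tendsto_tsum_of_dominated_convergence
    ((weight_hasSum t l).summable.mul_right ‖f‖) (fun k => (hpow k).const_smul _) ?_
  refine Eventually.of_forall fun n k => ?_
  rw [norm_smul, Real.norm_of_nonneg (weight_nonneg ht hl k)]
  exact mul_le_mul_of_nonneg_left (norm_pow_apply_le (hN' n) k f) (weight_nonneg ht hl k)

/-- Comparison of an orbit of the exponential semigroup with a curve that almost satisfies the same
differential equation (Duhamel's formula). -/
theorem norm_expSemigroup_sub_le (hN : ∀ f, ‖N f‖ ≤ ‖f‖) (hl : 0 ≤ l) {τ C : ℝ} (hτ : 0 ≤ τ)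
    {q q' : ℝ → H} (hq : ContinuousOn q (Icc 0 τ))
    (hq' : ∀ r ∈ Ico 0 τ, HasDerivWithinAt q (q' r) (Ici r) r)
    (hC : ∀ r ∈ Ico 0 τ, ‖q' r - (l • (N - 1)) (q r)‖ ≤ C) :
    ‖q τ - expSemigroup N l τ (q 0)‖ ≤ C * τ := by
  have hder : ∀ r : ℝ, HasDerivAt (fun r => expSemigroup N l (τ - r))
      (-(expSemigroup N l (τ - r) * (l • (N - 1)))) r := fun r =>
    (hasDerivAt_expSemigroup (N := N) (l := l) (τ - r)).comp_const_sub τ r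
  have h1 : ContinuousOn (fun r => expSemigroup N l (τ - r) (q r)) (Icc 0 τ) :=
    ContinuousOn.clm_apply (fun r _ => (hder r).continuousAt.continuousWithinAt) hq
  have h2 : ∀ r ∈ Ico 0 τ, HasDerivWithinAt (fun r => expSemigroup N l (τ - r) (q r))
      (expSemigroup N l (τ - r) (q' r - (l • (N - 1)) (q r))) (Ici r) r := fun r hr => by
    have := ((hder r).hasDerivWithinAt (s := Ici r)).clm_apply (hq' r hr)
    convert this using 1
    simp [mul_apply_eq_comp, sub_eq_neg_add]
  have h3 := norm_image_sub_le_of_norm_deriv_right_le_segment h1 h2 (C := C) (fun r hr =>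
    (norm_expSemigroup_le hN (by linarith [hr.2]) hl _).trans (hC r hr)) τ (right_mem_Icc.2 hτ)
  simpa using h3

end Exponential

section Positivity

variable {X : Type*} [MeasurableSpace X] {μ : Measure X} {N : Lp ℝ 2 μ →L[ℝ] Lp ℝ 2 μ} {l t : ℝ}

/-- The exponential semigroup of a Markov operator is Markov. -/
theorem expSemigroup_mem_Icc
    (hN : ∀ g : Lp ℝ 2 μ, (∀ᵐ x ∂μ, g x ∈ Icc (0 : ℝ) 1) → ∀ᵐ x ∂μ, N g x ∈ Icc (0 : ℝ) 1)
    (ht : 0 ≤ t) (hl : 0 ≤ l) (g : Lp ℝ 2 μ) (hg : ∀ᵐ x ∂μ, g x ∈ Icc (0 : ℝ) 1) :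
    ∀ᵐ x ∂μ, expSemigroup N l t g x ∈ Icc (0 : ℝ) 1 := by
  have hpow : ∀ k : ℕ, ∀ᵐ x ∂μ, (N ^ k) g x ∈ Icc (0 : ℝ) 1 := by
    intro k
    induction k with
    | zero => simpa using hg
    | succ k ih => rw [pow_succ']; exact hN _ ih
  have hcl : IsClosed {f : Lp ℝ 2 μ | ∀ᵐ x ∂μ, f x ∈ Icc (0 : ℝ) 1} :=
    isClosed_setOf_ae_mem (fun _ => Icc 0 1) fun _ => isClosed_Icc
  refine hcl.mem_of_tendsto (hasSum_expSemigroup t g) (Eventually.of_forall fun s => ?_)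
  set w : ℕ → ℝ := fun k => Real.exp (-(t * l)) * ((k.factorial : ℝ)⁻¹ * (t * l) ^ k) with hw
  have hw0 : ∀ k, 0 ≤ w k := weight_nonneg ht hl
  have hw1 : ∑ k ∈ s, w k ≤ 1 := sum_le_hasSum s (fun k _ => hw0 k) (weight_hasSum t l)
  have hind : ∀ s : Finset ℕ, ∀ᵐ x ∂μ, (∑ k ∈ s, w k • (N ^ k) g : Lp ℝ 2 μ) x
      = ∑ k ∈ s, w k * (N ^ k) g x := by
    intro s
    induction s using Finset.cons_induction with
    | empty =>
      simp only [Finset.sum_empty]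
      exact Lp.coeFn_zero ℝ 2 μ
    | cons a s has ih =>
      simp only [Finset.sum_cons]
      filter_upwards [ih, Lp.coeFn_add (w a • (N ^ a) g) (∑ k ∈ s, w k • (N ^ k) g),
        Lp.coeFn_smul (w a) ((N ^ a) g)] with x h1 h2 h3
      rw [h2, Pi.add_apply, h1, h3, Pi.smul_apply, smul_eq_mul]
  filter_upwards [hind s, ae_all_iff.2 hpow] with x h1 h2
  rw [h1]
  refine ⟨Finset.sum_nonneg fun k _ => mul_nonneg (hw0 k) (h2 k).1, le_trans ?_ hw1⟩
  exact Finset.sum_le_sum fun k _ => mul_le_of_le_one_right (hw0 k) (h2 k).2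

theorem expSemigroup_nonneg
    (hN : ∀ g : Lp ℝ 2 μ, (∀ᵐ x ∂μ, g x ∈ Icc (0 : ℝ) 1) → ∀ᵐ x ∂μ, N g x ∈ Icc (0 : ℝ) 1)
    (ht : 0 ≤ t) (hl : 0 ≤ l) (g : Lp ℝ 2 μ) (hg : ∀ᵐ x ∂μ, 0 ≤ g x) :
    ∀ᵐ x ∂μ, 0 ≤ expSemigroup N l t g x :=
  nonneg_of_mapsTo_Icc _
    (fun g hg => (expSemigroup_mem_Icc hN ht hl g hg).mono fun _ h => h.1) g hg

end Positivity

namespace DirichletForm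

section Yosida

variable {X : Type*} [MeasurableSpace X] {μ : Measure X} {E : DirichletForm μ} {F : Set X}
  {l k β : ℝ}

/-! ### Yosida approximations -/

theorem scaledResolvent_identity (hl : 0 < l) (hβ : 0 < β) (f : Lp ℝ 2 μ) :
    l • (E.scaledResolvent F β f - E.scaledResolvent F l (E.scaledResolvent F β f))
      = β • E.scaledResolvent F l (f - E.scaledResolvent F β f) := by
  have h1 := congrArg E.toL2 (resolvent_sub_resolvent (E := E) (F := F) hl hβ f)
  simp only [map_add, map_smul, map_sub, scaledResolvent_apply] at h1 ⊢
  nth_rw 1 [h1]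
  module

theorem commute_scaledResolvent (hl : 0 < l) (hk : 0 < k) :
    Commute (E.scaledResolvent F l) (E.scaledResolvent F k) := by
  ext1 f
  have h1 := congrArg E.toL2 (resolvent_comm (E := E) (F := F) hk hl f)
  simp only [mul_apply_eq_comp, scaledResolvent_apply, map_smul] at h1 ⊢
  rw [h1, smul_comm]

theorem norm_sub_scaledResolvent_le (hβ : 0 < β) (f : Lp ℝ 2 μ) :
    ‖f - E.scaledResolvent F β f‖ ≤ 2 * ‖f‖ := by
  have := norm_scaledResolvent_le (E := E) (F := F) hβ f
  linarith [norm_sub_le f (E.scaledResolvent F β f)]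

/-- `‖(1 - N_l) N_β f‖ ≤ 2 β ‖f‖ / l`. -/
theorem norm_sub_scaledResolvent_scaledResolvent_le (hl : 0 < l) (hβ : 0 < β) (f : Lp ℝ 2 μ) :
    ‖E.scaledResolvent F β f - E.scaledResolvent F l (E.scaledResolvent F β f)‖
      ≤ 2 * β * ‖f‖ / l := by
  have h1 := congrArg norm (scaledResolvent_identity (E := E) (F := F) hl hβ f)
  rw [norm_smul, norm_smul, Real.norm_of_nonneg hl.le, Real.norm_of_nonneg hβ.le] at h1
  rw [le_div_iff₀' hl, h1]
  have h2 := norm_scaledResolvent_le (E := E) (F := F) hl (f - E.scaledResolvent F β f)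
  have h3 := norm_sub_scaledResolvent_le (E := E) (F := F) hβ f
  nlinarith

variable (E F l) in
/-- The bounded operator `l (1 - l (l + L_F)⁻¹)`, the Yosida approximation of `L_F`. -/
noncomputable def yosida : Lp ℝ 2 μ →L[ℝ] Lp ℝ 2 μ := l • (1 - E.scaledResolvent F l)

theorem yosida_apply (f : Lp ℝ 2 μ) : E.yosida F l f = l • (f - E.scaledResolvent F l f) := rfl

theorem neg_yosida : l • (E.scaledResolvent F l - 1) = -E.yosida F l := by
  rw [yosida, ← smul_neg, neg_sub]

theorem commute_yosida (hl : 0 < l) (hk : 0 < k) :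
    Commute (E.scaledResolvent F k) (E.yosida F l) :=
  ((Commute.one_right _).sub_right (commute_scaledResolvent hk hl)).smul_right l

theorem yosida_comm (hl : 0 < l) (hk : 0 < k) (f : Lp ℝ 2 μ) :
    E.scaledResolvent F k (E.yosida F l f) = E.yosida F l (E.scaledResolvent F k f) :=
  DFunLike.congr_fun (commute_yosida (E := E) (F := F) hl hk) f

theorem norm_yosida_scaledResolvent_le (hl : 0 < l) (hβ : 0 < β) (f : Lp ℝ 2 μ) :
    ‖E.yosida F l (E.scaledResolvent F β f)‖ ≤ 2 * β * ‖f‖ := by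
  have h := norm_sub_scaledResolvent_scaledResolvent_le (E := E) (F := F) hl hβ f
  rw [yosida_apply, norm_smul, Real.norm_of_nonneg hl.le]
  rwa [le_div_iff₀' hl] at h

theorem norm_yosida_sq_le (hl : 0 < l) (hβ : 0 < β) (f : Lp ℝ 2 μ) :
    ‖E.yosida F l (E.yosida F l (E.scaledResolvent F β (E.scaledResolvent F β f)))‖
      ≤ 4 * β ^ 2 * ‖f‖ := by
  rw [← yosida_comm hl hβ]
  have h1 := norm_yosida_scaledResolvent_le (E := E) (F := F) hl hβ (E.yosida F l (E.scaledResolvent F β f))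
  have h2 := norm_yosida_scaledResolvent_le (E := E) (F := F) hl hβ f
  nlinarith

theorem norm_yosida_sub_yosida_le (hl : 0 < l) (hk : 0 < k) (hβ : 0 < β) (f : Lp ℝ 2 μ) :
    ‖E.yosida F l (E.scaledResolvent F β (E.scaledResolvent F β f))
      - E.yosida F k (E.scaledResolvent F β (E.scaledResolvent F β f))‖
      ≤ 4 * β ^ 2 * ‖f‖ * (1 / l + 1 / k) := by
  set g := f - E.scaledResolvent F β f with hg
  have e : ∀ {m : ℝ}, 0 < m → E.yosida F m (E.scaledResolvent F β (E.scaledResolvent F β f))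
      = β • E.scaledResolvent F m (E.scaledResolvent F β g) := fun {m} hm => by
    rw [yosida_apply, scaledResolvent_identity hm hβ, hg, map_sub (E.scaledResolvent F β)]
  rw [e hl, e hk, ← smul_sub, norm_smul, Real.norm_of_nonneg hβ.le]
  have h1 := norm_sub_scaledResolvent_scaledResolvent_le (E := E) (F := F) hl hβ g
  have h2 := norm_sub_scaledResolvent_scaledResolvent_le (E := E) (F := F) hk hβ g
  have h3 := norm_sub_scaledResolvent_le (E := E) (F := F) hβ f
  have h4 : ‖E.scaledResolvent F l (E.scaledResolvent F β g)
      - E.scaledResolvent F k (E.scaledResolvent F β g)‖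
      ≤ 2 * β * ‖g‖ / l + 2 * β * ‖g‖ / k := by
    refine le_trans ?_ (add_le_add h1 h2)
    rw [norm_sub_rev (E.scaledResolvent F β g)]
    refine le_trans (le_of_eq ?_) (norm_add_le _ _)
    congr 1; abel
  have h5 : 2 * β * ‖g‖ / l + 2 * β * ‖g‖ / k = 2 * β * ‖g‖ * (1 / l + 1 / k) := by ring
  rw [h5] at h4
  have h6 : 0 ≤ 1 / l + 1 / k := by positivity
  calc β * _ ≤ β * (2 * β * ‖g‖ * (1 / l + 1 / k)) := by gcongr
    _ ≤ β * (2 * β * (2 * ‖f‖) * (1 / l + 1 / k)) := by gcongr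
    _ = _ := by ring

variable (E F l) in
/-- The Yosida approximation of the semigroup of the form with Dirichlet conditions outside
`F`. -/
noncomputable def yosidaSemigroup (t : ℝ) : Lp ℝ 2 μ →L[ℝ] Lp ℝ 2 μ :=
  expSemigroup (E.scaledResolvent F l) l t

theorem norm_yosidaSemigroup_le (hl : 0 < l) {t : ℝ} (ht : 0 ≤ t) (f : Lp ℝ 2 μ) :
    ‖E.yosidaSemigroup F l t f‖ ≤ ‖f‖ :=
  norm_expSemigroup_le (norm_scaledResolvent_le hl) ht hl.le f

theorem yosidaSemigroup_nonneg (hl : 0 < l) {t : ℝ} (ht : 0 ≤ t) (f : Lp ℝ 2 μ)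
    (hf : ∀ᵐ x ∂μ, 0 ≤ f x) : ∀ᵐ x ∂μ, 0 ≤ E.yosidaSemigroup F l t f x :=
  expSemigroup_nonneg (scaledResolvent_mem_Icc hl) ht hl.le f hf

theorem hasDerivAt_yosidaSemigroup (t : ℝ) :
    HasDerivAt (E.yosidaSemigroup F l) (-(E.yosidaSemigroup F l t * E.yosida F l)) t := by
  have h := hasDerivAt_expSemigroup (N := E.scaledResolvent F l) (l := l) t
  rwa [neg_yosida, mul_neg] at h

theorem commute_yosida_yosidaSemigroup (t : ℝ) :
    Commute (E.yosida F l) (E.yosidaSemigroup F l t) :=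
  commute_expSemigroup (((Commute.one_left _).sub_left (Commute.refl _)).smul_left l) t

theorem norm_yosidaSemigroup_sub_le (hl : 0 < l) (hk : 0 < k) (hβ : 0 < β) {τ : ℝ} (hτ : 0 ≤ τ)
    (f : Lp ℝ 2 μ) :
    ‖E.yosidaSemigroup F l τ (E.scaledResolvent F β (E.scaledResolvent F β f))
      - E.yosidaSemigroup F k τ (E.scaledResolvent F β (E.scaledResolvent F β f))‖
      ≤ 4 * β ^ 2 * ‖f‖ * (1 / l + 1 / k) * τ := by
  set g := E.scaledResolvent F β (E.scaledResolvent F β f) with hg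
  have h := norm_expSemigroup_sub_le (N := E.scaledResolvent F k) (l := k)
    (norm_scaledResolvent_le hk) hk.le (C := 4 * β ^ 2 * ‖f‖ * (1 / l + 1 / k)) hτ
    (q := fun r => E.yosidaSemigroup F l r g)
    (q' := fun r => (-(E.yosidaSemigroup F l r * E.yosida F l)) g)
    (fun r _ => ((hasDerivAt_yosidaSemigroup r).clm_apply
      (hasDerivAt_const r g)).continuousAt.continuousWithinAt)
    (fun r _ => by
      have := (hasDerivAt_yosidaSemigroup (E := E) (F := F) (l := l) r).clm_apply
        (hasDerivAt_const r g)
      simpa using this.hasDerivWithinAt)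
    (fun r hr => by
      have hc : Commute (E.yosida F k) (E.yosidaSemigroup F l r) :=
        commute_expSemigroup (((Commute.one_left _).sub_left
          (commute_scaledResolvent hk hl)).smul_left k) r
      have hc' := DFunLike.congr_fun hc g
      simp only [mul_apply_eq_comp] at hc'
      rw [neg_yosida, neg_apply, neg_apply,
        mul_apply_eq_comp, hc', ← neg_sub', norm_neg, ← map_sub]
      exact (norm_yosidaSemigroup_le hl hr.1 _).trans (norm_yosida_sub_yosida_le hl hk hβ f))
  have h0 : E.yosidaSemigroup F l 0 g = g := by
    rw [yosidaSemigroup, expSemigroup_zero]; rfl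
  rw [h0] at h
  exact h

theorem tendsto_yosidaSemigroup {F : ℕ → Set X} (hF : Monotone F)
    (hd : ∀ f : E.Dom, ∀ ε > 0, ∃ n, ∃ g ∈ E.supported (F n), ‖f - g‖ < ε) (hl : 0 < l) {t : ℝ}
    (ht : 0 ≤ t) (f : Lp ℝ 2 μ) :
    Tendsto (fun n => E.yosidaSemigroup (F n) l t f) atTop (𝓝 (E.yosidaSemigroup univ l t f)) :=
  tendsto_expSemigroup (fun _ => norm_scaledResolvent_le hl) (tendsto_scaledResolvent hF hd hl) ht
    hl.le f

end Yosida

end DirichletForm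

/-! ### Symmetric contractions -/

section Doubling

/-- If `q n ^ 2 ≤ c * q (n + 1)` for a bounded sequence, then `q 0 ≤ c`. -/
theorem le_of_sq_le_mul_succ {q : ℕ → ℝ} {c K : ℝ} (hc : 0 ≤ c) (hK : ∀ n, q n ≤ K)
    (h : ∀ n, q n ^ 2 ≤ c * q (n + 1)) : q 0 ≤ c := by
  rcases hc.eq_or_lt with rfl | hc
  · have := h 0
    rw [zero_mul] at this
    nlinarith [sq_nonneg (q 0)]
  by_contra! hlt
  have hρ : 1 < q 0 / c := (one_lt_div hc).2 hlt
  have hge : ∀ n, q 0 * (q 0 / c) ^ n ≤ q n := by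
    intro n
    induction n with
    | zero => simp
    | succ n ih =>
      have h0 : 0 < q 0 := hc.trans hlt
      have h1 : q 0 ≤ q n := le_trans (by
        have := one_le_pow₀ hρ.le (n := n); nlinarith) ih
      have h2 : q n * (q 0 / c) ≤ q (n + 1) := by
        rw [mul_div_assoc', div_le_iff₀ hc]
        nlinarith [h n]
      calc q 0 * (q 0 / c) ^ (n + 1) = (q 0 * (q 0 / c) ^ n) * (q 0 / c) := by ring
        _ ≤ q n * (q 0 / c) := by gcongr
        _ ≤ _ := h2
  have hlim : Tendsto (fun n => q 0 * (q 0 / c) ^ n) atTop atTop :=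
    (tendsto_pow_atTop_atTop_of_one_lt hρ).const_mul_atTop (hc.trans hlt)
  obtain ⟨n, hn⟩ := (hlim.eventually_gt_atTop K).exists
  exact absurd (hK n) (not_le.2 (hn.trans_le (hge n)))

variable {H : Type*} [NormedAddCommGroup H] [InnerProductSpace ℝ H]

/-- A symmetric contraction that commutes with a nonnegative symmetric operator `B` is also a
contraction for the semi-inner product of `B`. -/
theorem inner_apply_le_of_commute {B T : H →L[ℝ] H} (hB : ∀ f g, inner ℝ (B f) g = inner ℝ f (B g))
    (hB0 : ∀ f, 0 ≤ inner ℝ (B f) f) (hT : ∀ f g, inner ℝ (T f) g = inner ℝ f (T g))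
    (hT1 : ∀ f, ‖T f‖ ≤ ‖f‖) (hBT : ∀ f, B (T f) = T (B f)) (f : H) :
    inner ℝ (B (T f)) (T f) ≤ inner ℝ (B f) f := by
  have hCS : ∀ f g, (inner ℝ (B f) g) ^ 2 ≤ inner ℝ (B f) f * inner ℝ (B g) g := fun f g => by
    have h : ∀ t : ℝ, 0 ≤ inner ℝ (B g) g * (t * t) + 2 * inner ℝ (B f) g * t
        + inner ℝ (B f) f := fun t => by
      have := hB0 (f + t • g)
      rw [map_add, map_smul, inner_add_left, inner_add_right, inner_add_right,
        real_inner_smul_left, real_inner_smul_left, real_inner_smul_right, real_inner_smul_right,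
        hB g f, real_inner_comm (B f) g] at this
      linarith
    have := discrim_le_zero h
    rw [discrim] at this
    nlinarith
  -- by Cauchy–Schwarz the energies along the powers `T^(2^n)` satisfy the doubling inequality
  set S : ℕ → H := fun n => T^[2 ^ n] f with hS
  have hTn : ∀ (k : ℕ) f g, inner ℝ (T^[k] f) g = inner ℝ f (T^[k] g) := by
    intro k
    induction k with
    | zero => intro f g; rfl
    | succ k ih =>
      intro f g
      rw [Function.iterate_succ_apply, ih, hT, ← Function.iterate_succ_apply' T]
  have hTB : ∀ (k : ℕ) f, B (T^[k] f) = T^[k] (B f) := by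
    intro k
    induction k with
    | zero => intro f; rfl
    | succ k ih =>
      intro f
      rw [Function.iterate_succ_apply, ih, hBT, ← Function.iterate_succ_apply T]
  have hTk : ∀ (k : ℕ) f, ‖T^[k] f‖ ≤ ‖f‖ := by
    intro k
    induction k with
    | zero => intro f; rfl
    | succ k ih => intro f; exact (ih _).trans (hT1 f)
  refine le_of_sq_le_mul_succ (q := fun n => inner ℝ (B (S n)) (S n)) (K := ‖B‖ * ‖f‖ * ‖f‖)
    (hB0 f) (fun n => ?_) (fun n => ?_)
  · refine (real_inner_le_norm _ _).trans (mul_le_mul ?_ (hTk _ f) (norm_nonneg _) (by positivity))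
    exact (B.le_opNorm _).trans (mul_le_mul_of_nonneg_left (hTk _ f) (norm_nonneg _))
  · have h1 : inner ℝ (B (S n)) (S n) = inner ℝ (B f) (S (n + 1)) := by
      rw [hS]
      simp only
      rw [hTB, hTn, ← Function.iterate_add_apply, pow_succ, mul_two]
    rw [h1]
    exact hCS f (S (n + 1))

end Doubling

namespace DirichletForm

section Semigroup

variable {X : Type*} [MeasurableSpace X] {μ : Measure X} {E : DirichletForm μ}
  {P : ℝ≥0 → Lp ℝ 2 μ →L[ℝ] Lp ℝ 2 μ}

/-! ### The heat semigroup -/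

/-- `semigroup` is chosen among the heat semigroups as soon as there is one. -/
theorem isHeatSemigroup_semigroup (h : ∃ P, E.IsHeatSemigroup P) :
    E.IsHeatSemigroup E.semigroup := by
  have : E.semigroup = h.choose := by
    funext t
    rw [semigroup, dif_pos h]
  rw [this]
  exact h.choose_spec

theorem tendsto_scaledResolvent_atTop {F : Set X} {f : Lp ℝ 2 μ}
    (hf : f ∈ closure (E.toL2 '' (E.supported F : Set E.Dom))) :
    Tendsto (fun l : ℝ => E.scaledResolvent F l f) atTop (𝓝 f) := by
  rw [Metric.tendsto_atTop]
  intro ε hε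
  obtain ⟨_, ⟨g, hg, rfl⟩, hfg⟩ := Metric.mem_closure_iff.1 hf (ε / 3) (by positivity)
  obtain ⟨N, hN0, hN⟩ : ∃ N : ℝ, 0 < N ∧ E.energy g g / N < (ε / 3) ^ 2 := by
    refine ⟨E.energy g g / (ε / 3) ^ 2 + 1, ?_, ?_⟩
    · have := E.energy_nonneg g; positivity
    · have h0 := E.energy_nonneg g
      rw [div_lt_iff₀ (by positivity), mul_add, mul_div_cancel₀ _ (by positivity)]
      have : 0 < (ε / 3) ^ 2 := by positivity
      linarith
  refine ⟨N, fun l hl => ?_⟩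
  have hl0 : 0 < l := hN0.trans_le hl
  have h1 := energy_scaledResolvent_le hl0 hg
  have h2 : ‖E.scaledResolvent F l (E.toL2 g) - E.toL2 g‖ < ε / 3 := by
    refine lt_of_pow_lt_pow_left₀ 2 (by positivity) (lt_of_le_of_lt ?_ hN)
    rw [le_div_iff₀ hN0]
    nlinarith [sq_nonneg ‖E.scaledResolvent F l (E.toL2 g) - E.toL2 g‖]
  have h3 := norm_scaledResolvent_le (E := E) (F := F) hl0 (f - E.toL2 g)
  rw [dist_eq_norm] at hfg ⊢
  have h4 : E.scaledResolvent F l f - f = E.scaledResolvent F l (f - E.toL2 g)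
      + (E.scaledResolvent F l (E.toL2 g) - E.toL2 g) - (f - E.toL2 g) := by
    rw [map_sub]; abel
  rw [h4]
  have h5 := norm_sub_le (E.scaledResolvent F l (f - E.toL2 g)
      + (E.scaledResolvent F l (E.toL2 g) - E.toL2 g)) (f - E.toL2 g)
  have h6 := norm_add_le (E.scaledResolvent F l (f - E.toL2 g))
    (E.scaledResolvent F l (E.toL2 g) - E.toL2 g)
  linarith

theorem mem_closure_supported_univ (f : Lp ℝ 2 μ) :
    f ∈ closure (E.toL2 '' (E.supported univ : Set E.Dom)) := by
  have : E.toL2 '' (E.supported univ : Set E.Dom) = range E.toL2 := by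
    ext g
    exact ⟨fun ⟨h, _, e⟩ => ⟨h, e⟩, fun ⟨h, e⟩ => ⟨h, mem_supported_univ h, e⟩⟩
  rw [this]
  exact E.denseRange_toL2 f

theorem norm_scaledResolvent_sq_sub_le {F : Set X} {l : ℝ} (hl : 0 < l) (f : Lp ℝ 2 μ) :
    ‖E.scaledResolvent F l (E.scaledResolvent F l f) - f‖
      ≤ 2 * ‖E.scaledResolvent F l f - f‖ := by
  have h1 := norm_scaledResolvent_le (E := E) (F := F) hl (E.scaledResolvent F l f - f)
  have h2 : E.scaledResolvent F l (E.scaledResolvent F l f) - f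
      = E.scaledResolvent F l (E.scaledResolvent F l f - f) + (E.scaledResolvent F l f - f) := by
    rw [map_sub]; abel
  rw [h2]
  linarith [norm_add_le (E.scaledResolvent F l (E.scaledResolvent F l f - f))
    (E.scaledResolvent F l f - f)]

theorem tendsto_scaledResolvent_sq_atTop {F : Set X} {f : Lp ℝ 2 μ}
    (hf : f ∈ closure (E.toL2 '' (E.supported F : Set E.Dom))) :
    Tendsto (fun l : ℝ => E.scaledResolvent F l (E.scaledResolvent F l f)) atTop (𝓝 f) := by
  rw [tendsto_iff_norm_sub_tendsto_zero]
  have h1 := (tendsto_iff_norm_sub_tendsto_zero.1 (tendsto_scaledResolvent_atTop hf)).const_mul 2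
  rw [mul_zero] at h1
  refine squeeze_zero' (Eventually.of_forall fun _ => norm_nonneg _) ?_ h1
  filter_upwards [eventually_gt_atTop 0] with l hl
  exact norm_scaledResolvent_sq_sub_le hl f

theorem isGenerator_resolvent {l : ℝ} (hl : 0 < l) (f : Lp ℝ 2 μ) :
    E.IsGenerator (E.toL2 (E.resolvent univ l f)) (f - E.scaledResolvent univ l f) := by
  refine ⟨E.resolvent univ l f, rfl, fun φ => ?_⟩
  have h := resolvent_eq hl f (mem_supported_univ φ)
  rw [inner_sub_left, scaledResolvent_apply, real_inner_smul_left]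
  linarith

variable (hP : E.IsHeatSemigroup P)

include hP

/-- Strong continuity at zero and the uniform boundedness principle. -/
theorem IsHeatSemigroup.norm_le_near_zero : ∃ δ : ℝ≥0, 0 < δ ∧ ∃ M : ℝ, 1 ≤ M ∧
    ∀ t ≤ δ, ‖P t‖ ≤ M := by
  by_contra! hcon
  have h1 : ∀ n : ℕ, ∃ t : ℝ≥0, t ≤ 1 / (n + 1 : ℝ≥0) ∧ (n + 1 : ℝ) < ‖P t‖ := fun n => by
    obtain ⟨t, ht, h⟩ := hcon (1 / (n + 1 : ℝ≥0)) (by positivity) (n + 1 : ℝ) (by simp)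
    exact ⟨t, ht, h⟩
  choose t ht htn using h1
  have ht0 : Tendsto t atTop (𝓝 0) := by
    refine tendsto_of_tendsto_of_tendsto_of_le_of_le tendsto_const_nhds ?_ (fun n => zero_le) ht
    rw [← NNReal.tendsto_coe]
    simpa using tendsto_one_div_add_atTop_nhds_zero_nat (𝕜 := ℝ)
  obtain ⟨C, hC⟩ := banach_steinhaus (g := fun n => P (t n)) fun f => by
    have h2 := ((hP.tendsto_zero f).comp ht0).norm
    obtain ⟨C, hC⟩ := h2.bddAbove_range
    exact ⟨C, fun n => hC ⟨n, rfl⟩⟩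
  obtain ⟨n, hn⟩ := exists_nat_gt C
  have := htn n
  have := hC n
  linarith

theorem IsHeatSemigroup.norm_le_of_le (T : ℝ≥0) : ∃ M : ℝ, ∀ t ≤ T, ‖P t‖ ≤ M := by
  obtain ⟨δ, hδ, M, hM1, hM⟩ := hP.norm_le_near_zero
  have h : ∀ n : ℕ, ∀ t ≤ n * δ, ‖P t‖ ≤ M ^ (n + 1) := by
    intro n
    induction n with
    | zero => intro t ht; rw [zero_add, pow_one]; exact hM t (by simp at ht; simp [ht])
    | succ n ih =>
      intro t ht
      rcases le_total t δ with h | h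
      · exact (hM t h).trans (le_self_pow₀ hM1 (by simp))
      · have h1 : t = δ + (t - δ) := (add_tsub_cancel_of_le h).symm
        rw [h1, hP.add]
        refine (ContinuousLinearMap.opNorm_comp_le _ _).trans ?_
        rw [pow_succ' M (n + 1)]
        refine mul_le_mul (hM δ le_rfl) (ih _ ?_) (norm_nonneg _) (by linarith)
        rw [tsub_le_iff_right]
        refine ht.trans (le_of_eq ?_)
        push_cast; ring
  obtain ⟨n, hn⟩ := exists_nat_ge (T / δ)
  refine ⟨M ^ (n + 1), fun t ht => h n t (ht.trans ?_)⟩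
  rwa [div_le_iff₀ hδ] at hn

theorem IsHeatSemigroup.continuous (f : Lp ℝ 2 μ) : Continuous fun t => P t f := by
  rw [continuous_iff_continuousAt]
  intro t₀
  obtain ⟨M, hM⟩ := hP.norm_le_of_le (t₀ + 1)
  rw [ContinuousAt, tendsto_iff_norm_sub_tendsto_zero]
  have hd : Tendsto (fun t : ℝ≥0 => (t - t₀) + (t₀ - t)) (𝓝 t₀) (𝓝 0) := by
    have : Continuous fun t : ℝ≥0 => (t - t₀) + (t₀ - t) := by fun_prop
    simpa using this.tendsto t₀
  have h1 := (tendsto_iff_norm_sub_tendsto_zero.1 ((hP.tendsto_zero f).comp hd)).const_mul M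
  rw [mul_zero] at h1
  refine squeeze_zero' (Eventually.of_forall fun _ => norm_nonneg _) ?_ h1
  filter_upwards [Iic_mem_nhds (show t₀ < t₀ + 1 by simp)] with t ht
  simp only [Function.comp_apply]
  rcases le_total t t₀ with h | h
  · have h2 : P t f - P t₀ f = -(P t (P (t₀ - t) f - f)) := by
      have : t₀ = t + (t₀ - t) := (add_tsub_cancel_of_le h).symm
      conv_lhs => rw [this, hP.add]
      simp
    rw [h2, norm_neg, tsub_eq_zero_of_le h, zero_add]
    exact (P t).le_of_opNorm_le (hM t ht) _
  · have h2 : P t f - P t₀ f = P t₀ (P (t - t₀) f - f) := by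
      have : t = t₀ + (t - t₀) := (add_tsub_cancel_of_le h).symm
      conv_lhs => rw [this, hP.add]
      simp
    rw [h2, tsub_eq_zero_of_le h, add_zero]
    exact (P t₀).le_of_opNorm_le (hM t₀ (by simp)) _

theorem IsHeatSemigroup.isGenerator_apply {f g : Lp ℝ 2 μ} (h : E.IsGenerator f g) (t : ℝ≥0) :
    E.IsGenerator (P t f) (P t g) := by
  rw [← hP.generator] at h ⊢
  refine (((P t).continuous.tendsto g).comp h).congr fun s => ?_
  simp only [Function.comp_apply, map_smul, map_sub]
  rw [← ContinuousLinearMap.comp_apply, ← ContinuousLinearMap.comp_apply, ← hP.add, ← hP.add,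
    add_comm]

theorem IsHeatSemigroup.hasDerivWithinAt {f g : Lp ℝ 2 μ} (h : E.IsGenerator f g) {r : ℝ}
    (hr : 0 ≤ r) :
    HasDerivWithinAt (fun r : ℝ => P r.toNNReal f) (-P r.toNNReal g) (Ici r) r := by
  have h1 := (hP.generator _ _).2 (hP.isGenerator_apply h r.toNNReal)
  rw [← hasDerivWithinAt_Ioi_iff_Ici, hasDerivWithinAt_iff_tendsto_slope' (by simp)]
  have h2 : Tendsto (fun s : ℝ => (s - r).toNNReal) (𝓝[>] r) (𝓝[>] 0) := by
    refine tendsto_nhdsWithin_iff.2 ⟨?_, ?_⟩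
    · have : Continuous fun s : ℝ => (s - r).toNNReal := by fun_prop
      have := this.tendsto r
      simp only [sub_self, Real.toNNReal_zero] at this
      exact this.mono_left nhdsWithin_le_nhds
    · filter_upwards [self_mem_nhdsWithin] with s hs
      exact Real.toNNReal_pos.2 (sub_pos.2 hs)
  refine ((h1.comp h2).neg).congr' ?_
  filter_upwards [self_mem_nhdsWithin] with s hs
  have hs' : r < s := hs
  rw [slope_def_module, Function.comp_apply, Real.coe_toNNReal _ (sub_pos.2 hs').le,
    ← ContinuousLinearMap.comp_apply, ← hP.add, ← Real.toNNReal_add (sub_pos.2 hs').le hr,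
    sub_add_cancel, ← smul_neg, neg_sub]

/-- The semigroup is contractive, because `‖P t f‖ ^ 2` has derivative `-2 E(P t f, P t f)` for
`f` in the domain of the generator, which is dense. -/
theorem IsHeatSemigroup.norm_apply_le (t : ℝ≥0) (f : Lp ℝ 2 μ) : ‖P t f‖ ≤ ‖f‖ := by
  have key : ∀ f g : Lp ℝ 2 μ, E.IsGenerator f g → ‖P t f‖ ≤ ‖f‖ := by
    intro f g hfg
    have hder : ∀ r ∈ Ico (0 : ℝ) t, HasDerivWithinAt (fun r : ℝ => ‖P r.toNNReal f‖ ^ 2)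
        (2 * inner ℝ (P r.toNNReal f) (-P r.toNNReal g)) (Ici r) r := fun r hr =>
      (hP.hasDerivWithinAt hfg hr.1).norm_sq
    have hc : Continuous fun r : ℝ => ‖P r.toNNReal f‖ ^ 2 :=
      (((hP.continuous f).comp continuous_real_toNNReal).norm).pow 2
    have := image_le_of_deriv_right_le_deriv_boundary (B := fun _ => ‖f‖ ^ 2) (B' := fun _ => 0)
      hc.continuousOn hder (by simp [hP.zero]) continuousOn_const
      (fun r _ => hasDerivWithinAt_const _ _ _) (fun r hr => by
        obtain ⟨f', hf', hE⟩ := hP.isGenerator_apply hfg r.toNNReal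
        have h1 := hE f'
        have h2 := E.energy_nonneg f'
        rw [hf'] at h1
        rw [inner_neg_right, real_inner_comm]
        linarith) (right_mem_Icc.2 t.2)
    simp only [Real.toNNReal_coe] at this
    exact le_of_sq_le_sq this (norm_nonneg _)
  have hlim : Tendsto (fun l : ℝ => E.scaledResolvent univ l f) atTop (𝓝 f) :=
    tendsto_scaledResolvent_atTop (mem_closure_supported_univ f)
  refine le_of_tendsto_of_tendsto (((P t).continuous.tendsto f).comp hlim).norm hlim.norm ?_
  filter_upwards [eventually_gt_atTop 0] with l hl
  rw [Function.comp_apply, scaledResolvent_apply, map_smul, norm_smul, norm_smul]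
  exact mul_le_mul_of_nonneg_left (key _ _ (isGenerator_resolvent hl f)) (norm_nonneg _)

theorem IsHeatSemigroup.apply_resolvent {l : ℝ} (hl : 0 < l) (t : ℝ≥0) (f : Lp ℝ 2 μ) :
    P t (E.toL2 (E.resolvent univ l f)) = E.toL2 (E.resolvent univ l (P t f)) := by
  obtain ⟨f', hf', hE⟩ := hP.isGenerator_apply (isGenerator_resolvent hl f) t
  rw [← hf']
  congr 1
  refine eq_resolvent hl _ (mem_supported_univ _) fun g _ => ?_
  rw [hE, hf', map_sub, inner_sub_left, scaledResolvent_apply, map_smul, real_inner_smul_left]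
  ring

theorem IsHeatSemigroup.apply_scaledResolvent {l : ℝ} (hl : 0 < l) (t : ℝ≥0) (f : Lp ℝ 2 μ) :
    P t (E.scaledResolvent univ l f) = E.scaledResolvent univ l (P t f) := by
  rw [scaledResolvent_apply, map_smul, hP.apply_resolvent hl, scaledResolvent_apply]

/-- The Yosida approximations converge to the semigroup. -/
theorem IsHeatSemigroup.norm_sub_yosidaSemigroup_le {l β : ℝ} (hl : 0 < l) (hβ : 0 < β) (τ : ℝ≥0)
    (f : Lp ℝ 2 μ) :
    ‖P τ (E.scaledResolvent univ β (E.scaledResolvent univ β f))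
      - E.yosidaSemigroup univ l τ (E.scaledResolvent univ β (E.scaledResolvent univ β f))‖
      ≤ 4 * β ^ 2 * ‖f‖ / l * τ := by
  set h : Lp ℝ 2 μ := f - E.scaledResolvent univ β f with hh
  set g := E.scaledResolvent univ β (E.scaledResolvent univ β f) with hg
  have hgen : E.IsGenerator g (β • E.scaledResolvent univ β h) := by
    obtain ⟨f', hf', hE⟩ := isGenerator_resolvent (E := E) hβ (E.scaledResolvent univ β f)
    refine ⟨β • f', by rw [map_smul, hf', hg]; rfl, fun φ => ?_⟩
    rw [map_smul, LinearMap.smul_apply, hE, smul_eq_mul, real_inner_smul_left, hh, map_sub]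
  have hyg : E.yosida univ l g = E.scaledResolvent univ l (β • E.scaledResolvent univ β h) := by
    rw [map_smul, yosida_apply, hg, scaledResolvent_identity hl hβ, hh,
      map_sub (E.scaledResolvent univ β)]
  have hbound : ‖E.yosida univ l g - β • E.scaledResolvent univ β h‖ ≤ 4 * β ^ 2 * ‖f‖ / l := by
    rw [hyg, map_smul, ← smul_sub, norm_smul, Real.norm_of_nonneg hβ.le, norm_sub_rev]
    have h1 := norm_sub_scaledResolvent_scaledResolvent_le (E := E) (F := univ) hl hβ h
    have h2 := norm_sub_scaledResolvent_le (E := E) (F := univ) hβ f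
    rw [← hh] at h2
    calc _ ≤ β * (2 * β * ‖h‖ / l) := by gcongr
      _ ≤ β * (2 * β * (2 * ‖f‖) / l) := by gcongr
      _ = _ := by ring
  have hq : Continuous fun r : ℝ => P r.toNNReal g :=
    (hP.continuous g).comp continuous_real_toNNReal
  have := norm_expSemigroup_sub_le (N := E.scaledResolvent univ l) (l := l)
    (norm_scaledResolvent_le hl) hl.le (C := 4 * β ^ 2 * ‖f‖ / l) τ.2 hq.continuousOn
    (fun r hr => hP.hasDerivWithinAt hgen hr.1) (fun r hr => by
      have hc : E.yosida univ l (P r.toNNReal g) = P r.toNNReal (E.yosida univ l g) := by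
        rw [yosida_apply, yosida_apply, map_smul, map_sub, hP.apply_scaledResolvent hl]
      rw [neg_yosida, neg_apply, hc, ← neg_sub', norm_neg, ← map_sub]
      exact (hP.norm_apply_le _ _).trans (by rw [norm_sub_rev]; exact hbound))
  simpa [hP.zero, yosidaSemigroup] using this

theorem IsHeatSemigroup.tendsto_yosidaSemigroup (τ : ℝ≥0) (f : Lp ℝ 2 μ) :
    Tendsto (fun l : ℝ => E.yosidaSemigroup univ l τ f) atTop (𝓝 (P τ f)) := by
  rw [Metric.tendsto_atTop]
  intro ε hε
  have hlim := tendsto_scaledResolvent_sq_atTop (E := E) (mem_closure_supported_univ f)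
  obtain ⟨β, hβd, hβ⟩ := ((hlim.eventually (Metric.ball_mem_nhds f (show 0 < ε / 3 by positivity))).and
    (eventually_gt_atTop 0)).exists
  set g := E.scaledResolvent univ β (E.scaledResolvent univ β f) with hg
  have hgf : ‖g - f‖ < ε / 3 := by rwa [dist_eq_norm] at hβd
  obtain ⟨N, hN⟩ := exists_gt (4 * β ^ 2 * ‖f‖ * τ / (ε / 3))
  refine ⟨max N 1, fun l hl => ?_⟩
  have hl0 : 0 < l := lt_of_lt_of_le one_pos ((le_max_right _ _).trans hl)
  have h1 := hP.norm_sub_yosidaSemigroup_le hl0 hβ τ f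
  rw [← hg] at h1
  have h2 : 4 * β ^ 2 * ‖f‖ / l * τ < ε / 3 := by
    have h3 : 4 * β ^ 2 * ‖f‖ * τ / (ε / 3) < l := hN.trans_le ((le_max_left _ _).trans hl)
    rw [div_lt_iff₀ (by positivity)] at h3
    rw [div_mul_eq_mul_div, div_lt_iff₀ hl0]
    linarith
  have h3 := norm_yosidaSemigroup_le (E := E) (F := univ) hl0 τ.2 (f - g)
  have h4 := hP.norm_apply_le τ (g - f)
  rw [norm_sub_rev] at h3
  rw [dist_eq_norm]
  have h5 : E.yosidaSemigroup univ l τ f - P τ f = E.yosidaSemigroup univ l τ (f - g)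
      - (P τ g - E.yosidaSemigroup univ l τ g) + P τ (g - f) := by
    rw [map_sub, map_sub]; abel
  rw [h5]
  have h6 := norm_add_le (E.yosidaSemigroup univ l τ (f - g)
      - (P τ g - E.yosidaSemigroup univ l τ g)) (P τ (g - f))
  have h7 := norm_sub_le (E.yosidaSemigroup univ l τ (f - g))
    (P τ g - E.yosidaSemigroup univ l τ g)
  have h8 : ‖E.yosidaSemigroup univ l (τ : ℝ) (f - g)‖ ≤ ‖g - f‖ := h3
  linarith

theorem IsHeatSemigroup.mem_Icc (τ : ℝ≥0) (f : Lp ℝ 2 μ) (hf : ∀ᵐ x ∂μ, f x ∈ Icc (0 : ℝ) 1) :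
    ∀ᵐ x ∂μ, P τ f x ∈ Icc (0 : ℝ) 1 := by
  have hcl : IsClosed {f : Lp ℝ 2 μ | ∀ᵐ x ∂μ, f x ∈ Icc (0 : ℝ) 1} :=
    isClosed_setOf_ae_mem (fun _ => Icc 0 1) fun _ => isClosed_Icc
  refine hcl.mem_of_tendsto (hP.tendsto_yosidaSemigroup τ f) ?_
  filter_upwards [eventually_gt_atTop 0] with l hl
  exact expSemigroup_mem_Icc (scaledResolvent_mem_Icc hl) τ.2 hl.le f hf

theorem IsHeatSemigroup.apply_nonneg (τ : ℝ≥0) (f : Lp ℝ 2 μ) (hf : ∀ᵐ x ∂μ, 0 ≤ f x) :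
    ∀ᵐ x ∂μ, 0 ≤ P τ f x :=
  nonneg_of_mapsTo_Icc _ (fun g hg => (hP.mem_Icc τ g hg).mono fun _ h => h.1) f hf

theorem IsHeatSemigroup.inner_symm (τ : ℝ≥0) (f g : Lp ℝ 2 μ) :
    inner ℝ (P τ f) g = inner ℝ f (P τ g) := by
  have h1 := (hP.tendsto_yosidaSemigroup τ f).inner (tendsto_const_nhds (x := g)) (𝕜 := ℝ)
  have h2 := (tendsto_const_nhds (x := f)).inner (hP.tendsto_yosidaSemigroup τ g) (𝕜 := ℝ)
  refine tendsto_nhds_unique_of_eventuallyEq h1 h2 ?_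
  filter_upwards [eventually_gt_atTop 0] with l hl
  have hpow : ∀ (k : ℕ) (f g : Lp ℝ 2 μ), inner ℝ ((E.scaledResolvent univ l ^ k) f) g
      = inner ℝ f ((E.scaledResolvent univ l ^ k) g) := by
    intro k
    induction k with
    | zero => intro f g; rfl
    | succ k ih =>
      intro f g
      have e1 : (E.scaledResolvent univ l ^ (k + 1)) f
          = E.scaledResolvent univ l ((E.scaledResolvent univ l ^ k) f) := by
        rw [pow_succ']; rfl
      have e2 : (E.scaledResolvent univ l ^ (k + 1)) g
          = (E.scaledResolvent univ l ^ k) (E.scaledResolvent univ l g) := by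
        rw [pow_succ]; rfl
      rw [e1, e2, inner_scaledResolvent_symm hl, ih]
  have s1 := (hasSum_expSemigroup (N := E.scaledResolvent univ l) (l := l) (τ : ℝ) f).mapL
    (innerSL ℝ g)
  have s2 := (hasSum_expSemigroup (N := E.scaledResolvent univ l) (l := l) (τ : ℝ) g).mapL
    (innerSL ℝ f)
  have s3 : (fun k : ℕ => innerSL ℝ g ((Real.exp (-(τ * l)) * ((k.factorial : ℝ)⁻¹ * (τ * l) ^ k)) •
        (E.scaledResolvent univ l ^ k) f)) = fun k : ℕ => innerSL ℝ f
        ((Real.exp (-(τ * l)) * ((k.factorial : ℝ)⁻¹ * (τ * l) ^ k)) •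
        (E.scaledResolvent univ l ^ k) g) := by
    funext k
    simp only [innerSL_apply_apply, real_inner_smul_right]
    rw [real_inner_comm, hpow]
  rw [s3] at s1
  have := s1.unique s2
  simp only [innerSL_apply_apply] at this
  rw [real_inner_comm]
  exact this

end Semigroup

end DirichletForm

namespace DirichletForm

section FormSemigroup

variable {X : Type*} [MeasurableSpace X] {μ : Measure X} {E : DirichletForm μ}
  {P : ℝ≥0 → Lp ℝ 2 μ →L[ℝ] Lp ℝ 2 μ}

/-! ### The heat semigroup on the form domain -/

/-- A vector of the form domain orthogonal to the range of the resolvent is orthogonal to the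
whole space in `L²`. -/
theorem denseRange_resolvent : DenseRange (E.resolvent univ 1) := by
  have h : (LinearMap.range (E.resolvent univ 1 : Lp ℝ 2 μ →ₗ[ℝ] E.Dom)).topologicalClosure = ⊤ := by
    rw [Submodule.topologicalClosure_eq_top_iff, Submodule.eq_bot_iff]
    intro g hg
    apply E.toL2_injective
    rw [map_zero, ← inner_self_eq_zero (𝕜 := ℝ)]
    have h1 := (Submodule.mem_orthogonal _ _).1 hg (E.resolvent univ 1 (E.toL2 g)) ⟨_, rfl⟩
    have h2 := resolvent_eq one_pos (E.toL2 g) (mem_supported_univ g)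
    rw [inner_dom] at h1
    linarith
  intro f
  have : f ∈ (LinearMap.range (E.resolvent univ 1 : Lp ℝ 2 μ →ₗ[ℝ] E.Dom)).topologicalClosure := by
    rw [h]; trivial
  exact this

theorem energy_resolvent (f g : Lp ℝ 2 μ) :
    E.energy (E.resolvent univ 1 f) (E.resolvent univ 1 g)
      = inner ℝ (E.scaledResolvent univ 1 f
          - E.scaledResolvent univ 1 (E.scaledResolvent univ 1 f)) g := by
  have h := resolvent_eq one_pos f (mem_supported_univ (E.resolvent univ 1 g))
  have e : ∀ h, E.toL2 (E.resolvent univ 1 h) = E.scaledResolvent univ 1 h := fun h => by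
    rw [scaledResolvent_apply, one_smul]
  rw [one_mul, e, e] at h
  rw [inner_sub_left, inner_scaledResolvent_symm one_pos (E.scaledResolvent univ 1 f),
    inner_scaledResolvent_symm one_pos f]
  linarith

variable (hP : E.IsHeatSemigroup P)

include hP

/-- With `N` the scaled resolvent, the energy of the resolvent of `f` is the quadratic form of `N
- N ^ 2`, which commutes with the semigroup. -/
theorem IsHeatSemigroup.energy_resolvent_le (t : ℝ≥0) (f : Lp ℝ 2 μ) :
    E.energy (E.resolvent univ 1 (P t f)) (E.resolvent univ 1 (P t f))
      ≤ E.energy (E.resolvent univ 1 f) (E.resolvent univ 1 f) := by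
  set N := E.scaledResolvent univ 1
  have hN : ∀ f g, inner ℝ (N f) g = inner ℝ f (N g) := inner_scaledResolvent_symm one_pos
  have := inner_apply_le_of_commute (B := N - N * N) (T := P t)
    (fun f g => by
      simp only [sub_apply, mul_apply_eq_comp, inner_sub_left, inner_sub_right]
      rw [hN, hN, hN])
    (fun f => by
      have h1 := energy_resolvent (E := E) f f
      have h2 := E.energy_nonneg (E.resolvent univ 1 f)
      rw [h1] at h2
      exact h2)
    (hP.inner_symm t) (hP.norm_apply_le t)
    (fun f => by
      simp only [sub_apply, mul_apply_eq_comp, map_sub]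
      rw [hP.apply_scaledResolvent one_pos, hP.apply_scaledResolvent one_pos,
        hP.apply_scaledResolvent one_pos]) f
  rw [energy_resolvent, energy_resolvent]
  exact this

theorem IsHeatSemigroup.norm_resolvent_le (t : ℝ≥0) (f : Lp ℝ 2 μ) :
    ‖E.resolvent univ 1 (P t f)‖ ≤ ‖E.resolvent univ 1 f‖ := by
  refine le_of_sq_le_sq ?_ (norm_nonneg _)
  rw [norm_sq_dom, norm_sq_dom, ← hP.apply_resolvent one_pos]
  exact add_le_add (hP.energy_resolvent_le t f)
    (pow_le_pow_left₀ (norm_nonneg _) (hP.norm_apply_le _ _) 2)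

/-- The heat semigroup maps the form domain to itself and decreases the energy; this extends from
the range of the resolvent by density. -/
theorem IsHeatSemigroup.exists_dom (t : ℝ≥0) (f : E.Dom) :
    ∃ f' : E.Dom, E.toL2 f' = P t (E.toL2 f) ∧ ‖f'‖ ≤ ‖f‖ ∧ E.energy f' f' ≤ E.energy f f := by
  obtain ⟨u, hu⟩ := mem_closure_iff_seq_limit.1 (denseRange_resolvent (E := E) f)
  obtain ⟨hu1, hu⟩ := hu
  choose h hh using hu1
  have hconv : Tendsto (fun n => E.resolvent univ 1 (h n)) atTop (𝓝 f) := by simpa [hh] using hu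
  have hcau : CauchySeq fun n => E.resolvent univ 1 (P t (h n)) := by
    have := hconv.cauchySeq
    rw [Metric.cauchySeq_iff] at this ⊢
    intro ε hε
    obtain ⟨N, hN⟩ := this ε hε
    refine ⟨N, fun m hm n hn => lt_of_le_of_lt ?_ (hN m hm n hn)⟩
    rw [dist_eq_norm, dist_eq_norm, ← map_sub, ← map_sub, ← map_sub]
    exact hP.norm_resolvent_le t _
  obtain ⟨f', hf'⟩ := cauchySeq_tendsto_of_complete hcau
  refine ⟨f', ?_, ?_, ?_⟩
  · have h1 : Tendsto (fun n => E.toL2 (E.resolvent univ 1 (P t (h n)))) atTop (𝓝 (E.toL2 f')) :=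
      (E.incl.continuous.tendsto f').comp hf'
    simp only [← hP.apply_resolvent one_pos] at h1
    exact tendsto_nhds_unique h1
      (((P t).continuous.tendsto _).comp ((E.incl.continuous.tendsto f).comp hconv))
  · exact le_of_tendsto_of_tendsto hf'.norm hconv.norm
      (Eventually.of_forall fun n => hP.norm_resolvent_le t _)
  · have hc : Continuous fun g : E.Dom => E.energy g g :=
      E.energyL.continuous.clm_apply continuous_id
    exact le_of_tendsto_of_tendsto ((hc.tendsto f').comp hf') ((hc.tendsto f).comp hconv)
      (Eventually.of_forall fun n => hP.energy_resolvent_le t _)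

/-- The heat semigroup on the form domain. -/
noncomputable def IsHeatSemigroup.dom (t : ℝ≥0) : E.Dom →L[ℝ] E.Dom :=
  LinearMap.mkContinuous
    { toFun := fun f => (hP.exists_dom t f).choose
      map_add' := fun f g => E.toL2_injective ((hP.exists_dom t (f + g)).choose_spec.1.trans (by
        rw [map_add E.toL2 (hP.exists_dom t f).choose, (hP.exists_dom t f).choose_spec.1,
          (hP.exists_dom t g).choose_spec.1, map_add, map_add]))
      map_smul' := fun r f => E.toL2_injective ((hP.exists_dom t (r • f)).choose_spec.1.trans (by
        rw [map_smul E.toL2 _ (hP.exists_dom t f).choose, (hP.exists_dom t f).choose_spec.1,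
          map_smul, map_smul, RingHom.id_apply])) } 1
    fun f => by
      rw [one_mul]
      exact (hP.exists_dom t f).choose_spec.2.1

theorem IsHeatSemigroup.toL2_dom (t : ℝ≥0) (f : E.Dom) :
    E.toL2 (hP.dom t f) = P t (E.toL2 f) := (hP.exists_dom t f).choose_spec.1

theorem IsHeatSemigroup.norm_dom_le (t : ℝ≥0) (f : E.Dom) : ‖hP.dom t f‖ ≤ ‖f‖ :=
  (hP.exists_dom t f).choose_spec.2.1

theorem IsHeatSemigroup.energy_dom_le (t : ℝ≥0) (f : E.Dom) :
    E.energy (hP.dom t f) (hP.dom t f) ≤ E.energy f f :=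
  (hP.exists_dom t f).choose_spec.2.2

theorem IsHeatSemigroup.dom_zero (f : E.Dom) : hP.dom 0 f = f :=
  E.toL2_injective (by rw [hP.toL2_dom, hP.zero]; rfl)

theorem IsHeatSemigroup.dom_resolvent (t : ℝ≥0) (f : Lp ℝ 2 μ) :
    hP.dom t (E.resolvent univ 1 f) = E.resolvent univ 1 (P t f) :=
  E.toL2_injective (by rw [hP.toL2_dom, hP.apply_resolvent one_pos])

theorem IsHeatSemigroup.continuous_dom (f : E.Dom) : Continuous fun t => hP.dom t f := by
  refine continuous_of_uniform_approx_of_continuous fun u hu => ?_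
  obtain ⟨ε, hε, hεu⟩ := Metric.mem_uniformity_dist.1 hu
  obtain ⟨_, ⟨g, rfl⟩, hg⟩ := Metric.mem_closure_iff.1 (denseRange_resolvent (E := E) f) ε hε
  refine ⟨fun t => hP.dom t (E.resolvent univ 1 g), ?_, fun t => hεu ?_⟩
  · simp only [hP.dom_resolvent]
    exact (E.resolvent univ 1).continuous.comp (hP.continuous g)
  · rw [dist_eq_norm, ← map_sub]
    exact (hP.norm_dom_le _ _).trans_lt (by rwa [dist_eq_norm] at hg)

/-- The weak heat equation in integrated form, for initial data in the form domain. -/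
theorem IsHeatSemigroup.inner_sub_eq_integral (f g : E.Dom) {t : ℝ} (ht : 0 ≤ t) :
    inner ℝ (E.toL2 f) (E.toL2 g) - inner ℝ (P t.toNNReal (E.toL2 f)) (E.toL2 g)
      = ∫ r in (0 : ℝ)..t, E.energy (hP.dom r.toNNReal f) g := by
  -- both sides are continuous in `f`, so the dense range of the resolvent suffices
  have hcl : IsClosed {f : E.Dom | inner ℝ (E.toL2 f) (E.toL2 g)
      - inner ℝ (P t.toNNReal (E.toL2 f)) (E.toL2 g)
      = ∫ r in (0 : ℝ)..t, E.energy (hP.dom r.toNNReal f) g} := by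
    refine isClosed_eq ?_ ?_
    · have h1 : Continuous fun f : E.Dom => E.toL2 f := E.incl.continuous
      fun_prop
    · have h3 : ∀ a b : E.Dom, (∫ r in (0 : ℝ)..t, E.energy (hP.dom r.toNNReal a) g)
          - ∫ r in (0 : ℝ)..t, E.energy (hP.dom r.toNNReal b) g
          = ∫ r in (0 : ℝ)..t, E.energy (hP.dom r.toNNReal (a - b)) g := fun a b => by
        have hi : ∀ a : E.Dom, Continuous fun r : ℝ => E.energy (hP.dom r.toNNReal a) g := fun a =>
          (E.energyL.continuous.comp ((hP.continuous_dom a).comp continuous_real_toNNReal)).clm_apply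
            continuous_const
        rw [← intervalIntegral.integral_sub ((hi a).intervalIntegrable _ _)
          ((hi b).intervalIntegrable _ _)]
        simp
      refine (LipschitzWith.of_dist_le_mul (K := (‖g‖ * t).toNNReal) fun a b => ?_).continuous
      rw [Real.dist_eq, h3, dist_eq_norm, Real.coe_toNNReal _ (by positivity)]
      have := intervalIntegral.norm_integral_le_of_norm_le_const (a := (0 : ℝ)) (b := t)
        (C := ‖a - b‖ * ‖g‖) (f := fun r => E.energy (hP.dom r.toNNReal (a - b)) g) (fun r _ => by
          rw [Real.norm_eq_abs]
          exact (E.abs_energy_le _ _).trans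
            (mul_le_mul_of_nonneg_right (hP.norm_dom_le _ _) (norm_nonneg _)))
      rw [Real.norm_eq_abs, sub_zero, abs_of_nonneg ht] at this
      linarith
  refine denseRange_resolvent.induction_on f hcl fun h => ?_
  have hgen := isGenerator_resolvent (E := E) one_pos h
  have hder : ∀ r ∈ Ioo (min 0 t) (max 0 t), HasDerivWithinAt
      (fun r : ℝ => inner ℝ (P r.toNNReal (E.toL2 (E.resolvent univ 1 h))) (E.toL2 g))
      (-E.energy (hP.dom r.toNNReal (E.resolvent univ 1 h)) g) (Ioi r) r := fun r hr => by
    rw [min_eq_left ht, max_eq_right ht] at hr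
    have h1 := ((hP.hasDerivWithinAt hgen hr.1.le).Ioi_of_Ici).inner ℝ
      (hasDerivWithinAt_const r _ (E.toL2 g))
    refine h1.congr_deriv ?_
    obtain ⟨f', hf', hE⟩ := hP.isGenerator_apply hgen r.toNNReal
    have h2 : f' = hP.dom r.toNNReal (E.resolvent univ 1 h) :=
      E.toL2_injective (by rw [hf', hP.toL2_dom])
    rw [← h2, hE, inner_zero_right, zero_add, inner_neg_left]
  have hc : Continuous fun r : ℝ =>
      inner ℝ (P r.toNNReal (E.toL2 (E.resolvent univ 1 h))) (E.toL2 g) :=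
    ((hP.continuous _).comp continuous_real_toNNReal).inner continuous_const
  have hc' : Continuous fun r : ℝ => E.energy (hP.dom r.toNNReal (E.resolvent univ 1 h)) g :=
    (E.energyL.continuous.comp ((hP.continuous_dom _).comp continuous_real_toNNReal)).clm_apply
      continuous_const
  have := intervalIntegral.integral_eq_sub_of_hasDeriv_right hc.continuousOn hder
    (hc'.neg.intervalIntegrable 0 t)
  rw [intervalIntegral.integral_neg] at this
  simp only [Real.toNNReal_zero, hP.zero, ContinuousLinearMap.coe_id', id_eq] at this
  linarith

theorem IsHeatSemigroup.continuous_energy_dom (f g : E.Dom) :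
    Continuous fun r : ℝ => E.energy (hP.dom r.toNNReal f) g :=
  (E.energyL.continuous.comp ((hP.continuous_dom _).comp continuous_real_toNNReal)).clm_apply
    continuous_const

/-- The weak heat equation for initial data in the form domain. -/
theorem IsHeatSemigroup.hasDerivAt_inner (f g : E.Dom) {t : ℝ} (ht : 0 < t) :
    HasDerivAt (fun r : ℝ => (inner ℝ (P r.toNNReal (E.toL2 f)) (E.toL2 g) : ℝ))
      (-E.energy (hP.dom t.toNNReal f) g) t := by
  have hc := hP.continuous_energy_dom f g
  have h1 := (intervalIntegral.integral_hasDerivAt_right (hc.intervalIntegrable 0 t)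
    (hc.stronglyMeasurableAtFilter _ _) hc.continuousAt).const_sub
    (inner ℝ (E.toL2 f) (E.toL2 g) : ℝ)
  refine h1.congr_of_eventuallyEq ?_
  filter_upwards [lt_mem_nhds ht] with r hr
  rw [← hP.inner_sub_eq_integral f g hr.le]
  ring

/-- The approximating forms `t⁻¹ ⟨f - P_t f, g⟩` converge to the form on its domain. -/
theorem IsHeatSemigroup.tendsto_approx (f g : E.Dom) :
    Tendsto (fun t : ℝ => t⁻¹ * inner ℝ (E.toL2 f - P t.toNNReal (E.toL2 f)) (E.toL2 g))
      (𝓝[>] 0) (𝓝 (E.energy f g)) := by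
  have hc := hP.continuous_energy_dom f g
  have h1 := intervalIntegral.integral_hasDerivAt_right (hc.intervalIntegrable 0 0)
    (hc.stronglyMeasurableAtFilter _ _) hc.continuousAt
  rw [Real.toNNReal_zero, hP.dom_zero] at h1
  have h2 := (hasDerivWithinAt_iff_tendsto_slope' (s := Ioi (0 : ℝ)) (by simp)).1
    (h1.hasDerivWithinAt (s := Ioi 0))
  refine h2.congr' ?_
  filter_upwards [self_mem_nhdsWithin] with t ht
  have ht' : (0 : ℝ) < t := ht
  rw [slope_def_field, intervalIntegral.integral_same, sub_zero, sub_zero,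
    ← hP.inner_sub_eq_integral f g ht'.le, inner_sub_left, div_eq_inv_mul]

theorem IsHeatSemigroup.approx_le (f : E.Dom) {t : ℝ} (ht : 0 < t) :
    t⁻¹ * inner ℝ (E.toL2 f - P t.toNNReal (E.toL2 f)) (E.toL2 f) ≤ E.energy f f := by
  rw [inv_mul_le_iff₀ ht, inner_sub_left, hP.inner_sub_eq_integral f f ht.le]
  have := intervalIntegral.integral_mono_on (μ := volume) ht.le
    ((hP.continuous_energy_dom f f).intervalIntegrable 0 t) intervalIntegrable_const
    (g := fun _ => E.energy f f) (fun r _ => by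
      have h1 := E.energy_sq_le (hP.dom r.toNNReal f) f
      have h2 := hP.energy_dom_le r.toNNReal f
      have h3 := E.energy_nonneg f
      refine le_of_sq_le_sq ?_ h3
      nlinarith)
  simpa using this

/-- An `L²` function with bounded approximating forms belongs to the form domain. -/
theorem IsHeatSemigroup.exists_toL2_eq_of_approx_le (f : Lp ℝ 2 μ) (C : ℝ)
    (hC : ∀ t : ℝ, 0 < t → t⁻¹ * inner ℝ (f - P t.toNNReal f) f ≤ C) :
    ∃ f' : E.Dom, E.toL2 f' = f ∧ E.energy f' f' ≤ C := by
  have h1 : ∀ n : ℕ, E.energy ((n + 1 : ℝ) • E.resolvent univ (n + 1 : ℝ) f)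
      ((n + 1 : ℝ) • E.resolvent univ (n + 1 : ℝ) f) ≤ C := by
    intro n
    have hn : (0 : ℝ) < n + 1 := by positivity
    refine le_of_tendsto (hP.tendsto_approx _ _) ?_
    filter_upwards [self_mem_nhdsWithin] with t ht
    have ht' : (0 : ℝ) < t := ht
    refine le_trans ?_ (hC t ht')
    refine mul_le_mul_of_nonneg_left ?_ (inv_nonneg.2 ht'.le)
    rw [← scaledResolvent_eq_toL2]
    refine inner_apply_le_of_commute (B := 1 - P t.toNNReal)
      (T := E.scaledResolvent univ (n + 1 : ℝ)) (fun f g => ?_) (fun f => ?_)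
      (inner_scaledResolvent_symm hn) (norm_scaledResolvent_le hn) (fun f => ?_) f
    · simp only [sub_apply, one_apply_eq_self, inner_sub_left, inner_sub_right, hP.inner_symm]
    · simp only [sub_apply, one_apply_eq_self, inner_sub_left, real_inner_self_eq_norm_sq]
      have h2 := real_inner_le_norm (P t.toNNReal f) f
      have h3 := hP.norm_apply_le t.toNNReal f
      nlinarith [norm_nonneg f]
    · simp only [sub_apply, one_apply_eq_self, map_sub, hP.apply_scaledResolvent hn]
  have hlim : Tendsto (fun n : ℕ => E.toL2 ((n + 1 : ℝ) • E.resolvent univ (n + 1 : ℝ) f)) atTop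
      (𝓝 f) := by
    have h2 : Tendsto (fun n : ℕ => (n + 1 : ℝ)) atTop atTop :=
      tendsto_natCast_atTop_atTop.atTop_add tendsto_const_nhds
    refine ((tendsto_scaledResolvent_atTop (E := E) (mem_closure_supported_univ f)).comp h2).congr
      fun n => ?_
    rw [Function.comp_apply, scaledResolvent_eq_toL2]
  obtain ⟨f', hf'⟩ := E.exists_toL2_eq_of_tendsto _ (Real.sqrt (C + ‖f‖ ^ 2)) (fun n => by
    have hn : (0 : ℝ) < n + 1 := by positivity
    refine Real.le_sqrt_of_sq_le ?_
    rw [norm_sq_dom, ← scaledResolvent_eq_toL2]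
    exact add_le_add (h1 n) (pow_le_pow_left₀ (norm_nonneg _) (norm_scaledResolvent_le hn f) 2))
    f hlim
  refine ⟨f', hf', le_of_tendsto (hP.tendsto_approx f' f') ?_⟩
  filter_upwards [self_mem_nhdsWithin] with t ht
  rw [hf']
  exact hC t ht

/-! ### Lattice operations on the form domain -/

/-- The approximating forms `f ↦ t⁻¹ ⟪f - P t f, f⟫` do not increase when `f` is replaced by
`|f|`. -/
theorem IsHeatSemigroup.inner_apply_le_abs (t : ℝ≥0) (f : Lp ℝ 2 μ) :
    inner ℝ (P t f) f ≤ (inner ℝ (P t |f|) |f| : ℝ) := by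
  have h1 : ∀ᵐ x ∂μ, 0 ≤ P t (|f| - f) x := hP.apply_nonneg t _ (by
    filter_upwards [Lp.coeFn_sub |f| f, Lp.coeFn_abs f] with x h1 h2
    rw [h1, Pi.sub_apply, h2]
    linarith [le_abs_self (f x)])
  have h2 : ∀ᵐ x ∂μ, 0 ≤ P t (|f| + f) x := hP.apply_nonneg t _ (by
    filter_upwards [Lp.coeFn_add |f| f, Lp.coeFn_abs f] with x h1 h2
    rw [h1, Pi.add_apply, h2]
    linarith [neg_abs_le (f x)])
  rw [map_sub] at h1
  rw [map_add] at h2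
  rw [inner_eq_integral, inner_eq_integral]
  refine integral_mono_ae (integrable_mul _ _) (integrable_mul _ _) ?_
  filter_upwards [h1, h2, Lp.coeFn_sub (P t |f|) (P t f), Lp.coeFn_add (P t |f|) (P t f),
    Lp.coeFn_abs f] with x h1 h2 h3 h4 h5
  rw [h3, Pi.sub_apply] at h1
  rw [h4, Pi.add_apply] at h2
  simp only [h5]
  have h6 : |P t f x| ≤ P t |f| x := abs_le.2 ⟨by linarith, by linarith⟩
  calc P t f x * f x ≤ |P t f x * f x| := le_abs_self _
    _ = |P t f x| * |f x| := abs_mul _ _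
    _ ≤ _ := mul_le_mul_of_nonneg_right h6 (abs_nonneg _)

/-- The form domain is stable under absolute values, as it consists of the functions with bounded
approximating forms. -/
theorem IsHeatSemigroup.exists_abs (f : E.Dom) : ∃ g : E.Dom, E.toL2 g = |E.toL2 f| := by
  obtain ⟨g, hg, -⟩ := hP.exists_toL2_eq_of_approx_le |E.toL2 f| (E.energy f f) fun t ht => by
    refine le_trans ?_ (hP.approx_le f ht)
    refine mul_le_mul_of_nonneg_left ?_ (inv_nonneg.2 ht.le)
    have := hP.inner_apply_le_abs t.toNNReal (E.toL2 f)
    rw [inner_sub_left, inner_sub_left, real_inner_self_eq_norm_sq, real_inner_self_eq_norm_sq,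
      norm_abs_eq_norm]
    linarith
  exact ⟨g, hg⟩

theorem IsHeatSemigroup.exists_pos (f : E.Dom) :
    ∃ g : E.Dom, E.toL2 g =ᵐ[μ] fun x => max (E.toL2 f x) 0 := by
  obtain ⟨g, hg⟩ := hP.exists_abs f
  refine ⟨(1 / 2 : ℝ) • (f + g), ?_⟩
  rw [map_smul, map_add, hg]
  filter_upwards [Lp.coeFn_smul (1 / 2 : ℝ) (E.toL2 f + |E.toL2 f|),
    Lp.coeFn_add (E.toL2 f) |E.toL2 f|, Lp.coeFn_abs (E.toL2 f)] with x h1 h2 h3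
  rw [h1, Pi.smul_apply, h2, Pi.add_apply, h3, smul_eq_mul]
  rcases le_total 0 (E.toL2 f x) with h | h
  · rw [abs_of_nonneg h, max_eq_left h]; ring
  · rw [abs_of_nonpos h, max_eq_right h]; ring

/-- The form is nonpositive on pairs of nonnegative functions with disjoint supports. -/
theorem IsHeatSemigroup.energy_nonpos (f g : E.Dom) (hf : ∀ᵐ x ∂μ, 0 ≤ E.toL2 f x)
    (hg : ∀ᵐ x ∂μ, 0 ≤ E.toL2 g x) (hfg : ∀ᵐ x ∂μ, E.toL2 f x * E.toL2 g x = 0) :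
    E.energy f g ≤ 0 := by
  refine le_of_tendsto (hP.tendsto_approx f g) ?_
  filter_upwards [self_mem_nhdsWithin] with t ht
  have ht' : (0 : ℝ) < t := ht
  have h1 : inner ℝ (E.toL2 f) (E.toL2 g) = (0 : ℝ) := by
    rw [inner_eq_integral, integral_congr_ae hfg, integral_zero]
  have h2 := inner_nonneg_of_ae (hP.apply_nonneg t.toNNReal _ hf) hg
  rw [inner_sub_left, h1, zero_sub]
  exact mul_nonpos_of_nonneg_of_nonpos (inv_nonneg.2 ht'.le) (by linarith)

/-! ### Potentials with Dirichlet conditions are subharmonic across the boundary -/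

/-- For `q ≥ 0` the function `R_F q = (l + L_F)⁻¹ q` satisfies `(l + L) R_F q ≤ q` on all of the
space. Indeed `d = R q - R_F q` minimises the energy among the functions that are at least `R q`
off `F`, since taking the minimum with the potential `R q` does not increase energy. -/
theorem IsHeatSemigroup.energy_resolvent_add_le {F : Set X} {l : ℝ} (hl : 0 < l) {q : Lp ℝ 2 μ}
    (hq : ∀ᵐ x ∂μ, 0 ≤ q x) (w : E.Dom) (hw : ∀ᵐ x ∂μ, 0 ≤ E.toL2 w x) :
    E.energy (E.resolvent F l q) w + l * inner ℝ (E.toL2 (E.resolvent F l q)) (E.toL2 w)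
      ≤ inner ℝ q (E.toL2 w) := by
  set B : E.Dom → E.Dom → ℝ := fun f g => E.energy f g + l * inner ℝ (E.toL2 f) (E.toL2 g) with hB
  have hBadd : ∀ f g h, B (f + g) h = B f h + B g h := fun f g h => by
    simp only [hB, map_add, LinearMap.add_apply, inner_add_left]; ring
  have hBsymm : ∀ f g, B f g = B g f := fun f g => by
    simp only [hB]; rw [E.energy_symm, real_inner_comm]
  have hBsmul : ∀ (r : ℝ) f g, B (r • f) g = r * B f g := fun r f g => by
    simp only [hB, map_smul, LinearMap.smul_apply, real_inner_smul_left, smul_eq_mul]; ring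
  have hB0 : ∀ f, 0 ≤ B f f := fun f => add_nonneg (E.energy_nonneg f)
    (mul_nonneg hl.le real_inner_self_nonneg)
  have hBsub : ∀ f g h, B (f - g) h = B f h - B g h := fun f g h => by
    rw [eq_sub_iff_add_eq, ← hBadd, sub_add_cancel]
  set r := E.resolvent univ l q with hr
  set rF := E.resolvent F l q with hrF
  have hBr : ∀ g, B r g = inner ℝ q (E.toL2 g) := fun g => resolvent_eq hl q (mem_supported_univ g)
  have hBrF : ∀ g ∈ E.supported F, B rF g = inner ℝ q (E.toL2 g) := fun g hg => resolvent_eq hl q hg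
  have hrFm : rF ∈ E.supported F := resolvent_mem hl q
  set d := r - rF with hd
  have hd0 : ∀ g ∈ E.supported F, B d g = 0 := fun g hg => by
    rw [hd, hBsub, hBr, hBrF g hg, sub_self]
  change B rF w ≤ _
  rw [← hBr w]
  -- perturb `d` in the direction `w`; the claim is the first-order term
  suffices hmain : ∀ ε : ℝ, 0 < ε → 0 ≤ 2 * B d w + ε * B w w by
    have h1 : Tendsto (fun ε : ℝ => 2 * B d w + ε * B w w) (𝓝[>] 0)
        (𝓝 (2 * B d w + 0 * B w w)) :=
      ((tendsto_id.mul_const _).const_add _).mono_left nhdsWithin_le_nhds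
    have h2 : 0 ≤ 2 * B d w + 0 * B w w :=
      ge_of_tendsto h1 (by filter_upwards [self_mem_nhdsWithin] with ε hε using hmain ε hε)
    have h3 : B d w = B r w - B rF w := hBsub _ _ _
    linarith
  intro ε hε
  -- `m` is the minimum of `f` and `r`, and `a` is the positive part of `f - r`.
  set f := d + ε • w with hf
  obtain ⟨a, ha⟩ := hP.exists_pos (f - r)
  obtain ⟨b, hb⟩ := hP.exists_pos (r - f)
  have ha0 : ∀ᵐ x ∂μ, 0 ≤ E.toL2 a x := by
    filter_upwards [ha] with x hx; rw [hx]; exact le_max_right _ _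
  have hb0 : ∀ᵐ x ∂μ, 0 ≤ E.toL2 b x := by
    filter_upwards [hb] with x hx; rw [hx]; exact le_max_right _ _
  have hfr : ∀ᵐ x ∂μ, E.toL2 (f - r) x = E.toL2 f x - E.toL2 r x := by
    rw [map_sub]; exact Lp.coeFn_sub _ _
  have hrf : ∀ᵐ x ∂μ, E.toL2 (r - f) x = E.toL2 r x - E.toL2 f x := by
    rw [map_sub]; exact Lp.coeFn_sub _ _
  have hab : ∀ᵐ x ∂μ, E.toL2 b x * E.toL2 a x = 0 := by
    filter_upwards [ha, hb, hfr, hrf] with x h1 h2 h3 h4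
    rw [h1, h2, h3, h4]
    rcases le_total (E.toL2 r x) (E.toL2 f x) with h | h
    · rw [max_eq_right (sub_nonpos.2 h), zero_mul]
    · rw [max_eq_right (sub_nonpos.2 h), mul_zero]
  set m := f - a with hm
  have hmb : m = r - b := by
    refine toL2_ext ?_
    rw [hm, map_sub, map_sub]
    filter_upwards [ha, hb, hfr, hrf, Lp.coeFn_sub (E.toL2 f) (E.toL2 a),
      Lp.coeFn_sub (E.toL2 r) (E.toL2 b)] with x h1 h2 h3 h4 h5 h6
    rw [h5, h6, Pi.sub_apply, Pi.sub_apply, h1, h2, h3, h4]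
    rcases le_total (E.toL2 r x) (E.toL2 f x) with h | h
    · rw [max_eq_right (sub_nonpos.2 h), max_eq_left (sub_nonneg.2 h)]; ring
    · rw [max_eq_right (sub_nonpos.2 h), max_eq_left (sub_nonneg.2 h)]; ring
  have hma : 0 ≤ B m a := by
    rw [hmb, hBsub, hBr]
    have h1 : 0 ≤ inner ℝ q (E.toL2 a) := inner_nonneg_of_ae hq ha0
    have h2 : B b a ≤ 0 := by
      have h3 := hP.energy_nonpos b a hb0 ha0 hab
      have h4 : inner ℝ (E.toL2 b) (E.toL2 a) = (0 : ℝ) := by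
        rw [inner_eq_integral, integral_congr_ae hab, integral_zero]
      simp only [hB, h4]
      linarith
    linarith
  -- taking the minimum with the potential `r` does not increase the energy
  have hmf : B m m ≤ B f f := by
    have h1 : f = m + a := by rw [hm]; abel
    rw [h1, hBadd, hBsymm m (m + a), hBsymm a (m + a), hBadd, hBadd, hBsymm a m]
    linarith [hB0 a]
  have hmd : m - d ∈ E.supported F := by
    have h1 := scaledResolvent_nonneg (E := E) (F := univ) hl q hq
    filter_upwards [mem_supported.1 hrFm, hw, ha, hfr,
      (by rw [map_sub]; exact Lp.coeFn_sub _ _ : E.toL2 (m - d) =ᵐ[μ] E.toL2 m - E.toL2 d),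
      (by rw [hm, map_sub]; exact Lp.coeFn_sub _ _ : E.toL2 m =ᵐ[μ] E.toL2 f - E.toL2 a),
      (by rw [hd, map_sub]; exact Lp.coeFn_sub _ _ : E.toL2 d =ᵐ[μ] E.toL2 r - E.toL2 rF),
      (by rw [hf, map_add, map_smul]; exact Lp.coeFn_add _ _ :
        E.toL2 f =ᵐ[μ] E.toL2 d + (ε • E.toL2 w : Lp ℝ 2 μ)),
      Lp.coeFn_smul ε (E.toL2 w)] with x h2 h3 h4 h5 h6 h7 h8 h9 h10 h11
    rw [h6, Pi.sub_apply, h7, Pi.sub_apply, h4, h5, h9, Pi.add_apply, h10, Pi.smul_apply,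
      h8, Pi.sub_apply, h2 h11, smul_eq_mul]
    rw [max_eq_left (by nlinarith)]
    ring
  -- `d` minimises the energy among the functions that agree with it off `F`
  have hdm : B d d ≤ B m m := by
    have h1 : m = d + (m - d) := by abel
    have h2 := hd0 _ hmd
    set k := m - d
    rw [h1, hBadd, hBsymm d (d + k), hBsymm k (d + k), hBadd, hBadd, hBsymm k d, h2]
    linarith [hB0 (m - d)]
  have hff : B f f = B d d + 2 * ε * B d w + ε ^ 2 * B w w := by
    rw [hf, hBadd, hBsymm d (d + ε • w), hBsymm (ε • w) (d + ε • w), hBadd, hBadd, hBsmul,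
      hBsymm d (ε • w), hBsmul, hBsmul, hBsymm w (ε • w), hBsmul, hBsymm w d]
    ring
  have h5 : 0 ≤ ε * (2 * B d w + ε * B w w) := by nlinarith
  exact nonneg_of_mul_nonneg_right h5 hε

end FormSemigroup

end DirichletForm

/-! ### Continuous heat kernels -/

section Continuous

variable {X : Type*} [MetricSpace X] [LocallyCompactSpace X] [MeasurableSpace X] [BorelSpace X]
  {μ : Measure X} [μ.Regular]

theorem exists_bump_one (K : Set X) (hK : IsCompact K) (U : Set X) (hU : IsOpen U) (h : K ⊆ U) :
    ∃ f : X → ℝ, Continuous f ∧ HasCompactSupport f ∧ tsupport f ⊆ U ∧ (∀ x, f x ∈ Icc (0 : ℝ) 1) ∧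
      ∀ x ∈ K, f x = 1 := by
  obtain ⟨V, hV, hKV, hVU, -⟩ := exists_open_between_and_isCompact_closure hK hU h
  obtain ⟨f, h1, h2, h3, h4⟩ := exists_continuous_one_zero_of_isCompact hK hV.isClosed_compl
    (disjoint_compl_right_iff_subset.2 hKV)
  refine ⟨f, f.continuous, h3, ?_, h4, fun x hx => h1 hx⟩
  refine (closure_mono fun x hx => ?_).trans hVU
  by_contra hxV
  exact hx (h2 hxV)

theorem integrable_mul_of_continuous {F g : X → ℝ} (hF : Continuous F) (hg : Continuous g)
    (hgc : HasCompactSupport g) : Integrable (fun x => F x * g x) μ :=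
  (hF.mul hg).integrable_of_hasCompactSupport hgc.mul_left

/-- A continuous function that has nonnegative integrals against bump functions is nonnegative. -/
theorem nonneg_of_integral_mul_nonneg [μ.IsOpenPosMeasure] {F : X → ℝ} (hF : Continuous F)
    (h : ∀ g : X → ℝ, Continuous g → HasCompactSupport g → (∀ x, 0 ≤ g x) →
      0 ≤ ∫ x, F x * g x ∂μ) (x : X) : 0 ≤ F x := by
  by_contra! hx
  obtain ⟨g, h1, h2, h3, h4, h5⟩ := exists_bump_one {x} isCompact_singleton {y | F y < 0}
    (isOpen_lt hF continuous_const) (by simpa using hx)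
  have h6 : 0 < ∫ x, -(F x * g x) ∂μ := by
    refine Continuous.integral_pos_of_hasCompactSupport_nonneg_nonzero (x := x)
      (hF.mul h1).neg ?_ (fun y => ?_) ?_
    · exact (h2.mul_left (f := F)).neg
    · by_cases hy : y ∈ tsupport g
      · have := h3 hy
        simp only [mem_ofPred_eq] at this
        have := (h4 y).1
        simp only [Pi.zero_apply]
        nlinarith
      · simp [image_eq_zero_of_notMem_tsupport hy]
    · rw [h5 x rfl]; simpa using hx.ne
  rw [integral_neg] at h6
  linarith [h g h1 h2 fun x => (h4 x).1]

theorem eq_zero_of_integral_mul_eq_zero [μ.IsOpenPosMeasure] {F : X → ℝ} (hF : Continuous F)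
    (h : ∀ g : X → ℝ, Continuous g → HasCompactSupport g → ∫ x, F x * g x ∂μ = 0) (x : X) :
    F x = 0 :=
  le_antisymm
    (neg_nonneg.1 (nonneg_of_integral_mul_nonneg (μ := μ) hF.neg (fun g h1 h2 _ => by
      simp [neg_mul, integral_neg, h g h1 h2]) x))
    (nonneg_of_integral_mul_nonneg (μ := μ) hF (fun g h1 h2 _ => (h g h1 h2).ge) x)

end Continuous

section Kernel

variable {X : Type*} [TopologicalSpace X] {p : ℝ → X → X → ℝ}

theorem continuous_kernel (hp : ContinuousOn (fun z : ℝ × X × X => p z.1 z.2.1 z.2.2)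
    (Ioi (0 : ℝ) ×ˢ univ)) {t : ℝ} (ht : 0 < t) : Continuous fun z : X × X => p t z.1 z.2 :=
  hp.comp_continuous (f := fun z : X × X => (t, z)) (by fun_prop) fun _ => ⟨ht, trivial⟩

/-- Compactly supported heat potentials are continuous in space-time. -/
theorem continuousOn_integral_kernel [MeasurableSpace X] [OpensMeasurableSpace X]
    (hp : ContinuousOn (fun z : ℝ × X × X => p z.1 z.2.1 z.2.2) (Ioi (0 : ℝ) ×ˢ univ))
    {f : X → ℝ} (hf : Continuous f) (hfc : HasCompactSupport f) (ν : Measure X)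
    [IsFiniteMeasureOnCompacts ν] :
    ContinuousOn (fun z : ℝ × X => ∫ y, p z.1 z.2 y * f y ∂ν) (Ioi (0 : ℝ) ×ˢ univ) := by
  refine continuousOn_integral_of_compact_support hfc ?_ fun z x _ hx => by
    rw [image_eq_zero_of_notMem_tsupport hx, mul_zero]
  have h1 : ContinuousOn (fun w : (ℝ × X) × X => p w.1.1 w.1.2 w.2) ((Ioi (0 : ℝ) ×ˢ univ) ×ˢ univ) :=
    hp.comp (f := fun w : (ℝ × X) × X => (w.1.1, w.1.2, w.2)) (by fun_prop)
      fun w hw => ⟨hw.1.1, trivial⟩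
  exact h1.mul (hf.comp continuous_snd).continuousOn

theorem continuous_integral_kernel [MeasurableSpace X] [OpensMeasurableSpace X]
    (hp : ContinuousOn (fun z : ℝ × X × X => p z.1 z.2.1 z.2.2) (Ioi (0 : ℝ) ×ˢ univ))
    {f : X → ℝ} (hf : Continuous f) (hfc : HasCompactSupport f) (ν : Measure X)
    [IsFiniteMeasureOnCompacts ν] {t : ℝ} (ht : 0 < t) :
    Continuous (fun x : X => ∫ y, p t x y * f y ∂ν) :=
  (continuousOn_integral_kernel hp hf hfc ν).comp_continuous (f := fun x : X => (t, x))
    (by fun_prop) fun _ => ⟨ht, trivial⟩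

end Kernel

namespace DirichletForm

section Kernel

variable {X : Type*} [MetricSpace X] [LocallyCompactSpace X] [MeasurableSpace X] [BorelSpace X]
  {μ : Measure X} [μ.Regular] [μ.IsOpenPosMeasure] {E : DirichletForm μ} {p : ℝ → X → X → ℝ}

/-- The class in `L²` of a continuous function with compact support. -/
noncomputable def _root_.Widder.ltwo (μ : Measure X) [μ.Regular] (f : X → ℝ) (hf : Continuous f)
    (hfc : HasCompactSupport f) : Lp ℝ 2 μ :=
  (hf.memLp_of_hasCompactSupport (μ := μ) hfc).toLp f

theorem _root_.Widder.ltwo_ae {f : X → ℝ} (hf : Continuous f)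
    (hfc : HasCompactSupport f) : ltwo μ f hf hfc =ᵐ[μ] f := MemLp.coeFn_toLp _

theorem IsContinuousHeatKernel.semigroup_ae (hp : E.IsContinuousHeatKernel p) {t : ℝ} (ht : 0 < t)
    (f : Lp ℝ 2 μ) : E.semigroup t.toNNReal f =ᵐ[μ] fun x => ∫ y, p t x y * f y ∂μ := by
  have := hp.semigroup_eq t.toNNReal (Real.toNNReal_pos.2 ht) f
  filter_upwards [this] with x hx
  rw [hx.2, Real.coe_toNNReal t ht.le]

theorem IsContinuousHeatKernel.semigroup_ltwo_ae (hp : E.IsContinuousHeatKernel p) {t : ℝ}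
    (ht : 0 < t) {f : X → ℝ} (hf : Continuous f) (hfc : HasCompactSupport f) :
    E.semigroup t.toNNReal (ltwo μ f hf hfc) =ᵐ[μ] fun x => ∫ y, p t x y * f y ∂μ := by
  refine (hp.semigroup_ae ht _).trans (Eventually.of_forall fun x => ?_)
  refine integral_congr_ae ?_
  filter_upwards [ltwo_ae (μ := μ) hf hfc] with y hy
  rw [hy]

/-- If there were no heat semigroup, `semigroup` would be zero by convention, and so would the
kernel integrals, contrary to their convergence at time zero. -/
theorem IsContinuousHeatKernel.isHeatSemigroup [Nonempty X] (hp : E.IsContinuousHeatKernel p)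
    (hp0 : ∀ f : X → ℝ, Continuous f → HasCompactSupport f → ∀ x : X,
      Tendsto (fun t : ℝ => ∫ y, p t x y * f y ∂μ) (𝓝[>] 0) (𝓝 (f x))) :
    E.IsHeatSemigroup E.semigroup := by
  refine isHeatSemigroup_semigroup ?_
  by_contra hno
  obtain ⟨x⟩ := ‹Nonempty X›
  obtain ⟨f, hf, hfc, -, -, h5⟩ := exists_bump_one {x} isCompact_singleton univ isOpen_univ
    (subset_univ _)
  have h1 : ∀ t : ℝ, 0 < t → ∫ y, p t x y * f y ∂μ = 0 := fun t ht => by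
    have h2 := hp.semigroup_ltwo_ae ht hf hfc
    have h3 : E.semigroup t.toNNReal = 0 := by rw [semigroup, dif_neg hno]
    rw [h3] at h2
    have h4 : (fun x => ∫ y, p t x y * f y ∂μ) =ᵐ[μ] fun _ => (0 : ℝ) :=
      h2.symm.trans (Lp.coeFn_zero ℝ 2 μ)
    exact congrFun (((continuous_integral_kernel hp.continuousOn hf hfc μ ht).ae_eq_iff_eq μ
      continuous_const).1 h4) x
  have h2 := hp0 f hf hfc x
  have h3 : Tendsto (fun t : ℝ => ∫ y, p t x y * f y ∂μ) (𝓝[>] 0) (𝓝 0) := by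
    refine tendsto_const_nhds.congr' ?_
    filter_upwards [self_mem_nhdsWithin] with t ht using (h1 t ht).symm
  have := tendsto_nhds_unique h2 h3
  rw [h5 x rfl] at this
  exact one_ne_zero this

variable (hp : E.IsContinuousHeatKernel p) (hP : E.IsHeatSemigroup E.semigroup)

include hp hP

/-- Positivity of the operators, which holds almost everywhere, becomes pointwise by continuity of
the kernel and full support of the measure. -/
theorem IsContinuousHeatKernel.nonneg {t : ℝ} (ht : 0 < t) (x y : X) : 0 ≤ p t x y := by
  have hc := continuous_kernel hp.continuousOn ht
  refine nonneg_of_integral_mul_nonneg (μ := μ) (F := fun y => p t x y) (by fun_prop)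
    (fun g hg hgc hg0 => ?_) y
  have h1 := hP.apply_nonneg t.toNNReal (ltwo μ g hg hgc) (by
    filter_upwards [ltwo_ae (μ := μ) hg hgc] with y hy
    rw [hy]; exact hg0 y)
  have hcont := continuous_integral_kernel hp.continuousOn hg hgc μ ht
  refine nonneg_of_integral_mul_nonneg (μ := μ) hcont (fun k _ _ hk0 => ?_) x
  refine integral_nonneg_of_ae ?_
  filter_upwards [h1, hp.semigroup_ltwo_ae ht hg hgc] with x h1 h2
  rw [h2] at h1
  exact mul_nonneg h1 (hk0 x)

/-- Symmetry of the operators, tested with bump functions at two points. -/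
theorem IsContinuousHeatKernel.symm {t : ℝ} (ht : 0 < t) (x y : X) : p t x y = p t y x := by
  have hc := continuous_kernel hp.continuousOn ht
  have hc' : Continuous fun z : X × X => p t z.2 z.1 := hc.comp continuous_swap
  rw [← sub_eq_zero]
  refine eq_zero_of_integral_mul_eq_zero (μ := μ) (F := fun y => p t x y - p t y x) (by fun_prop)
    (fun g hg hgc => ?_) y
  have hcont : Continuous fun x => ∫ y, (p t x y - p t y x) * g y ∂μ := by
    rw [← continuousOn_univ]
    refine continuousOn_integral_of_compact_support hgc (Continuous.continuousOn ?_)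
      fun z x _ hx => by rw [image_eq_zero_of_notMem_tsupport hx, mul_zero]
    exact (hc.sub hc').mul (hg.comp continuous_snd)
  refine eq_zero_of_integral_mul_eq_zero (μ := μ) hcont (fun k hk hkc => ?_) x
  have h1 := hP.inner_symm t.toNNReal (ltwo μ g hg hgc) (ltwo μ k hk hkc)
  have h2 : inner ℝ (E.semigroup t.toNNReal (ltwo μ g hg hgc)) (ltwo μ k hk hkc)
      = ∫ x, (∫ y, p t x y * g y ∂μ) * k x ∂μ := by
    rw [inner_eq_integral]
    refine integral_congr_ae ?_
    filter_upwards [hp.semigroup_ltwo_ae ht hg hgc, ltwo_ae (μ := μ) hk hkc] with x h1 h2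
    rw [h1, h2]
  have h3 : inner ℝ (ltwo μ g hg hgc) (E.semigroup t.toNNReal (ltwo μ k hk hkc))
      = ∫ y, g y * (∫ x, p t y x * k x ∂μ) ∂μ := by
    rw [inner_eq_integral]
    refine integral_congr_ae ?_
    filter_upwards [hp.semigroup_ltwo_ae ht hk hkc, ltwo_ae (μ := μ) hg hgc] with x h1 h2
    rw [h1, h2]
  have h4 : ∫ y, g y * (∫ x, p t y x * k x ∂μ) ∂μ = ∫ x, (∫ y, p t y x * g y ∂μ) * k x ∂μ := by
    simp_rw [← integral_const_mul, ← integral_mul_const]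
    rw [integral_integral_swap_of_hasCompactSupport (f := fun y x => g y * (p t y x * k x))]
    · refine integral_congr_ae (Eventually.of_forall fun x => ?_)
      refine integral_congr_ae (Eventually.of_forall fun y => ?_)
      simp only; ring
    · exact (hg.comp continuous_fst).mul (hc.mul (hk.comp continuous_snd))
    · refine HasCompactSupport.intro (hgc.isCompact.prod hkc.isCompact) fun z hz => ?_
      simp only [Function.uncurry]
      by_cases h : z.1 ∈ tsupport g
      · have : z.2 ∉ tsupport k := fun h' => hz ⟨h, h'⟩
        rw [image_eq_zero_of_notMem_tsupport this, mul_zero, mul_zero]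
      · rw [image_eq_zero_of_notMem_tsupport h, zero_mul]
  rw [h2, h3, h4, ← sub_eq_zero, ← integral_sub] at h1
  · rw [← h1]
    refine integral_congr_ae (Eventually.of_forall fun x => ?_)
    simp only
    rw [← sub_mul, ← integral_sub]
    · congr 1
      refine integral_congr_ae (Eventually.of_forall fun y => ?_)
      simp only; ring
    · exact integrable_mul_of_continuous (by fun_prop) hg hgc
    · exact integrable_mul_of_continuous (by fun_prop) hg hgc
  · exact integrable_mul_of_continuous
      (continuous_integral_kernel hp.continuousOn hg hgc μ ht) hk hkc
  · refine integrable_mul_of_continuous ?_ hk hkc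
    rw [← continuousOn_univ]
    refine continuousOn_integral_of_compact_support hgc (Continuous.continuousOn ?_)
      fun z x _ hx => by rw [image_eq_zero_of_notMem_tsupport hx, mul_zero]
    exact hc'.mul (hg.comp continuous_snd)

theorem IsContinuousHeatKernel.integral_mem_Icc {t : ℝ} (ht : 0 < t) {f : X → ℝ}
    (hf : Continuous f) (hfc : HasCompactSupport f) (hf1 : ∀ x, f x ∈ Icc (0 : ℝ) 1) (x : X) :
    ∫ y, p t x y * f y ∂μ ∈ Icc (0 : ℝ) 1 := by
  have hcont := continuous_integral_kernel hp.continuousOn hf hfc μ ht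
  have h1 := hP.mem_Icc t.toNNReal (ltwo μ f hf hfc) (by
    filter_upwards [ltwo_ae (μ := μ) hf hfc] with y hy
    rw [hy]; exact hf1 y)
  refine ⟨integral_nonneg fun y => mul_nonneg (hp.nonneg hP ht x y) (hf1 y).1, ?_⟩
  rw [← sub_nonneg]
  refine nonneg_of_integral_mul_nonneg (μ := μ) (continuous_const.sub hcont)
    (fun k _ _ hk0 => ?_) x
  refine integral_nonneg_of_ae ?_
  filter_upwards [h1, hp.semigroup_ltwo_ae ht hf hfc] with x h1 h2
  rw [h2] at h1
  exact mul_nonneg (sub_nonneg.2 h1.2) (hk0 x)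

/-- The Markov property applied to cutoffs along a compact exhaustion. -/
theorem IsContinuousHeatKernel.lintegral_le_one [SecondCountableTopology X] {t : ℝ} (ht : 0 < t)
    (x : X) : ∫⁻ y, ENNReal.ofReal (p t x y) ∂μ ≤ 1 := by
  have hc := continuous_kernel hp.continuousOn ht
  have hcx : Continuous fun y => p t x y := by fun_prop
  let K := CompactExhaustion.choice X
  choose f hf hfc _ hf1 hfK using fun n =>
    exists_bump_one (K n) (K.isCompact n) univ isOpen_univ (subset_univ _)
  have h1 : ∀ y, Tendsto (fun n => ENNReal.ofReal (p t x y * f n y)) atTop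
      (𝓝 (ENNReal.ofReal (p t x y))) := fun y => by
    refine tendsto_const_nhds.congr' ?_
    filter_upwards [eventually_ge_atTop (K.find y)] with n hn
    rw [hfK n y (K.subset hn (K.mem_find y)), mul_one]
  calc ∫⁻ y, ENNReal.ofReal (p t x y) ∂μ
      = ∫⁻ y, liminf (fun n => ENNReal.ofReal (p t x y * f n y)) atTop ∂μ := by
        simp_rw [fun y => (h1 y).liminf_eq]
    _ ≤ liminf (fun n => ∫⁻ y, ENNReal.ofReal (p t x y * f n y) ∂μ) atTop :=
        lintegral_liminf_le fun n => (ENNReal.continuous_ofReal.comp (hcx.mul (hf n))).measurable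
    _ ≤ 1 := by
        refine liminf_le_of_frequently_le' (Frequently.of_forall fun n => ?_)
        rw [← ofReal_integral_eq_lintegral_ofReal
          (integrable_mul_of_continuous hcx (hf n) (hfc n))
          (Eventually.of_forall fun y => mul_nonneg (hp.nonneg hP ht x y) (hf1 n y).1)]
        rw [← ENNReal.ofReal_one]
        exact ENNReal.ofReal_le_ofReal (hp.integral_mem_Icc hP ht (hf n) (hfc n) (hf1 n) x).2

end Kernel

end DirichletForm

/-! ### Energy estimates through the heat kernel -/

namespace DirichletForm

section KernelMeasure

variable {X : Type*} [MetricSpace X] [LocallyCompactSpace X] [SecondCountableTopology X]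
  [MeasurableSpace X] [BorelSpace X]
  {μ : Measure X} [μ.Regular] [μ.IsOpenPosMeasure] {E : DirichletForm μ} {p : ℝ → X → X → ℝ}

/-- The symmetric measure `p(t, x, y) μ(dx) μ(dy)`. -/
noncomputable def _root_.Widder.kernelMeasure (μ : Measure X) (p : ℝ → X → X → ℝ) (t : ℝ) :
    Measure (X × X) :=
  (μ.prod μ).withDensity fun z => ENNReal.ofReal (p t z.1 z.2)

variable (hp : E.IsContinuousHeatKernel p) (hP : E.IsHeatSemigroup E.semigroup)
  {t : ℝ} (ht : 0 < t)

include hp ht in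
theorem IsContinuousHeatKernel.measurable_ofReal :
    Measurable fun z : X × X => ENNReal.ofReal (p t z.1 z.2) :=
  (continuous_kernel hp.continuousOn ht).measurable.ennreal_ofReal

include hp hP ht

/-- The kernel is sub-Markovian. -/
theorem IsContinuousHeatKernel.map_fst_le : (kernelMeasure μ p t).map Prod.fst ≤ μ := by
  refine Measure.le_iff.2 fun A hA => ?_
  rw [Measure.map_apply measurable_fst hA, kernelMeasure, withDensity_apply _ (measurable_fst hA),
    ← lintegral_indicator (measurable_fst hA), lintegral_prod _
      ((hp.measurable_ofReal ht).indicator (measurable_fst hA)).aemeasurable]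
  calc _ = ∫⁻ x, A.indicator (fun x => ∫⁻ y, ENNReal.ofReal (p t x y) ∂μ) x ∂μ := by
        refine lintegral_congr fun x => ?_
        by_cases hx : x ∈ A
        · rw [indicator_of_mem hx]
          exact lintegral_congr fun y => indicator_of_mem (s := Prod.fst ⁻¹' A) hx _
        · rw [indicator_of_notMem hx]
          rw [← lintegral_zero (μ := μ)]
          exact lintegral_congr fun y => indicator_of_notMem (s := Prod.fst ⁻¹' A) hx _
    _ ≤ ∫⁻ x, A.indicator (fun _ => 1) x ∂μ :=
        lintegral_mono fun x => indicator_le_indicator (hp.lintegral_le_one hP ht x)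
    _ = μ A := by rw [lintegral_indicator hA, setLIntegral_one]

theorem IsContinuousHeatKernel.map_swap :
    (kernelMeasure μ p t).map Prod.swap = kernelMeasure μ p t := by
  refine Measure.ext fun A hA => ?_
  rw [Measure.map_apply measurable_swap hA, kernelMeasure,
    withDensity_apply _ (measurable_swap hA), withDensity_apply _ hA]
  conv_rhs => rw [← Measure.prod_swap, setLIntegral_map hA (hp.measurable_ofReal ht) measurable_swap]
  refine setLIntegral_congr_fun (measurable_swap hA) fun z _ => ?_
  simp only [Prod.fst_swap, Prod.snd_swap]
  rw [hp.symm hP ht]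

theorem IsContinuousHeatKernel.map_snd_le : (kernelMeasure μ p t).map Prod.snd ≤ μ := by
  rw [← hp.map_swap hP ht, Measure.map_map measurable_snd measurable_swap]
  exact hp.map_fst_le hP ht

theorem IsContinuousHeatKernel.ae_fst {q : X → Prop} (h : ∀ᵐ x ∂μ, q x) :
    ∀ᵐ z ∂kernelMeasure μ p t, q z.1 :=
  ae_of_ae_map measurable_fst.aemeasurable
    ((Measure.absolutelyContinuous_of_le (hp.map_fst_le hP ht)).ae_le h)

theorem IsContinuousHeatKernel.ae_snd {q : X → Prop} (h : ∀ᵐ x ∂μ, q x) :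
    ∀ᵐ z ∂kernelMeasure μ p t, q z.2 :=
  ae_of_ae_map measurable_snd.aemeasurable
    ((Measure.absolutelyContinuous_of_le (hp.map_snd_le hP ht)).ae_le h)

theorem IsContinuousHeatKernel.integrable_fst {f : X → ℝ} (hf : Integrable f μ) :
    Integrable (fun z : X × X => f z.1) (kernelMeasure μ p t) :=
  (hf.mono_measure (hp.map_fst_le hP ht)).comp_measurable measurable_fst

theorem IsContinuousHeatKernel.integrable_snd {f : X → ℝ} (hf : Integrable f μ) :
    Integrable (fun z : X × X => f z.2) (kernelMeasure μ p t) :=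
  (hf.mono_measure (hp.map_snd_le hP ht)).comp_measurable measurable_snd

theorem IsContinuousHeatKernel.memLp_fst (f : Lp ℝ 2 μ) :
    MemLp (fun z : X × X => f z.1) 2 (kernelMeasure μ p t) :=
  ((Lp.memLp f).mono_measure (hp.map_fst_le hP ht)).comp_of_map measurable_fst.aemeasurable

theorem IsContinuousHeatKernel.memLp_snd (f : Lp ℝ 2 μ) :
    MemLp (fun z : X × X => f z.2) 2 (kernelMeasure μ p t) :=
  ((Lp.memLp f).mono_measure (hp.map_snd_le hP ht)).comp_of_map measurable_snd.aemeasurable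

theorem IsContinuousHeatKernel.integral_fst_eq_snd {f : X → ℝ} (hf : Integrable f μ) :
    ∫ z, f z.1 ∂kernelMeasure μ p t = ∫ z, f z.2 ∂kernelMeasure μ p t := by
  have h1 := (hp.integrable_fst hP ht hf).aestronglyMeasurable
  conv_lhs => rw [← hp.map_swap hP ht]
  rw [integral_map measurable_swap.aemeasurable (by rwa [hp.map_swap hP ht])]
  rfl

theorem IsContinuousHeatKernel.integral_fst_le {f : X → ℝ} (hf : Integrable f μ)
    (hf0 : ∀ᵐ x ∂μ, 0 ≤ f x) : ∫ z, f z.1 ∂kernelMeasure μ p t ≤ ∫ x, f x ∂μ := by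
  rw [← integral_map measurable_fst.aemeasurable (f := f)
    (hf.mono_measure (hp.map_fst_le hP ht)).aestronglyMeasurable]
  exact integral_mono_measure (hp.map_fst_le hP ht) hf0 hf

theorem IsContinuousHeatKernel.integrable_mul_kernelMeasure (f g : Lp ℝ 2 μ) :
    Integrable (fun z : X × X => f z.1 * g z.2) (kernelMeasure μ p t) :=
  (hp.memLp_fst hP ht f).integrable_mul (hp.memLp_snd hP ht g)

theorem IsContinuousHeatKernel.inner_semigroup_eq (f g : Lp ℝ 2 μ) :
    inner ℝ (E.semigroup t.toNNReal f) g = ∫ z, g z.1 * f z.2 ∂kernelMeasure μ p t := by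
  have h1 := hp.integrable_mul_kernelMeasure hP ht g f
  rw [kernelMeasure, integrable_withDensity_iff_integrable_smul' (hp.measurable_ofReal ht)
    (Eventually.of_forall fun _ => ENNReal.ofReal_lt_top)] at h1
  rw [inner_eq_integral, kernelMeasure, integral_withDensity_eq_integral_toReal_smul
    (hp.measurable_ofReal ht) (Eventually.of_forall fun _ => ENNReal.ofReal_lt_top),
    integral_prod _ h1]
  refine integral_congr_ae ?_
  filter_upwards [hp.semigroup_ae ht f] with x hx
  rw [hx, ← integral_mul_const]
  refine integral_congr_ae (Eventually.of_forall fun y => ?_)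
  simp only [ENNReal.toReal_ofReal (hp.nonneg hP ht x y), smul_eq_mul]
  ring

/-- The approximating forms in terms of squares of differences. -/
theorem IsContinuousHeatKernel.inner_sub_semigroup_eq (f g : Lp ℝ 2 μ) :
    inner ℝ (f - E.semigroup t.toNNReal f) g
      = (∫ x, f x * g x ∂μ - ∫ z, f z.1 * g z.1 ∂kernelMeasure μ p t)
        + (1 / 2) * ∫ z, (f z.1 - f z.2) * (g z.1 - g z.2) ∂kernelMeasure μ p t := by
  have i1 := hp.integrable_fst hP ht (integrable_mul f g)
  have i2 := hp.integrable_snd hP ht (integrable_mul f g)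
  have i3 := hp.integrable_mul_kernelMeasure hP ht f g
  have i4 := hp.integrable_mul_kernelMeasure hP ht g f
  have e1 := hp.integral_fst_eq_snd hP ht (integrable_mul f g)
  have e2 : ∫ z, (f z.1 - f z.2) * (g z.1 - g z.2) ∂kernelMeasure μ p t
      = (∫ z, f z.1 * g z.1 ∂kernelMeasure μ p t) + (∫ z, f z.2 * g z.2 ∂kernelMeasure μ p t)
        - (∫ z, f z.1 * g z.2 ∂kernelMeasure μ p t)
        - ∫ z, g z.1 * f z.2 ∂kernelMeasure μ p t := by
    have i5 : Integrable (fun z : X × X => f z.1 * g z.1 + f z.2 * g z.2)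
      (kernelMeasure μ p t) := i1.add i2
    have i6 : Integrable (fun z : X × X => f z.1 * g z.1 + f z.2 * g z.2 - f z.1 * g z.2)
      (kernelMeasure μ p t) := i5.sub i3
    rw [← integral_add i1 i2, ← integral_sub i5 i3, ← integral_sub i6 i4]
    refine integral_congr_ae (Eventually.of_forall fun z => ?_)
    simp only
    ring
  have e3 := hp.inner_semigroup_eq hP ht f g
  have e4 := hp.inner_semigroup_eq hP ht g f
  rw [hP.inner_symm, real_inner_comm] at e4
  rw [inner_sub_left, inner_eq_integral f g, e2, ← e1]
  linarith

theorem IsContinuousHeatKernel.integrable_sub_mul_sub (f g : Lp ℝ 2 μ) :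
    Integrable (fun z : X × X => (f z.1 - f z.2) * (g z.1 - g z.2)) (kernelMeasure μ p t) :=
  ((hp.memLp_fst hP ht f).sub (hp.memLp_snd hP ht f)).integrable_mul
    ((hp.memLp_fst hP ht g).sub (hp.memLp_snd hP ht g))

/-- The approximating form is the sum of a jump part and a nonnegative killing part, which is
dropped. -/
theorem IsContinuousHeatKernel.integral_sub_sq_le (f : Lp ℝ 2 μ) :
    (1 / 2) * ∫ z, (f z.1 - f z.2) ^ 2 ∂kernelMeasure μ p t
      ≤ inner ℝ (f - E.semigroup t.toNNReal f) f := by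
  rw [hp.inner_sub_semigroup_eq hP ht]
  have h1 := hp.integral_fst_le hP ht (integrable_mul f f)
    (Eventually.of_forall fun x => mul_self_nonneg _)
  simp only [pow_two]
  linarith

/-- In the approximating form of a product of bounded functions, the jump part is estimated by the
product rule for differences, and the killing part directly. -/
theorem IsContinuousHeatKernel.approx_mul_le {M : ℝ} (f g k : Lp ℝ 2 μ)
    (hf : ∀ᵐ x ∂μ, |f x| ≤ M) (hg : ∀ᵐ x ∂μ, |g x| ≤ M) (hk : k =ᵐ[μ] fun x => f x * g x) :
    inner ℝ (k - E.semigroup t.toNNReal k) k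
      ≤ 2 * M ^ 2 * (inner ℝ (f - E.semigroup t.toNNReal f) f
        + inner ℝ (g - E.semigroup t.toNNReal g) g) := by
  have hF : ∀ᵐ x ∂μ, k x * k x ≤ M ^ 2 * (f x * f x) := by
    filter_upwards [hg, hk] with x h2 h3
    rw [h3]
    have : g x ^ 2 ≤ M ^ 2 := by
      rw [← sq_abs]; exact pow_le_pow_left₀ (abs_nonneg _) h2 2
    nlinarith [sq_nonneg (f x)]
  have i1 : Integrable (fun x => M ^ 2 * (f x * f x) - k x * k x) μ :=
    ((integrable_mul f f).const_mul _).sub (integrable_mul k k)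
  have h1 := hp.integral_fst_le hP ht i1 (by
    filter_upwards [hF] with x hx using sub_nonneg.2 hx)
  rw [integral_sub ((integrable_mul f f).const_mul _) (integrable_mul k k),
    integral_sub ((hp.integrable_fst hP ht (integrable_mul f f)).const_mul _)
      (hp.integrable_fst hP ht (integrable_mul k k)), integral_const_mul, integral_const_mul] at h1
  have h2 : ∫ z, (k z.1 - k z.2) * (k z.1 - k z.2) ∂kernelMeasure μ p t
      ≤ 2 * M ^ 2 * (∫ z, (f z.1 - f z.2) * (f z.1 - f z.2) ∂kernelMeasure μ p t
        + ∫ z, (g z.1 - g z.2) * (g z.1 - g z.2) ∂kernelMeasure μ p t) := by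
    rw [← integral_add (hp.integrable_sub_mul_sub hP ht f f) (hp.integrable_sub_mul_sub hP ht g g),
      ← integral_const_mul]
    refine integral_mono_ae (hp.integrable_sub_mul_sub hP ht k k)
      (((hp.integrable_sub_mul_sub hP ht f f).add (hp.integrable_sub_mul_sub hP ht g g)).const_mul _)
      ?_
    filter_upwards [hp.ae_fst hP ht hf, hp.ae_snd hP ht hg, hp.ae_fst hP ht hk,
      hp.ae_snd hP ht hk] with z h1 h2 h3 h4
    rw [h3, h4]
    have e1 : f z.1 ^ 2 ≤ M ^ 2 := by
      rw [← sq_abs]; exact pow_le_pow_left₀ (abs_nonneg _) h1 2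
    have e2 : g z.2 ^ 2 ≤ M ^ 2 := by
      rw [← sq_abs]; exact pow_le_pow_left₀ (abs_nonneg _) h2 2
    have e3 : f z.1 * g z.1 - f z.2 * g z.2
        = f z.1 * (g z.1 - g z.2) + g z.2 * (f z.1 - f z.2) := by ring
    have e4 : f z.1 ^ 2 * (g z.1 - g z.2) ^ 2 ≤ M ^ 2 * (g z.1 - g z.2) ^ 2 :=
      mul_le_mul_of_nonneg_right e1 (sq_nonneg _)
    have e5 : g z.2 ^ 2 * (f z.1 - f z.2) ^ 2 ≤ M ^ 2 * (f z.1 - f z.2) ^ 2 :=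
      mul_le_mul_of_nonneg_right e2 (sq_nonneg _)
    rw [e3]
    nlinarith [sq_nonneg (f z.1 * (g z.1 - g z.2) - g z.2 * (f z.1 - f z.2))]
  have h3 := hp.integral_fst_le hP ht (integrable_mul f f)
    (Eventually.of_forall fun x => mul_self_nonneg _)
  have h4 := hp.integral_fst_le hP ht (integrable_mul g g)
    (Eventually.of_forall fun x => mul_self_nonneg _)
  rw [hp.inner_sub_semigroup_eq hP ht, hp.inner_sub_semigroup_eq hP ht f,
    hp.inner_sub_semigroup_eq hP ht g]
  have h5 := mul_nonneg (sq_nonneg M) (sub_nonneg.2 h3)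
  have h6 := mul_nonneg (sq_nonneg M) (sub_nonneg.2 h4)
  nlinarith

/-- Comparison of the approximating forms of `ψ v` and of the pair `(v, ψ² v)`. -/
theorem IsContinuousHeatKernel.approx_cutoff_le {M : ℝ} {ψ : X → ℝ} (v w z k : Lp ℝ 2 μ)
    (hv : ∀ᵐ x ∂μ, |v x| ≤ M) (hw : w =ᵐ[μ] fun x => ψ x * v x)
    (hz : z =ᵐ[μ] fun x => ψ x * (ψ x * v x)) (hk : k =ᵐ[μ] ψ) :
    inner ℝ (w - E.semigroup t.toNNReal w) w
      ≤ inner ℝ (v - E.semigroup t.toNNReal v) z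
        + M ^ 2 * inner ℝ (k - E.semigroup t.toNNReal k) k := by
  rw [hp.inner_sub_semigroup_eq hP ht, hp.inner_sub_semigroup_eq hP ht v]
  have e1 : ∀ᵐ x ∂μ, w x * w x = v x * z x := by
    filter_upwards [hw, hz] with x h1 h2
    rw [h1, h2]; ring
  have e1' : (fun y : X × X => w y.1 * w y.1) =ᵐ[kernelMeasure μ p t] fun y => v y.1 * z y.1 :=
    hp.ae_fst hP ht e1
  rw [integral_congr_ae e1, integral_congr_ae e1']
  have h1 : ∫ y, (w y.1 - w y.2) * (w y.1 - w y.2) ∂kernelMeasure μ p t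
      ≤ (∫ y, (v y.1 - v y.2) * (z y.1 - z y.2) ∂kernelMeasure μ p t)
        + M ^ 2 * ∫ y, (k y.1 - k y.2) ^ 2 ∂kernelMeasure μ p t := by
    have ik : Integrable (fun y : X × X => (k y.1 - k y.2) ^ 2) (kernelMeasure μ p t) :=
      (hp.integrable_sub_mul_sub hP ht k k).congr (Eventually.of_forall fun y => (sq _).symm)
    rw [← integral_const_mul, ← integral_add (hp.integrable_sub_mul_sub hP ht v z)
      (ik.const_mul _)]
    refine integral_mono_ae (hp.integrable_sub_mul_sub hP ht w w)
      ((hp.integrable_sub_mul_sub hP ht v z).add (ik.const_mul _)) ?_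
    filter_upwards [hp.ae_fst hP ht hv, hp.ae_snd hP ht hv, hp.ae_fst hP ht hw,
      hp.ae_snd hP ht hw, hp.ae_fst hP ht hz, hp.ae_snd hP ht hz, hp.ae_fst hP ht hk,
      hp.ae_snd hP ht hk] with y h1 h2 h3 h4 h5 h6 h7 h8
    rw [h3, h4, h5, h6, h7, h8]
    have e2 : v y.1 * v y.2 ≤ M ^ 2 := by
      calc v y.1 * v y.2 ≤ |v y.1 * v y.2| := le_abs_self _
        _ = |v y.1| * |v y.2| := abs_mul _ _
        _ ≤ M * M := mul_le_mul h1 h2 (abs_nonneg _) ((abs_nonneg _).trans h1)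
        _ = M ^ 2 := (sq M).symm
    nlinarith [mul_nonneg (sub_nonneg.2 e2) (sq_nonneg (ψ y.1 - ψ y.2))]
  have h2 := hp.integral_sub_sq_le hP ht k
  nlinarith [mul_nonneg (sq_nonneg M) (sub_nonneg.2 h2)]

omit ht

/-- Bounded functions of the form domain form an algebra. -/
theorem IsContinuousHeatKernel.exists_mul {M : ℝ} (f g : E.Dom)
    (hf : ∀ᵐ x ∂μ, |E.toL2 f x| ≤ M) (hg : ∀ᵐ x ∂μ, |E.toL2 g x| ≤ M) :
    ∃ k : E.Dom, E.toL2 k =ᵐ[μ] fun x => E.toL2 f x * E.toL2 g x := by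
  have hm : MemLp (fun x => E.toL2 f x * E.toL2 g x) 2 μ := by
    refine ((Lp.memLp (E.toL2 g)).const_mul M).mono
      ((Lp.aestronglyMeasurable _).mul (Lp.aestronglyMeasurable _)) ?_
    filter_upwards [hf] with x hx
    rw [norm_mul, norm_mul, Real.norm_eq_abs, Real.norm_eq_abs M]
    exact mul_le_mul_of_nonneg_right (hx.trans (le_abs_self M)) (norm_nonneg _)
  obtain ⟨k, hk, -⟩ := hP.exists_toL2_eq_of_approx_le hm.toLp
    (2 * M ^ 2 * (E.energy f f + E.energy g g)) fun t ht => by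
      have h1 := hp.approx_mul_le hP ht (E.toL2 f) (E.toL2 g) hm.toLp hf hg hm.coeFn_toLp
      have h2 := hP.approx_le f ht
      have h3 := hP.approx_le g ht
      have h4 := mul_le_mul_of_nonneg_left h1 (inv_nonneg.2 ht.le)
      refine h4.trans ?_
      calc _ = 2 * M ^ 2 * (t⁻¹ * inner ℝ (E.toL2 f - E.semigroup t.toNNReal (E.toL2 f)) (E.toL2 f)
            + t⁻¹ * inner ℝ (E.toL2 g - E.semigroup t.toNNReal (E.toL2 g)) (E.toL2 g)) := by ring
        _ ≤ _ := mul_le_mul_of_nonneg_left (add_le_add h2 h3) (by positivity)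
  exact ⟨k, by rw [hk]; exact hm.coeFn_toLp⟩

/-- The algebraic part of the Caccioppoli inequality. -/
theorem IsContinuousHeatKernel.energy_cutoff_le {M : ℝ} {ψ : X → ℝ} (v w z k : E.Dom)
    (hv : ∀ᵐ x ∂μ, |E.toL2 v x| ≤ M) (hw : E.toL2 w =ᵐ[μ] fun x => ψ x * E.toL2 v x)
    (hz : E.toL2 z =ᵐ[μ] fun x => ψ x * (ψ x * E.toL2 v x)) (hk : E.toL2 k =ᵐ[μ] ψ) :
    E.energy w w ≤ E.energy v z + M ^ 2 * E.energy k k := by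
  refine le_of_tendsto_of_tendsto (hP.tendsto_approx w w)
    ((hP.tendsto_approx v z).add ((hP.tendsto_approx k k).const_mul (M ^ 2))) ?_
  filter_upwards [self_mem_nhdsWithin] with t ht
  have ht' : (0 : ℝ) < t := ht
  have h1 := hp.approx_cutoff_le hP ht' (E.toL2 v) (E.toL2 w) (E.toL2 z) (E.toL2 k) hv hw hz hk
  have h4 := mul_le_mul_of_nonneg_left h1 (inv_nonneg.2 ht'.le)
  linarith

end KernelMeasure

end DirichletForm

/-! ### Functions of time with compact support -/

section Time

variable {H : Type*} [NormedAddCommGroup H] [NormedSpace ℝ H]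

theorem deriv_eq_zero_of_notMem_tsupport {χ : ℝ → ℝ} {t : ℝ} (h : t ∉ tsupport χ) :
    deriv χ t = 0 :=
  image_eq_zero_of_notMem_tsupport fun h' => h (tsupport_deriv_subset h')

theorem setIntegral_eq_of_tsupport {I : Set ℝ} {χ : ℝ → ℝ} (h : tsupport χ ⊆ I) (f : ℝ → ℝ) :
    ∫ t in I, χ t * f t = ∫ t, χ t * f t :=
  setIntegral_eq_integral_of_forall_compl_eq_zero fun t ht => by
    rw [image_eq_zero_of_notMem_tsupport fun h' => ht (h h'), zero_mul]

theorem setIntegral_deriv_eq_of_tsupport {I : Set ℝ} {χ : ℝ → ℝ} (h : tsupport χ ⊆ I)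
    (f : ℝ → ℝ) : ∫ t in I, deriv χ t * f t = ∫ t, deriv χ t * f t :=
  setIntegral_eq_of_tsupport ((tsupport_deriv_subset).trans h) f

theorem memLp_smul_of_tsupport {a b : ℝ} {v : ℝ → H} (hv : MemLp v 2 (volume.restrict (Ioo a b)))
    {χ : ℝ → ℝ} (hχ : Continuous χ) (hχc : HasCompactSupport χ) (h : tsupport χ ⊆ Ioo a b) :
    MemLp (fun t => χ t • v t) 2 volume := by
  obtain ⟨C, hC⟩ := hχc.exists_bound_of_continuous hχ
  have h1 : MemLp (fun t => χ t • v t) 2 (volume.restrict (Ioo a b)) :=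
    hv.of_le_mul (c := C) (hχ.aestronglyMeasurable.smul hv.aestronglyMeasurable)
      (Eventually.of_forall fun t => by
        rw [norm_smul]; exact mul_le_mul_of_nonneg_right (hC t) (norm_nonneg _))
  have h2 := (memLp_indicator_iff_restrict measurableSet_Ioo).2 h1
  convert h2 using 1
  funext t
  by_cases ht : t ∈ Ioo a b
  · rw [indicator_of_mem ht]
  · rw [indicator_of_notMem ht, image_eq_zero_of_notMem_tsupport fun h' => ht (h h'), zero_smul]

/-- A smooth cutoff function in time. -/
theorem exists_smooth_cutoff {a' a b b' : ℝ} (h1 : a' < a) (h2 : b < b') :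
    ∃ θ : ℝ → ℝ, ContDiff ℝ ∞ θ ∧ HasCompactSupport θ ∧ tsupport θ ⊆ Ioo a' b' ∧
      ∀ t ∈ Icc a b, θ t = 1 ∧ deriv θ t = 0 := by
  obtain ⟨θ, hθ1, hθ2, hθ3⟩ := exists_contMDiff_zero_iff_one_iff_of_isClosed
    (modelWithCornersSelf ℝ ℝ) (n := (⊤ : ℕ∞))
    (s := (Ioo ((2 * a' + a) / 3) ((b + 2 * b') / 3))ᶜ)
    (t := Icc ((a' + 2 * a) / 3) ((2 * b + b') / 3))
    isOpen_Ioo.isClosed_compl isClosed_Icc (by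
      rw [disjoint_compl_left_iff_subset]
      exact Icc_subset_Ioo (by linarith) (by linarith))
  have hs : Function.support θ ⊆ Icc ((2 * a' + a) / 3) ((b + 2 * b') / 3) := fun t ht => by
    by_contra hn
    exact ht ((hθ3.1 t).1 fun h' => hn (Ioo_subset_Icc_self h'))
  have hts : tsupport θ ⊆ Icc ((2 * a' + a) / 3) ((b + 2 * b') / 3) :=
    closure_minimal hs isClosed_Icc
  refine ⟨θ, hθ1.contDiff, HasCompactSupport.of_support_subset_isCompact isCompact_Icc hs,
    hts.trans (Icc_subset_Ioo (by linarith) (by linarith)), fun t ht => ⟨?_, ?_⟩⟩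
  · exact (hθ3.2 t).1 ⟨by linarith [ht.1], by linarith [ht.2]⟩
  · have : θ =ᶠ[𝓝 t] fun _ => 1 := by
      filter_upwards [Ioo_mem_nhds (show (a' + 2 * a) / 3 < t by linarith [ht.1])
        (show t < (2 * b + b') / 3 by linarith [ht.2])] with r hr
      exact (hθ3.2 r).1 ⟨hr.1.le, hr.2.le⟩
    rw [this.deriv_eq, deriv_const]

end Time

/-! ### Locality and cutoff functions -/

namespace DirichletForm

section Locality

variable {X : Type*} [MetricSpace X] [LocallyCompactSpace X] [MeasurableSpace X] [BorelSpace X]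
  {μ : Measure X} {E : DirichletForm μ} {ψ : X → ℝ} {A U : Set X}

theorem toL2_sub_ae (f g : E.Dom) : E.toL2 (f - g) =ᵐ[μ] fun x => E.toL2 f x - E.toL2 g x := by
  rw [map_sub]; exact Lp.coeFn_sub _ _

theorem toL2_smul_ae (r : ℝ) (g : E.Dom) : E.toL2 (r • g) =ᵐ[μ] fun x => r * E.toL2 g x := by
  rw [map_smul]; exact Lp.coeFn_smul _ _

/-- The form only sees the values of a function near the support of the test function. -/
theorem IsNiceCutoff.energy_mul (hreg : E.IsRegular) (hloc : E.IsStrictlyLocal)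
    (h : E.IsNiceCutoff ψ A U) {K : Set X} (hK : IsCompact K) (hKA : K ⊆ interior A) (f : E.Dom)
    {φ : E.Dom} (hφ : φ ∈ E.supported K) : E.energy (h.mul f) φ = E.energy f φ := by
  have hcl : IsClosed {f : E.Dom | E.energy (h.mul f) φ = E.energy f φ} :=
    isClosed_eq ((E.energyL.continuous.comp h.mul.continuous).clm_apply continuous_const)
      (E.energyL.continuous.clm_apply continuous_const)
  suffices hd : Dense {f : E.Dom | E.energy (h.mul f) φ = E.energy f φ} from by
    have h1 := hd f
    rwa [hcl.closure_eq] at h1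
  intro f
  refine Metric.mem_closure_iff.2 fun ε hε => ?_
  obtain ⟨g, q, -, hqc, hgq, hfg⟩ := hreg.1 f ε hε
  refine ⟨g, ?_, by rwa [dist_eq_norm]⟩
  change E.energy (h.mul g) φ = E.energy g φ
  have h1 := hloc (g - h.mul g) φ (tsupport q) K (interior A) 0 hqc.isCompact hK isOpen_interior
    hKA (by
      filter_upwards [toL2_sub_ae g (h.mul g), h.mul_ae g, hgq] with x h1 h2 h3 h4
      rw [h1, h2, h3, image_eq_zero_of_notMem_tsupport h4, mul_zero, sub_zero]) hφ (by
      filter_upwards [toL2_sub_ae g (h.mul g), h.mul_ae g] with x h1 h2 h4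
      rw [h1, h2, h.eq_one x (interior_subset h4), one_mul, sub_self])
  rw [map_sub, LinearMap.sub_apply] at h1
  linarith

theorem IsNiceCutoff.inner_mul (h : E.IsNiceCutoff ψ A U) (f g : E.Dom) :
    (inner ℝ (E.toL2 (h.mul f)) (E.toL2 g) : ℝ) = inner ℝ (E.toL2 f) (E.toL2 (h.mul g)) := by
  refine inner_congr_ae ?_
  filter_upwards [h.mul_ae f, h.mul_ae g] with x h1 h2
  rw [h1, h2]; ring

theorem IsNiceCutoff.mul_mem_supported (h : E.IsNiceCutoff ψ A U) (f : E.Dom) :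
    h.mul f ∈ E.supported (tsupport ψ) := by
  filter_upwards [h.mul_ae f] with x h1 h2
  rw [h1, image_eq_zero_of_notMem_tsupport h2, zero_mul]

theorem IsNiceCutoff.mul_eq_self (h : E.IsNiceCutoff ψ A U) {f : E.Dom} (hf : f ∈ E.supported A) :
    h.mul f = f := by
  refine toL2_ext ?_
  filter_upwards [h.mul_ae f, mem_supported.1 hf] with x h1 h2
  rw [h1]
  by_cases hx : x ∈ A
  · rw [h.eq_one x hx, one_mul]
  · rw [h2 hx, mul_zero]

theorem IsNiceCutoff.subset_tsupport (h : E.IsNiceCutoff ψ A U) : A ⊆ tsupport ψ := fun x hx =>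
  _root_.subset_tsupport ψ (by rw [Function.mem_support, h.eq_one x hx]; exact one_ne_zero)

/-- The form domain contains continuous cutoff functions. -/
theorem exists_cutoff (hreg : E.IsRegular) {K : Set X} (hK : IsCompact K) :
    ∃ (g : E.Dom) (c : X → ℝ), Continuous c ∧ HasCompactSupport c ∧ (∀ x, c x ∈ Icc (0 : ℝ) 1) ∧
      (∀ x ∈ K, c x = 1) ∧ E.toL2 g =ᵐ[μ] c := by
  obtain ⟨f, hf, hfc, -, -, hfK⟩ := exists_bump_one K hK univ isOpen_univ (subset_univ _)
  obtain ⟨q, hq, hqc, ⟨k, hk⟩, hqf⟩ := hreg.2 (fun x => 2 * f x) (by fun_prop) hfc.mul_left 1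
    one_pos
  obtain ⟨g, hg, -⟩ := E.markov (show E.domain from k)
  refine ⟨(show E.Dom from g), fun x => min (max (q x) 0) 1, by fun_prop, ?_, fun x => ?_, fun x hx => ?_, ?_⟩
  · exact hqc.comp_left (g := fun r : ℝ => min (max r 0) 1) (by simp)
  · exact ⟨le_min (le_max_right _ _) zero_le_one, min_le_right _ _⟩
  · have h1 := hqf x
    simp only [hfK x hx] at h1
    have h2 : 1 ≤ q x := by linarith [(abs_lt.1 h1).2]
    exact min_eq_right (h2.trans (le_max_left _ _))
  · have hg' : E.toL2 (show E.Dom from g) =ᵐ[μ] fun x => min (max (E.toL2 k x) 0) 1 := hg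
    filter_upwards [hg', hk] with x h1 h2
    rw [h1, h2]

/-- Nice cutoff functions belong to the form domain. -/
theorem IsNiceCutoff.exists_dom (hreg : E.IsRegular) (h : E.IsNiceCutoff ψ A U) :
    ∃ k : E.Dom, E.toL2 k =ᵐ[μ] ψ := by
  obtain ⟨g, c, -, -, -, hc, hg⟩ := exists_cutoff hreg h.hasCompactSupport.isCompact
  refine ⟨h.mul g, ?_⟩
  filter_upwards [h.mul_ae g, hg] with x h1 h2
  rw [h1, h2]
  by_cases hx : x ∈ tsupport ψ
  · rw [hc x hx, mul_one]
  · rw [image_eq_zero_of_notMem_tsupport hx, zero_mul]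

theorem IsNiceCutoff.aestronglyMeasurable (hreg : E.IsRegular) (h : E.IsNiceCutoff ψ A U) :
    AEStronglyMeasurable ψ μ := by
  obtain ⟨k, hk⟩ := h.exists_dom hreg
  exact (Lp.aestronglyMeasurable _).congr hk

end Locality

/-! ### Weak solutions -/

section WeakSolution

variable {X : Type*} [MetricSpace X] [LocallyCompactSpace X] [MeasurableSpace X] [BorelSpace X]
  {μ : Measure X}

/-- A curve in the form domain that satisfies the weak heat equation on `(a, b) × V`, tested
against products of a smooth function of time and of a function of the form domain with compact
support in `V`. -/
structure IsWeakCurve (E : DirichletForm μ) (a b : ℝ) (V : Set X) (v : ℝ → E.Dom) : Prop where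
  memLp : MemLp v 2 (volume.restrict (Ioo a b))
  weak : ∀ χ : ℝ → ℝ, ContDiff ℝ ∞ χ → HasCompactSupport χ → tsupport χ ⊆ Ioo a b →
    ∀ K : Set X, IsCompact K → K ⊆ V → ∀ g ∈ E.supported K,
      ∫ t, deriv χ t * inner ℝ (E.toL2 (v t)) (E.toL2 g) = ∫ t, χ t * E.energy (v t) g

/-- `u` is, after multiplication by nice cutoff functions, a weak solution of the heat equation. -/
def IsWeakSolution (E : DirichletForm μ) (I : Set ℝ) (U : Set X) (u : ℝ × X → ℝ) : Prop :=
  ∀ (ψ : X → ℝ) (A : Set X), IsCompact A → E.IsNiceCutoff ψ A U → ∀ a b : ℝ, Icc a b ⊆ I →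
    ∃ v : ℝ → E.Dom, E.IsWeakCurve a b (interior A) v ∧
      ∀ᵐ t ∂volume.restrict (Ioo a b), E.toL2 (v t) =ᵐ[μ] fun x => ψ x * u (t, x)

variable {E : DirichletForm μ}

/-- A local weak solution is cut off by multiplying with a nice cutoff function a representative
on its support; by strict locality the product satisfies the same equation where the cutoff is
one. -/
theorem IsLocalWeakSolution.isWeakSolution (hreg : E.IsRegular) (hloc : E.IsStrictlyLocal)
    {I : Set ℝ} {U : Set X} {u : ℝ × X → ℝ} (hu : E.IsLocalWeakSolution I U u) :
    E.IsWeakSolution I U u := by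
  intro ψ A hA h a b hab
  obtain ⟨w, w', hw, hwu, heq⟩ := hu.exists_local (Icc a b ×ˢ tsupport ψ)
    (isCompact_Icc.prod h.hasCompactSupport.isCompact) (prod_mono hab h.tsupport_subset)
  have hI : Ioo a b ⊆ I := Ioo_subset_Icc_self.trans hab
  refine ⟨fun t => h.mul (w t), ⟨?_, ?_⟩, ?_⟩
  · exact h.mul.comp_memLp' (hw.memLp.mono_measure (Measure.restrict_mono hI le_rfl))
  · intro χ hχ hχc hχs K hK hKA g hg
    have hχI : tsupport χ ⊆ I := hχs.trans hI
    have hd : Continuous (deriv χ) := hχ.continuous_deriv (by norm_num)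
    have hφ : E.IsW12 I (fun t => χ t • g) (fun t => deriv χ t • E.ltwoL g) := by
      refine ⟨?_, ?_, fun θ hθ hθc hθs f => ?_⟩
      · exact ((hχ.continuous.smul continuous_const).memLp_of_hasCompactSupport
          hχc.smul_right).restrict _
      · exact ((hd.smul continuous_const).memLp_of_hasCompactSupport
          hχc.deriv.smul_right).restrict _
      · simp only [smul_apply, ltwoL_apply, smul_eq_mul, map_smul, real_inner_smul_left]
        rw [setIntegral_eq_of_tsupport hθs, setIntegral_deriv_eq_of_tsupport hθs]
        have hparts := integral_mul_deriv_eq_deriv_mul_of_integrable (u := θ) (v := χ)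
          (u' := deriv θ) (v' := deriv χ)
          (fun t _ => (hθ.differentiable (by norm_num) t).hasDerivAt)
          (fun t _ => (hχ.differentiable (by norm_num) t).hasDerivAt)
          ((hθ.continuous.mul hd).integrable_of_hasCompactSupport hθc.mul_right)
          (((hθ.continuous_deriv (by norm_num)).mul
            hχ.continuous).integrable_of_hasCompactSupport hχc.mul_left)
          ((hθ.continuous.mul hχ.continuous).integrable_of_hasCompactSupport hθc.mul_right)
        simp only [← mul_assoc]
        rw [integral_mul_const, integral_mul_const, hparts, neg_mul]
    have h1 := heq _ _ hφ (by
      refine Eventually.of_forall fun t => ?_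
      filter_upwards [toL2_smul_ae (χ t) g, mem_supported.1 hg] with x h1 h2 h3
      rw [h1]
      by_cases ht : t ∈ tsupport χ
      · have hx : x ∉ K := fun hx => h3
          ⟨Ioo_subset_Icc_self (hχs ht), h.subset_tsupport (interior_subset (hKA hx))⟩
        rw [h2 hx, mul_zero]
      · rw [image_eq_zero_of_notMem_tsupport ht, zero_mul])
    have h2 := hw.weak_deriv χ hχ hχc hχI g
    simp only [map_smul, smul_eq_mul] at h1
    rw [setIntegral_eq_of_tsupport hχI, setIntegral_eq_of_tsupport hχI] at h1
    rw [setIntegral_eq_of_tsupport hχI, setIntegral_deriv_eq_of_tsupport hχI] at h2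
    simp only [h.energy_mul hreg hloc hK hKA _ hg, h.inner_mul,
      h.mul_eq_self (supported_mono (hKA.trans interior_subset) hg)]
    linarith
  · have h1 := ae_restrict_of_ae_restrict_of_subset hI hwu
    filter_upwards [h1, ae_restrict_mem measurableSet_Ioo] with t h1 ht
    filter_upwards [h.mul_ae (w t), h1] with x h2 h3
    rw [h2]
    by_cases hx : x ∈ tsupport ψ
    · rw [h3 ⟨Ioo_subset_Icc_self ht, hx⟩]
    · rw [image_eq_zero_of_notMem_tsupport hx, zero_mul, zero_mul]

/-- The representative on a compact set is the product of the solution with a cutoff function of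
time and one of space; its time derivative is given by the product rule. -/
theorem IsWeakSolution.isLocalWeakSolution (hreg : E.IsRegular) (hloc : E.IsStrictlyLocal)
    {I : Set ℝ} (hIo : IsOpen I) (hIc : I.OrdConnected) (hIn : I.Nonempty) {U : Set X}
    (hU : IsOpen U) (hUn : E.IsNice U) {u : ℝ × X → ℝ} (hu : E.IsWeakSolution I U u)
    (hum : AEStronglyMeasurable u ((volume.restrict I).prod (μ.restrict U))) :
    E.IsLocalWeakSolution I U u := by
  refine ⟨hum, fun K hK hKs => ?_⟩
  obtain ⟨t₀, ht₀⟩ := hIn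
  -- a compact rectangle that contains `K`, and slightly larger ones
  have hJ : IsCompact (insert t₀ (Prod.fst '' K)) := (hK.image continuous_fst).insert t₀
  have hJI : insert t₀ (Prod.fst '' K) ⊆ I := by
    rintro t (rfl | ⟨z, hz, rfl⟩)
    exacts [ht₀, (hKs hz).1]
  obtain ⟨a, ha, haJ⟩ := hJ.exists_isLeast (insert_nonempty _ _)
  obtain ⟨b, hb, hbJ⟩ := hJ.exists_isGreatest (insert_nonempty _ _)
  obtain ⟨a', haa', ha'⟩ : ∃ a' < a, Icc a' a ⊆ I := by
    obtain ⟨l, hl, hlI⟩ := exists_Ioc_subset_of_mem_nhds (hIo.mem_nhds (hJI ha)) ⟨a - 1, by simp⟩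
    exact ⟨(l + a) / 2, by linarith, fun r hr => hlI ⟨by linarith [hr.1], hr.2⟩⟩
  obtain ⟨b', hbb', hb'⟩ : ∃ b' > b, Icc b b' ⊆ I := by
    obtain ⟨l, hl, hlI⟩ := exists_Ico_subset_of_mem_nhds (hIo.mem_nhds (hJI hb)) ⟨b + 1, by simp⟩
    exact ⟨(l + b) / 2, by linarith, fun r hr => hlI ⟨hr.1, by linarith [hr.2]⟩⟩
  have hI' : Icc a' b' ⊆ I :=
    hIc.out (ha' (left_mem_Icc.2 haa'.le)) (hb' (right_mem_Icc.2 hbb'.le))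
  obtain ⟨θ, hθ, hθc, hθs, hθ1⟩ := exists_smooth_cutoff haa' hbb'
  have hKt : ∀ t x, (t, x) ∈ K → t ∈ Icc a b := fun t x h =>
    ⟨haJ (mem_insert_of_mem _ ⟨_, h, rfl⟩), hbJ (mem_insert_of_mem _ ⟨_, h, rfl⟩)⟩
  obtain ⟨A₁, hA₁, hKA₁, hA₁U⟩ := exists_compact_between (hK.image continuous_snd) hU (by
    rintro _ ⟨z, hz, rfl⟩; exact (hKs hz).2)
  obtain ⟨ψ₁, h₁⟩ := hUn A₁ hA₁ hA₁U
  obtain ⟨A₂, hA₂, hψA₂, hA₂U⟩ := exists_compact_between h₁.hasCompactSupport.isCompact hU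
    h₁.tsupport_subset
  obtain ⟨ψ₂, h₂⟩ := hUn A₂ hA₂ hA₂U
  obtain ⟨v, hv, hvu⟩ := hu ψ₂ A₂ hA₂ h₂ a' b' hI'
  have hθd : Continuous (deriv θ) := hθ.continuous_deriv (by norm_num)
  have hθds : tsupport (deriv θ) ⊆ Ioo a' b' := tsupport_deriv_subset.trans hθs
  have hmem : ∀ f, h₁.mul f ∈ E.supported (tsupport ψ₁) := h₁.mul_mem_supported
  refine ⟨fun t => θ t • h₁.mul (v t), fun t => deriv θ t • E.ltwoL (h₁.mul (v t))
    - θ t • (E.energyL (v t)).comp h₁.mul, ⟨?_, ?_, ?_⟩, ?_, ?_⟩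
  · exact (memLp_smul_of_tsupport (h₁.mul.comp_memLp' hv.memLp) hθ.continuous hθc hθs).restrict _
  · refine MemLp.sub ?_ ?_
    · exact (memLp_smul_of_tsupport ((E.ltwoL.comp h₁.mul).comp_memLp' hv.memLp) hθd hθc.deriv
        hθds).restrict _
    · exact (memLp_smul_of_tsupport ((((ContinuousLinearMap.compL ℝ E.Dom E.Dom ℝ).flip
        h₁.mul).comp E.energyL).comp_memLp' hv.memLp) hθ.continuous hθc hθs).restrict _
  · intro χ hχ hχc hχs f
    have hχθ : ContDiff ℝ ∞ (fun t => χ t * θ t) := hχ.mul hθ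
    have hχθs : tsupport (fun t => χ t * θ t) ⊆ Ioo a' b' := (tsupport_mul_subset_right).trans hθs
    have h1 := hv.weak _ hχθ hθc.mul_left hχθs (tsupport ψ₁) h₁.hasCompactSupport.isCompact hψA₂
      (h₁.mul f) (hmem f)
    rw [setIntegral_eq_of_tsupport hχs, setIntegral_deriv_eq_of_tsupport hχs]
    have hder : ∀ t, deriv (fun t => χ t * θ t) t = deriv χ t * θ t + χ t * deriv θ t := fun t =>
      deriv_fun_mul (hχ.differentiable (by norm_num) t) (hθ.differentiable (by norm_num) t)
    simp only [hder] at h1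
    have hvg : MemLp (fun t => (inner ℝ (E.toL2 (v t)) (E.toL2 (h₁.mul f)) : ℝ)) 2
        (volume.restrict (Ioo a' b')) := (E.ltwoL.flip (h₁.mul f)).comp_memLp' hv.memLp
    have hve : MemLp (fun t => E.energy (v t) (h₁.mul f)) 2
        (volume.restrict (Ioo a' b')) := (E.energyL.flip (h₁.mul f)).comp_memLp' hv.memLp
    have hχm : MemLp χ 2 volume := hχ.continuous.memLp_of_hasCompactSupport hχc
    have hχdm : MemLp (deriv χ) 2 volume :=
      (hχ.continuous_deriv (by norm_num)).memLp_of_hasCompactSupport hχc.deriv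
    have i1 : Integrable (fun t => χ t * (deriv θ t * inner ℝ (E.toL2 (v t)) (E.toL2 (h₁.mul f))))
        volume := hχm.integrable_mul (memLp_smul_of_tsupport hvg hθd hθc.deriv hθds)
    have i2 : Integrable (fun t => χ t * (θ t * E.energy (v t) (h₁.mul f))) volume :=
      hχm.integrable_mul (memLp_smul_of_tsupport hve hθ.continuous hθc hθs)
    have i3 : Integrable (fun t => deriv χ t * (θ t * inner ℝ (E.toL2 (v t)) (E.toL2 (h₁.mul f))))
        volume := hχdm.integrable_mul (memLp_smul_of_tsupport hvg hθ.continuous hθc hθs)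
    simp only [sub_apply, smul_apply, ltwoL_apply, ContinuousLinearMap.comp_apply, energyL_apply,
      smul_eq_mul, map_smul, real_inner_smul_left, h₁.inner_mul, mul_sub]
    rw [integral_sub i1 i2]
    have h3 : ∫ t, (deriv χ t * θ t + χ t * deriv θ t)
          * inner ℝ (E.toL2 (v t)) (E.toL2 (h₁.mul f))
        = (∫ t, deriv χ t * (θ t * inner ℝ (E.toL2 (v t)) (E.toL2 (h₁.mul f))))
          + ∫ t, χ t * (deriv θ t * inner ℝ (E.toL2 (v t)) (E.toL2 (h₁.mul f))) := by
      rw [← integral_add i3 i1]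
      exact integral_congr_ae (Eventually.of_forall fun t => by ring)
    have h4 : ∫ t, χ t * θ t * E.energy (v t) (h₁.mul f)
        = ∫ t, χ t * (θ t * E.energy (v t) (h₁.mul f)) :=
      integral_congr_ae (Eventually.of_forall fun t => by ring)
    rw [h3, h4] at h1
    linarith
  · have h1 := (ae_restrict_iff' measurableSet_Ioo).1 hvu
    refine ae_restrict_of_ae ?_
    filter_upwards [h1] with t h1
    by_cases ht : t ∈ Icc a b
    · filter_upwards [h1 (Icc_subset_Ioo haa' hbb' ht), toL2_smul_ae (θ t) (h₁.mul (v t)),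
        h₁.mul_ae (v t)] with x h1 h2 h3 hx
      have hx1 : x ∈ A₁ := interior_subset (hKA₁ ⟨_, hx, rfl⟩)
      rw [h2, h3, h1, (hθ1 t ht).1, h₁.eq_one x hx1,
        h₂.eq_one x (interior_subset (hψA₂ (h₁.subset_tsupport hx1)))]
      ring
    · exact Eventually.of_forall fun x hx => absurd (hKt t x hx) ht
  · intro φ φ' _ hφs
    rw [← eq_neg_iff_add_eq_zero, ← integral_neg]
    refine integral_congr_ae ?_
    filter_upwards [hφs] with t hφ
    by_cases ht : t ∈ Icc a b
    · have hφK : φ t ∈ E.supported (Prod.snd '' K) := by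
        filter_upwards [hφ] with x hx hxK
        exact hx fun h' => hxK ⟨_, h', rfl⟩
      rw [(hθ1 t ht).1, (hθ1 t ht).2, zero_smul, zero_sub, one_smul, one_smul,
        h₁.energy_mul hreg hloc (hK.image continuous_snd) hKA₁ _ hφK, neg_apply,
        ContinuousLinearMap.comp_apply, energyL_apply,
        h₁.mul_eq_self (supported_mono (hKA₁.trans interior_subset) hφK)]
    · have h0 : φ t = 0 := toL2_ext (by
        rw [map_zero]
        filter_upwards [hφ, Lp.coeFn_zero ℝ 2 μ] with x hx hx0
        rw [hx fun h' => ht (hKt t x h'), hx0]; rfl)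
      rw [h0, map_zero, map_zero, neg_zero]

end WeakSolution

end DirichletForm

/-! ### Mollification in time -/

/-- Bump functions on the line, whose supports shrink to the origin. -/
noncomputable def timeBump (j : ℕ) : ContDiffBump (0 : ℝ) where
  rIn := 1 / (2 * (j + 1))
  rOut := 1 / (j + 1)
  rIn_pos := by positivity
  rIn_lt_rOut := by
    have : (0 : ℝ) < j + 1 := by positivity
    gcongr
    linarith

/-- The radius of the support of the mollifier. -/
noncomputable def radius (j : ℕ) : ℝ := 1 / (j + 1)

/-- The standard mollifier on the line. -/
noncomputable def mollifier (j : ℕ) : ℝ → ℝ := (timeBump j).normed volume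

theorem radius_pos (j : ℕ) : 0 < radius j := by unfold radius; positivity

theorem tendsto_radius : Tendsto radius atTop (𝓝 0) := tendsto_one_div_add_atTop_nhds_zero_nat

theorem mollifier_nonneg (j : ℕ) (r : ℝ) : 0 ≤ mollifier j r := (timeBump j).nonneg_normed r

theorem contDiff_mollifier (j : ℕ) : ContDiff ℝ ∞ (mollifier j) := (timeBump j).contDiff_normed

theorem hasCompactSupport_mollifier (j : ℕ) : HasCompactSupport (mollifier j) :=
  (timeBump j).hasCompactSupport_normed

theorem integral_mollifier (j : ℕ) : ∫ r, mollifier j r = 1 := (timeBump j).integral_normed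

theorem integral_mollifier_sub (j : ℕ) (t : ℝ) : ∫ r, mollifier j (t - r) = 1 := by
  rw [integral_sub_left_eq_self (mollifier j) volume t, integral_mollifier]

theorem mollifier_eq_zero {j : ℕ} {r : ℝ} (h : radius j ≤ |r|) : mollifier j r = 0 := by
  have : r ∉ Function.support (mollifier j) := by
    rw [show Function.support (mollifier j) = Metric.ball 0 (radius j) from
      (timeBump j).support_normed_eq]
    simpa using h
  simpa using this

theorem mollifier_sub_eq_zero {j : ℕ} {t r a b : ℝ} (h1 : a + radius j ≤ t) (h2 : t ≤ b - radius j)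
    (hr : r ∉ Ioo a b) : mollifier j (t - r) = 0 := by
  refine mollifier_eq_zero ?_
  by_cases h : a < r
  · have : b ≤ r := by by_contra! h'; exact hr ⟨h, h'⟩
    rw [abs_sub_comm]
    exact le_trans (by linarith) (le_abs_self _)
  · exact le_trans (by linarith) (le_abs_self _)

theorem tsupport_mollifier_sub {j : ℕ} {t a b : ℝ} (h1 : a + radius j < t)
    (h2 : t < b - radius j) : tsupport (fun r => mollifier j (t - r)) ⊆ Ioo a b := by
  have h : Function.support (fun r => mollifier j (t - r)) ⊆ Icc (t - radius j) (t + radius j) := by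
    intro r hr
    by_contra hn
    refine hr (mollifier_eq_zero ?_)
    by_contra! h'
    have := abs_lt.1 h'
    exact hn ⟨by linarith, by linarith⟩
  exact (closure_minimal h isClosed_Icc).trans (Icc_subset_Ioo (by linarith) (by linarith))

theorem hasCompactSupport_mollifier_sub (j : ℕ) (t : ℝ) :
    HasCompactSupport (fun r => mollifier j (t - r)) :=
  HasCompactSupport.of_support_subset_isCompact (K := Icc (t - radius j) (t + radius j))
    isCompact_Icc fun r hr => by
      by_contra hn
      refine hr (mollifier_eq_zero ?_)
      by_contra! h'
      have := abs_lt.1 h'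
      exact hn ⟨by linarith, by linarith⟩

theorem contDiff_mollifier_sub (j : ℕ) (t : ℝ) : ContDiff ℝ ∞ (fun r => mollifier j (t - r)) :=
  (contDiff_mollifier j).comp (contDiff_const.sub contDiff_id)

section Vector

variable {H H' : Type*} [NormedAddCommGroup H] [NormedSpace ℝ H]
  [NormedAddCommGroup H'] [NormedSpace ℝ H']

/-- The mollification of a vector-valued function of time. -/
noncomputable def mollify (j : ℕ) (w : ℝ → H) (t : ℝ) : H := ∫ r, mollifier j (t - r) • w r

theorem integrable_mollifier_smul (j : ℕ) {w : ℝ → H} (hw : Integrable w) (t : ℝ) :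
    Integrable fun r => mollifier j (t - r) • w r := by
  have hc := (contDiff_mollifier_sub j t).continuous
  obtain ⟨C, hC⟩ := (hasCompactSupport_mollifier_sub j t).exists_bound_of_continuous hc
  exact hw.bdd_smul C hc.aestronglyMeasurable (Eventually.of_forall hC)

theorem integrable_deriv_mollifier_smul (j : ℕ) {w : ℝ → H} (hw : Integrable w) (t : ℝ) :
    Integrable fun r => deriv (mollifier j) (t - r) • w r := by
  have hc : Continuous (deriv (mollifier j)) := (contDiff_mollifier j).continuous_deriv (by norm_num)
  obtain ⟨C, hC⟩ := (hasCompactSupport_mollifier j).deriv.exists_bound_of_continuous hc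
  exact hw.bdd_smul C (hc.comp (continuous_const.sub continuous_id)).aestronglyMeasurable
    (Eventually.of_forall fun r => hC _)

theorem mollify_eq_convolution (j : ℕ) (w : ℝ → H) :
    mollify j w = convolution ((timeBump j).normed volume) w (ContinuousLinearMap.lsmul ℝ ℝ) volume := by
  funext t
  rw [convolution_lsmul_swap]
  rfl

theorem hasDerivAt_mollify (j : ℕ) [CompleteSpace H] {w : ℝ → H} (hw : Integrable w) (t : ℝ) :
    HasDerivAt (mollify j w) (∫ r, deriv (mollifier j) (t - r) • w r) t := by
  rw [mollify_eq_convolution]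
  have := (hasCompactSupport_mollifier j).hasDerivAt_convolution_left
    (ContinuousLinearMap.lsmul ℝ ℝ) ((contDiff_mollifier j).of_le (by norm_num))
    hw.locallyIntegrable t
  rwa [convolution_lsmul_swap] at this

theorem continuous_mollify (j : ℕ) [CompleteSpace H] {w : ℝ → H} (hw : Integrable w) :
    Continuous (mollify j w) :=
  continuous_iff_continuousAt.2 fun t => (hasDerivAt_mollify j hw t).continuousAt

theorem clm_mollify (j : ℕ) [CompleteSpace H] [CompleteSpace H'] (L : H →L[ℝ] H') {w : ℝ → H}
    (hw : Integrable w) (t : ℝ) : L (mollify j w t) = mollify j (fun r => L (w r)) t := by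
  rw [mollify, mollify, ← L.integral_comp_comm (integrable_mollifier_smul j hw t)]
  simp only [map_smul]

theorem ae_tendsto_mollify [CompleteSpace H] {w : ℝ → H} (hw : Integrable w) :
    ∀ᵐ t, Tendsto (fun j => mollify j w t) atTop (𝓝 (w t)) := by
  have h := ContDiffBump.ae_convolution_tendsto_right_of_locallyIntegrable (μ := volume)
    (φ := timeBump) (K := 2) (l := atTop) tendsto_radius (Eventually.of_forall fun j => by
      have : (0 : ℝ) < j + 1 := by positivity
      simp only [timeBump]
      refine le_of_eq ?_
      field_simp)
    hw.locallyIntegrable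
  filter_upwards [h] with t ht
  simp only [mollify_eq_convolution]
  exact ht

/-- Mollification does not leave closed convex sets. -/
theorem mollify_mem {j : ℕ} [CompleteSpace H] {w : ℝ → H} (hw : Integrable w) {S : Set H}
    (hS : Convex ℝ S) (hSc : IsClosed S) {a b t : ℝ} (hwS : ∀ᵐ r ∂volume.restrict (Ioo a b), w r ∈ S)
    (h1 : a + radius j ≤ t) (h2 : t ≤ b - radius j) : mollify j w t ∈ S := by
  have hm : Measurable fun r => ENNReal.ofReal (mollifier j (t - r)) :=
    (contDiff_mollifier_sub j t).continuous.measurable.ennreal_ofReal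
  set ρ := (volume : Measure ℝ).withDensity fun r => ENNReal.ofReal (mollifier j (t - r)) with hρ
  have hi : Integrable fun r => mollifier j (t - r) :=
    (contDiff_mollifier_sub j t).continuous.integrable_of_hasCompactSupport
      (hasCompactSupport_mollifier_sub j t)
  have : IsProbabilityMeasure ρ := ⟨by
    rw [hρ, withDensity_apply _ MeasurableSet.univ, setLIntegral_univ,
      ← ofReal_integral_eq_lintegral_ofReal hi (Eventually.of_forall fun r => mollifier_nonneg j _),
      integral_mollifier_sub, ENNReal.ofReal_one]⟩
  have h3 : mollify j w t = ∫ r, w r ∂ρ := by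
    rw [hρ, integral_withDensity_eq_integral_toReal_smul hm
      (Eventually.of_forall fun _ => ENNReal.ofReal_lt_top), mollify]
    exact integral_congr_ae (Eventually.of_forall fun r => by
      simp only [ENNReal.toReal_ofReal (mollifier_nonneg j _)])
  rw [h3]
  refine hS.integral_mem hSc ?_ ?_
  · rw [hρ, ae_withDensity_iff hm]
    filter_upwards [(ae_restrict_iff' measurableSet_Ioo).1 hwS] with r hr h0
    refine hr ?_
    by_contra hn
    exact h0 (by rw [mollifier_sub_eq_zero h1 h2 hn, ENNReal.ofReal_zero])
  · rw [hρ, integrable_withDensity_iff_integrable_smul' hm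
      (Eventually.of_forall fun _ => ENNReal.ofReal_lt_top)]
    refine (integrable_mollifier_smul j hw t).congr (Eventually.of_forall fun r => ?_)
    simp only [ENNReal.toReal_ofReal (mollifier_nonneg j _)]

theorem mollify_congr_ae {j : ℕ} {w w' : ℝ → H} {a b t : ℝ}
    (h : ∀ᵐ r ∂volume.restrict (Ioo a b), w r = w' r)
    (h1 : a + radius j ≤ t) (h2 : t ≤ b - radius j) : mollify j w t = mollify j w' t := by
  refine integral_congr_ae ?_
  filter_upwards [(ae_restrict_iff' measurableSet_Ioo).1 h] with r hr
  by_cases hr' : r ∈ Ioo a b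
  · rw [hr hr']
  · rw [mollifier_sub_eq_zero h1 h2 hr', zero_smul, zero_smul]

theorem integrable_indicator_of_memLp {a b : ℝ} {v : ℝ → H}
    (hv : MemLp v 2 (volume.restrict (Ioo a b))) : Integrable ((Ioo a b).indicator v) :=
  (integrable_indicator_iff measurableSet_Ioo).2 (hv.integrable one_le_two)

end Vector

/-- The Bochner integral of a curve in `L²` can be computed pointwise. -/
theorem integral_Lp_ae {X : Type*} [MeasurableSpace X] {μ : Measure X} [SigmaFinite μ]
    {G : ℝ → Lp ℝ 2 μ} (hG : Integrable G) {g : ℝ × X → ℝ}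
    (hg : AEStronglyMeasurable g ((volume : Measure ℝ).prod μ))
    (hGg : ∀ᵐ r, G r =ᵐ[μ] fun x => g (r, x)) :
    (∫ r, G r : Lp ℝ 2 μ) =ᵐ[μ] fun x => ∫ r, g (r, x) := by
  have key : ∀ B, MeasurableSet B → μ B < ⊤ →
      Integrable g ((volume : Measure ℝ).prod (μ.restrict B)) := by
    intro B hB hμB
    have : Fact (μ B < ⊤) := ⟨hμB⟩
    have hgB : AEStronglyMeasurable g ((volume : Measure ℝ).prod (μ.restrict B)) :=
      hg.mono_ac (Measure.AbsolutelyContinuous.rfl.prod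
        Measure.restrict_le_self.absolutelyContinuous)
    rw [integrable_prod_iff hgB]
    constructor
    · filter_upwards [hGg] with r hr
      exact (((Lp.memLp (G r)).restrict B).integrable one_le_two).congr (ae_restrict_of_ae hr)
    · refine (hG.norm.const_mul ‖indicatorConstLp 2 hB hμB.ne (1 : ℝ)‖).mono
        hgB.norm.integral_prod_right' ?_
      filter_upwards [hGg] with r hr
      have h1 : ∫ x in B, ‖g (r, x)‖ ∂μ = inner ℝ (indicatorConstLp 2 hB hμB.ne (1 : ℝ)) |G r| := by
        rw [L2.inner_indicatorConstLp_one]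
        refine integral_congr_ae (ae_restrict_of_ae ?_)
        filter_upwards [hr, Lp.coeFn_abs (G r)] with x h1 h2
        rw [h2, h1, Real.norm_eq_abs]
      rw [h1, norm_mul, norm_norm, norm_norm, ← norm_abs_eq_norm (G r)]
      exact norm_inner_le_norm _ _
  refine ae_eq_of_forall_setIntegral_eq_of_sigmaFinite (fun B _ hμB => ?_) (fun B hB hμB => ?_)
    fun B hB hμB => ?_
  · have : Fact (μ B < ⊤) := ⟨hμB⟩
    exact ((Lp.memLp _).restrict B).integrable one_le_two
  · exact (key B hB hμB).integral_prod_right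
  · have h1 : ∫ x in B, (∫ r, g (r, x)) ∂μ = ∫ r, ∫ x in B, g (r, x) ∂μ :=
      (integral_integral_swap (f := fun r x => g (r, x)) (key B hB hμB)).symm
    rw [h1, ← L2.inner_indicatorConstLp_one (𝕜 := ℝ) hB hμB.ne]
    have h2 := (innerSL ℝ (indicatorConstLp 2 hB hμB.ne (1 : ℝ))).integral_comp_comm hG
    simp only [innerSL_apply_apply] at h2
    rw [← h2]
    refine integral_congr_ae ?_
    filter_upwards [hGg] with r hr
    rw [L2.inner_indicatorConstLp_one]
    exact integral_congr_ae (ae_restrict_of_ae hr)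

namespace DirichletForm

section Mollify

variable {X : Type*} [MetricSpace X] [LocallyCompactSpace X] [MeasurableSpace X] [BorelSpace X]
  {μ : Measure X} {E : DirichletForm μ} {a b : ℝ} {V : Set X} {v : ℝ → E.Dom}

theorem IsWeakCurve.integrable (hv : E.IsWeakCurve a b V v) : Integrable ((Ioo a b).indicator v) :=
  integrable_indicator_of_memLp hv.memLp

/-- The mollification of a weak solution is a classical solution. -/
theorem IsWeakCurve.exists_hasDerivAt_mollify (hv : E.IsWeakCurve a b V v) {j : ℕ} {t : ℝ}
    (h1 : a + radius j < t) (h2 : t < b - radius j) :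
    ∃ d : E.Dom, HasDerivAt (mollify j ((Ioo a b).indicator v)) d t ∧
      ∀ K : Set X, IsCompact K → K ⊆ V → ∀ g ∈ E.supported K,
        inner ℝ (E.toL2 d) (E.toL2 g)
          = -E.energy (mollify j ((Ioo a b).indicator v) t) g := by
  refine ⟨_, hasDerivAt_mollify j hv.integrable t, fun K hK hKV g hg => ?_⟩
  have h3 := hv.weak _ (contDiff_mollifier_sub j t) (hasCompactSupport_mollifier_sub j t)
    (tsupport_mollifier_sub h1 h2) K hK hKV g hg
  have h4 := (E.ltwoL.flip g).integral_comp_comm (integrable_deriv_mollifier_smul j hv.integrable t)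
  have h5 := (E.energyL.flip g).integral_comp_comm (integrable_mollifier_smul j hv.integrable t)
  simp only [ContinuousLinearMap.flip_apply, ltwoL_apply, energyL_apply] at h4 h5
  rw [← h4, mollify, ← h5]
  have h6 : ∀ r, deriv (fun r => mollifier j (t - r)) r = -deriv (mollifier j) (t - r) := fun r =>
    deriv_comp_const_sub _ _ _
  simp only [h6] at h3
  have h7 : ∀ r, mollifier j (t - r) * E.energy (v r) g
      = E.energy (mollifier j (t - r) • (Ioo a b).indicator v r) g := fun r => by
    by_cases hr : r ∈ Ioo a b
    · rw [indicator_of_mem hr, map_smul]; rfl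
    · rw [mollifier_sub_eq_zero h1.le h2.le hr, zero_mul, zero_smul, map_zero]; rfl
  have h8 : ∀ r, -deriv (mollifier j) (t - r) * inner ℝ (E.toL2 (v r)) (E.toL2 g)
      = -inner ℝ (E.toL2 (deriv (mollifier j) (t - r) • (Ioo a b).indicator v r)) (E.toL2 g) :=
    fun r => by
    by_cases hr : r ∈ Ioo a b
    · rw [indicator_of_mem hr, map_smul, real_inner_smul_left, neg_mul]
    · have h9 : deriv (fun r => mollifier j (t - r)) r = 0 :=
        deriv_eq_zero_of_notMem_tsupport fun h' => hr (tsupport_mollifier_sub h1 h2 h')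
      rw [h6, neg_eq_zero] at h9
      rw [h9, neg_zero, zero_mul, zero_smul, map_zero, inner_zero_left, neg_zero]
  simp only [h7, h8, integral_neg] at h3
  linarith

end Mollify

end DirichletForm

/-! ### The Caccioppoli inequality and limits of weak solutions -/

section Bochner

variable {H : Type*} [NormedAddCommGroup H] [InnerProductSpace ℝ H] {T : Type*} [MeasurableSpace T]
  {ν : Measure T}

theorem norm_sq_Lp_eq_integral (f : Lp H 2 ν) : ‖f‖ ^ 2 = ∫ t, ‖f t‖ ^ 2 ∂ν := by
  rw [← real_inner_self_eq_norm_sq, L2.inner_def]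
  simp only [real_inner_self_eq_norm_sq]

/-- Bounded convergence in vector-valued `L²` over a finite measure space. -/
theorem tendsto_toLp_of_bounded [IsFiniteMeasure ν] {f : ℕ → Lp H 2 ν} {g : T → H}
    (hg : MemLp g 2 ν) {B : ℝ} (hb : ∀ n, ∀ᵐ t ∂ν, ‖f n t‖ ≤ B)
    (hl : ∀ᵐ t ∂ν, Tendsto (fun n => f n t) atTop (𝓝 (g t))) :
    Tendsto f atTop (𝓝 hg.toLp) := by
  rw [tendsto_iff_norm_sub_tendsto_zero]
  have hgb : ∀ᵐ t ∂ν, ‖g t‖ ≤ B := by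
    filter_upwards [hl, ae_all_iff.2 hb] with t h1 h2
    exact le_of_tendsto h1.norm (Eventually.of_forall h2)
  have h1 : Tendsto (fun n => ∫ t, ‖(f n - hg.toLp : Lp H 2 ν) t‖ ^ 2 ∂ν) atTop
      (𝓝 (∫ _, (0 : ℝ) ∂ν)) := by
    refine tendsto_integral_of_dominated_convergence (fun _ => 4 * B ^ 2)
      (fun n => (Lp.aestronglyMeasurable _).norm.pow 2) (integrable_const _) ?_ ?_
    · intro n
      filter_upwards [hb n, hgb, Lp.coeFn_sub (f n) hg.toLp, hg.coeFn_toLp] with t h1 h2 h3 h4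
      rw [h3, Pi.sub_apply, h4, Real.norm_eq_abs, abs_of_nonneg (sq_nonneg _)]
      have h5 := norm_sub_le (f n t) (g t)
      nlinarith [norm_nonneg (f n t - g t)]
    · filter_upwards [hl, ae_all_iff.2 fun n => Lp.coeFn_sub (f n) hg.toLp, hg.coeFn_toLp]
        with t h1 h2 h4
      have h3 := ((tendsto_iff_norm_sub_tendsto_zero.1 h1).pow 2)
      simp only [ne_eq, OfNat.ofNat_ne_zero, not_false_eq_true, zero_pow] at h3
      refine h3.congr fun n => ?_
      rw [h2 n, Pi.sub_apply, h4]
  rw [integral_zero] at h1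
  have h2 := h1.sqrt
  simp only [Real.sqrt_zero] at h2
  refine h2.congr fun n => ?_
  rw [← norm_sq_Lp_eq_integral, Real.sqrt_sq (norm_nonneg _)]

end Bochner

namespace DirichletForm

section Caccioppoli

variable {X : Type*} [MetricSpace X] [LocallyCompactSpace X] [MeasurableSpace X] [BorelSpace X]
  {μ : Measure X} {E : DirichletForm μ} {a b : ℝ} {V : Set X} {v : ℝ → E.Dom}
  {ψ : X → ℝ} {A U : Set X}

theorem convex_setOf_abs_le (E : DirichletForm μ) (M : ℝ) :
    Convex ℝ {f : E.Dom | ∀ᵐ x ∂μ, |E.toL2 f x| ≤ M} := by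
  intro f hf g hg r s hr hs hrs
  rw [mem_ofPred_eq] at *
  rw [map_add, map_smul, map_smul]
  filter_upwards [hf, hg, Lp.coeFn_add (r • E.toL2 f) (s • E.toL2 g), Lp.coeFn_smul r (E.toL2 f),
    Lp.coeFn_smul s (E.toL2 g)] with x h1 h2 h3 h4 h5
  rw [h3, Pi.add_apply, h4, h5, Pi.smul_apply, Pi.smul_apply, smul_eq_mul, smul_eq_mul]
  rw [abs_le] at *
  constructor
  · nlinarith
  · nlinarith

theorem isClosed_setOf_abs_le (E : DirichletForm μ) (M : ℝ) :
    IsClosed {f : E.Dom | ∀ᵐ x ∂μ, |E.toL2 f x| ≤ M} := by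
  have h := (isClosed_setOf_ae_mem (μ := μ) (fun _ => Icc (-M) M) fun _ => isClosed_Icc).preimage
    E.incl.continuous
  convert h using 1
  ext f
  simp only [mem_ofPred_eq, mem_preimage, incl_apply, mem_Icc, abs_le]

theorem convex_setOf_nonneg (E : DirichletForm μ) :
    Convex ℝ {f : E.Dom | ∀ᵐ x ∂μ, 0 ≤ E.toL2 f x} := by
  intro f hf g hg r s hr hs hrs
  rw [mem_ofPred_eq] at *
  rw [map_add, map_smul, map_smul]
  filter_upwards [hf, hg, Lp.coeFn_add (r • E.toL2 f) (s • E.toL2 g), Lp.coeFn_smul r (E.toL2 f),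
    Lp.coeFn_smul s (E.toL2 g)] with x h1 h2 h3 h4 h5
  rw [h3, Pi.add_apply, h4, h5, Pi.smul_apply, Pi.smul_apply, smul_eq_mul, smul_eq_mul]
  positivity

theorem isClosed_setOf_nonneg (E : DirichletForm μ) :
    IsClosed {f : E.Dom | ∀ᵐ x ∂μ, 0 ≤ E.toL2 f x} :=
  (isClosed_setOf_ae_mem (μ := μ) (fun _ => Ici 0) fun _ => isClosed_Ici).preimage E.incl.continuous

theorem IsWeakCurve.mono_time (hv : E.IsWeakCurve a b V v) {c d : ℝ} (hac : a ≤ c) (hdb : d ≤ b) :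
    E.IsWeakCurve c d V v :=
  ⟨hv.memLp.mono_measure (Measure.restrict_mono (Ioo_subset_Ioo hac hdb) le_rfl),
    fun χ h1 h2 h3 => hv.weak χ h1 h2 (h3.trans (Ioo_subset_Ioo hac hdb))⟩

theorem IsWeakCurve.mul (hreg : E.IsRegular) (hloc : E.IsStrictlyLocal)
    (hv : E.IsWeakCurve a b V v) (h : E.IsNiceCutoff ψ A U) (hψ : tsupport ψ ⊆ V) :
    E.IsWeakCurve a b (interior A) fun t => h.mul (v t) := by
  refine ⟨h.mul.comp_memLp' hv.memLp, fun χ h1 h2 h3 K hK hKA g hg => ?_⟩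
  simp only [h.energy_mul hreg hloc hK hKA _ hg, h.inner_mul,
    h.mul_eq_self (supported_mono (hKA.trans interior_subset) hg)]
  exact hv.weak χ h1 h2 h3 K hK
    (hKA.trans (interior_subset.trans (h.subset_tsupport.trans hψ))) g hg

theorem IsNiceCutoff.norm_toL2_mul_le_of_abs_le (h : E.IsNiceCutoff ψ A U) {k f : E.Dom}
    (hk : E.toL2 k =ᵐ[μ] ψ) {M : ℝ} (hf : ∀ᵐ x ∂μ, |E.toL2 f x| ≤ M) (hM : 0 ≤ M) :
    ‖E.toL2 (h.mul f)‖ ≤ M * ‖E.toL2 k‖ := by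
  have h1 : ‖E.toL2 (h.mul f)‖ ≤ ‖M • E.toL2 k‖ := by
    refine norm_le_of_ae_abs_le ?_
    filter_upwards [h.mul_ae f, hf, hk, Lp.coeFn_smul M (E.toL2 k)] with x h1 h2 h3 h4
    rw [h4, Pi.smul_apply, h1, h3, smul_eq_mul, abs_mul, abs_mul, abs_of_nonneg hM, mul_comm]
    exact mul_le_mul_of_nonneg_right h2 (abs_nonneg _)
  rwa [norm_smul, Real.norm_eq_abs, abs_of_nonneg hM] at h1

variable [SecondCountableTopology X] [μ.Regular] [μ.IsOpenPosMeasure]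
  {p : ℝ → X → X → ℝ}

/-- The Caccioppoli inequality for bounded weak solutions. -/
theorem IsWeakCurve.lintegral_energy_le (hp : E.IsContinuousHeatKernel p)
    (hP : E.IsHeatSemigroup E.semigroup)
    (hv : E.IsWeakCurve a b V v) (h : E.IsNiceCutoff ψ A U) (hψ : tsupport ψ ⊆ V)
    {k : E.Dom} (hk : E.toL2 k =ᵐ[μ] ψ) {M : ℝ} (hM : 0 ≤ M)
    (hvM : ∀ᵐ t ∂volume.restrict (Ioo a b), ∀ᵐ x ∂μ, |E.toL2 (v t) x| ≤ M) {c d : ℝ}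
    (hac : a < c) (hcd : c ≤ d) (hdb : d < b) :
    ∫⁻ t in Ioo c d, ENNReal.ofReal (E.energy (h.mul (v t)) (h.mul (v t)))
      ≤ ENNReal.ofReal ((d - c) * (M ^ 2 * E.energy k k) + (1 / 2) * (M * ‖E.toL2 k‖) ^ 2) := by
  set w := (Ioo a b).indicator v with hw
  have hwi : Integrable w := hv.integrable
  have hec : Continuous fun f : E.Dom => E.energy (h.mul f) (h.mul f) :=
    (E.energyL.continuous.comp h.mul.continuous).clm_apply h.mul.continuous
  -- the estimate for the mollified solutions
  have key : ∀ᶠ j in atTop, ∫⁻ t in Ioo c d,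
      ENNReal.ofReal (E.energy (h.mul (mollify j w t)) (h.mul (mollify j w t)))
      ≤ ENNReal.ofReal ((d - c) * (M ^ 2 * E.energy k k) + (1 / 2) * (M * ‖E.toL2 k‖) ^ 2) := by
    filter_upwards [tendsto_radius.eventually (gt_mem_nhds (sub_pos.2 hac)),
      tendsto_radius.eventually (gt_mem_nhds (sub_pos.2 hdb))] with j hj1 hj2
    have hyM : ∀ t ∈ Icc c d, ∀ᵐ x ∂μ, |E.toL2 (mollify j w t) x| ≤ M := fun t ht =>
      mollify_mem hwi (convex_setOf_abs_le E M) (isClosed_setOf_abs_le E M) (a := a) (b := b) (by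
        filter_upwards [hvM, ae_restrict_mem measurableSet_Ioo] with r hr hr'
        rw [hw, indicator_of_mem hr']; exact hr) (by linarith [ht.1]) (by linarith [ht.2])
    have hyc : Continuous fun t => E.energy (h.mul (mollify j w t)) (h.mul (mollify j w t)) :=
      hec.comp (continuous_mollify j hwi)
    have hGc : Continuous fun t => -((1 / 2) * ‖E.toL2 (h.mul (mollify j w t))‖ ^ 2) :=
      (continuous_const.mul ((E.incl.continuous.comp (h.mul.continuous.comp
        (continuous_mollify j hwi))).norm.pow 2)).neg
    have hder : ∀ t ∈ Ioo c d, ∃ g', HasDerivAt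
        (fun t => -((1 / 2) * ‖E.toL2 (h.mul (mollify j w t))‖ ^ 2)) g' t ∧
        E.energy (h.mul (mollify j w t)) (h.mul (mollify j w t)) - M ^ 2 * E.energy k k ≤ g' := by
      intro t ht
      obtain ⟨e, he, heq⟩ := hv.exists_hasDerivAt_mollify (j := j) (t := t) (by linarith [ht.1])
        (by linarith [ht.2])
      have h1 := ((E.incl.comp h.mul).hasFDerivAt.comp_hasDerivAt t he)
      have h2 := h1.norm_sq
      refine ⟨_, (h2.const_mul (1 / 2)).neg, ?_⟩
      have h3 := heq _ h.hasCompactSupport.isCompact hψ (h.mul (h.mul (mollify j w t)))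
        (h.mul_mem_supported _)
      have h4 := hp.energy_cutoff_le hP (mollify j w t) (h.mul (mollify j w t))
        (h.mul (h.mul (mollify j w t))) k (hyM t ⟨ht.1.le, ht.2.le⟩) (h.mul_ae _) (by
          filter_upwards [h.mul_ae (h.mul (mollify j w t)), h.mul_ae (mollify j w t)] with x h1 h2
          rw [h1, h2]) hk
      rw [← h.inner_mul, real_inner_comm] at h3
      simp only [Function.comp_apply, ContinuousLinearMap.comp_apply, incl_apply]
      rw [h3]
      linarith
    choose! G' hG' hle using hder
    have h1 := intervalIntegral.integral_le_sub_of_hasDeriv_right_of_le hcd hGc.continuousOn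
      (fun t ht => (hG' t ht).hasDerivWithinAt)
      ((hyc.sub continuous_const).integrableOn_Icc) hle
    simp only [Pi.sub_apply] at h1
    rw [intervalIntegral.integral_sub (hyc.intervalIntegrable _ _) intervalIntegrable_const,
      intervalIntegral.integral_const, smul_eq_mul] at h1
    have h2 : ‖E.toL2 (h.mul (mollify j w c))‖ ^ 2 ≤ (M * ‖E.toL2 k‖) ^ 2 :=
      pow_le_pow_left₀ (norm_nonneg _)
        (h.norm_toL2_mul_le_of_abs_le hk (hyM c ⟨le_rfl, hcd⟩) hM) 2
    have h3 : ∫ t in c..d, E.energy (h.mul (mollify j w t)) (h.mul (mollify j w t))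
        ≤ (d - c) * (M ^ 2 * E.energy k k) + (1 / 2) * (M * ‖E.toL2 k‖) ^ 2 := by
      nlinarith [sq_nonneg ‖E.toL2 (h.mul (mollify j w d))‖]
    rw [intervalIntegral.integral_of_le hcd, integral_Ioc_eq_integral_Ioo] at h3
    rw [← ofReal_integral_eq_lintegral_ofReal
      ((hyc.integrableOn_Icc (μ := volume)).mono_set Ioo_subset_Icc_self)
      (Eventually.of_forall fun t => E.energy_nonneg _)]
    exact ENNReal.ofReal_le_ofReal h3
  have hlim : ∀ᵐ t ∂volume.restrict (Ioo c d), Tendsto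
      (fun j => ENNReal.ofReal (E.energy (h.mul (mollify j w t)) (h.mul (mollify j w t)))) atTop
      (𝓝 (ENNReal.ofReal (E.energy (h.mul (v t)) (h.mul (v t))))) := by
    filter_upwards [ae_restrict_of_ae (ae_tendsto_mollify hwi), ae_restrict_mem measurableSet_Ioo]
      with t ht ht'
    have h1 : w t = v t :=
      indicator_of_mem (show t ∈ Ioo a b from ⟨hac.trans ht'.1, ht'.2.trans hdb⟩) v
    rw [h1] at ht
    exact (ENNReal.continuous_ofReal.tendsto _).comp ((hec.tendsto _).comp ht)
  calc _ = ∫⁻ t in Ioo c d, liminf (fun j => ENNReal.ofReal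
          (E.energy (h.mul (mollify j w t)) (h.mul (mollify j w t)))) atTop :=
        lintegral_congr_ae (by filter_upwards [hlim] with t ht using ht.liminf_eq.symm)
    _ ≤ liminf (fun j => ∫⁻ t in Ioo c d, ENNReal.ofReal
          (E.energy (h.mul (mollify j w t)) (h.mul (mollify j w t)))) atTop :=
        lintegral_liminf_le fun j => (ENNReal.continuous_ofReal.comp
          (hec.comp (continuous_mollify j hwi))).measurable
    _ ≤ _ := liminf_le_of_frequently_le' key.frequently

/-- Locally bounded limits of weak solutions are weak solutions. -/
theorem exists_isWeakCurve_of_tendsto (hreg : E.IsRegular) (hloc : E.IsStrictlyLocal)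
    (hp : E.IsContinuousHeatKernel p) (hP : E.IsHeatSemigroup E.semigroup)
    {v : ℕ → ℝ → E.Dom} (hv : ∀ n, E.IsWeakCurve a b V (v n))
    (h : E.IsNiceCutoff ψ A U) (hψ : tsupport ψ ⊆ V) {M : ℝ} (hM : 0 ≤ M)
    (hvM : ∀ n, ∀ᵐ t ∂volume.restrict (Ioo a b), ∀ᵐ x ∂μ, |E.toL2 (v n t) x| ≤ M) {c d : ℝ}
    (hac : a < c) (hcd : c ≤ d) (hdb : d < b) {f : ℝ → Lp ℝ 2 μ}
    (hf : ∀ᵐ t ∂volume.restrict (Ioo c d),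
      Tendsto (fun n => E.toL2 (h.mul (v n t))) atTop (𝓝 (f t))) :
    ∃ z : ℝ → E.Dom, E.IsWeakCurve c d (interior A) z ∧
      ∀ᵐ t ∂volume.restrict (Ioo c d), E.toL2 (z t) = f t := by
  obtain ⟨k, hk⟩ := h.exists_dom hreg
  set ν := (volume : Measure ℝ).restrict (Ioo c d) with hν
  have hsub : Ioo c d ⊆ Ioo a b := Ioo_subset_Ioo hac.le hdb.le
  have hz : ∀ n, E.IsWeakCurve c d (interior A) fun t => h.mul (v n t) := fun n =>
    ((hv n).mul hreg hloc h hψ).mono_time hac.le hdb.le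
  set Z : ℕ → Lp E.Dom 2 ν := fun n => (hz n).memLp.toLp with hZ
  have hZae : ∀ n, Z n =ᵐ[ν] fun t => h.mul (v n t) := fun n => (hz n).memLp.coeFn_toLp
  have hb : ∀ n, ∀ᵐ t ∂ν, ‖E.toL2 (h.mul (v n t))‖ ≤ M * ‖E.toL2 k‖ := fun n => by
    filter_upwards [ae_restrict_of_ae_restrict_of_subset hsub (hvM n)] with t ht
    exact h.norm_toL2_mul_le_of_abs_le hk ht hM
  -- the sequence is bounded in `L²((c, d); 𝔻)` by the Caccioppoli inequality
  set C := (d - c) * (M ^ 2 * E.energy k k) + (1 / 2) * (M * ‖E.toL2 k‖) ^ 2 with hC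
  have hC0 : 0 ≤ C := by
    have := E.energy_nonneg k
    have := sub_nonneg.2 hcd
    positivity
  have hZb : ∀ n, ‖Z n‖ ≤ Real.sqrt (C + (d - c) * (M * ‖E.toL2 k‖) ^ 2) := by
    intro n
    refine Real.le_sqrt_of_sq_le ?_
    rw [norm_sq_Lp_eq_integral]
    have h1 : ∫ t, ‖Z n t‖ ^ 2 ∂ν = ∫ t, (E.energy (h.mul (v n t)) (h.mul (v n t))
        + ‖E.toL2 (h.mul (v n t))‖ ^ 2) ∂ν := by
      refine integral_congr_ae ?_
      filter_upwards [hZae n] with t ht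
      rw [ht, norm_sq_dom]
    have hmeas : AEStronglyMeasurable (fun t => E.energy (h.mul (v n t)) (h.mul (v n t))) ν :=
      (E.energyL.continuous.clm_apply continuous_id).comp_aestronglyMeasurable
        (hz n).memLp.aestronglyMeasurable
    have hcac := (hv n).lintegral_energy_le hp hP h hψ hk hM (hvM n) hac hcd hdb
    have i1 : Integrable (fun t => E.energy (h.mul (v n t)) (h.mul (v n t))) ν := by
      refine ⟨hmeas, ?_⟩
      rw [hasFiniteIntegral_iff_ofReal (Eventually.of_forall fun t => E.energy_nonneg _)]
      exact hcac.trans_lt ENNReal.ofReal_lt_top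
    have i2 : Integrable (fun t => ‖E.toL2 (h.mul (v n t))‖ ^ 2) ν :=
      (E.incl.comp_memLp' (hz n).memLp).integrable_norm_pow two_ne_zero
    rw [h1, integral_add i1 i2]
    refine add_le_add ?_ ?_
    · rw [integral_eq_lintegral_of_nonneg_ae (Eventually.of_forall fun t => E.energy_nonneg _) hmeas]
      exact ENNReal.toReal_le_of_le_ofReal hC0 hcac
    · calc ∫ t, ‖E.toL2 (h.mul (v n t))‖ ^ 2 ∂ν ≤ ∫ _, (M * ‖E.toL2 k‖) ^ 2 ∂ν := by
            refine integral_mono_ae i2 (integrable_const _) ?_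
            filter_upwards [hb n] with t ht
            exact pow_le_pow_left₀ (norm_nonneg _) ht 2
        _ = (d - c) * (M * ‖E.toL2 k‖) ^ 2 := by
            rw [integral_const, smul_eq_mul, hν, measureReal_restrict_apply_univ, Real.volume_real_Ioo_of_le hcd]
  obtain ⟨y, z, hy, hyz⟩ := exists_tendsto_mem_convexHull_tail Z _ hZb
  -- closed convex sets that contain the sequence contain the limit
  have hmem : ∀ S : Set (Lp E.Dom 2 ν), Convex ℝ S → IsClosed S → (∀ n, Z n ∈ S) → z ∈ S :=
    fun S hS hSc hZS => hSc.mem_of_tendsto hyz (Eventually.of_forall fun m =>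
      convexHull_min (by rintro _ ⟨n, -, rfl⟩; exact hZS n) hS (hy m))
  refine ⟨z, ⟨Lp.memLp z, fun χ hχ hχc hχs K hK hKA g hg => ?_⟩, ?_⟩
  · -- the weak equation is a closed linear condition
    set g₁ := (InnerProductSpace.toDual ℝ E.Dom).symm (E.ltwoL.flip g) with hg₁
    set g₂ := (InnerProductSpace.toDual ℝ E.Dom).symm (E.energyL.flip g) with hg₂
    have e1 : ∀ f, (inner ℝ g₁ f : ℝ) = inner ℝ (E.toL2 f) (E.toL2 g) := fun f => by
      rw [hg₁, InnerProductSpace.toDual_symm_apply]; rfl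
    have e2 : ∀ f, (inner ℝ g₂ f : ℝ) = E.energy f g := fun f => by
      rw [hg₂, InnerProductSpace.toDual_symm_apply]; rfl
    have hχd : Continuous (deriv χ) := hχ.continuous_deriv (by norm_num)
    have hQ : MemLp (fun t => deriv χ t • g₁ - χ t • g₂) 2 ν :=
      ((((hχd.smul continuous_const).memLp_of_hasCompactSupport hχc.deriv.smul_right)).sub
        ((hχ.continuous.smul continuous_const).memLp_of_hasCompactSupport hχc.smul_right)).restrict _
    have e3 : ∀ (w : Lp E.Dom 2 ν) (w' : ℝ → E.Dom), w =ᵐ[ν] w' → inner ℝ hQ.toLp w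
        = (∫ t, deriv χ t * inner ℝ (E.toL2 (w' t)) (E.toL2 g))
          - ∫ t, χ t * E.energy (w' t) g := by
      intro w w' hw'
      have hw2 : MemLp w' 2 ν := (Lp.memLp w).ae_eq hw'
      rw [← setIntegral_eq_of_tsupport hχs, ← setIntegral_deriv_eq_of_tsupport hχs,
        ← integral_sub, L2.inner_def]
      · refine integral_congr_ae ?_
        filter_upwards [hQ.coeFn_toLp, hw'] with t h1 h2
        rw [h1, h2, inner_sub_left, real_inner_smul_left, real_inner_smul_left, e1, e2]
      · exact MemLp.integrable_mul (p := 2) (q := 2)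
          ((hχd.memLp_of_hasCompactSupport hχc.deriv).restrict _) ((E.ltwoL.flip g).comp_memLp' hw2)
      · exact MemLp.integrable_mul (p := 2) (q := 2)
          ((hχ.continuous.memLp_of_hasCompactSupport hχc).restrict _) ((E.energyL.flip g).comp_memLp' hw2)
    have h1 : z ∈ {w : Lp E.Dom 2 ν | (inner ℝ hQ.toLp w : ℝ) = 0} := by
      refine hmem _ ?_ ?_ fun n => ?_
      · intro w hw w' hw' r s _ _ _
        rw [mem_ofPred_eq] at *
        rw [inner_add_right, real_inner_smul_right, real_inner_smul_right, hw, hw']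
        simp
      · exact isClosed_eq (continuous_const.inner continuous_id) continuous_const
      · rw [mem_ofPred_eq, e3 _ _ (hZae n), (hz n).weak χ hχ hχc hχs K hK hKA g hg, sub_self]
    rw [mem_ofPred_eq, e3 z z EventuallyEq.rfl] at h1
    exact sub_eq_zero.1 h1
  · -- the values in `L²` converge
    have hfm : MemLp f 2 ν := by
      refine MemLp.of_bound (aestronglyMeasurable_of_tendsto_ae atTop
        (fun n => (E.incl.comp_memLp' (hz n).memLp).aestronglyMeasurable) hf) (M * ‖E.toL2 k‖) ?_
      filter_upwards [hf, ae_all_iff.2 hb] with t h1 h2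
      exact le_of_tendsto h1.norm (Eventually.of_forall h2)
    have hcomp : ∀ w : Lp E.Dom 2 ν, E.incl.compLpL 2 ν w =ᵐ[ν] fun t => E.toL2 (w t) := fun w =>
      E.incl.coeFn_compLpL w
    have h1 : Tendsto (fun n => E.incl.compLpL 2 ν (Z n)) atTop (𝓝 hfm.toLp) := by
      refine tendsto_toLp_of_bounded hfm (B := M * ‖E.toL2 k‖) (fun n => ?_) ?_
      · filter_upwards [hcomp (Z n), hZae n, hb n] with t h1 h2 h3
        rwa [h1, h2]
      · filter_upwards [ae_all_iff.2 fun n => hcomp (Z n), ae_all_iff.2 hZae, hf] with t h1 h2 h3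
        refine h3.congr fun n => ?_
        rw [h1, h2]
    have h2 : Tendsto (fun m => E.incl.compLpL 2 ν (y m)) atTop (𝓝 hfm.toLp) := by
      rw [Metric.tendsto_atTop] at h1 ⊢
      intro ε hε
      obtain ⟨N, hN⟩ := h1 ε hε
      refine ⟨N, fun m hm => ?_⟩
      have hs : convexHull ℝ (Z '' Ici m) ⊆ (E.incl.compLpL 2 ν) ⁻¹' (Metric.ball hfm.toLp ε) := by
        refine convexHull_min ?_ ((convex_ball _ ε).linear_preimage
          (E.incl.compLpL 2 ν : Lp E.Dom 2 ν →ₗ[ℝ] Lp (Lp ℝ 2 μ) 2 ν))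
        rintro _ ⟨n, hn, rfl⟩
        exact hN n (hm.trans hn)
      exact hs (hy m)
    have h3 : E.incl.compLpL 2 ν z = hfm.toLp :=
      tendsto_nhds_unique (((E.incl.compLpL 2 ν).continuous.tendsto z).comp hyz) h2
    have h4 := hcomp z
    rw [h3] at h4
    filter_upwards [h4, hfm.coeFn_toLp] with t h5 h6
    rw [← h5, h6]

end Caccioppoli

end DirichletForm

/-! ### Comparison with the heat semigroup -/

namespace DirichletForm

section Comparison

variable {X : Type*} [MeasurableSpace X] {μ : Measure X} {E : DirichletForm μ} {F : Set X}

theorem scaledResolvent_yosidaSemigroup {l k : ℝ} (hl : 0 < l) (hk : 0 < k) (t : ℝ)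
    (f : Lp ℝ 2 μ) :
    E.scaledResolvent F k (E.yosidaSemigroup F l t f)
      = E.yosidaSemigroup F l t (E.scaledResolvent F k f) :=
  DFunLike.congr_fun (commute_expSemigroup (commute_scaledResolvent (F := F) hk hl) t) f

theorem norm_yosidaSemigroup_sub_self_le {l β : ℝ} (hl : 0 < l) (hβ : 0 < β) {t : ℝ} (ht : 0 ≤ t)
    (f : Lp ℝ 2 μ) :
    ‖E.scaledResolvent F l
        (E.yosidaSemigroup F l t (E.scaledResolvent F β (E.scaledResolvent F β f)))
      - E.yosidaSemigroup F l t (E.scaledResolvent F β (E.scaledResolvent F β f))‖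
      ≤ 2 * β * ‖f‖ / l := by
  rw [scaledResolvent_yosidaSemigroup hl hl, ← map_sub]
  refine (norm_yosidaSemigroup_le hl ht _).trans ?_
  rw [norm_sub_rev]
  refine (norm_sub_scaledResolvent_scaledResolvent_le hl hβ _).trans ?_
  gcongr
  exact norm_scaledResolvent_le hβ f

/-- A nonnegative classical solution `v` on a neighbourhood of `F` is tested against approximations
of the semigroup with Dirichlet conditions off `F`, run backwards in time. By
`energy_resolvent_add_le`, the pairing almost increases. -/
theorem IsHeatSemigroup.le_inner_of_hasDerivAt {P : ℝ≥0 → Lp ℝ 2 μ →L[ℝ] Lp ℝ 2 μ}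
    (hP : E.IsHeatSemigroup P) {v d : ℝ → E.Dom} {s t M : ℝ} (hst : s ≤ t)
    (hv : ∀ r ∈ Icc s t, HasDerivAt v (d r) r)
    (hd : ∀ r ∈ Icc s t, ∀ g ∈ E.supported F,
      inner ℝ (E.toL2 (d r)) (E.toL2 g) = -E.energy (v r) g)
    (hv0 : ∀ r ∈ Icc s t, ∀ᵐ x ∂μ, 0 ≤ E.toL2 (v r) x)
    (hM : ∀ r ∈ Icc s t, ‖E.toL2 (v r)‖ ≤ M) {l β : ℝ} (hl : 0 < l) (hβ : 0 < β)
    {g : Lp ℝ 2 μ} (hg : ∀ᵐ x ∂μ, 0 ≤ g x) :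
    inner ℝ (E.toL2 (v s)) (E.scaledResolvent F l (E.yosidaSemigroup F l (t - s)
        (E.scaledResolvent F β (E.scaledResolvent F β g))))
      - M * (4 * β ^ 2 * ‖g‖) / l * (t - s)
      ≤ (inner ℝ (E.toL2 (v t)) (E.scaledResolvent F l
        (E.scaledResolvent F β (E.scaledResolvent F β g))) : ℝ) := by
  set G := E.scaledResolvent F β (E.scaledResolvent F β g) with hG
  have hG0 : ∀ᵐ x ∂μ, 0 ≤ G x := scaledResolvent_nonneg hβ _ (scaledResolvent_nonneg hβ _ hg)
  set Ψ : ℝ → Lp ℝ 2 μ := fun r => E.yosidaSemigroup F l (t - r) G with hΨ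
  set φ : ℝ → Lp ℝ 2 μ := fun r => E.scaledResolvent F l (Ψ r) with hφ
  set A := E.yosida F l with hA
  have hM0 : 0 ≤ M := (norm_nonneg _).trans (hM s ⟨le_rfl, hst⟩)
  have hΨd : ∀ r, HasDerivAt Ψ (A (Ψ r)) r := fun r => by
    have h1 := ((hasDerivAt_yosidaSemigroup (E := E) (F := F) (l := l) (t - r)).comp_const_sub t r)
    have h2 := h1.clm_apply (hasDerivAt_const r G)
    refine h2.congr_deriv ?_
    have h3 := DFunLike.congr_fun
      (commute_yosida_yosidaSemigroup (E := E) (F := F) (l := l) (t - r)) G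
    rw [mul_apply_eq_comp, mul_apply_eq_comp] at h3
    rw [map_zero, add_zero, neg_neg, mul_apply_eq_comp, ← h3]
  have hφd : ∀ r, HasDerivAt φ (E.scaledResolvent F l (A (Ψ r))) r := fun r =>
    (E.scaledResolvent F l).hasFDerivAt.comp_hasDerivAt r (hΨd r)
  -- the linear term compensates the error, so that the sum is monotone
  have hζd : ∀ r ∈ Icc s t, HasDerivAt (fun r => (inner ℝ (E.toL2 (v r)) (φ r) : ℝ)
      + M * (4 * β ^ 2 * ‖g‖) / l * r)
      (inner ℝ (E.toL2 (v r)) (E.scaledResolvent F l (A (Ψ r))) + inner ℝ (E.toL2 (d r)) (φ r)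
        + M * (4 * β ^ 2 * ‖g‖) / l) r := fun r hr => by
    have h1 := (E.incl.hasFDerivAt.comp_hasDerivAt r (hv r hr)).inner ℝ (hφd r)
    have h2 := (hasDerivAt_id r).const_mul (M * (4 * β ^ 2 * ‖g‖) / l)
    rw [mul_one] at h2
    exact h1.add h2
  have hpos : ∀ r ∈ Icc s t, 0 ≤ inner ℝ (E.toL2 (v r)) (E.scaledResolvent F l (A (Ψ r)))
      + inner ℝ (E.toL2 (d r)) (φ r) + M * (4 * β ^ 2 * ‖g‖) / l := fun r hr => by
    have hr0 : 0 ≤ t - r := sub_nonneg.2 hr.2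
    have hΨ0 : ∀ᵐ x ∂μ, 0 ≤ Ψ r x := yosidaSemigroup_nonneg hl hr0 G hG0
    have h1 := hP.energy_resolvent_add_le (F := F) hl hΨ0 (v r)
      (hv0 r hr)
    have h2 := hd r hr (l • E.resolvent F l (Ψ r)) (Submodule.smul_mem _ _ (resolvent_mem hl _))
    rw [← scaledResolvent_eq_toL2, map_smul, smul_eq_mul, E.energy_symm] at h2
    have h3 : inner ℝ (E.toL2 (v r)) (E.scaledResolvent F l (A (Ψ r)))
        = inner ℝ (E.toL2 (v r)) (A (Ψ r)) - l⁻¹ * inner ℝ (E.toL2 (v r)) (A (A (Ψ r))) := by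
      rw [show A (A (Ψ r)) = l • (A (Ψ r) - E.scaledResolvent F l (A (Ψ r))) from yosida_apply _,
        real_inner_smul_right, ← mul_assoc, inv_mul_cancel₀ hl.ne', one_mul, inner_sub_right]
      ring
    have h4 : inner ℝ (E.toL2 (v r)) (A (Ψ r))
        = l * inner ℝ (Ψ r) (E.toL2 (v r))
          - l * (l * inner ℝ (E.toL2 (E.resolvent F l (Ψ r))) (E.toL2 (v r))) := by
      rw [hA, yosida_apply, real_inner_comm, real_inner_smul_left, inner_sub_left,
        scaledResolvent_apply, real_inner_smul_left]
      ring
    have h5 : |inner ℝ (E.toL2 (v r)) (A (A (Ψ r)))| ≤ M * (4 * β ^ 2 * ‖g‖) := by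
      refine (abs_real_inner_le_norm _ _).trans ?_
      refine mul_le_mul (hM r hr) ?_ (norm_nonneg _) hM0
      have h6 : A (A (Ψ r)) = E.yosidaSemigroup F l (t - r) (A (A G)) := by
        have hc := commute_yosida_yosidaSemigroup (E := E) (F := F) (l := l) (t - r)
        have h7 : ∀ f, A (E.yosidaSemigroup F l (t - r) f) = E.yosidaSemigroup F l (t - r) (A f) :=
          fun f => DFunLike.congr_fun hc f
        rw [hΨ]
        simp only [h7]
      rw [h6]
      exact (norm_yosidaSemigroup_le hl hr0 _).trans (norm_yosida_sq_le hl hβ g)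
    have h6 : l⁻¹ * inner ℝ (E.toL2 (v r)) (A (A (Ψ r))) ≤ M * (4 * β ^ 2 * ‖g‖) / l := by
      rw [div_eq_inv_mul]
      exact mul_le_mul_of_nonneg_left ((le_abs_self _).trans h5) (inv_nonneg.2 hl.le)
    have h7 := mul_le_mul_of_nonneg_left h1 hl.le
    rw [mul_add] at h7
    have h8 : inner ℝ (E.toL2 (d r)) (φ r) = -(l * E.energy (E.resolvent F l (Ψ r)) (v r)) := h2
    rw [h3, h8, h4]
    linarith
  have hmono : MonotoneOn (fun r => (inner ℝ (E.toL2 (v r)) (φ r) : ℝ)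
      + M * (4 * β ^ 2 * ‖g‖) / l * r) (Icc s t) :=
    monotoneOn_of_hasDerivWithinAt_nonneg (convex_Icc s t)
      (fun r hr => (hζd r hr).continuousAt.continuousWithinAt)
      (fun r hr => (hζd r (interior_subset hr)).hasDerivWithinAt)
      fun r hr => hpos r (interior_subset hr)
  have h9 := hmono (left_mem_Icc.2 hst) (right_mem_Icc.2 hst) hst
  have h10 : φ t = E.scaledResolvent F l G := by
    rw [hφ]
    simp only [hΨ, sub_self]
    rw [show E.yosidaSemigroup F l 0 = 1 from expSemigroup_zero]; rfl
  simp only [h10] at h9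
  have h11 : φ s = E.scaledResolvent F l (E.yosidaSemigroup F l (t - s) G) := rfl
  rw [h11] at h9
  linarith

/-- The limit `l → ∞` of `IsHeatSemigroup.le_inner_of_hasDerivAt`. The error only depends on the
initial value `w` and on the test function. -/
theorem IsHeatSemigroup.inner_yosidaSemigroup_le {P : ℝ≥0 → Lp ℝ 2 μ →L[ℝ] Lp ℝ 2 μ}
    (hP : E.IsHeatSemigroup P) {v d : ℝ → E.Dom} {s t : ℝ} (hst : s ≤ t)
    (hv : ∀ r ∈ Icc s t, HasDerivAt v (d r) r)
    (hd : ∀ r ∈ Icc s t, ∀ g ∈ E.supported F,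
      inner ℝ (E.toL2 (d r)) (E.toL2 g) = -E.energy (v r) g)
    (hv0 : ∀ r ∈ Icc s t, ∀ᵐ x ∂μ, 0 ≤ E.toL2 (v r) x)
    {w : Lp ℝ 2 μ} (hw : ∀ᵐ x ∂μ, w x ≤ E.toL2 (v s) x)
    {k β : ℝ} (hk : 0 < k) (hβ : 0 < β) {g : Lp ℝ 2 μ} (hg : ∀ᵐ x ∂μ, 0 ≤ g x) :
    inner ℝ w (E.yosidaSemigroup F k (t - s) (E.scaledResolvent F β (E.scaledResolvent F β g)))
      - ‖w‖ * (4 * β ^ 2 * ‖g‖ * (1 / k) * (t - s))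
      ≤ (inner ℝ (E.toL2 (v t)) (E.scaledResolvent F β (E.scaledResolvent F β g)) : ℝ) := by
  have hτ : 0 ≤ t - s := sub_nonneg.2 hst
  obtain ⟨M, hM⟩ : ∃ M, ∀ r ∈ Icc s t, ‖E.toL2 (v r)‖ ≤ M := by
    have hc : ContinuousOn (fun r => E.incl (v r)) (Icc s t) := fun r hr =>
      (E.incl.continuous.continuousAt.comp (hv r hr).continuousAt).continuousWithinAt
    exact isCompact_Icc.exists_bound_of_continuousOn hc
  set G := E.scaledResolvent F β (E.scaledResolvent F β g) with hG
  have hG0 : ∀ᵐ x ∂μ, 0 ≤ G x := scaledResolvent_nonneg hβ _ (scaledResolvent_nonneg hβ _ hg)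
  have key : ∀ l : ℝ, 0 < l →
      inner ℝ w (E.yosidaSemigroup F k (t - s) G)
        - ‖w‖ * (4 * β ^ 2 * ‖g‖ * (1 / l + 1 / k) * (t - s) + 2 * β * ‖g‖ / l)
        - M * (4 * β ^ 2 * ‖g‖) / l * (t - s) - ‖E.toL2 (v t)‖ * (2 * β * ‖g‖ / l)
        ≤ (inner ℝ (E.toL2 (v t)) G : ℝ) := by
    intro l hl
    have h1 := hP.le_inner_of_hasDerivAt hst hv hd hv0 hM hl hβ hg
    have h2 : (inner ℝ w (E.scaledResolvent F l (E.yosidaSemigroup F l (t - s) G)) : ℝ)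
        ≤ inner ℝ (E.toL2 (v s)) (E.scaledResolvent F l (E.yosidaSemigroup F l (t - s) G)) :=
      inner_le_inner_of_ae hw (scaledResolvent_nonneg hl _ (yosidaSemigroup_nonneg hl hτ _ hG0))
    have h3 := norm_yosidaSemigroup_sub_self_le (E := E) (F := F) hl hβ hτ g
    have h4 := norm_yosidaSemigroup_sub_le (E := E) (F := F) hl hk hβ hτ g
    have h5 : |inner ℝ w (E.scaledResolvent F l (E.yosidaSemigroup F l (t - s) G))
        - inner ℝ w (E.yosidaSemigroup F k (t - s) G)|
        ≤ ‖w‖ * (4 * β ^ 2 * ‖g‖ * (1 / l + 1 / k) * (t - s) + 2 * β * ‖g‖ / l) := by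
      rw [← inner_sub_right]
      refine (abs_real_inner_le_norm _ _).trans (mul_le_mul_of_nonneg_left ?_ (norm_nonneg _))
      calc _ = ‖(E.scaledResolvent F l (E.yosidaSemigroup F l (t - s) G)
              - E.yosidaSemigroup F l (t - s) G)
            + (E.yosidaSemigroup F l (t - s) G - E.yosidaSemigroup F k (t - s) G)‖ := by
              congr 1; abel
        _ ≤ _ := (norm_add_le _ _).trans (by linarith)
    have h6 : |inner ℝ (E.toL2 (v t)) (E.scaledResolvent F l G) - inner ℝ (E.toL2 (v t)) G|
        ≤ ‖E.toL2 (v t)‖ * (2 * β * ‖g‖ / l) := by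
      rw [← inner_sub_right]
      refine (abs_real_inner_le_norm _ _).trans (mul_le_mul_of_nonneg_left ?_ (norm_nonneg _))
      rw [norm_sub_rev]
      refine (norm_sub_scaledResolvent_scaledResolvent_le hl hβ _).trans ?_
      gcongr
      exact norm_scaledResolvent_le hβ g
    have h7 := abs_le.1 h5
    have h8 := abs_le.1 h6
    linarith [h7.1, h8.2]
  have hlim : Tendsto (fun l : ℝ => inner ℝ w (E.yosidaSemigroup F k (t - s) G)
        - ‖w‖ * (4 * β ^ 2 * ‖g‖ * (1 / l + 1 / k) * (t - s) + 2 * β * ‖g‖ / l)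
        - M * (4 * β ^ 2 * ‖g‖) / l * (t - s) - ‖E.toL2 (v t)‖ * (2 * β * ‖g‖ / l)) atTop
      (𝓝 (inner ℝ w (E.yosidaSemigroup F k (t - s) G)
        - ‖w‖ * (4 * β ^ 2 * ‖g‖ * (0 + 1 / k) * (t - s) + 0)
        - 0 * (t - s) - ‖E.toL2 (v t)‖ * 0)) := by
    have hdiv : ∀ c : ℝ, Tendsto (fun l : ℝ => c / l) atTop (𝓝 0) := fun c =>
      tendsto_const_nhds.div_atTop tendsto_id
    exact ((tendsto_const_nhds.sub (((((hdiv 1).add_const _).const_mul _).mul_const _).add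
      (hdiv _) |>.const_mul _)).sub ((hdiv _).mul_const _)).sub ((hdiv _).const_mul _)
  have h9 := le_of_tendsto hlim (by filter_upwards [eventually_gt_atTop 0] with l hl using key l hl)
  simpa using h9

/-- The comparison for all test functions in the closure of the functions supported in `F`. -/
theorem IsHeatSemigroup.inner_yosidaSemigroup_le' {P : ℝ≥0 → Lp ℝ 2 μ →L[ℝ] Lp ℝ 2 μ}
    (hP : E.IsHeatSemigroup P) {v d : ℝ → E.Dom} {s t : ℝ} (hst : s ≤ t)
    (hv : ∀ r ∈ Icc s t, HasDerivAt v (d r) r)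
    (hd : ∀ r ∈ Icc s t, ∀ g ∈ E.supported F,
      inner ℝ (E.toL2 (d r)) (E.toL2 g) = -E.energy (v r) g)
    (hv0 : ∀ r ∈ Icc s t, ∀ᵐ x ∂μ, 0 ≤ E.toL2 (v r) x)
    {w : Lp ℝ 2 μ} (hw : ∀ᵐ x ∂μ, w x ≤ E.toL2 (v s) x)
    {k β : ℝ} (hk : 0 < k) (hβ : 0 < β) {g : Lp ℝ 2 μ} (hg : ∀ᵐ x ∂μ, 0 ≤ g x)
    (hgF : g ∈ closure (E.toL2 '' (E.supported F : Set E.Dom))) :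
    inner ℝ w (E.yosidaSemigroup F k (t - s) g)
      - ‖w‖ * (4 * β ^ 2 * ‖g‖ * (1 / k) * (t - s))
      - 2 * ‖w‖ * ‖E.scaledResolvent F β (E.scaledResolvent F β g) - g‖
      ≤ (inner ℝ (E.toL2 (v t)) g : ℝ) := by
  have hτ : 0 ≤ t - s := sub_nonneg.2 hst
  set N : ℝ → Lp ℝ 2 μ := fun β => E.scaledResolvent F β (E.scaledResolvent F β g) with hN
  have hclose : ∀ (k β : ℝ), 0 < k → |inner ℝ w (E.yosidaSemigroup F k (t - s) (N β))
      - inner ℝ w (E.yosidaSemigroup F k (t - s) g)| ≤ ‖w‖ * ‖N β - g‖ := fun k β hk => by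
    rw [← inner_sub_right, ← map_sub]
    exact (abs_real_inner_le_norm _ _).trans
      (mul_le_mul_of_nonneg_left (norm_yosidaSemigroup_le hk hτ _) (norm_nonneg _))
  have key : ∀ k' β' : ℝ, 0 < k' → 0 < β' →
      inner ℝ w (E.yosidaSemigroup F k (t - s) g)
        - ‖w‖ * (4 * β ^ 2 * ‖g‖ * (1 / k' + 1 / k) * (t - s)) - 2 * ‖w‖ * ‖N β - g‖
        - ‖w‖ * (4 * β' ^ 2 * ‖g‖ * (1 / k') * (t - s))
        - (‖w‖ + ‖E.toL2 (v t)‖) * ‖N β' - g‖ ≤ (inner ℝ (E.toL2 (v t)) g : ℝ) := by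
    intro k' β' hk' hβ'
    have h1 := hP.inner_yosidaSemigroup_le hst hv hd hv0 hw hk' hβ' hg
    have h2 : |inner ℝ (E.toL2 (v t)) (N β') - inner ℝ (E.toL2 (v t)) g|
        ≤ ‖E.toL2 (v t)‖ * ‖N β' - g‖ := by
      rw [← inner_sub_right]
      exact abs_real_inner_le_norm _ _
    have h3 : |inner ℝ w (E.yosidaSemigroup F k' (t - s) (N β))
        - inner ℝ w (E.yosidaSemigroup F k (t - s) (N β))|
        ≤ ‖w‖ * (4 * β ^ 2 * ‖g‖ * (1 / k' + 1 / k) * (t - s)) := by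
      rw [← inner_sub_right]
      exact (abs_real_inner_le_norm _ _).trans (mul_le_mul_of_nonneg_left
        (norm_yosidaSemigroup_sub_le hk' hk hβ hτ g) (norm_nonneg _))
    have h4 := abs_le.1 (hclose k' β' hk')
    have h5 := abs_le.1 (hclose k' β hk')
    have h6 := abs_le.1 (hclose k β hk)
    have h7 := abs_le.1 h2
    have h8 := abs_le.1 h3
    have h9 : inner ℝ w (E.yosidaSemigroup F k' (t - s) (N β'))
      - ‖w‖ * (4 * β' ^ 2 * ‖g‖ * (1 / k') * (t - s))
      ≤ (inner ℝ (E.toL2 (v t)) (N β') : ℝ) := h1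
    linarith [h4.1, h4.2, h5.1, h5.2, h6.1, h6.2, h7.1, h7.2, h8.1, h8.2]
  have hstep : ∀ β' : ℝ, 0 < β' → inner ℝ w (E.yosidaSemigroup F k (t - s) g)
        - ‖w‖ * (4 * β ^ 2 * ‖g‖ * (1 / k) * (t - s)) - 2 * ‖w‖ * ‖N β - g‖
        - (‖w‖ + ‖E.toL2 (v t)‖) * ‖N β' - g‖ ≤ (inner ℝ (E.toL2 (v t)) g : ℝ) := by
    intro β' hβ'
    have hdiv : Tendsto (fun l : ℝ => 1 / l) atTop (𝓝 0) :=
      tendsto_const_nhds.div_atTop tendsto_id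
    have hlim : Tendsto (fun k' : ℝ => inner ℝ w (E.yosidaSemigroup F k (t - s) g)
        - ‖w‖ * (4 * β ^ 2 * ‖g‖ * (1 / k' + 1 / k) * (t - s)) - 2 * ‖w‖ * ‖N β - g‖
        - ‖w‖ * (4 * β' ^ 2 * ‖g‖ * (1 / k') * (t - s))
        - (‖w‖ + ‖E.toL2 (v t)‖) * ‖N β' - g‖) atTop
        (𝓝 (inner ℝ w (E.yosidaSemigroup F k (t - s) g)
        - ‖w‖ * (4 * β ^ 2 * ‖g‖ * (0 + 1 / k) * (t - s)) - 2 * ‖w‖ * ‖N β - g‖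
        - ‖w‖ * (4 * β' ^ 2 * ‖g‖ * 0 * (t - s))
        - (‖w‖ + ‖E.toL2 (v t)‖) * ‖N β' - g‖)) :=
      (((tendsto_const_nhds.sub ((((hdiv.add_const _).const_mul _).mul_const _).const_mul _)).sub
        tendsto_const_nhds).sub (((hdiv.const_mul _).mul_const _).const_mul _)).sub
        tendsto_const_nhds
    have h9 := le_of_tendsto hlim
      (by filter_upwards [eventually_gt_atTop 0] with l hl using key l β' hl hβ')
    simpa using h9
  have hlim : Tendsto (fun β' : ℝ => inner ℝ w (E.yosidaSemigroup F k (t - s) g)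
        - ‖w‖ * (4 * β ^ 2 * ‖g‖ * (1 / k) * (t - s)) - 2 * ‖w‖ * ‖N β - g‖
        - (‖w‖ + ‖E.toL2 (v t)‖) * ‖N β' - g‖) atTop
      (𝓝 (inner ℝ w (E.yosidaSemigroup F k (t - s) g)
        - ‖w‖ * (4 * β ^ 2 * ‖g‖ * (1 / k) * (t - s)) - 2 * ‖w‖ * ‖N β - g‖
        - (‖w‖ + ‖E.toL2 (v t)‖) * 0)) :=
    tendsto_const_nhds.sub ((tendsto_iff_norm_sub_tendsto_zero.1
      (tendsto_scaledResolvent_sq_atTop hgF)).const_mul _)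
  have h9 := le_of_tendsto hlim
    (by filter_upwards [eventually_gt_atTop 0] with l hl using hstep l hl)
  simpa using h9

/-- The comparison with the heat semigroup of the whole space, along an exhaustion. -/
theorem IsHeatSemigroup.inner_le_of_exhaustion {P : ℝ≥0 → Lp ℝ 2 μ →L[ℝ] Lp ℝ 2 μ}
    (hP : E.IsHeatSemigroup P) {F : ℕ → Set X} (hF : Monotone F)
    (hFd : ∀ f : E.Dom, ∀ ε > 0, ∃ n, ∃ g ∈ E.supported (F n), ‖f - g‖ < ε)
    {v d : ℕ → ℝ → E.Dom} {s t : ℝ} (hst : s ≤ t)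
    (hv : ∀ n, ∀ r ∈ Icc s t, HasDerivAt (v n) (d n r) r)
    (hd : ∀ n, ∀ r ∈ Icc s t, ∀ g ∈ E.supported (F n),
      inner ℝ (E.toL2 (d n r)) (E.toL2 g) = -E.energy (v n r) g)
    (hv0 : ∀ n, ∀ r ∈ Icc s t, ∀ᵐ x ∂μ, 0 ≤ E.toL2 (v n r) x)
    {w : Lp ℝ 2 μ} (hw : ∀ n, ∀ᵐ x ∂μ, w x ≤ E.toL2 (v n s) x) {m : ℕ}
    {g : E.Dom} (hg : ∀ᵐ x ∂μ, 0 ≤ E.toL2 g x) (hgm : g ∈ E.supported (F m)) {c : ℝ}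
    (hc : ∀ n, m ≤ n → inner ℝ (E.toL2 (v n t)) (E.toL2 g) = c) :
    inner ℝ w (P (t - s).toNNReal (E.toL2 g)) ≤ c := by
  have hτ : 0 ≤ t - s := sub_nonneg.2 hst
  have hin : Continuous fun g : Lp ℝ 2 μ => (inner ℝ w g : ℝ) := by fun_prop
  have h1 : ∀ k β : ℝ, 0 < k → 0 < β →
      inner ℝ w (E.yosidaSemigroup univ k (t - s) (E.toL2 g))
      - ‖w‖ * (4 * β ^ 2 * ‖E.toL2 g‖ * (1 / k) * (t - s))
      - 2 * ‖w‖ * (2 * Real.sqrt (E.energy g g / β)) ≤ c := by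
    intro k β hk hβ
    have hlim := (hin.tendsto _).comp
      (DirichletForm.tendsto_yosidaSemigroup hF hFd hk hτ (E.toL2 g))
    refine le_of_tendsto ((hlim.sub_const _).sub_const _) ?_
    filter_upwards [eventually_ge_atTop m] with n hn
    have hgn : g ∈ E.supported (F n) := supported_mono (hF hn) hgm
    have h2 := hP.inner_yosidaSemigroup_le' hst (hv n) (hd n) (hv0 n) (hw n) hk hβ hg
      (subset_closure ⟨g, hgn, rfl⟩)
    rw [hc n hn] at h2
    have h3 : ‖E.scaledResolvent (F n) β (E.scaledResolvent (F n) β (E.toL2 g)) - E.toL2 g‖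
        ≤ 2 * Real.sqrt (E.energy g g / β) := by
      refine (norm_scaledResolvent_sq_sub_le hβ _).trans ?_
      refine mul_le_mul_of_nonneg_left (Real.le_sqrt_of_sq_le ?_) zero_le_two
      rw [le_div_iff₀' hβ]
      exact energy_scaledResolvent_le hβ hgn
    have h4 := mul_le_mul_of_nonneg_left h3 (mul_nonneg zero_le_two (norm_nonneg w))
    simp only [Function.comp_apply]
    linarith
  have h2 : ∀ β : ℝ, 0 < β → inner ℝ w (P (t - s).toNNReal (E.toL2 g))
      - 2 * ‖w‖ * (2 * Real.sqrt (E.energy g g / β)) ≤ c := by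
    intro β hβ
    have hlim := (hin.tendsto _).comp
      (hP.tendsto_yosidaSemigroup (t - s).toNNReal (E.toL2 g))
    rw [Real.coe_toNNReal _ hτ] at hlim
    have hdiv : Tendsto (fun l : ℝ => 1 / l) atTop (𝓝 0) :=
      tendsto_const_nhds.div_atTop tendsto_id
    have hlim2 := (hlim.sub (((hdiv.const_mul (4 * β ^ 2 * ‖E.toL2 g‖)).mul_const
      (t - s)).const_mul ‖w‖)).sub_const (2 * ‖w‖ * (2 * Real.sqrt (E.energy g g / β)))
    have h3 := le_of_tendsto hlim2
      (by filter_upwards [eventually_gt_atTop 0] with k hk using h1 k β hk hβ)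
    simpa using h3
  have hdiv : Tendsto (fun β : ℝ => E.energy g g / β) atTop (𝓝 0) :=
    tendsto_const_nhds.div_atTop tendsto_id
  have hlim := ((hdiv.sqrt.const_mul 2).const_mul (2 * ‖w‖)).const_sub
    (inner ℝ w (P (t - s).toNNReal (E.toL2 g)))
  have h3 := le_of_tendsto hlim
    (by filter_upwards [eventually_gt_atTop 0] with k hk using h2 k hk)
  simpa using h3

end Comparison

end DirichletForm

namespace DirichletForm

section Exhaustion

variable {X : Type*} [MetricSpace X] [LocallyCompactSpace X] [MeasurableSpace X] [BorelSpace X]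
  {μ : Measure X} {E : DirichletForm μ} {U : ℕ → Set X}

theorem _root_.Widder.exists_subset_of_exhaustion (hU : Monotone U) (hUo : ∀ n, IsOpen (U n))
    (hUX : (⋃ n, U n) = univ) {K : Set X} (hK : IsCompact K) : ∃ n, K ⊆ U n :=
  hK.elim_directed_cover U hUo (by rw [hUX]; exact subset_univ K) hU.directed_le

theorem IsNiceCutoff.mono {ψ : X → ℝ} {A V W : Set X} (h : E.IsNiceCutoff ψ A V) (hVW : V ⊆ W) :
    E.IsNiceCutoff ψ A W :=
  ⟨h.mem_Icc, h.eq_one, h.hasCompactSupport, h.tsupport_subset.trans hVW, h.mul_mem⟩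

theorem HasNiceExhaustion.isNice_univ (h : E.HasNiceExhaustion) : E.IsNice univ := by
  obtain ⟨U, hU, hUX, hUn⟩ := h
  intro K hK _
  obtain ⟨n, hn⟩ := exists_subset_of_exhaustion hU (fun n => (hUn n).1) hUX hK
  obtain ⟨ψ, hψ⟩ := (hUn n).2.2.2 K hK hn
  exact ⟨ψ, hψ.mono (subset_univ _)⟩

theorem exists_supported_near (hreg : E.IsRegular) (hU : Monotone U) (hUo : ∀ n, IsOpen (U n))
    (hUX : (⋃ n, U n) = univ) (f : E.Dom) {ε : ℝ} (hε : 0 < ε) :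
    ∃ n, ∃ g ∈ E.supported (closure (U n)), ‖f - g‖ < ε := by
  obtain ⟨g, q, -, hqc, hgq, hfg⟩ := hreg.1 f ε hε
  obtain ⟨n, hn⟩ := exists_subset_of_exhaustion hU hUo hUX hqc.isCompact
  refine ⟨n, g, ?_, hfg⟩
  filter_upwards [hgq] with x h1 h2
  rw [h1, image_eq_zero_of_notMem_tsupport fun h' => h2 (subset_closure (hn h'))]

/-- Functions that vanish off a compact set are limits of functions of the form domain with
support in a slightly larger compact set. -/
theorem IsNiceCutoff.mem_closure_supported {ψ : X → ℝ} {A V F : Set X} (h : E.IsNiceCutoff ψ A V)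
    (hF : tsupport ψ ⊆ F) {q : Lp ℝ 2 μ} (hq : ∀ᵐ x ∂μ, x ∉ A → q x = 0) :
    q ∈ closure (E.toL2 '' (E.supported F : Set E.Dom)) := by
  refine Metric.mem_closure_iff.2 fun ε hε => ?_
  obtain ⟨f, hf⟩ := Metric.mem_closure_range_iff.1 (E.denseRange_toL2 q) ε hε
  refine ⟨_, ⟨h.mul f, supported_mono hF (h.mul_mem_supported f), rfl⟩, ?_⟩
  refine lt_of_le_of_lt ?_ hf
  rw [dist_eq_norm, dist_eq_norm]
  refine norm_le_of_ae_abs_le ?_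
  filter_upwards [h.mul_ae f, hq, Lp.coeFn_sub q (E.toL2 (h.mul f)), Lp.coeFn_sub q (E.toL2 f)]
    with x h1 h2 h3 h4
  rw [h3, h4, Pi.sub_apply, Pi.sub_apply, h1]
  by_cases hx : x ∈ A
  · rw [h.eq_one x hx, one_mul]
  · rw [h2 hx, zero_sub, zero_sub, abs_neg, abs_neg, abs_mul]
    have h5 := h.mem_Icc x
    rw [abs_of_nonneg h5.1]
    exact mul_le_of_le_one_left (abs_nonneg _) h5.2

end Exhaustion

section Mollified

variable {X : Type*} [MetricSpace X] [LocallyCompactSpace X] [SecondCountableTopology X]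
  [MeasurableSpace X] [BorelSpace X]
  {μ : Measure X} [μ.Regular] {E : DirichletForm μ}

theorem _root_.Widder.stronglyMeasurable_mollify {u : ℝ × X → ℝ} (hu : StronglyMeasurable u)
    (j : ℕ) : StronglyMeasurable fun z : ℝ × X => mollify j (fun r => u (r, z.2)) z.1 := by
  have h1 : StronglyMeasurable fun w : (ℝ × X) × ℝ => mollifier j (w.1.1 - w.2) • u (w.2, w.1.2) := by
    have ha : StronglyMeasurable fun w : (ℝ × X) × ℝ => mollifier j (w.1.1 - w.2) :=
      ((contDiff_mollifier j).continuous.comp (by fun_prop)).stronglyMeasurable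
    have hb : StronglyMeasurable fun w : (ℝ × X) × ℝ => u (w.2, w.1.2) :=
      hu.comp_measurable (by fun_prop)
    exact ha.mul hb
  exact h1.integral_prod_right'

/-- Mollified weak solutions can be computed pointwise. -/
theorem toL2_mollify_ae {u : ℝ × X → ℝ} (hu : StronglyMeasurable u) {ψ : X → ℝ}
    (hψ : AEStronglyMeasurable ψ μ) {a b : ℝ} {v : ℝ → E.Dom}
    (hv : Integrable ((Ioo a b).indicator v))
    (hvu : ∀ᵐ t ∂volume.restrict (Ioo a b), E.toL2 (v t) =ᵐ[μ] fun x => ψ x * u (t, x))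
    {j : ℕ} {t : ℝ} (h1 : a + radius j ≤ t) (h2 : t ≤ b - radius j) :
    E.toL2 (mollify j ((Ioo a b).indicator v) t)
      =ᵐ[μ] fun x => ψ x * mollify j (fun r => u (r, x)) t := by
  have e1 : E.toL2 (mollify j ((Ioo a b).indicator v) t)
      = ∫ r, mollifier j (t - r) • E.incl ((Ioo a b).indicator v r) :=
    clm_mollify j E.incl hv t
  have hG : Integrable fun r => mollifier j (t - r) • E.incl ((Ioo a b).indicator v r) :=
    integrable_mollifier_smul j (E.incl.integrable_comp hv) t
  have hg : AEStronglyMeasurable (fun z : ℝ × X => mollifier j (t - z.1) * (ψ z.2 * u z))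
      ((volume : Measure ℝ).prod μ) := by
    refine AEStronglyMeasurable.mul ?_ (AEStronglyMeasurable.mul ?_ hu.aestronglyMeasurable)
    · exact (((contDiff_mollifier_sub j t).continuous.comp continuous_fst)).aestronglyMeasurable
    · exact hψ.comp_snd
  have h3 := integral_Lp_ae hG hg (by
    filter_upwards [(ae_restrict_iff' measurableSet_Ioo).1 hvu] with r hr
    by_cases hr' : r ∈ Ioo a b
    · rw [indicator_of_mem hr']
      filter_upwards [hr hr', Lp.coeFn_smul (mollifier j (t - r)) (E.incl (v r))] with x h1 h2
      rw [h2, Pi.smul_apply, smul_eq_mul, incl_apply, h1]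
    · rw [mollifier_sub_eq_zero h1 h2 hr', zero_smul]
      filter_upwards [Lp.coeFn_zero ℝ 2 μ] with x hx
      rw [hx, zero_mul]; rfl)
  rw [e1]
  filter_upwards [h3] with x hx
  rw [hx, mollify, ← integral_const_mul]
  refine integral_congr_ae (Eventually.of_forall fun r => ?_)
  simp only [smul_eq_mul]
  ring

theorem ae_nonneg_of_inner_negPart_nonneg {Q h : Lp ℝ 2 μ} {A : Set X}
    (hh : h =ᵐ[μ] A.indicator fun x => max (-Q x) 0) (hQ : 0 ≤ (inner ℝ Q h : ℝ)) :
    ∀ᵐ x ∂μ, x ∈ A → 0 ≤ Q x := by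
  rw [inner_eq_integral] at hQ
  have h1 : ∀ᵐ x ∂μ, 0 ≤ -(Q x * h x) := by
    filter_upwards [hh] with x hx
    rw [hx]
    by_cases hxA : x ∈ A
    · rw [indicator_of_mem hxA]
      rcases le_total 0 (Q x) with h | h
      · rw [max_eq_right (neg_nonpos.2 h), mul_zero, neg_zero]
      · rw [max_eq_left (neg_nonneg.2 h)]; nlinarith
    · rw [indicator_of_notMem hxA, mul_zero, neg_zero]
  have h2 : ∫ x, -(Q x * h x) ∂μ = 0 :=
    le_antisymm (by rw [integral_neg]; linarith) (integral_nonneg_of_ae h1)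
  have h3 := (integral_eq_zero_iff_of_nonneg_ae h1 (integrable_mul Q h).neg).1 h2
  filter_upwards [h3, hh] with x h4 h5 hxA
  by_contra! hlt
  have h6 : -(Q x * h x) = 0 := h4
  rw [h5, indicator_of_mem hxA, max_eq_left (by linarith)] at h6
  nlinarith

/-- A nonnegative solution dominates the heat flow of any function that it dominates at an earlier
time. -/
theorem IsWeakSolution.semigroup_le (hreg : E.IsRegular) (hnice : E.HasNiceExhaustion)
    {P : ℝ≥0 → Lp ℝ 2 μ →L[ℝ] Lp ℝ 2 μ} (hP : E.IsHeatSemigroup P) {I : Set ℝ} {u : ℝ × X → ℝ}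
    (hu : E.IsWeakSolution I univ u) (hum : StronglyMeasurable u)
    (hu0 : ∀ᵐ t ∂volume.restrict I, ∀ᵐ x ∂μ, 0 ≤ u (t, x)) {a b s t : ℝ} {j : ℕ}
    (hab : Icc a b ⊆ I) (has : a + radius j < s) (hst : s ≤ t) (htb : t < b - radius j)
    {w : Lp ℝ 2 μ} {K : Set X} (hK : IsCompact K) (hwK : ∀ᵐ x ∂μ, x ∉ K → w x = 0)
    (hwu : ∀ᵐ x ∂μ, w x ≤ mollify j (fun r => u (r, x)) s)
    (hus : ∀ᵐ x ∂μ, 0 ≤ mollify j (fun r => u (r, x)) s) :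
    ∀ᵐ x ∂μ, P (t - s).toNNReal w x ≤ mollify j (fun r => u (r, x)) t := by
  have hX := hnice.isNice_univ
  obtain ⟨U, hU, hUX, hUn⟩ := hnice
  have hUo := fun n => (hUn n).1
  set F : ℕ → Set X := fun n => closure (U n) with hF
  have hFm : Monotone F := fun m n h => closure_mono (hU h)
  have hFc : ∀ n, IsCompact (F n) := fun n => (hUn n).2.1
  have hex : ∀ n, ∃ A : Set X, IsCompact A ∧ F n ∪ K ⊆ interior A := fun n =>
    exists_compact_superset ((hFc n).union hK)
  choose A hA hFA using hex
  choose ψ hψ using fun n => hX (A n) (hA n) (subset_univ _)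
  choose V hV hVu using fun n => hu (ψ n) (A n) (hA n) (hψ n) a b hab
  set v : ℕ → ℝ → E.Dom := fun n => mollify j ((Ioo a b).indicator (V n)) with hv
  have hψm : ∀ n, AEStronglyMeasurable (ψ n) μ := fun n => (hψ n).aestronglyMeasurable hreg
  have hvu : ∀ n, ∀ r ∈ Icc s t, E.toL2 (v n r)
      =ᵐ[μ] fun x => ψ n x * mollify j (fun r => u (r, x)) r := fun n r hr =>
    toL2_mollify_ae hum (hψm n) (hV n).integrable (hVu n) (by linarith [hr.1]) (by linarith [hr.2])
  have hdex : ∀ n r, ∃ d : E.Dom, r ∈ Icc s t → HasDerivAt (v n) d r ∧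
      ∀ g ∈ E.supported (F n), inner ℝ (E.toL2 d) (E.toL2 g) = -E.energy (v n r) g := by
    intro n r
    by_cases hr : r ∈ Icc s t
    · obtain ⟨d, hd, hd2⟩ := (hV n).exists_hasDerivAt_mollify (j := j) (t := r)
        (by linarith [hr.1]) (by linarith [hr.2])
      exact ⟨d, fun _ => ⟨hd, fun g hg => hd2 _ (hFc n) (subset_union_left.trans (hFA n)) g hg⟩⟩
    · exact ⟨0, fun h => absurd h hr⟩
  choose d hd using hdex
  have hI : Ioo a b ⊆ I := Ioo_subset_Icc_self.trans hab
  have hv0 : ∀ n, ∀ r ∈ Icc s t, ∀ᵐ x ∂μ, 0 ≤ E.toL2 (v n r) x := fun n r hr =>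
    mollify_mem (hV n).integrable E.convex_setOf_nonneg E.isClosed_setOf_nonneg (a := a) (b := b)
      (by
        filter_upwards [hVu n, ae_restrict_of_ae_restrict_of_subset hI hu0,
          ae_restrict_mem measurableSet_Ioo] with r h1 h2 h3
        rw [indicator_of_mem h3]
        filter_upwards [h1, h2] with x h4 h5
        rw [h4]
        exact mul_nonneg ((hψ n).mem_Icc x).1 h5) (by linarith [hr.1]) (by linarith [hr.2])
  have hw : ∀ n, ∀ᵐ x ∂μ, w x ≤ E.toL2 (v n s) x := fun n => by
    filter_upwards [hvu n s ⟨le_rfl, hst⟩, hwu, hwK, hus] with x h1 h2 h3 h4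
    rw [h1]
    by_cases hx : x ∈ K
    · rw [(hψ n).eq_one x (interior_subset (hFA n (Or.inr hx))), one_mul]; exact h2
    · rw [h3 hx]; exact mul_nonneg ((hψ n).mem_Icc x).1 h4
  -- pairing with nonnegative functions of the form domain with compact support
  have hpair : ∀ m, ∀ g ∈ E.supported (F m), (∀ᵐ x ∂μ, 0 ≤ E.toL2 g x) →
      0 ≤ (inner ℝ (E.toL2 (v m t) - P (t - s).toNNReal w) (E.toL2 g) : ℝ) := by
    intro m g hgm hg0
    rw [inner_sub_left, hP.inner_symm, sub_nonneg]
    refine hP.inner_le_of_exhaustion hFm (fun f ε hε => exists_supported_near hreg hU hUo hUX f hε)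
      hst (v := v) (d := d) (fun n r hr => (hd n r hr).1) (fun n r hr => (hd n r hr).2) hv0 hw hg0
      hgm fun n hn => ?_
    refine inner_congr_ae ?_
    filter_upwards [hvu n t ⟨hst, le_rfl⟩, hvu m t ⟨hst, le_rfl⟩, mem_supported.1 hgm]
      with x h1 h2 h3
    by_cases hx : x ∈ F m
    · rw [h1, h2, (hψ n).eq_one x (interior_subset (hFA n (Or.inl (hFm hn hx)))),
        (hψ m).eq_one x (interior_subset (hFA m (Or.inl hx)))]
    · rw [h3 hx, mul_zero, mul_zero]
  -- test with the negative part of the difference, approximated in the form domain by resolvents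
  have hm : ∀ m, ∀ᵐ x ∂μ, x ∈ F m → P (t - s).toNNReal w x ≤ mollify j (fun r => u (r, x)) t := by
    intro m
    obtain ⟨χ, hχ⟩ := hX (F m) (hFc m) (subset_univ _)
    obtain ⟨n, hn⟩ := exists_subset_of_exhaustion hU hUo hUX
      (hχ.hasCompactSupport.isCompact.union (hFc m))
    set Q := E.toL2 (v n t) - P (t - s).toNNReal w with hQ
    have hmemLp : MemLp ((F m).indicator fun x => max (-Q x) 0) 2 μ := by
      refine MemLp.indicator (hFc m).isClosed.measurableSet ?_
      refine (Lp.memLp Q).mono ((Lp.aestronglyMeasurable Q).neg.sup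
        aestronglyMeasurable_const) (Eventually.of_forall fun x => ?_)
      rw [Real.norm_eq_abs, Real.norm_eq_abs, abs_of_nonneg (le_max_right _ _)]
      exact max_le (neg_le_abs _) (abs_nonneg _)
    have hh := hmemLp.coeFn_toLp
    set h := hmemLp.toLp with hhdef
    have hcl : h ∈ closure (E.toL2 '' (E.supported (F n) : Set E.Dom)) :=
      hχ.mem_closure_supported
        ((subset_union_left.trans hn).trans subset_closure) (by
        filter_upwards [hh] with x h1 h2
        rw [h1, indicator_of_notMem h2])
    have hlim := ((by fun_prop : Continuous fun g : Lp ℝ 2 μ => (inner ℝ Q g : ℝ)).tendsto h).comp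
      (tendsto_scaledResolvent_atTop hcl)
    have h0 : ∀ᵐ x ∂μ, 0 ≤ h x := by
      filter_upwards [hh] with x h1
      rw [h1]
      exact indicator_nonneg (fun _ _ => le_max_right _ _) x
    have hpos : 0 ≤ (inner ℝ Q h : ℝ) := by
      refine ge_of_tendsto hlim ?_
      filter_upwards [eventually_gt_atTop 0] with l hl
      rw [Function.comp_apply, scaledResolvent_eq_toL2]
      refine hpair n _ (Submodule.smul_mem _ _ (resolvent_mem hl h)) ?_
      rw [← scaledResolvent_eq_toL2]
      exact scaledResolvent_nonneg hl h h0
    filter_upwards [ae_nonneg_of_inner_negPart_nonneg hh hpos, hvu n t ⟨hst, le_rfl⟩,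
      Lp.coeFn_sub (E.toL2 (v n t)) (P (t - s).toNNReal w)] with x h1 h2 h3 hx
    have h4 := h1 hx
    rw [hQ, h3, Pi.sub_apply, h2, (hψ n).eq_one x (interior_subset (hFA n (Or.inl
      (subset_closure (hn (Or.inr hx)))))), one_mul] at h4
    linarith
  filter_upwards [ae_all_iff.2 hm] with x hx
  have hxU : x ∈ ⋃ n, U n := by rw [hUX]; trivial
  obtain ⟨m, hxm⟩ := mem_iUnion.1 hxU
  exact hx m (subset_closure hxm)

end Mollified

end DirichletForm

/-! ### The parabolic Harnack inequality on arbitrary time intervals -/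

namespace DirichletForm

section Shift

variable {X : Type*} [MetricSpace X] [LocallyCompactSpace X] [MeasurableSpace X] [BorelSpace X]
  {μ : Measure X} {E : DirichletForm μ} {a b : ℝ} {V : Set X} {v : ℝ → E.Dom}

theorem _root_.Widder.measurePreserving_add_restrict (l a b : ℝ) :
    MeasurePreserving (fun t : ℝ => t + l) (volume.restrict (Ioo (a - l) (b - l)))
      (volume.restrict (Ioo a b)) := by
  have h := (measurePreserving_add_right (volume : Measure ℝ) l).restrict_preimage
    (measurableSet_Ioo (a := a) (b := b))
  rwa [preimage_add_const_Ioo] at h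

theorem IsWeakCurve.shift (hv : E.IsWeakCurve a b V v) (l : ℝ) :
    E.IsWeakCurve (a - l) (b - l) V fun t => v (t + l) := by
  refine ⟨hv.memLp.comp_measurePreserving (measurePreserving_add_restrict l a b),
    fun χ hχ hχc hχs K hK hKV g hg => ?_⟩
  have e : tsupport (fun t => χ (t - l)) = (fun t => t - l) ⁻¹' tsupport χ :=
    tsupport_comp_eq_preimage χ (Homeomorph.subRight l)
  have h := hv.weak (fun t => χ (t - l)) (hχ.comp (contDiff_id.sub contDiff_const))
    (hχc.comp_homeomorph (Homeomorph.subRight l)) (by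
      rw [e]
      intro t ht
      have := hχs ht
      exact ⟨by linarith [this.1], by linarith [this.2]⟩) K hK hKV g hg
  simp only [deriv_comp_sub_const] at h
  rw [← integral_add_right_eq_self _ l,
    ← integral_add_right_eq_self (fun t => χ (t - l) * E.energy (v t) g) l] at h
  simpa using h

theorem IsWeakSolution.shift {I : Set ℝ} {U : Set X} {u : ℝ × X → ℝ} (hu : E.IsWeakSolution I U u)
    (l : ℝ) : E.IsWeakSolution ((fun t => t + l) ⁻¹' I) U fun z => u (z.1 + l, z.2) := by
  intro ψ A hA h a b hab
  obtain ⟨v, hv, hvu⟩ := hu ψ A hA h (a + l) (b + l) (by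
    intro t ht
    simpa using @hab (t - l) ⟨by linarith [ht.1], by linarith [ht.2]⟩)
  have h1 := hv.shift l
  have h2 := (measurePreserving_add_restrict l (a + l) (b + l)).quasiMeasurePreserving.ae hvu
  simp only [add_sub_cancel_right] at h1 h2
  exact ⟨_, h1, h2⟩

theorem IsWeakSolution.mono {I J : Set ℝ} {U V : Set X} {u : ℝ × X → ℝ}
    (hu : E.IsWeakSolution I U u) (hJ : J ⊆ I) (hV : V ⊆ U) : E.IsWeakSolution J V u :=
  fun ψ A hA h a b hab => hu ψ A hA (h.mono hV) a b (hab.trans hJ)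

theorem IsWeakSolution.congr {I : Set ℝ} {U : Set X} {u w : ℝ × X → ℝ}
    (hu : E.IsWeakSolution I U u)
    (h : ∀ᵐ t ∂volume.restrict I, ∀ᵐ x ∂μ, x ∈ U → u (t, x) = w (t, x)) :
    E.IsWeakSolution I U w := by
  intro ψ A hA hψ a b hab
  obtain ⟨v, hv, hvu⟩ := hu ψ A hA hψ a b hab
  refine ⟨v, hv, ?_⟩
  filter_upwards [hvu, ae_restrict_of_ae_restrict_of_subset (Ioo_subset_Icc_self.trans hab) h]
    with t h1 h2
  filter_upwards [h1, h2] with x h3 h4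
  rw [h3]
  by_cases hx : x ∈ tsupport ψ
  · rw [h4 (hψ.tsupport_subset hx)]
  · rw [image_eq_zero_of_notMem_tsupport hx, zero_mul, zero_mul]

end Shift

section Harnack

variable {X : Type*} [MetricSpace X] [LocallyCompactSpace X] [SecondCountableTopology X]
  [MeasurableSpace X] [BorelSpace X]
  {μ : Measure X} [μ.Regular] {E : DirichletForm μ}

/-- The parabolic Harnack inequality for weak solutions on an arbitrary time interval. -/
theorem ParabolicHarnack.exists_const (hH : E.ParabolicHarnack) (hreg : E.IsRegular)
    (hloc : E.IsStrictlyLocal) {U K : Set X} (hU : IsOpen U) (hUc : IsConnected U)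
    (hUn : E.IsNice U) (hK : IsCompact K) (hKU : K ⊆ U) {l a b c d r : ℝ} (hla : l < a)
    (hab : a < b) (hbc : b < c) (hcd : c < d) (hdr : d < r) :
    ∃ C : ℝ≥0, ∀ u : ℝ × X → ℝ, StronglyMeasurable u → E.IsWeakSolution (Ioo l r) U u →
      (∀ᵐ t ∂volume.restrict (Ioo l r), ∀ᵐ x ∂μ, x ∈ U → 0 ≤ u (t, x)) → ∃ m : ℝ≥0∞,
      (∀ᵐ t ∂volume.restrict (Icc a b), ∀ᵐ x ∂μ, x ∈ K → ENNReal.ofReal (u (t, x)) ≤ C * m) ∧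
      (∀ᵐ t ∂volume.restrict (Icc c d), ∀ᵐ x ∂μ, x ∈ K → m ≤ ENNReal.ofReal (u (t, x))) := by
  obtain ⟨C, hC⟩ := hH U K hU hUc hK hKU (a - l) (b - l) (c - l) (d - l) (r - l)
    (by linarith) (by linarith) (by linarith) (by linarith) (by linarith)
  refine ⟨C, fun u hum hu hu0 => ?_⟩
  set w : ℝ × X → ℝ := fun z => u (z.1 + l, z.2) with hw
  have hwm : StronglyMeasurable w := hum.comp_measurable (by fun_prop)
  have hpre : (fun t : ℝ => t + l) ⁻¹' Ioo l r = Ioo 0 (r - l) := by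
    rw [preimage_add_const_Ioo, sub_self]
  have hws : E.IsWeakSolution (Ioo 0 (r - l)) U w := by
    have := hu.shift l
    rwa [hpre] at this
  have hlr : l < r := by linarith
  have h1 := hC w (hws.isLocalWeakSolution hreg hloc isOpen_Ioo ordConnected_Ioo
    (nonempty_Ioo.2 (by linarith)) hU hUn hwm.aestronglyMeasurable) (by
      refine (Measure.ae_prod_iff_ae_ae (measurableSet_le measurable_const hwm.measurable)).2 ?_
      have := (measurePreserving_add_restrict l l r).quasiMeasurePreserving.ae hu0
      rw [sub_self] at this
      filter_upwards [this] with t ht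
      exact (ae_restrict_iff' hU.measurableSet).2 ht)
  set m := essInf (fun z => ENNReal.ofReal (w z))
    ((volume.restrict (Icc (c - l) (d - l))).prod (μ.restrict K)) with hm
  have hback : ∀ (s t : ℝ) (q : ℝ → X → Prop), (∀ᵐ r ∂volume.restrict (Icc (s - l) (t - l)),
      ∀ᵐ x ∂μ.restrict K, q (r + l) x) →
      ∀ᵐ r ∂volume.restrict (Icc s t), ∀ᵐ x ∂μ, x ∈ K → q r x := by
    intro s t q hq
    have h := (measurePreserving_sub_right (volume : Measure ℝ) l).restrict_preimage
      (measurableSet_Icc (a := s - l) (b := t - l))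
    rw [preimage_sub_const_Icc, sub_add_cancel, sub_add_cancel] at h
    filter_upwards [h.quasiMeasurePreserving.ae hq] with r hr
    rw [sub_add_cancel] at hr
    exact (ae_restrict_iff' hK.isClosed.measurableSet).1 hr
  refine ⟨m, ?_, ?_⟩
  · refine hback a b (fun t x => ENNReal.ofReal (u (t, x)) ≤ C * m) ?_
    refine Measure.ae_ae_of_ae_prod (p := fun z => ENNReal.ofReal (w z) ≤ C * m) ?_
    filter_upwards [ENNReal.ae_le_essSup (μ := (volume.restrict (Icc (a - l) (b - l))).prod
      (μ.restrict K)) fun z => ENNReal.ofReal (w z)] with z hz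
    exact hz.trans h1
  · refine hback c d (fun t x => m ≤ ENNReal.ofReal (u (t, x))) ?_
    exact Measure.ae_ae_of_ae_prod (p := fun z => m ≤ ENNReal.ofReal (w z)) ae_essInf_le

/-- A bound of a nonnegative solution at later times gives a bound at earlier times. -/
theorem ParabolicHarnack.exists_bound (hH : E.ParabolicHarnack) (hreg : E.IsRegular)
    (hloc : E.IsStrictlyLocal) {U K : Set X} (hU : IsOpen U) (hUc : IsConnected U)
    (hUn : E.IsNice U) (hK : IsCompact K) (hKU : K ⊆ U) {l a b c d r : ℝ} (hla : l < a)
    (hab : a < b) (hbc : b < c) (hcd : c < d) (hdr : d < r) :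
    ∃ C : ℝ≥0, ∀ u : ℝ × X → ℝ, StronglyMeasurable u → E.IsWeakSolution (Ioo l r) U u →
      (∀ᵐ t ∂volume.restrict (Ioo l r), ∀ᵐ x ∂μ, x ∈ U → 0 ≤ u (t, x)) → ∀ M : ℝ, 0 ≤ M →
      (∀ᵐ t ∂volume.restrict (Icc c d), ∀ᵐ x ∂μ, x ∈ K → u (t, x) ≤ M) →
      ∀ᵐ t ∂volume.restrict (Icc a b), ∀ᵐ x ∂μ, x ∈ K → u (t, x) ≤ C * M := by
  obtain ⟨C, hC⟩ := hH.exists_const hreg hloc hU hUc hUn hK hKU hla hab hbc hcd hdr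
  refine ⟨C, fun u hum hu hu0 M hM huM => ?_⟩
  obtain ⟨m, h1, h2⟩ := hC u hum hu hu0
  -- over a null set the essential infimum `m` may be infinite
  rcases eq_or_ne (μ K) 0 with h0 | h0
  · have h3 : ∀ᵐ x ∂μ, x ∉ K := measure_eq_zero_iff_ae_notMem.1 h0
    exact Eventually.of_forall fun t => h3.mono fun x hx hx' => absurd hx' hx
  have hmM : m ≤ ENNReal.ofReal M := by
    have h3 : volume (Icc c d) ≠ 0 := by
      rw [Real.volume_Icc]; simpa using hcd
    have : NeZero (volume.restrict (Icc c d)) := ⟨fun h => h3 (by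
      rw [← Measure.restrict_apply_univ, h, Measure.coe_zero, Pi.zero_apply])⟩
    obtain ⟨t, ht1, ht2⟩ := (h2.and huM).exists
    have : NeZero (μ.restrict K) := ⟨fun h => h0 (by
      rw [← Measure.restrict_apply_univ, h, Measure.coe_zero, Pi.zero_apply])⟩
    obtain ⟨x, hx1, hx2⟩ := (((ae_restrict_iff' hK.isClosed.measurableSet).2 ht1).and
      ((ae_restrict_iff' hK.isClosed.measurableSet).2 ht2)).exists
    exact hx1.trans (ENNReal.ofReal_le_ofReal hx2)
  filter_upwards [h1] with t ht
  filter_upwards [ht] with x hx hxK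
  have h3 := (hx hxK).trans (mul_le_mul_right hmM (C : ℝ≥0∞))
  rw [← ENNReal.ofReal_coe_nnreal, ← ENNReal.ofReal_mul C.coe_nonneg] at h3
  exact (ENNReal.ofReal_le_ofReal_iff (mul_nonneg C.coe_nonneg hM)).1 h3

/-- Nonnegative weak solutions are locally bounded. -/
theorem ParabolicHarnack.exists_local_bound (hH : E.ParabolicHarnack) (hreg : E.IsRegular)
    (hloc : E.IsStrictlyLocal) {U K : Set X} (hU : IsOpen U) (hUc : IsConnected U)
    (hUn : E.IsNice U) (hK : IsCompact K) (hKU : K ⊆ U) {l a b r : ℝ} (hla : l < a)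
    (hab : a < b) (hbr : b < r) {u : ℝ × X → ℝ} (hum : StronglyMeasurable u)
    (hu : E.IsWeakSolution (Ioo l r) U u)
    (hu0 : ∀ᵐ t ∂volume.restrict (Ioo l r), ∀ᵐ x ∂μ, x ∈ U → 0 ≤ u (t, x)) :
    ∃ M : ℝ≥0, ∀ᵐ t ∂volume.restrict (Icc a b), ∀ᵐ x ∂μ, x ∈ K → u (t, x) ≤ M := by
  obtain ⟨C, hC⟩ := hH.exists_const hreg hloc hU hUc hUn hK hKU hla hab
    (show b < b + (r - b) / 3 by linarith) (show b + (r - b) / 3 < b + 2 * (r - b) / 3 by linarith)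
    (show b + 2 * (r - b) / 3 < r by linarith)
  obtain ⟨m, h1, h2⟩ := hC u hum hu hu0
  -- over a null set the essential infimum `m` may be infinite
  rcases eq_or_ne (μ K) 0 with h0 | h0
  · have h3 : ∀ᵐ x ∂μ, x ∉ K := measure_eq_zero_iff_ae_notMem.1 h0
    exact ⟨0, Eventually.of_forall fun t => h3.mono fun x hx hx' => absurd hx' hx⟩
  have hm : m ≠ ⊤ := by
    have h3 : volume (Icc (b + (r - b) / 3) (b + 2 * (r - b) / 3)) ≠ 0 := by
      rw [Real.volume_Icc, ne_eq, ENNReal.ofReal_eq_zero]; linarith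
    have : NeZero (volume.restrict (Icc (b + (r - b) / 3) (b + 2 * (r - b) / 3))) := ⟨fun h => h3 (by
      rw [← Measure.restrict_apply_univ, h, Measure.coe_zero, Pi.zero_apply])⟩
    obtain ⟨t, ht⟩ := h2.exists
    have : NeZero (μ.restrict K) := ⟨fun h => h0 (by
      rw [← Measure.restrict_apply_univ, h, Measure.coe_zero, Pi.zero_apply])⟩
    obtain ⟨x, hx⟩ := ((ae_restrict_iff' hK.isClosed.measurableSet).2 ht).exists
    exact ne_top_of_le_ne_top ENNReal.ofReal_ne_top hx
  refine ⟨(C * m).toNNReal, ?_⟩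
  filter_upwards [h1] with t ht
  filter_upwards [ht] with x hx hxK
  have h3 := hx hxK
  rw [← ENNReal.coe_toNNReal (ENNReal.mul_ne_top ENNReal.coe_ne_top hm),
    ← ENNReal.ofReal_coe_nnreal] at h3
  exact (ENNReal.ofReal_le_ofReal_iff NNReal.zero_le_coe).1 h3

end Harnack

end DirichletForm

/-! ### Vague compactness of measures -/

section Vague

variable {X : Type*} [MetricSpace X] [LocallyCompactSpace X] [MeasurableSpace X] [BorelSpace X]

theorem abs_setIntegral_le_of_abs_le {m : Measure X} {K : Set X} {B : ℝ≥0}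
    (hB : m K ≤ B) {F : X → ℝ} {ε : ℝ} (hF : ∀ x ∈ K, |F x| ≤ ε) (hε : 0 ≤ ε)
    (hF0 : ∀ x ∉ K, F x = 0) : |∫ x, F x ∂m| ≤ ε * B := by
  have h1 : m K < ⊤ := hB.trans_lt ENNReal.coe_lt_top
  rw [← setIntegral_eq_integral_of_forall_compl_eq_zero hF0, ← Real.norm_eq_abs]
  refine (norm_setIntegral_le_of_norm_le_const h1 fun x hx => hF x hx).trans ?_
  refine mul_le_mul_of_nonneg_left ?_ hε
  exact ENNReal.toReal_le_coe_of_le_coe hB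

/-- A sequence of measures that is bounded on every compact set has a vaguely convergent
subsequence. -/
theorem exists_tendsto_vague [SecondCountableTopology X] (m : ℕ → Measure X)
    (hm : ∀ K : Set X, IsCompact K → ∃ B : ℝ≥0, ∀ j, m j K ≤ B) :
    ∃ (φ : ℕ → ℕ) (ν : Measure X), StrictMono φ ∧ ν.Regular ∧
      ∀ f : X → ℝ, Continuous f → HasCompactSupport f →
        Tendsto (fun j => ∫ x, f x ∂m (φ j)) atTop (𝓝 (∫ x, f x ∂ν)) := by
  have hfin : ∀ j, IsFiniteMeasureOnCompacts (m j) := fun j => ⟨fun K hK => by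
    obtain ⟨B, hB⟩ := hm K hK
    exact (hB j).trans_lt ENNReal.coe_lt_top⟩
  set E : CompactExhaustion X := default
  choose c hcc hcs _ hcI hc1 using fun n =>
    exists_bump_one (E n) (E.isCompact n) univ isOpen_univ (subset_univ _)
  obtain ⟨D, hD⟩ := TopologicalSpace.exists_countable_dense C(X, ℝ)
  have hDn : D.Nonempty := hD.2.nonempty
  obtain ⟨d, hd⟩ := hD.1.exists_eq_range hDn
  -- boundedness of the integrals against a countable family
  have hbd : ∀ i : ℕ × ℕ, ∃ B : ℝ, ∀ j, |∫ x, c i.2 x * d i.1 x ∂m j| ≤ B := by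
    intro i
    obtain ⟨B, hB⟩ := hm _ (hcs i.2).isCompact
    have hcont : Continuous fun x => c i.2 x * d i.1 x := (hcc i.2).mul (d i.1).continuous
    obtain ⟨C, hC⟩ := ((hcs i.2).mul_right (f' := d i.1)).exists_bound_of_continuous hcont
    refine ⟨max C 0 * B, fun j => abs_setIntegral_le_of_abs_le (hB j)
      (fun x _ => (hC x).trans (le_max_left _ _)) (le_max_right _ _) fun x hx => ?_⟩
    rw [image_eq_zero_of_notMem_tsupport hx, zero_mul]
  choose B hB using hbd
  obtain ⟨a, -, φ, hφ, ha⟩ := (isCompact_univ_pi fun i => isCompact_Icc (a := -B i) (b := B i)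
    ).tendsto_subseq (x := fun j i => ∫ x, c i.2 x * d i.1 x ∂m j) fun j i _ => abs_le.1 (hB i j)
  have hcau : ∀ f : X → ℝ, Continuous f → HasCompactSupport f →
      ∃ l, Tendsto (fun j => ∫ x, f x ∂m (φ j)) atTop (𝓝 l) := by
    intro f hf hfc
    refine cauchySeq_tendsto_of_complete (Metric.cauchySeq_iff.2 fun ε hε => ?_)
    obtain ⟨n, hn⟩ := E.exists_superset_of_isCompact hfc.isCompact
    obtain ⟨b, hb⟩ := hm _ (hcs n).isCompact
    have hε' : 0 < ε / (3 * (b + 1)) := by positivity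
    obtain ⟨g, hgD, hg⟩ : ∃ g ∈ D, ∀ x ∈ tsupport (c n), |f x - g x| < ε / (3 * (b + 1)) := by
      have h1 := ContinuousMap.tendsto_iff_forall_isCompact_tendstoUniformlyOn.1
        (tendsto_id (x := 𝓝 (⟨f, hf⟩ : C(X, ℝ)))) _ (hcs n).isCompact
      obtain ⟨g, hg1, hg2⟩ := ((mem_closure_iff_frequently.1 (hD.2 ⟨f, hf⟩)).and_eventually
        (Metric.tendstoUniformlyOn_iff.1 h1 _ hε')).exists
      exact ⟨g, hg1, fun x hx => hg2 x hx⟩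
    rw [hd] at hgD
    obtain ⟨k, rfl⟩ := hgD
    have hap : ∀ j, |∫ x, f x ∂m (φ j) - ∫ x, c n x * d k x ∂m (φ j)| ≤ ε / 3 := by
      intro j
      have hb0 : (0 : ℝ) ≤ b := b.coe_nonneg
      have hi : Integrable (fun x => c n x * d k x) (m (φ j)) :=
        ((hcc n).mul (d k).continuous).integrable_of_hasCompactSupport (hcs n).mul_right
      rw [← integral_sub (hf.integrable_of_hasCompactSupport hfc) hi]
      refine (abs_setIntegral_le_of_abs_le (hb _)
        (ε := ε / (3 * (b + 1))) (fun x hx => ?_) hε'.le fun x hx => ?_).trans ?_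
      · have h2 : f x = c n x * f x := by
          by_cases hx' : x ∈ tsupport f
          · rw [hc1 n x (hn hx'), one_mul]
          · rw [image_eq_zero_of_notMem_tsupport hx', mul_zero]
        rw [h2, ← mul_sub, abs_mul, abs_of_nonneg (hcI n x).1]
        exact (mul_le_of_le_one_left (abs_nonneg _) (hcI n x).2).trans (hg x hx).le
      · rw [image_eq_zero_of_notMem_tsupport hx, zero_mul, sub_zero]
        refine image_eq_zero_of_notMem_tsupport fun h => hx (subset_tsupport _ ?_)
        rw [Function.mem_support, hc1 n x (hn h)]
        exact one_ne_zero
      · rw [div_mul_eq_mul_div, div_le_div_iff₀ (by positivity) (by norm_num)]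
        nlinarith
    have h3 := (((tendsto_pi_nhds.1 ha) (k, n)).cauchySeq)
    obtain ⟨N, hN⟩ := Metric.cauchySeq_iff.1 h3 (ε / 3) (by positivity)
    refine ⟨N, fun i hi j hj => ?_⟩
    have h4 := hN i hi j hj
    have h5 := hap i
    have h6 := hap j
    simp only [Function.comp_apply] at h4
    rw [Real.dist_eq, abs_lt] at *
    rw [abs_le] at h5 h6
    constructor <;> linarith [h4.1, h4.2, h5.1, h5.2, h6.1, h6.2]
  choose! L hL using hcau
  have hint : ∀ (f : CompactlySupportedContinuousMap X ℝ) j, Integrable f (m j) := fun f j =>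
    f.continuous.integrable_of_hasCompactSupport f.hasCompactSupport
  have hL' : ∀ f : CompactlySupportedContinuousMap X ℝ,
      Tendsto (fun j => ∫ x, f x ∂m (φ j)) atTop (𝓝 (L f)) := fun f =>
    hL f f.continuous f.hasCompactSupport
  let Λ₀ : CompactlySupportedContinuousMap X ℝ →ₗ[ℝ] ℝ :=
    { toFun := fun f => L f
      map_add' := fun f g => by
        refine tendsto_nhds_unique (hL' (f + g)) (((hL' f).add (hL' g)).congr fun j => ?_)
        rw [← integral_add (hint f _) (hint g _)]
        rfl
      map_smul' := fun r f => by
        refine tendsto_nhds_unique (hL' (r • f)) (((hL' f).const_mul r).congr fun j => ?_)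
        rw [← integral_const_mul]
        rfl }
  let Λ : CompactlySupportedContinuousMap X ℝ →ₚ[ℝ] ℝ := PositiveLinearMap.mk₀ Λ₀ fun f hf =>
    ge_of_tendsto' (hL' f) fun j => integral_nonneg hf
  refine ⟨φ, RealRMK.rieszMeasure Λ, hφ, RealRMK.regular_rieszMeasure Λ, fun f hf hfc => ?_⟩
  have h := RealRMK.integral_rieszMeasure Λ ⟨⟨f, hf⟩, hfc⟩
  change ∫ x, f x ∂_ = L f at h
  rw [h]
  exact hL f hf hfc

/-- Vague convergence with integrands that converge uniformly on a compact set containing their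
supports. -/
theorem tendsto_integral_of_tendstoUniformlyOn {m : ℕ → Measure X} {ν : Measure X}
    (hν : ∀ f : X → ℝ, Continuous f → HasCompactSupport f →
      Tendsto (fun j => ∫ x, f x ∂m j) atTop (𝓝 (∫ x, f x ∂ν)))
    {K : Set X} (hK : IsCompact K) {B : ℝ≥0} (hB : ∀ j, m j K ≤ B) {F : ℕ → X → ℝ} {f : X → ℝ}
    (hf : Continuous f) (hf0 : ∀ x ∉ K, f x = 0) (hF : ∀ j, Integrable (F j) (m j))
    (hFi : ∀ j, Integrable f (m j))
    (hF0 : ∀ j, ∀ x ∉ K, F j x = 0) (hFf : TendstoUniformlyOn F f atTop K) :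
    Tendsto (fun j => ∫ x, F j x ∂m j) atTop (𝓝 (∫ x, f x ∂ν)) := by
  have h1 := hν f hf (HasCompactSupport.intro hK hf0)
  have h2 : Tendsto (fun j => ∫ x, F j x ∂m j - ∫ x, f x ∂m j) atTop (𝓝 0) := by
    rw [Metric.tendsto_nhds]
    intro ε hε
    have hb0 : (0 : ℝ) ≤ B := B.coe_nonneg
    have hε' : 0 < ε / (B + 1) := by positivity
    filter_upwards [Metric.tendstoUniformlyOn_iff.1 hFf _ hε'] with j hj
    rw [dist_zero_right, Real.norm_eq_abs, ← integral_sub (hF j) (hFi j)]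
    refine (abs_setIntegral_le_of_abs_le (hB j) (fun x hx => ?_) hε'.le fun x hx => ?_).trans_lt
      (?_ : ε / (B + 1) * B < ε)
    · have := hj x hx
      rw [Real.dist_eq, abs_sub_comm] at this
      exact this.le
    · rw [hF0 j x hx, hf0 x hx, sub_zero]
    · rw [div_mul_eq_mul_div, div_lt_iff₀ (by positivity)]
      nlinarith
  simpa using h2.add h1

end Vague

/-! ### Extension by zero and pointwise limits -/

namespace DirichletForm

section Extension

variable {X : Type*} [MetricSpace X] [LocallyCompactSpace X] [MeasurableSpace X] [BorelSpace X]
  {μ : Measure X} {E : DirichletForm μ} {a b s : ℝ} {V : Set X}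

/-- A classical solution that starts from zero at time `s`, extended by zero to earlier times, is
a weak solution. -/
theorem isWeakCurve_extend {y : ℝ → E.Dom} (hy : Continuous y) (hy0 : y s = 0)
    (hyd : ∀ K : Set X, IsCompact K → K ⊆ V → ∀ g ∈ E.supported K, ∀ t ∈ Ioo s b,
      HasDerivAt (fun r => (inner ℝ (E.toL2 (y r)) (E.toL2 g) : ℝ)) (-E.energy (y t) g) t) :
    E.IsWeakCurve a b V fun t => if t ≤ s then 0 else y t := by
  set z : ℝ → E.Dom := fun t => if t ≤ s then 0 else y t with hz
  have hzc : Continuous z := continuous_const.if_le hy continuous_id continuous_const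
    fun t ht => by rw [show t = s from ht, hy0]
  refine ⟨?_, ?_⟩
  · obtain ⟨C, hC⟩ := isCompact_Icc.exists_bound_of_continuousOn (s := Icc a b) hzc.continuousOn
    refine MemLp.of_bound hzc.aestronglyMeasurable C ?_
    filter_upwards [ae_restrict_mem measurableSet_Ioo] with t ht
    exact hC t (Ioo_subset_Icc_self ht)
  · intro χ hχ hχc hχs K hK hKV g hg
    have hq : Continuous fun t => (inner ℝ (E.toL2 (z t)) (E.toL2 g) : ℝ) :=
      (E.ltwoL.flip g).continuous.comp hzc
    have he : Continuous fun t => E.energy (z t) g := (E.energyL.flip g).continuous.comp hzc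
    have hχd : Continuous (deriv χ) := hχ.continuous_deriv (by norm_num)
    -- the derivative at `s`, where the two pieces meet, exists by continuity of the derivatives
    have hd : ∀ t, HasDerivAt (fun t => χ t * (inner ℝ (E.toL2 (z t)) (E.toL2 g) : ℝ))
        (deriv χ t * inner ℝ (E.toL2 (z t)) (E.toL2 g) - χ t * E.energy (z t) g) t := by
      refine hasDerivAt_of_hasDerivAt_of_ne' (x := s)
        (g := fun t => deriv χ t * inner ℝ (E.toL2 (z t)) (E.toL2 g) - χ t * E.energy (z t) g)
        (fun t ht => ?_) (hχ.continuous.mul hq).continuousAt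
        ((hχd.mul hq).sub (hχ.continuous.mul he)).continuousAt
      rcases lt_or_gt_of_ne ht with hts | hts
      · have h1 : (fun t => χ t * (inner ℝ (E.toL2 (z t)) (E.toL2 g) : ℝ)) =ᶠ[𝓝 t] fun _ => 0 := by
          filter_upwards [Iio_mem_nhds hts] with r hr
          rw [hz]
          simp only [if_pos (le_of_lt (mem_Iio.1 hr)), map_zero, inner_zero_left, mul_zero]
        have h2 : z t = 0 := if_pos hts.le
        rw [h2]
        simp only [map_zero, inner_zero_left, mul_zero, LinearMap.zero_apply, sub_zero]
        exact (hasDerivAt_const t (0 : ℝ)).congr_of_eventuallyEq h1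
      · by_cases htb : t < b
        · have h2 : z t = y t := if_neg (not_le.2 hts)
          have h1 : (fun r => (inner ℝ (E.toL2 (z r)) (E.toL2 g) : ℝ))
              =ᶠ[𝓝 t] fun r => inner ℝ (E.toL2 (y r)) (E.toL2 g) := by
            filter_upwards [Ioi_mem_nhds hts] with r hr
            rw [hz]
            simp only [if_neg (not_le.2 (mem_Ioi.1 hr))]
          have h3 := (hyd K hK hKV g hg t ⟨hts, htb⟩).congr_of_eventuallyEq h1
          have h4 := ((hχ.differentiable (by norm_num) t).hasDerivAt).mul h3
          refine h4.congr_deriv ?_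
          rw [h2]; ring
        · have ht' : t ∉ tsupport χ := fun h => htb (hχs h).2
          have h1 : (fun t => χ t * (inner ℝ (E.toL2 (z t)) (E.toL2 g) : ℝ)) =ᶠ[𝓝 t] fun _ => 0 := by
            filter_upwards [(notMem_tsupport_iff_eventuallyEq.1 ht')] with r hr
            rw [hr, Pi.zero_apply, zero_mul]
          rw [image_eq_zero_of_notMem_tsupport ht', deriv_eq_zero_of_notMem_tsupport ht', zero_mul,
            zero_mul, sub_zero]
          exact (hasDerivAt_const t (0 : ℝ)).congr_of_eventuallyEq h1
    have i1 : Integrable fun t => deriv χ t * (inner ℝ (E.toL2 (z t)) (E.toL2 g) : ℝ) :=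
      (hχd.mul hq).integrable_of_hasCompactSupport hχc.deriv.mul_right
    have i2 : Integrable fun t => χ t * E.energy (z t) g :=
      (hχ.continuous.mul he).integrable_of_hasCompactSupport hχc.mul_right
    have h := integral_eq_zero_of_hasDerivAt_of_integrable hd (i1.sub i2)
      ((hχ.continuous.mul hq).integrable_of_hasCompactSupport hχc.mul_right)
    rw [integral_sub i1 i2] at h
    exact sub_eq_zero.1 h

end Extension

section Limits

variable {X : Type*} [MetricSpace X] [LocallyCompactSpace X] [SecondCountableTopology X]
  [MeasurableSpace X] [BorelSpace X]
  {μ : Measure X} [μ.Regular] [μ.IsOpenPosMeasure] {E : DirichletForm μ} {p : ℝ → X → X → ℝ}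

/-- Locally bounded pointwise limits of weak solutions are weak solutions. -/
theorem isWeakSolution_of_tendsto (hreg : E.IsRegular) (hloc : E.IsStrictlyLocal)
    (hp : E.IsContinuousHeatKernel p) (hP : E.IsHeatSemigroup E.semigroup) {r : ℝ} {U : Set X}
    (hU : IsOpen U) (hUn : E.IsNice U) {f : ℕ → ℝ × X → ℝ} {g : ℝ × X → ℝ}
    (hf : ∀ᶠ n in atTop, E.IsWeakSolution (Iio r) U (f n))
    (hb : ∀ K : Set X, IsCompact K → K ⊆ U → ∀ a b : ℝ, a < b → b < r → ∃ M : ℝ, 0 ≤ M ∧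
      ∀ᶠ n in atTop, ∀ᵐ t ∂volume.restrict (Ioo a b), ∀ᵐ x ∂μ, x ∈ K → |f n (t, x)| ≤ M)
    (hfg : ∀ᵐ t ∂volume.restrict (Iio r), ∀ᵐ x ∂μ, x ∈ U →
      Tendsto (fun n => f n (t, x)) atTop (𝓝 (g (t, x)))) :
    E.IsWeakSolution (Iio r) U g := by
  intro ψ A hA h a b hab
  rcases lt_or_ge b a with hba | hba
  · refine ⟨fun _ => 0, ⟨by simp, fun χ _ _ _ _ _ _ _ _ => ?_⟩, ?_⟩
    · simp
    · rw [Ioo_eq_empty (not_lt.2 hba.le), Measure.restrict_empty, ae_zero]; exact Filter.eventually_bot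
  have hbr : b < r := hab (right_mem_Icc.2 hba)
  set b' := (b + r) / 2 with hb'
  obtain ⟨A', hA', hA'1, hA'2⟩ := exists_compact_between h.hasCompactSupport.isCompact hU
    h.tsupport_subset
  obtain ⟨ψ', h'⟩ := hUn A' hA' hA'2
  obtain ⟨M, hM, hfM⟩ := hb _ h'.hasCompactSupport.isCompact h'.tsupport_subset (a - 1) b'
    (by linarith) (by linarith)
  obtain ⟨N, hN⟩ := (hf.and hfM).exists_forall_of_atTop
  choose v hv hvf using fun n => (hN (n + N) (Nat.le_add_left _ _)).1 ψ' A' hA' h' (a - 1) b'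
    fun t ht => by rw [mem_Iio]; linarith [ht.2]
  have hsub : Ioo a b ⊆ Ioo (a - 1) b' := Ioo_subset_Ioo (by linarith) (by linarith)
  have hvM : ∀ n, ∀ᵐ t ∂volume.restrict (Ioo (a - 1) b'), ∀ᵐ x ∂μ, |E.toL2 (v n t) x| ≤ M := by
    intro n
    filter_upwards [hvf n, (hN (n + N) (Nat.le_add_left _ _)).2] with t h1 h2
    filter_upwards [h1, h2] with x h3 h4
    rw [h3, abs_mul, abs_of_nonneg (h'.mem_Icc x).1]
    by_cases hx : x ∈ tsupport ψ'
    · exact (mul_le_of_le_one_left (abs_nonneg _) (h'.mem_Icc x).2).trans (h4 hx)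
    · rw [image_eq_zero_of_notMem_tsupport hx, zero_mul]; exact hM
  have hae : ∀ n, ∀ᵐ t ∂volume.restrict (Ioo a b),
      E.toL2 (h.mul (v n t)) =ᵐ[μ] fun x => ψ x * f (n + N) (t, x) := by
    intro n
    filter_upwards [ae_restrict_of_ae_restrict_of_subset hsub (hvf n)] with t h1
    filter_upwards [h.mul_ae (v n t), h1] with x h2 h3
    rw [h2, h3]
    by_cases hx : x ∈ tsupport ψ
    · rw [h'.eq_one x (interior_subset (hA'1 hx)), one_mul]
    · rw [image_eq_zero_of_notMem_tsupport hx, zero_mul, zero_mul]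
  obtain ⟨k, hk⟩ := h.exists_dom hreg
  have hIr : Ioo a b ⊆ Iio r := Ioo_subset_Icc_self.trans hab
  have hlim : ∀ᵐ t ∂volume.restrict (Ioo a b), ∃ q : Lp ℝ 2 μ,
      (q =ᵐ[μ] fun x => ψ x * g (t, x)) ∧
      Tendsto (fun n => E.toL2 (h.mul (v n t))) atTop (𝓝 q) := by
    filter_upwards [ae_all_iff.2 hae, ae_restrict_of_ae_restrict_of_subset hIr hfg,
      ae_all_iff.2 fun n => ae_restrict_of_ae_restrict_of_subset hsub (hvM n)] with t h1 h2 h3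
    have hlim1 : ∀ᵐ x ∂μ, Tendsto (fun n => E.toL2 (h.mul (v n t)) x) atTop
        (𝓝 (ψ x * g (t, x))) := by
      filter_upwards [ae_all_iff.2 h1, h2] with x h4 h5
      simp only [h4]
      by_cases hx : x ∈ tsupport ψ
      · exact ((tendsto_add_atTop_iff_nat N).2 (h5 (h.tsupport_subset hx))).const_mul _
      · rw [image_eq_zero_of_notMem_tsupport hx, zero_mul]
        simp only [zero_mul]
        exact tendsto_const_nhds
    have hdom : ∀ n, ∀ᵐ x ∂μ, |E.toL2 (h.mul (v n t)) x| ≤ |(M • E.toL2 k : Lp ℝ 2 μ) x| := by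
      intro n
      filter_upwards [h.mul_ae (v n t), h3 n, hk, Lp.coeFn_smul M (E.toL2 k)] with x h4 h5 h6 h7
      rw [h4, h7, Pi.smul_apply, h6, smul_eq_mul, abs_mul, abs_mul, mul_comm, abs_of_nonneg hM]
      exact mul_le_mul_of_nonneg_right h5 (abs_nonneg _)
    have hmem : MemLp (fun x => ψ x * g (t, x)) 2 μ := by
      refine (Lp.memLp (M • E.toL2 k)).mono (aestronglyMeasurable_of_tendsto_ae atTop
        (fun n => Lp.aestronglyMeasurable _) hlim1) ?_
      filter_upwards [hlim1, ae_all_iff.2 hdom] with x h4 h5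
      exact le_of_tendsto h4.abs (Eventually.of_forall h5)
    refine ⟨hmem.toLp, hmem.coeFn_toLp, tendsto_Lp_of_dominated hdom ?_⟩
    filter_upwards [hlim1, hmem.coeFn_toLp] with x h4 h5
    rwa [h5]
  have hch : ∀ t, ∃ q : Lp ℝ 2 μ, (∃ q : Lp ℝ 2 μ, (q =ᵐ[μ] fun x => ψ x * g (t, x)) ∧
      Tendsto (fun n => E.toL2 (h.mul (v n t))) atTop (𝓝 q)) →
      (q =ᵐ[μ] fun x => ψ x * g (t, x)) ∧
      Tendsto (fun n => E.toL2 (h.mul (v n t))) atTop (𝓝 q) := fun t => by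
    by_cases h0 : ∃ q : Lp ℝ 2 μ, (q =ᵐ[μ] fun x => ψ x * g (t, x)) ∧
      Tendsto (fun n => E.toL2 (h.mul (v n t))) atTop (𝓝 q)
    · exact ⟨h0.choose, fun _ => h0.choose_spec⟩
    · exact ⟨0, fun h1 => absurd h1 h0⟩
  choose q hq using hch
  obtain ⟨z, hz, hzq⟩ := exists_isWeakCurve_of_tendsto hreg hloc hp hP hv h hA'1 hM hvM
    (c := a) (d := b) (by linarith) hba (by linarith) (f := q) (by
      filter_upwards [hlim] with t ht
      exact (hq t ht).2)
  refine ⟨z, hz, ?_⟩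
  filter_upwards [hlim, hzq] with t h1 h2
  rw [h2]
  exact (hq t h1).1

end Limits

/-! ### Mollification of functions of time and space -/

section Slices

variable {X : Type*} [MeasurableSpace X] {μ : Measure X} [SFinite μ] {u : ℝ × X → ℝ}
  {K : Set X} {a b M : ℝ}

theorem _root_.Widder.ae_ae_le_of_ae_ae_le (hum : Measurable u) (hK : MeasurableSet K)
    (h : ∀ᵐ t ∂volume.restrict (Ioo a b), ∀ᵐ x ∂μ, x ∈ K → u (t, x) ≤ M) :
    ∀ᵐ x ∂μ, x ∈ K → ∀ᵐ t ∂volume.restrict (Ioo a b), u (t, x) ≤ M := by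
  have h1 := (Measure.ae_ae_comm (p := fun (t : ℝ) (x : X) => x ∈ K → u (t, x) ≤ M) (by
    have : {z : ℝ × X | z.2 ∈ K → u (z.1, z.2) ≤ M}
        = (Prod.snd ⁻¹' K)ᶜ ∪ {z | u z ≤ M} := by
      ext z
      simp only [mem_ofPred_eq, mem_union, mem_compl_iff, mem_preimage, Prod.mk.eta]
      exact imp_iff_not_or
    rw [this]
    exact (measurable_snd hK).compl.union (measurableSet_le hum measurable_const))).1 h
  filter_upwards [h1] with x hx hxK
  filter_upwards [hx] with t ht
  exact ht hxK

/-- Local bounds pass to the mollification, for all times simultaneously. -/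
theorem _root_.Widder.mollify_le (hum : Measurable u) (hu0 : ∀ z, 0 ≤ u z) (hK : MeasurableSet K)
    (h : ∀ᵐ t ∂volume.restrict (Ioo a b), ∀ᵐ x ∂μ, x ∈ K → u (t, x) ≤ M) :
    ∀ᵐ x ∂μ, x ∈ K → ∀ (j : ℕ) (t : ℝ), a + radius j ≤ t → t ≤ b - radius j →
      mollify j (fun r => u (r, x)) t ≤ M := by
  filter_upwards [ae_ae_le_of_ae_ae_le hum hK h] with x hx hxK j t h1 h2
  calc mollify j (fun r => u (r, x)) t ≤ ∫ r, mollifier j (t - r) * M := by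
        refine integral_mono_of_nonneg (Eventually.of_forall fun r =>
          mul_nonneg (mollifier_nonneg _ _) (hu0 _)) ?_ ?_
        · exact ((contDiff_mollifier_sub j t).continuous.integrable_of_hasCompactSupport
            (hasCompactSupport_mollifier_sub j t)).mul_const M
        · filter_upwards [(ae_restrict_iff' measurableSet_Ioo).1 (hx hxK)] with r hr
          by_cases hr' : r ∈ Ioo a b
          · exact mul_le_mul_of_nonneg_left (hr hr') (mollifier_nonneg _ _)
          · simp only [mollifier_sub_eq_zero h1 h2 hr', zero_mul, zero_smul, le_refl]
    _ = M := by rw [integral_mul_const, integral_mollifier_sub, one_mul]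

theorem _root_.Widder.mollify_nonneg (hu0 : ∀ z, 0 ≤ u z) (j : ℕ) (t : ℝ) (x : X) :
    0 ≤ mollify j (fun r => u (r, x)) t :=
  integral_nonneg fun _ => mul_nonneg (mollifier_nonneg _ _) (hu0 _)

/-- Mollifications of locally bounded functions converge almost everywhere. -/
theorem _root_.Widder.ae_ae_tendsto_mollify (hum : Measurable u)
    (hmm : ∀ j, Measurable fun z : ℝ × X => mollify j (fun r => u (r, z.2)) z.1)
    (hu0 : ∀ z, 0 ≤ u z) (hK : MeasurableSet K)
    (h : ∀ᵐ t ∂volume.restrict (Ioo a b), ∀ᵐ x ∂μ, x ∈ K → u (t, x) ≤ M) :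
    ∀ᵐ t ∂volume.restrict (Ioo a b), ∀ᵐ x ∂μ, x ∈ K →
      Tendsto (fun j => mollify j (fun r => u (r, x)) t) atTop (𝓝 (u (t, x))) := by
  refine (Measure.ae_ae_comm (p := fun (t : ℝ) (x : X) => x ∈ K →
    Tendsto (fun j => mollify j (fun r => u (r, x)) t) atTop (𝓝 (u (t, x)))) ?_).2 ?_
  · have : {z : ℝ × X | z.2 ∈ K → Tendsto (fun j => mollify j (fun r => u (r, z.2)) z.1) atTop
        (𝓝 (u (z.1, z.2)))} = (Prod.snd ⁻¹' K)ᶜ ∪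
          {z | Tendsto (fun j => mollify j (fun r => u (r, z.2)) z.1) atTop (𝓝 (u z))} := by
      ext z
      simp only [mem_ofPred_eq, mem_union, mem_compl_iff, mem_preimage, Prod.mk.eta]
      exact imp_iff_not_or
    rw [this]
    exact (measurable_snd hK).compl.union (measurableSet_tendsto_fun hmm hum)
  · filter_upwards [ae_ae_le_of_ae_ae_le hum hK h] with x hx
    by_cases hxK : x ∈ K
    swap
    · exact Eventually.of_forall fun t h => absurd h hxK
    have hi : Integrable ((Ioo a b).indicator fun t => u (t, x)) := by
      refine (integrable_indicator_iff measurableSet_Ioo).2 ?_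
      refine Measure.integrableOn_of_bounded (M := M) measure_Ioo_lt_top.ne
        (hum.comp (by fun_prop : Measurable fun t : ℝ => (t, x))).aestronglyMeasurable ?_
      filter_upwards [hx hxK] with t ht
      rwa [Real.norm_eq_abs, abs_of_nonneg (hu0 _)]
    filter_upwards [ae_restrict_of_ae (ae_tendsto_mollify hi), ae_restrict_mem measurableSet_Ioo]
      with t ht1 ht2 _
    rw [indicator_of_mem ht2] at ht1
    refine ht1.congr' ?_
    filter_upwards [tendsto_radius.eventually (gt_mem_nhds (sub_pos.2 ht2.1)),
      tendsto_radius.eventually (gt_mem_nhds (sub_pos.2 ht2.2))] with j h1 h2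
    refine mollify_congr_ae (a := a) (b := b) ?_ (by linarith) (by linarith)
    filter_upwards [ae_restrict_mem measurableSet_Ioo] with r hr
    rw [indicator_of_mem hr]

end Slices

end DirichletForm

/-! ### Removal of the heat flow of the initial value -/

namespace DirichletForm

section Remainder

variable {X : Type*} [MetricSpace X] [LocallyCompactSpace X] [SecondCountableTopology X]
  [MeasurableSpace X] [BorelSpace X]
  {μ : Measure X} [μ.Regular] [μ.IsOpenPosMeasure] {E : DirichletForm μ} {p : ℝ → X → X → ℝ}
  {T : EReal} {u : ℝ × X → ℝ}

/-- Nonnegative, locally bounded weak solutions on `(0, T) × X`, with a strongly measurable and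
everywhere nonnegative representative. -/
structure IsBoundedSolution (E : DirichletForm μ) (T : EReal) (u : ℝ × X → ℝ) : Prop where
  stronglyMeasurable : StronglyMeasurable u
  nonneg : ∀ z, 0 ≤ u z
  isWeakSolution : E.IsWeakSolution (timeIoo 0 T) univ u
  exists_bound : ∀ K : Set X, IsCompact K → ∀ a b : ℝ, 0 < a → a < b → (b : EReal) < T →
    ∃ M : ℝ, 0 ≤ M ∧ ∀ᵐ t ∂volume.restrict (Ioo a b), ∀ᵐ x ∂μ, x ∈ K → u (t, x) ≤ M

/-- The measure whose density is the mollified solution at time `2 * radius j`; it approximates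
the initial value of the solution. -/
noncomputable def initialMeasure (μ : Measure X) (u : ℝ × X → ℝ) (j : ℕ) : Measure X :=
  μ.withDensity fun x => ENNReal.ofReal (mollify j (fun r => u (r, x)) (2 * radius j))

/-- The difference of the mollified solution and the heat flow of a part of its value at time
`2 * radius j`, extended by zero to earlier times. -/
noncomputable def remainder (μ : Measure X) (p : ℝ → X → X → ℝ) (u : ℝ × X → ℝ) (c : X → ℝ)
    (j : ℕ) (z : ℝ × X) : ℝ :=
  if z.1 ≤ 2 * radius j then 0
  else mollify j (fun r => u (r, z.2)) z.1
    - ∫ y, p (z.1 - 2 * radius j) z.2 y * c y ∂initialMeasure μ u j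

theorem measurable_mollify_slice (hu : StronglyMeasurable u) (j : ℕ) (t : ℝ) :
    Measurable fun x => mollify j (fun r => u (r, x)) t :=
  ((stronglyMeasurable_mollify hu j).comp_measurable
    (by fun_prop : Measurable fun x : X => (t, x))).measurable

/-- The approximate initial measure has the mollified solution as its density. -/
theorem integral_initialMeasure (hu : StronglyMeasurable u) (hu0 : ∀ z, 0 ≤ u z) (j : ℕ)
    (f : X → ℝ) : ∫ x, f x ∂initialMeasure μ u j
      = ∫ x, f x * mollify j (fun r => u (r, x)) (2 * radius j) ∂μ := by
  rw [initialMeasure, integral_withDensity_eq_integral_toReal_smul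
    (measurable_mollify_slice hu j _).ennreal_ofReal
    (Eventually.of_forall fun _ => ENNReal.ofReal_lt_top)]
  refine integral_congr_ae (Eventually.of_forall fun x => ?_)
  simp only [ENNReal.toReal_ofReal (mollify_nonneg hu0 j _ x), smul_eq_mul, mul_comm]

namespace IsBoundedSolution

theorem exists_mollify_le (hu : E.IsBoundedSolution T u) {K : Set X} (hK : IsCompact K)
    {a b : ℝ} (ha : 0 < a) (hb : (b : EReal) < T) :
    ∃ M : ℝ, 0 ≤ M ∧ ∀ᵐ x ∂μ, x ∈ K → ∀ (j : ℕ) (t : ℝ), a + radius j ≤ t → t ≤ b - radius j →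
      mollify j (fun r => u (r, x)) t ≤ M := by
  rcases lt_or_ge a b with hab | hab
  · obtain ⟨M, hM, h⟩ := hu.exists_bound K hK a b ha hab hb
    exact ⟨M, hM, mollify_le hu.stronglyMeasurable.measurable hu.nonneg hK.isClosed.measurableSet h⟩
  · refine ⟨0, le_rfl, Eventually.of_forall fun x _ j t h1 h2 => ?_⟩
    linarith [radius_pos j]

theorem isFiniteMeasureOnCompacts (hu : E.IsBoundedSolution T u) {j : ℕ} {b : ℝ}
    (hj : 3 * radius j < b) (hb : (b : EReal) < T) :
    IsFiniteMeasureOnCompacts (initialMeasure μ u j) := by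
  refine ⟨fun K hK => ?_⟩
  have hr := radius_pos j
  obtain ⟨M, hM, h⟩ := hu.exists_mollify_le hK (half_pos hr) hb
  rw [initialMeasure, withDensity_apply _ hK.isClosed.measurableSet]
  refine (setLIntegral_mono_ae (g := fun _ => ENNReal.ofReal M) measurable_const.aemeasurable
    ?_).trans_lt ?_
  · filter_upwards [h] with x hx hxK
    exact ENNReal.ofReal_le_ofReal (hx hxK j _ (by linarith) (by linarith))
  · rw [setLIntegral_const]
    exact ENNReal.mul_lt_top ENNReal.ofReal_lt_top hK.measure_lt_top

variable {c : X → ℝ} {g : E.Dom} {j : ℕ} {b₀ : ℝ}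

/-- The cut-off initial value is in the form domain, because the bounded functions in the form
domain form an algebra. -/
theorem exists_dom_mul (hreg : E.IsRegular) (hp : E.IsContinuousHeatKernel p)
    (hP : E.IsHeatSemigroup E.semigroup) (hnice : E.HasNiceExhaustion)
    (hu : E.IsBoundedSolution T u) (hc : HasCompactSupport c)
    (hcI : ∀ x, c x ∈ Icc (0 : ℝ) 1) (hg : E.toL2 g =ᵐ[μ] c)
    (hj : 3 * radius j < b₀) (hb₀ : (b₀ : EReal) < T) :
    ∃ w : E.Dom, E.toL2 w =ᵐ[μ] fun x => c x * mollify j (fun r => u (r, x)) (2 * radius j) := by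
  have hr := radius_pos j
  obtain ⟨A, hA, hcA⟩ := exists_compact_superset hc.isCompact
  obtain ⟨ψ, hψ⟩ := hnice.isNice_univ A hA (subset_univ _)
  obtain ⟨v, hv, hvu⟩ := hu.isWeakSolution ψ A hA hψ (radius j / 2) b₀ fun t ht =>
    ⟨by exact_mod_cast (half_pos hr).trans_le ht.1,
      lt_of_le_of_lt (by exact_mod_cast ht.2) hb₀⟩
  have h1 := toL2_mollify_ae hu.stronglyMeasurable (hψ.aestronglyMeasurable hreg) hv.integrable hvu
    (j := j) (t := 2 * radius j) (by linarith) (by linarith)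
  obtain ⟨M, hM, hMu⟩ := hu.exists_mollify_le hψ.hasCompactSupport.isCompact (half_pos hr) hb₀
  obtain ⟨w, hw⟩ := hp.exists_mul hP (M := max M 1) g
    (mollify j ((Ioo (radius j / 2) b₀).indicator v) (2 * radius j)) (by
      filter_upwards [hg] with x hx
      rw [hx, abs_of_nonneg (hcI x).1]
      exact (hcI x).2.trans (le_max_right _ _)) (by
      filter_upwards [h1, hMu] with x h2 h3
      rw [h2, abs_of_nonneg (mul_nonneg (hψ.mem_Icc x).1 (mollify_nonneg hu.nonneg _ _ _))]
      by_cases hx : x ∈ tsupport ψ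
      · exact (mul_le_of_le_one_left (mollify_nonneg hu.nonneg _ _ _) (hψ.mem_Icc x).2).trans
          ((h3 hx j _ (by linarith) (by linarith)).trans (le_max_left _ _))
      · rw [image_eq_zero_of_notMem_tsupport hx, zero_mul]
        exact hM.trans (le_max_left _ _))
  refine ⟨w, ?_⟩
  filter_upwards [hw, hg, h1] with x h2 h3 h4
  rw [h2, h3, h4]
  by_cases hx : x ∈ tsupport c
  · rw [hψ.eq_one x (interior_subset (hcA hx)), one_mul]
  · rw [image_eq_zero_of_notMem_tsupport hx, zero_mul, zero_mul]

/-- The heat flow of the cut-off initial value is an integral against the approximate initial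
measure. -/
theorem semigroup_eq (hp : E.IsContinuousHeatKernel p) (hu : E.IsBoundedSolution T u) {w : E.Dom}
    (hw : E.toL2 w =ᵐ[μ] fun x => c x * mollify j (fun r => u (r, x)) (2 * radius j)) {t : ℝ}
    (ht : 0 < t) : E.semigroup t.toNNReal (E.toL2 w)
      =ᵐ[μ] fun x => ∫ y, p t x y * c y ∂initialMeasure μ u j := by
  filter_upwards [hp.semigroup_ae ht (E.toL2 w)] with x hx
  rw [hx, integral_initialMeasure hu.stronglyMeasurable hu.nonneg]
  refine integral_congr_ae ?_
  filter_upwards [hw] with y hy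
  rw [hy, mul_assoc]

/-- Where the cutoff is one, the solution and the heat flow of its cut-off initial value start
from the same value, so that their difference extends by zero to a weak solution. -/
theorem remainder_isWeakSolution (hreg : E.IsRegular) (hloc : E.IsStrictlyLocal)
    (hp : E.IsContinuousHeatKernel p) (hP : E.IsHeatSemigroup E.semigroup)
    (hnice : E.HasNiceExhaustion) (hu : E.IsBoundedSolution T u) (hc : HasCompactSupport c)
    (hcI : ∀ x, c x ∈ Icc (0 : ℝ) 1) (hg : E.toL2 g =ᵐ[μ] c) {U : Set X} (hcU : ∀ x ∈ U, c x = 1)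
    {r : ℝ} (hj : 3 * radius j < b₀) (hr : r + radius j < b₀) (hb₀ : (b₀ : EReal) < T) :
    E.IsWeakSolution (Iio r) U (remainder μ p u c j) := by
  intro ψ A hA h a b hab
  have hrj := radius_pos j
  rcases lt_or_ge b a with hba | hba
  · refine ⟨fun _ => 0, ⟨by simp, fun χ _ _ _ _ _ _ _ _ => ?_⟩, ?_⟩
    · simp
    · rw [Ioo_eq_empty (not_lt.2 hba.le), Measure.restrict_empty, ae_zero]
      exact Filter.eventually_bot
  have hbr : b < r := hab (right_mem_Icc.2 hba)
  obtain ⟨w, hw⟩ := hu.exists_dom_mul hreg hp hP hnice hc hcI hg hj hb₀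
  obtain ⟨v, hv, hvu⟩ := hu.isWeakSolution ψ A hA (h.mono (subset_univ _)) (radius j / 2) b₀
    fun t ht => ⟨by exact_mod_cast (half_pos hrj).trans_le ht.1,
      lt_of_le_of_lt (by exact_mod_cast ht.2) hb₀⟩
  set s := 2 * radius j with hs
  set y : ℝ → E.Dom := fun t => mollify j ((Ioo (radius j / 2) b₀).indicator v) t
    - h.mul (hP.dom (t - s).toNNReal w) with hy
  have hmoll : ∀ t, s ≤ t → t ≤ b₀ - radius j →
      E.toL2 (mollify j ((Ioo (radius j / 2) b₀).indicator v) t)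
        =ᵐ[μ] fun x => ψ x * mollify j (fun r => u (r, x)) t := fun t h1 h2 =>
    toL2_mollify_ae hu.stronglyMeasurable (h.aestronglyMeasurable hreg) hv.integrable hvu
      (by linarith) h2
  refine ⟨fun t => if t ≤ s then 0 else y t, isWeakCurve_extend ?_ ?_ ?_, ?_⟩
  · exact (continuous_mollify j hv.integrable).sub (h.mul.continuous.comp
      ((hP.continuous_dom w).comp (continuous_real_toNNReal.comp (by fun_prop))))
  · refine sub_eq_zero.2 (toL2_ext ?_)
    rw [sub_self, Real.toNNReal_zero, hP.dom_zero]
    filter_upwards [hmoll s le_rfl (by linarith), h.mul_ae w, hw] with x h1 h2 h3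
    rw [h1, h2, h3]
    by_cases hx : x ∈ tsupport ψ
    · rw [hcU x (h.tsupport_subset hx), one_mul]
    · rw [image_eq_zero_of_notMem_tsupport hx, zero_mul, zero_mul]
  · intro K hK hKA f hf t ht
    obtain ⟨d, hd, hd2⟩ := hv.exists_hasDerivAt_mollify (j := j) (t := t) (by linarith [ht.1])
      (by linarith [ht.2])
    have h1 : HasDerivAt (fun r => (inner ℝ (E.toL2 (mollify j
        ((Ioo (radius j / 2) b₀).indicator v) r)) (E.toL2 f) : ℝ)) (inner ℝ (E.toL2 d) (E.toL2 f)) t :=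
      (E.ltwoL.flip f).hasFDerivAt.comp_hasDerivAt t hd
    have h2 := (hP.hasDerivAt_inner w f (sub_pos.2 ht.1)).comp_sub_const t s
    have h3 := h1.sub h2
    rw [hd2 K hK hKA f hf] at h3
    refine (h3.congr_deriv ?_).congr_of_eventuallyEq (Eventually.of_forall fun r => ?_)
    · rw [hy]
      simp only [map_sub, LinearMap.sub_apply, h.energy_mul hreg hloc hK hKA _ hf]
      ring
    · simp only [hy, map_sub, inner_sub_left, h.inner_mul,
        h.mul_eq_self (supported_mono (hKA.trans interior_subset) hf), hP.toL2_dom, Pi.sub_apply]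
  · filter_upwards [ae_restrict_mem measurableSet_Ioo] with t ht
    by_cases hts : t ≤ s
    · simp only [remainder, ← hs, if_pos hts, map_zero, mul_zero]
      exact Lp.coeFn_zero ℝ 2 μ
    · have hts' := sub_pos.2 (not_le.1 hts)
      simp only [remainder, ← hs, if_neg hts]
      filter_upwards [toL2_sub_ae (mollify j ((Ioo (radius j / 2) b₀).indicator v) t)
        (h.mul (hP.dom (t - s).toNNReal w)), hmoll t (not_le.1 hts).le (by linarith [ht.2]),
        h.mul_ae (hP.dom (t - s).toNNReal w), hu.semigroup_eq hp hw hts'] with x h1 h2 h3 h4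
      rw [hy]
      simp only
      rw [h1, h2, h3, hP.toL2_dom, h4, mul_sub]

/-- Comparison of the solution with the heat flow of its cut-off initial value. -/
theorem remainder_nonneg (hreg : E.IsRegular)
    (hp : E.IsContinuousHeatKernel p) (hP : E.IsHeatSemigroup E.semigroup)
    (hnice : E.HasNiceExhaustion) (hu : E.IsBoundedSolution T u) (hc : HasCompactSupport c)
    (hcI : ∀ x, c x ∈ Icc (0 : ℝ) 1) (hg : E.toL2 g =ᵐ[μ] c)
    {t : ℝ} (hj : 3 * radius j < b₀) (ht : t + radius j < b₀) (hb₀ : (b₀ : EReal) < T) :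
    ∀ᵐ x ∂μ, 0 ≤ remainder μ p u c j (t, x) := by
  have hrj := radius_pos j
  by_cases hts : t ≤ 2 * radius j
  · exact Eventually.of_forall fun x => by rw [remainder, if_pos hts]
  obtain ⟨w, hw⟩ := hu.exists_dom_mul hreg hp hP hnice hc hcI hg hj hb₀
  have h1 := hu.isWeakSolution.semigroup_le hreg hnice hP hu.stronglyMeasurable
    (Eventually.of_forall fun t => Eventually.of_forall fun x => hu.nonneg _)
    (a := radius j / 2) (b := b₀) (s := 2 * radius j) (t := t) (j := j)
    (fun t ht => ⟨by exact_mod_cast (half_pos hrj).trans_le ht.1,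
      lt_of_le_of_lt (by exact_mod_cast ht.2) hb₀⟩) (by linarith) (not_le.1 hts).le (by linarith)
    (w := E.toL2 w) hc.isCompact (by
      filter_upwards [hw] with x h2 h3
      rw [h2, image_eq_zero_of_notMem_tsupport h3, zero_mul]) (by
      filter_upwards [hw] with x h2
      rw [h2]
      exact mul_le_of_le_one_left (mollify_nonneg hu.nonneg _ _ _) (hcI x).2)
    (Eventually.of_forall fun x => mollify_nonneg hu.nonneg _ _ _)
  filter_upwards [h1, hu.semigroup_eq hp hw (sub_pos.2 (not_le.1 hts))] with x h2 h3
  rw [remainder, if_neg hts, sub_nonneg]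
  simp only
  rw [← h3]
  exact h2

theorem remainder_le (hp : E.IsContinuousHeatKernel p)
    (hP : E.IsHeatSemigroup E.semigroup) (hu : E.IsBoundedSolution T u)
    (hcI : ∀ x, c x ∈ Icc (0 : ℝ) 1) (t : ℝ) (x : X) :
    remainder μ p u c j (t, x) ≤ mollify j (fun r => u (r, x)) t := by
  rw [remainder]
  split_ifs with hts
  · exact mollify_nonneg hu.nonneg _ _ _
  · refine sub_le_self _ (integral_nonneg fun y => mul_nonneg ?_ (hcI y).1)
    exact hp.nonneg hP (sub_pos.2 (not_le.1 hts)) _ _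

theorem stronglyMeasurable_remainder (hp : E.IsContinuousHeatKernel p)
    (hu : E.IsBoundedSolution T u) (hcc : Continuous c) (hc : HasCompactSupport c)
    (hj : 3 * radius j < b₀) (hb₀ : (b₀ : EReal) < T) :
    StronglyMeasurable (remainder μ p u c j) := by
  have := hu.isFiniteMeasureOnCompacts hj hb₀
  refine Measurable.stronglyMeasurable ?_
  have h1 : ContinuousOn (fun z : ℝ × X => ∫ y, p (z.1 - 2 * radius j) z.2 y * c y
      ∂initialMeasure μ u j) (Ioi (2 * radius j) ×ˢ univ) :=
    (continuousOn_integral_kernel hp.continuousOn hcc hc (initialMeasure μ u j)).comp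
      (f := fun z : ℝ × X => (z.1 - 2 * radius j, z.2)) (by fun_prop)
      fun z hz => ⟨mem_Ioi.2 (sub_pos.2 hz.1), trivial⟩
  classical
  have h2 := h1.measurable_piecewise (g := fun _ => 0) continuousOn_const
    (measurableSet_Ioi.prod MeasurableSet.univ)
  have h3 : Measurable fun z : ℝ × X => if z.1 ≤ 2 * radius j then (0 : ℝ) else
      mollify j (fun r => u (r, z.2)) z.1 - ((Ioi (2 * radius j) ×ˢ univ).piecewise
        (fun z : ℝ × X => ∫ y, p (z.1 - 2 * radius j) z.2 y * c y ∂initialMeasure μ u j)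
        fun _ => 0) z :=
    Measurable.ite (measurableSet_le measurable_fst measurable_const) measurable_const
      ((stronglyMeasurable_mollify hu.stronglyMeasurable j).measurable.sub h2)
  convert h3 using 1
  funext z
  by_cases hz : z.1 ≤ 2 * radius j
  · rw [remainder, if_pos hz, if_pos hz]
  · rw [remainder, if_neg hz, if_neg hz,
      piecewise_eq_of_mem _ _ _ (mk_mem_prod (mem_Ioi.2 (not_le.1 hz)) (mem_univ _))]

end IsBoundedSolution

end Remainder

end DirichletForm

/-! ### Approximate initial measures -/

namespace DirichletForm

section InitialMass

variable {X : Type*} [MetricSpace X] [LocallyCompactSpace X] [SecondCountableTopology X]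
  [MeasurableSpace X] [BorelSpace X]
  {μ : Measure X} [μ.Regular] [μ.IsOpenPosMeasure] {E : DirichletForm μ} {p : ℝ → X → X → ℝ}
  {T : EReal} {u : ℝ × X → ℝ}

namespace IsBoundedSolution

/-- The approximate initial measures are bounded on sets where the heat flow of a fixed function is
not small: test the domination of the heat flow by the solution with that function. -/
theorem exists_mass_bound_of_flow (hreg : E.IsRegular) (hp : E.IsContinuousHeatKernel p)
    (hP : E.IsHeatSemigroup E.semigroup) (hnice : E.HasNiceExhaustion)
    (hu : E.IsBoundedSolution T u) {b : ℝ} (hb : (b : EReal) < T) {K : Set X} (hK : IsCompact K)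
    {f : X → ℝ} (hf : Continuous f) (hfc : HasCompactSupport f) (hf0 : ∀ x, 0 ≤ f x)
    {r : ℝ} (hr : 0 < r) :
    ∃ B : ℝ≥0, ∀ j, 3 * radius j + r < b → initialMeasure μ u j
      (K ∩ {x | 1 / 2 < ∫ y, p r x y * f y ∂μ}) ≤ B := by
  obtain ⟨M, hM, hMu⟩ := hu.exists_mollify_le hfc.isCompact hr hb
  obtain ⟨g, c, hcc, hcs, hcI, hc1, hg⟩ := exists_cutoff hreg hK
  refine ⟨(2 * (M * ∫ x, f x ∂μ)).toNNReal, fun j hj => ?_⟩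
  have hrj := radius_pos j
  obtain ⟨w, hw⟩ := hu.exists_dom_mul hreg hp hP hnice hcs hcI hg (j := j) (b₀ := b)
    (by linarith) hb
  set s := 2 * radius j with hs
  have h1 : ∀ᵐ x ∂μ, E.semigroup r.toNNReal (E.toL2 w) x ≤ mollify j (fun r => u (r, x)) (s + r) := by
    filter_upwards [hu.remainder_nonneg hreg hp hP hnice hcs hcI hg (j := j) (t := s + r) (b₀ := b)
      (by linarith) (by linarith) hb, hu.semigroup_eq hp hw hr] with x h2 h3
    rw [remainder, if_neg (by simp only; linarith), sub_nonneg] at h2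
    simp only [← hs, add_sub_cancel_left] at h2
    rw [h3]; exact h2
  have h2 : (inner ℝ (E.semigroup r.toNNReal (E.toL2 w)) (ltwo μ f hf hfc) : ℝ)
      ≤ M * ∫ x, f x ∂μ := by
    rw [inner_eq_integral, ← integral_const_mul]
    refine integral_mono_ae (integrable_mul _ _)
      ((hf.integrable_of_hasCompactSupport hfc).const_mul M) ?_
    filter_upwards [h1, hMu, ltwo_ae (μ := μ) hf hfc] with x h3 h4 h5
    rw [h5]
    by_cases hx : x ∈ tsupport f
    · exact mul_le_mul_of_nonneg_right (h3.trans (h4 hx j (s + r) (by linarith) (by linarith)))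
        (hf0 x)
    · rw [image_eq_zero_of_notMem_tsupport hx, mul_zero, mul_zero]
  rw [hP.inner_symm, real_inner_comm, inner_eq_integral] at h2
  have hG : ∀ᵐ x ∂μ, 0 ≤ E.semigroup r.toNNReal (ltwo μ f hf hfc) x := by
    refine hP.apply_nonneg _ _ ?_
    filter_upwards [ltwo_ae (μ := μ) hf hfc] with x hx
    rw [hx]; exact hf0 x
  have hGw : ∀ᵐ x ∂μ, 0 ≤ E.semigroup r.toNNReal (ltwo μ f hf hfc) x * E.toL2 w x := by
    filter_upwards [hG, hw] with x h3 h4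
    rw [h4]
    exact mul_nonneg h3 (mul_nonneg (hcI x).1 (mollify_nonneg hu.nonneg _ _ _))
  have hSm : MeasurableSet (K ∩ {x | 1 / 2 < ∫ y, p r x y * f y ∂μ}) :=
    hK.isClosed.measurableSet.inter (measurableSet_lt measurable_const
      (continuous_integral_kernel hp.continuousOn hf hfc μ hr).measurable)
  rw [initialMeasure, withDensity_apply _ hSm]
  calc ∫⁻ x in K ∩ {x | 1 / 2 < ∫ y, p r x y * f y ∂μ},
        ENNReal.ofReal (mollify j (fun r => u (r, x)) s) ∂μ
      ≤ ∫⁻ x in K ∩ {x | 1 / 2 < ∫ y, p r x y * f y ∂μ},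
        ENNReal.ofReal (2 * (E.semigroup r.toNNReal (ltwo μ f hf hfc) x * E.toL2 w x)) ∂μ := by
        refine lintegral_mono_ae ((ae_restrict_iff' hSm).2 ?_)
        filter_upwards [hw, hp.semigroup_ltwo_ae hr hf hfc] with x h3 h4 hx
        refine ENNReal.ofReal_le_ofReal ?_
        rw [h3, h4, hc1 x hx.1, one_mul]
        have h5 := mollify_nonneg hu.nonneg j s x
        have h6 : 1 / 2 < ∫ y, p r x y * f y ∂μ := hx.2
        nlinarith
    _ ≤ ∫⁻ x, ENNReal.ofReal (2 * (E.semigroup r.toNNReal (ltwo μ f hf hfc) x * E.toL2 w x)) ∂μ :=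
        setLIntegral_le_lintegral _ _
    _ = ENNReal.ofReal (2 * ∫ x, E.semigroup r.toNNReal (ltwo μ f hf hfc) x * E.toL2 w x ∂μ) := by
        rw [← integral_const_mul, ofReal_integral_eq_lintegral_ofReal
          ((integrable_mul _ _).const_mul 2)]
        filter_upwards [hGw] with x hx
        exact mul_nonneg zero_le_two hx
    _ ≤ _ := ENNReal.ofReal_le_ofReal (by linarith)

/-- By comparison the solution dominates the heat flow of its initial measure. Each point of the
compact set has a neighbourhood on which, at some short time, the flow of a bump function exceeds
`1 / 2`, and which therefore has bounded mass; finitely many of these cover. -/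
theorem exists_mass_bound (hreg : E.IsRegular) (hp : E.IsContinuousHeatKernel p)
    (hp0 : ∀ f : X → ℝ, Continuous f → HasCompactSupport f → ∀ x : X,
      Tendsto (fun t : ℝ => ∫ y, p t x y * f y ∂μ) (𝓝[>] 0) (𝓝 (f x)))
    (hP : E.IsHeatSemigroup E.semigroup) (hnice : E.HasNiceExhaustion)
    (hu : E.IsBoundedSolution T u) {b : ℝ} (hb : (b : EReal) < T) {K : Set X} (hK : IsCompact K)
    {l : ℝ} (hlb : l < b) :
    ∃ B : ℝ≥0, ∀ j, 3 * radius j ≤ l → initialMeasure μ u j K ≤ B := by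
  obtain ⟨f, hf, hfc, -, hfI, hf1⟩ := exists_bump_one K hK univ isOpen_univ (subset_univ _)
  refine hK.induction_on (p := fun S => ∃ B : ℝ≥0, ∀ j, 3 * radius j ≤ l →
    initialMeasure μ u j S ≤ B) ⟨0, by simp⟩ ?_ ?_ ?_
  · rintro S S' hS ⟨B, hB⟩
    exact ⟨B, fun j hj => (measure_mono hS).trans (hB j hj)⟩
  · rintro S S' ⟨B, hB⟩ ⟨B', hB'⟩
    refine ⟨B + B', fun j hj => (measure_union_le _ _).trans ?_⟩
    rw [ENNReal.coe_add]
    exact add_le_add (hB j hj) (hB' j hj)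
  · intro x hx
    have h1 : ∀ᶠ r in 𝓝[>] (0 : ℝ), 1 / 2 < ∫ y, p r x y * f y ∂μ :=
      (hp0 f hf hfc x).eventually (lt_mem_nhds (by rw [hf1 x hx]; norm_num))
    have h2 : ∀ᶠ r in 𝓝[>] (0 : ℝ), r < b - l :=
      eventually_nhdsWithin_of_eventually_nhds (gt_mem_nhds (sub_pos.2 hlb))
    obtain ⟨r, ⟨h3, h4⟩, h5⟩ := ((h1.and h2).and self_mem_nhdsWithin).exists
    obtain ⟨B, hB⟩ := hu.exists_mass_bound_of_flow hreg hp hP hnice hb hK hf hfc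
      (fun x => (hfI x).1) h5
    refine ⟨_, inter_mem_nhdsWithin K (IsOpen.mem_nhds ?_ h3), B, fun j hj => hB j (by linarith)⟩
    exact isOpen_lt continuous_const (continuous_integral_kernel hp.continuousOn hf hfc μ h5)

end IsBoundedSolution

/-- Convergence of the heat flows of vaguely convergent measures. -/
theorem _root_.Widder.tendsto_integral_kernel
    (hp : ContinuousOn (fun z : ℝ × X × X => p z.1 z.2.1 z.2.2) (Ioi (0 : ℝ) ×ˢ univ))
    {m : ℕ → Measure X} {ν : Measure X} [∀ j, IsFiniteMeasureOnCompacts (m j)]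
    (hν : ∀ f : X → ℝ, Continuous f → HasCompactSupport f →
      Tendsto (fun j => ∫ x, f x ∂m j) atTop (𝓝 (∫ x, f x ∂ν)))
    (hm : ∀ K : Set X, IsCompact K → ∃ B : ℝ≥0, ∀ j, m j K ≤ B) {c : X → ℝ} (hc : Continuous c)
    (hcc : HasCompactSupport c) {s : ℕ → ℝ} (hs : Tendsto s atTop (𝓝 0)) {t : ℝ} (ht : 0 < t)
    (x : X) :
    Tendsto (fun j => ∫ y, p (t - s j) x y * c y ∂m j) atTop (𝓝 (∫ y, p t x y * c y ∂ν)) := by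
  obtain ⟨B, hB⟩ := hm _ hcc.isCompact
  have hcont : ContinuousOn (Function.uncurry fun (r : ℝ) (y : X) => p r x y * c y)
      (Ioi 0 ×ˢ tsupport c) := by
    refine ContinuousOn.mul ?_ (by fun_prop)
    exact hp.comp (f := fun w : ℝ × X => (w.1, x, w.2)) (by fun_prop)
      fun w hw => ⟨hw.1, trivial⟩
  have hr : ∀ r : ℝ, 0 < r → Continuous fun y => p r x y * c y := fun r hr =>
    Continuous.mul (hp.comp_continuous (f := fun y : X => (r, x, y)) (by fun_prop)
      fun y => ⟨hr, trivial⟩) hc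
  -- times are truncated below so that they are positive for every `j`
  have hs' : ∀ᶠ j in atTop, max (t - s j) (t / 2) = t - s j := by
    filter_upwards [hs.eventually (gt_mem_nhds (half_pos ht))] with j hj
    exact max_eq_left (by linarith)
  have hpos : ∀ j, 0 < max (t - s j) (t / 2) := fun j => lt_max_of_lt_right (half_pos ht)
  have key : Tendsto (fun j => ∫ y, p (max (t - s j) (t / 2)) x y * c y ∂m j) atTop
      (𝓝 (∫ y, p t x y * c y ∂ν)) := by
    refine tendsto_integral_of_tendstoUniformlyOn hν hcc.isCompact hB (hr t ht)
      (fun y hy => by rw [image_eq_zero_of_notMem_tsupport hy, mul_zero])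
      (fun j => (hr _ (hpos j)).integrable_of_hasCompactSupport hcc.mul_left)
      (fun j => (hr t ht).integrable_of_hasCompactSupport hcc.mul_left)
      (fun j y hy => by rw [image_eq_zero_of_notMem_tsupport hy, mul_zero]) ?_
    refine Metric.tendstoUniformlyOn_iff.2 fun ε hε => ?_
    obtain ⟨v, hv, hv2⟩ := hcc.isCompact.mem_uniformity_of_prod hcont (mem_Ioi.2 ht)
      (Metric.dist_mem_uniformity hε)
    rw [nhdsWithin_eq_nhds.2 (Ioi_mem_nhds ht)] at hv
    have h1 : Tendsto (fun j => t - s j) atTop (𝓝 t) := by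
      simpa using tendsto_const_nhds.sub hs
    filter_upwards [h1 hv, hs'] with j h2 h3 y hy
    rw [h3, dist_comm]
    exact hv2 _ h2 y hy
  refine key.congr' ?_
  filter_upwards [hs'] with j hj
  rw [hj]

end InitialMass

end DirichletForm

/-! ### The limit of the approximate initial measures -/

namespace DirichletForm

section InitialLimit

variable {X : Type*} [MetricSpace X] [LocallyCompactSpace X] [SecondCountableTopology X]
  [MeasurableSpace X] [BorelSpace X]
  {μ : Measure X} [μ.Regular] [μ.IsOpenPosMeasure] {E : DirichletForm μ} {p : ℝ → X → X → ℝ}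
  {T : EReal} {u : ℝ × X → ℝ}

/-- `ν` is the vague limit of the approximate initial measures along the sequence `σ`. -/
structure IsInitialLimit (μ : Measure X) (u : ℝ × X → ℝ) (σ : ℕ → ℕ) (ν : Measure X) : Prop where
  tendsto : Tendsto σ atTop atTop
  finite : ∀ k, IsFiniteMeasureOnCompacts (initialMeasure μ u (σ k))
  exists_bound : ∀ K : Set X, IsCompact K → ∃ B : ℝ≥0, ∀ k, initialMeasure μ u (σ k) K ≤ B
  regular : ν.Regular
  tendsto_integral : ∀ f : X → ℝ, Continuous f → HasCompactSupport f →
    Tendsto (fun k => ∫ x, f x ∂initialMeasure μ u (σ k)) atTop (𝓝 (∫ x, f x ∂ν))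

/-- Vague compactness of the approximate initial measures. -/
theorem IsBoundedSolution.exists_isInitialLimit (hreg : E.IsRegular)
    (hp : E.IsContinuousHeatKernel p)
    (hp0 : ∀ f : X → ℝ, Continuous f → HasCompactSupport f → ∀ x : X,
      Tendsto (fun t : ℝ => ∫ y, p t x y * f y ∂μ) (𝓝[>] 0) (𝓝 (f x)))
    (hP : E.IsHeatSemigroup E.semigroup) (hnice : E.HasNiceExhaustion) (hT : 0 < T)
    (hu : E.IsBoundedSolution T u) : ∃ σ ν, IsInitialLimit μ u σ ν := by
  obtain ⟨b, hb0, hb⟩ := EReal.lt_iff_exists_real_btwn.1 hT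
  have hb0' : 0 < b := by exact_mod_cast hb0
  have h1 : ∀ᶠ j in atTop, 3 * radius j ≤ b / 2 := by
    filter_upwards [tendsto_radius.eventually (gt_mem_nhds (show 0 < b / 6 by linarith))] with j hj
    linarith
  obtain ⟨J, hJ⟩ := h1.exists_forall_of_atTop
  have hbd : ∀ K : Set X, IsCompact K → ∃ B : ℝ≥0, ∀ j, initialMeasure μ u (j + J) K ≤ B := by
    intro K hK
    obtain ⟨B, hB⟩ := hu.exists_mass_bound hreg hp hp0 hP hnice hb hK (half_lt_self hb0')
    exact ⟨B, fun j => hB _ (hJ _ (Nat.le_add_left _ _))⟩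
  obtain ⟨φ, ν, hφ, hν, hlim⟩ := exists_tendsto_vague (fun j => initialMeasure μ u (j + J)) hbd
  refine ⟨fun k => φ k + J, ν, tendsto_atTop_mono (fun k => Nat.le_add_right _ _) hφ.tendsto_atTop, fun k => ?_,
    fun K hK => ?_, hν, hlim⟩
  · exact hu.isFiniteMeasureOnCompacts (b := b)
      ((hJ _ (Nat.le_add_left _ _)).trans_lt (half_lt_self hb0')) hb
  · obtain ⟨B, hB⟩ := hbd K hK
    exact ⟨B, fun k => hB _⟩

/-- The difference of the solution and the heat flow of a part of its initial measure, extended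
by zero to nonpositive times. -/
noncomputable def limitRemainder (p : ℝ → X → X → ℝ) (u : ℝ × X → ℝ) (c : X → ℝ) (ν : Measure X)
    (z : ℝ × X) : ℝ :=
  if z.1 ≤ 0 then 0 else u z - ∫ y, p z.1 z.2 y * c y ∂ν

theorem tendsto_two_radius {σ : ℕ → ℕ} (hσ : Tendsto σ atTop atTop) :
    Tendsto (fun k => 2 * radius (σ k)) atTop (𝓝 0) := by
  simpa using (tendsto_radius.comp hσ).const_mul 2

theorem IsInitialLimit.tendsto_flow (hp : E.IsContinuousHeatKernel p) {σ : ℕ → ℕ} {ν : Measure X}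
    (h : IsInitialLimit μ u σ ν) {c : X → ℝ} (hcc : Continuous c) (hc : HasCompactSupport c)
    {t : ℝ} (ht : 0 < t) (x : X) :
    Tendsto (fun k => ∫ y, p (t - 2 * radius (σ k)) x y * c y ∂initialMeasure μ u (σ k)) atTop
      (𝓝 (∫ y, p t x y * c y ∂ν)) := by
  have := h.finite
  exact tendsto_integral_kernel hp.continuousOn h.tendsto_integral h.exists_bound hcc hc
    (tendsto_two_radius h.tendsto) ht x

theorem IsBoundedSolution.ae_tendsto_mollify (hu : E.IsBoundedSolution T u) {K : Set X}
    (hK : IsCompact K) {r : ℝ} (hr : (r : EReal) < T) :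
    ∀ᵐ t ∂volume.restrict (Ioo 0 r), ∀ᵐ x ∂μ, x ∈ K →
      Tendsto (fun j => mollify j (fun r => u (r, x)) t) atTop (𝓝 (u (t, x))) := by
  rw [ae_restrict_iff' measurableSet_Ioo]
  have h1 : ∀ n : ℕ, ∀ᵐ t : ℝ, t ∈ Ioo (radius n) r → ∀ᵐ x ∂μ, x ∈ K →
      Tendsto (fun j => mollify j (fun r => u (r, x)) t) atTop (𝓝 (u (t, x))) := by
    intro n
    rcases lt_or_ge (radius n) r with hnr | hnr
    · obtain ⟨M, -, hM⟩ := hu.exists_bound K hK _ r (radius_pos n) hnr hr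
      exact (ae_restrict_iff' measurableSet_Ioo).1 (ae_ae_tendsto_mollify
        hu.stronglyMeasurable.measurable
        (fun j => (stronglyMeasurable_mollify hu.stronglyMeasurable j).measurable) hu.nonneg
        hK.isClosed.measurableSet hM)
    · exact Eventually.of_forall fun t ht => absurd (ht.1.trans ht.2) (not_lt.2 hnr)
  filter_upwards [ae_all_iff.2 h1] with t ht ht0
  obtain ⟨n, hn⟩ := (tendsto_radius.eventually (gt_mem_nhds ht0.1)).exists
  exact ht n ⟨hn, ht0.2⟩

/-- The mollified solution converges by the Lebesgue differentiation property, the subtracted heat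
flow by vague convergence. -/
theorem IsInitialLimit.ae_tendsto_remainder (hp : E.IsContinuousHeatKernel p)
    (hu : E.IsBoundedSolution T u) {σ : ℕ → ℕ} {ν : Measure X}
    (h : IsInitialLimit μ u σ ν) {c : X → ℝ} (hcc : Continuous c) (hc : HasCompactSupport c)
    {K : Set X} (hK : IsCompact K) {r : ℝ} (hr : (r : EReal) < T) :
    ∀ᵐ t ∂volume.restrict (Iio r), ∀ᵐ x ∂μ, x ∈ K →
      Tendsto (fun k => remainder μ p u c (σ k) (t, x)) atTop
        (𝓝 (limitRemainder p u c ν (t, x))) := by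
  rw [ae_restrict_iff' measurableSet_Iio]
  filter_upwards [(ae_restrict_iff' measurableSet_Ioo).1 (hu.ae_tendsto_mollify hK hr)]
    with t ht htr
  rcases le_or_gt t 0 with h0 | h0
  · refine Eventually.of_forall fun x _ => ?_
    rw [limitRemainder, if_pos h0]
    refine tendsto_const_nhds.congr fun k => ?_
    rw [remainder, if_pos]
    exact h0.trans (mul_nonneg zero_le_two (radius_pos _).le)
  · filter_upwards [ht ⟨h0, htr⟩] with x hx hxK
    rw [limitRemainder, if_neg (not_le.2 h0)]
    refine (((hx hxK).comp h.tendsto).sub (h.tendsto_flow hp hcc hc h0 x)).congr' ?_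
    filter_upwards [(tendsto_two_radius h.tendsto).eventually (gt_mem_nhds h0)] with k hk
    rw [remainder, if_neg (not_le.2 hk)]
    rfl

/-- The remainders are locally bounded, uniformly in the part of the initial value that is taken
into account: they are dominated by the solution at positive times, and the Harnack inequality
transports the bound to earlier times. -/
theorem IsBoundedSolution.exists_remainder_le (hH : E.ParabolicHarnack) (hreg : E.IsRegular)
    (hloc : E.IsStrictlyLocal) (hp : E.IsContinuousHeatKernel p)
    (hP : E.IsHeatSemigroup E.semigroup) (hnice : E.HasNiceExhaustion)
    (hu : E.IsBoundedSolution T u) {U K : Set X} (hU : IsOpen U) (hUc : IsConnected U)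
    (hUn : E.IsNice U) (hK : IsCompact K) (hKU : K ⊆ U) {a b r : ℝ} (hab : a < b) (hbr : b < r)
    (hr0 : 0 < r) (hr : (r : EReal) < T) :
    ∃ M : ℝ, 0 ≤ M ∧ ∀ (c : X → ℝ) (g : E.Dom), Continuous c → HasCompactSupport c →
      (∀ x, c x ∈ Icc (0 : ℝ) 1) → E.toL2 g =ᵐ[μ] c → (∀ x ∈ U, c x = 1) →
      ∀ᶠ j in atTop, ∀ᵐ t ∂volume.restrict (Ioo a b), ∀ᵐ x ∂μ, x ∈ K →
        |remainder μ p u c j (t, x)| ≤ M := by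
  obtain ⟨b₀, hb₀, hb₀T⟩ := EReal.lt_iff_exists_real_btwn.1 hr
  have hrb : r < b₀ := by exact_mod_cast hb₀
  -- `Icc c₁ d₁` will be an interval of positive times after `b`, on which the solution bounds the
  -- remainder
  set e := max b 0 with he
  have heb : b ≤ e := le_max_left _ _
  have he0 : 0 ≤ e := le_max_right _ _
  have her : e < r := max_lt hbr hr0
  set c₁ := e + (r - e) / 3 with hc₁
  set d₁ := e + 2 * (r - e) / 3 with hd₁
  obtain ⟨C, hC⟩ := hH.exists_bound hreg hloc hU hUc hUn hK hKU (show a - 1 < a by linarith) hab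
    (show b < c₁ by linarith) (show c₁ < d₁ by linarith) (show d₁ < r by linarith)
  obtain ⟨M, hM, hMu⟩ := hu.exists_mollify_le hK (show 0 < c₁ / 2 by linarith) hb₀T
  refine ⟨C * M, mul_nonneg C.coe_nonneg hM, fun c g hcc hc hcI hg hcU => ?_⟩
  filter_upwards [tendsto_radius.eventually (gt_mem_nhds (show 0 < c₁ / 2 by linarith)),
    tendsto_radius.eventually (gt_mem_nhds (show 0 < b₀ - r by linarith)),
    tendsto_radius.eventually (gt_mem_nhds (show 0 < b₀ / 3 by linarith))] with j h1 h2 h3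
  have hw := hu.remainder_isWeakSolution hreg hloc hp hP hnice hc hcI hg hcU (j := j) (b₀ := b₀)
    (r := r) (by linarith) (by linarith) hb₀T
  have hn : ∀ t < r, ∀ᵐ x ∂μ, 0 ≤ remainder μ p u c j (t, x) := fun t ht =>
    hu.remainder_nonneg hreg hp hP hnice hc hcI hg (b₀ := b₀) (by linarith) (by linarith) hb₀T
  have h4 := hC _ (hu.stronglyMeasurable_remainder hp hcc hc (b₀ := b₀) (by linarith) hb₀T)
    (hw.mono (fun t ht => ht.2) subset_rfl) (by
      filter_upwards [ae_restrict_mem measurableSet_Ioo] with t ht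
      exact (hn t ht.2).mono fun x hx _ => hx) M hM (by
      filter_upwards [ae_restrict_mem measurableSet_Icc] with t ht
      filter_upwards [hMu] with x hx hxK
      exact (hu.remainder_le hp hP hcI t x).trans
        (hx hxK j t (by linarith [ht.1]) (by linarith [ht.2])))
  filter_upwards [ae_restrict_of_ae_restrict_of_subset Ioo_subset_Icc_self h4,
    ae_restrict_mem measurableSet_Ioo] with t h5 ht
  filter_upwards [h5, hn t (ht.2.trans hbr)] with x h6 h7 hxK
  rw [abs_of_nonneg h7]
  exact h6 hxK

theorem _root_.Widder.ae_ae_le_of_tendsto {f : ℕ → ℝ × X → ℝ} {g : ℝ × X → ℝ} {I : Set ℝ}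
    {K : Set X} {M : ℝ}
    (hf : ∀ᶠ n in atTop, ∀ᵐ t ∂volume.restrict I, ∀ᵐ x ∂μ, x ∈ K → |f n (t, x)| ≤ M)
    (hfg : ∀ᵐ t ∂volume.restrict I, ∀ᵐ x ∂μ, x ∈ K →
      Tendsto (fun n => f n (t, x)) atTop (𝓝 (g (t, x)))) :
    ∀ᵐ t ∂volume.restrict I, ∀ᵐ x ∂μ, x ∈ K → |g (t, x)| ≤ M := by
  obtain ⟨N, hN⟩ := hf.exists_forall_of_atTop
  filter_upwards [hfg, ae_all_iff.2 fun n => hN (n + N) (Nat.le_add_left _ _)] with t h1 h2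
  filter_upwards [h1, ae_all_iff.2 h2] with x h3 h4 hx
  exact le_of_tendsto ((tendsto_add_atTop_iff_nat N).2 (h3 hx)).abs
    (Eventually.of_forall fun n => h4 n hx)

/-- The remainders are nonnegative and locally bounded weak solutions, hence so is their limit. -/
theorem IsInitialLimit.limitRemainder_isWeakSolution (hH : E.ParabolicHarnack) (hreg : E.IsRegular)
    (hloc : E.IsStrictlyLocal) (hp : E.IsContinuousHeatKernel p)
    (hP : E.IsHeatSemigroup E.semigroup) (hnice : E.HasNiceExhaustion)
    (hu : E.IsBoundedSolution T u) {σ : ℕ → ℕ} {ν : Measure X}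
    (h : IsInitialLimit μ u σ ν) {U : Set X} (hU : IsOpen U) (hUc : IsConnected U)
    (hUn : E.IsNice U) (hUcl : IsCompact (closure U)) {r : ℝ} (hr0 : 0 < r) (hr : (r : EReal) < T)
    {c : X → ℝ} {g : E.Dom} (hcc : Continuous c) (hc : HasCompactSupport c)
    (hcI : ∀ x, c x ∈ Icc (0 : ℝ) 1) (hg : E.toL2 g =ᵐ[μ] c) (hcU : ∀ x ∈ U, c x = 1) :
    E.IsWeakSolution (Iio r) U (limitRemainder p u c ν) := by
  obtain ⟨b₀, hb₀, hb₀T⟩ := EReal.lt_iff_exists_real_btwn.1 hr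
  have hrb : r < b₀ := by exact_mod_cast hb₀
  refine isWeakSolution_of_tendsto hreg hloc hp hP hU hUn
    (f := fun k => remainder μ p u c (σ k)) ?_ (fun K hK hKU a b hab hbr => ?_) ?_
  · refine h.tendsto.eventually (p := fun j => E.IsWeakSolution (Iio r) U (remainder μ p u c j)) ?_
    filter_upwards [tendsto_radius.eventually (gt_mem_nhds (show 0 < b₀ - r by linarith)),
      tendsto_radius.eventually (gt_mem_nhds (show 0 < b₀ / 3 by linarith))] with j h2 h3
    exact hu.remainder_isWeakSolution hreg hloc hp hP hnice hc hcI hg hcU (b₀ := b₀)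
      (by linarith) (by linarith) hb₀T
  · obtain ⟨M, hM, hMu⟩ := hu.exists_remainder_le hH hreg hloc hp hP hnice hU hUc hUn hK hKU hab hbr
      hr0 hr
    exact ⟨M, hM, h.tendsto.eventually (hMu c g hcc hc hcI hg hcU)⟩
  · filter_upwards [h.ae_tendsto_remainder hp hu hcc hc hUcl hr] with t ht
    filter_upwards [ht] with x hx hxU
    exact hx (subset_closure hxU)

/-- The limit remainders are locally bounded, uniformly in the cutoff function. -/
theorem IsInitialLimit.exists_limitRemainder_le (hH : E.ParabolicHarnack) (hreg : E.IsRegular)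
    (hloc : E.IsStrictlyLocal) (hp : E.IsContinuousHeatKernel p)
    (hP : E.IsHeatSemigroup E.semigroup) (hnice : E.HasNiceExhaustion)
    (hu : E.IsBoundedSolution T u) {σ : ℕ → ℕ} {ν : Measure X}
    (h : IsInitialLimit μ u σ ν) {U K : Set X} (hU : IsOpen U) (hUc : IsConnected U)
    (hUn : E.IsNice U) (hK : IsCompact K) (hKU : K ⊆ U) {a b r : ℝ} (hab : a < b) (hbr : b < r)
    (hr0 : 0 < r) (hr : (r : EReal) < T) :
    ∃ M : ℝ, 0 ≤ M ∧ ∀ (c : X → ℝ) (g : E.Dom), Continuous c → HasCompactSupport c →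
      (∀ x, c x ∈ Icc (0 : ℝ) 1) → E.toL2 g =ᵐ[μ] c → (∀ x ∈ U, c x = 1) →
      ∀ᵐ t ∂volume.restrict (Ioo a b), ∀ᵐ x ∂μ, x ∈ K → |limitRemainder p u c ν (t, x)| ≤ M := by
  obtain ⟨M, hM, hMu⟩ := hu.exists_remainder_le hH hreg hloc hp hP hnice hU hUc hUn hK hKU hab hbr
    hr0 hr
  refine ⟨M, hM, fun c g hcc hc hcI hg hcU => ae_ae_le_of_tendsto
    (h.tendsto.eventually (hMu c g hcc hc hcI hg hcU)) ?_⟩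
  exact ae_restrict_of_ae_restrict_of_subset (fun t ht => ht.2.trans hbr)
    (h.ae_tendsto_remainder hp hu hcc hc hK hr)

theorem IsInitialLimit.limitRemainder_nonneg (hreg : E.IsRegular) (hp : E.IsContinuousHeatKernel p)
    (hP : E.IsHeatSemigroup E.semigroup) (hnice : E.HasNiceExhaustion)
    (hu : E.IsBoundedSolution T u) {σ : ℕ → ℕ} {ν : Measure X}
    (h : IsInitialLimit μ u σ ν) {K : Set X} (hK : IsCompact K) {r : ℝ} (hr0 : 0 < r)
    (hr : (r : EReal) < T) {c : X → ℝ} {g : E.Dom} (hcc : Continuous c) (hc : HasCompactSupport c)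
    (hcI : ∀ x, c x ∈ Icc (0 : ℝ) 1) (hg : E.toL2 g =ᵐ[μ] c) :
    ∀ᵐ t ∂volume.restrict (Iio r), ∀ᵐ x ∂μ, x ∈ K → 0 ≤ limitRemainder p u c ν (t, x) := by
  obtain ⟨b₀, hb₀, hb₀T⟩ := EReal.lt_iff_exists_real_btwn.1 hr
  have hrb : r < b₀ := by exact_mod_cast hb₀
  have h1 : ∀ᶠ j in atTop, ∀ t < r, ∀ᵐ x ∂μ, 0 ≤ remainder μ p u c j (t, x) := by
    filter_upwards [tendsto_radius.eventually (gt_mem_nhds (show 0 < b₀ - r by linarith)),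
      tendsto_radius.eventually (gt_mem_nhds (show 0 < b₀ / 3 by linarith))] with j h2 h3 t ht
    exact hu.remainder_nonneg hreg hp hP hnice hc hcI hg (b₀ := b₀) (by linarith) (by linarith) hb₀T
  obtain ⟨N, hN⟩ := (h.tendsto.eventually h1).exists_forall_of_atTop
  filter_upwards [h.ae_tendsto_remainder hp hu hcc hc hK hr, ae_restrict_mem measurableSet_Iio]
    with t h2 ht
  filter_upwards [h2, ae_all_iff.2 fun n => hN (n + N) (Nat.le_add_left _ _) t ht] with x h3 h4 hx
  exact ge_of_tendsto' ((tendsto_add_atTop_iff_nat N).2 (h3 hx)) h4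

/-- The heat flow of the initial measure is locally bounded, uniformly in the cutoff function. -/
theorem IsInitialLimit.exists_flow_le (hreg : E.IsRegular) (hp : E.IsContinuousHeatKernel p)
    (hP : E.IsHeatSemigroup E.semigroup) (hnice : E.HasNiceExhaustion)
    (hu : E.IsBoundedSolution T u) {σ : ℕ → ℕ} {ν : Measure X}
    (h : IsInitialLimit μ u σ ν) {t : ℝ} (ht0 : 0 < t) (ht : (t : EReal) < T) (x : X) :
    ∃ M : ℝ, ∀ (c : X → ℝ) (g : E.Dom), Continuous c → HasCompactSupport c →
      (∀ x, c x ∈ Icc (0 : ℝ) 1) → E.toL2 g =ᵐ[μ] c → ∫ y, p t x y * c y ∂ν ≤ M := by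
  obtain ⟨b₀, hb₀, hb₀T⟩ := EReal.lt_iff_exists_real_btwn.1 ht
  have htb : t < b₀ := by exact_mod_cast hb₀
  obtain ⟨K, hK, hxK⟩ := exists_compact_mem_nhds x
  obtain ⟨M, hM, hMu⟩ := hu.exists_mollify_le hK (half_pos ht0) hb₀T
  refine ⟨M, fun c g hcc hc hcI hg => ?_⟩
  have := h.regular
  have h1 : ∀ᶠ j in atTop, ∀ᵐ y ∂μ, y ∈ K →
      ∫ z, p (t - 2 * radius j) y z * c z ∂initialMeasure μ u j ≤ M := by
    filter_upwards [tendsto_radius.eventually (gt_mem_nhds (show 0 < b₀ - t by linarith)),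
      tendsto_radius.eventually (gt_mem_nhds (show 0 < b₀ / 3 by linarith)),
      tendsto_radius.eventually (gt_mem_nhds (show 0 < t / 2 by linarith))] with j h2 h3 h4
    filter_upwards [hu.remainder_nonneg hreg hp hP hnice hc hcI hg (b₀ := b₀) (j := j) (t := t)
      (by linarith) (by linarith) hb₀T, hMu] with y h5 h6 hy
    rw [remainder, if_neg (by simp only; linarith), sub_nonneg] at h5
    exact h5.trans (h6 hy j t (by linarith) (by linarith))
  obtain ⟨N, hN⟩ := (h.tendsto.eventually h1).exists_forall_of_atTop
  have h2 : ∀ᵐ y ∂μ, y ∈ K → ∫ z, p t y z * c z ∂ν ≤ M := by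
    filter_upwards [ae_all_iff.2 fun n => hN (n + N) (Nat.le_add_left _ _)] with y h3 hy
    exact le_of_tendsto' ((tendsto_add_atTop_iff_nat N).2 (h.tendsto_flow hp hcc hc ht0 y))
      fun n => h3 n hy
  -- continuity in space upgrades the almost everywhere bound to the point `x`
  by_contra! hlt
  have hopen : IsOpen (interior K ∩ {y | M < ∫ z, p t y z * c z ∂ν}) :=
    isOpen_interior.inter (isOpen_lt continuous_const
      (continuous_integral_kernel hp.continuousOn hcc hc ν ht0))
  have hpos := hopen.measure_pos μ ⟨x, mem_interior_iff_mem_nhds.2 hxK, hlt⟩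
  refine hpos.ne' (measure_mono_null ?_ (ae_iff.1 h2))
  rintro y ⟨hy1, hy2⟩
  rw [mem_ofPred_eq, Classical.not_imp, not_le]
  exact ⟨interior_subset hy1, hy2⟩

end InitialLimit

end DirichletForm

/-! ### The heat flow of the initial measure -/

section HeatMeasure

variable {X : Type*} [MetricSpace X] [SecondCountableTopology X]
  [MeasurableSpace X] [BorelSpace X] {p : ℝ → X → X → ℝ}

theorem measurable_heatMeasure
    (hp : ContinuousOn (fun z : ℝ × X × X => p z.1 z.2.1 z.2.2) (Ioi (0 : ℝ) ×ˢ univ))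
    (ν : Measure X) [SFinite ν] :
    Measurable ((Ioi (0 : ℝ) ×ˢ univ).indicator fun z : ℝ × X => heatMeasure p ν z.1 z.2) := by
  classical
  have h1 := (hp.measurable_piecewise (g := fun _ => 0) continuousOn_const
    (measurableSet_Ioi.prod MeasurableSet.univ)).ennreal_ofReal
  have h2 := (h1.comp (by fun_prop :
    Measurable fun w : (ℝ × X) × X => (w.1.1, w.1.2, w.2))).lintegral_prod_right' (ν := ν)
  convert h2 using 1
  funext z
  by_cases hz : z ∈ Ioi (0 : ℝ) ×ˢ (univ : Set X)
  · rw [indicator_of_mem hz, heatMeasure]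
    refine lintegral_congr fun y => ?_
    rw [Function.comp_apply, piecewise_eq_of_mem _ _ _ (mk_mem_prod hz.1 (mem_univ _))]
  · rw [indicator_of_notMem hz]
    symm
    refine (lintegral_congr fun y => ?_).trans lintegral_zero
    rw [Function.comp_apply, piecewise_eq_of_notMem _ _ _ fun h => hz ⟨h.1, trivial⟩,
      ENNReal.ofReal_zero]

theorem measurable_kernel
    (hp : ContinuousOn (fun z : ℝ × X × X => p z.1 z.2.1 z.2.2) (Ioi (0 : ℝ) ×ˢ univ))
    {t : ℝ} (ht : 0 < t) (x : X) : Measurable (p t x) :=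
  (hp.comp_continuous (f := fun y : X => (t, x, y)) (by fun_prop) fun y => ⟨ht, trivial⟩).measurable

/-- Fatou's lemma along cutoffs that increase to one. -/
theorem heatMeasure_le_of_tendsto
    (hp : ContinuousOn (fun z : ℝ × X × X => p z.1 z.2.1 z.2.2) (Ioi (0 : ℝ) ×ˢ univ))
    {ν : Measure X} [IsFiniteMeasureOnCompacts ν] {c : ℕ → X → ℝ} (hcc : ∀ n, Continuous (c n))
    (hcs : ∀ n, HasCompactSupport (c n)) (hc0 : ∀ n x, 0 ≤ c n x)
    (hc : ∀ x, Tendsto (fun n => c n x) atTop (𝓝 1)) {t : ℝ} (ht : 0 < t) {x : X}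
    (hpos : ∀ y, 0 ≤ p t x y) {M : ℝ} (hM : ∀ n, ∫ y, p t x y * c n y ∂ν ≤ M) :
    heatMeasure p ν t x ≤ ENNReal.ofReal M := by
  have hpm := measurable_kernel hp ht x
  have hpc : Continuous (p t x) :=
    hp.comp_continuous (f := fun y : X => (t, x, y)) (by fun_prop) fun y => ⟨ht, trivial⟩
  calc heatMeasure p ν t x
      = ∫⁻ y, liminf (fun n => ENNReal.ofReal (p t x y * c n y)) atTop ∂ν := by
        refine lintegral_congr fun y => ?_
        have h1 : Tendsto (fun n => ENNReal.ofReal (p t x y * c n y)) atTop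
            (𝓝 (ENNReal.ofReal (p t x y * 1))) := ENNReal.tendsto_ofReal ((hc y).const_mul _)
        rw [h1.liminf_eq, mul_one]
    _ ≤ liminf (fun n => ∫⁻ y, ENNReal.ofReal (p t x y * c n y) ∂ν) atTop :=
        lintegral_liminf_le fun n => (hpm.mul (hcc n).measurable).ennreal_ofReal
    _ ≤ ENNReal.ofReal M := by
        refine liminf_le_of_frequently_le' (Frequently.of_forall fun n => ?_)
        have hi : Integrable (fun y => p t x y * c n y) ν :=
          (hpc.mul (hcc n)).integrable_of_hasCompactSupport (hcs n).mul_left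
        rw [← ofReal_integral_eq_lintegral_ofReal hi
          (Eventually.of_forall fun y => mul_nonneg (hpos y) (hc0 n y))]
        exact ENNReal.ofReal_le_ofReal (hM n)

theorem tendsto_integral_kernel_mul
    (hp : ContinuousOn (fun z : ℝ × X × X => p z.1 z.2.1 z.2.2) (Ioi (0 : ℝ) ×ˢ univ))
    {ν : Measure X} {c : ℕ → X → ℝ} (hcc : ∀ n, Continuous (c n))
    (hcI : ∀ n x, c n x ∈ Icc (0 : ℝ) 1)
    (hc : ∀ x, Tendsto (fun n => c n x) atTop (𝓝 1)) {t : ℝ} (ht : 0 < t) {x : X}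
    (hpos : ∀ y, 0 ≤ p t x y) (hfin : heatMeasure p ν t x ≠ ⊤) :
    Tendsto (fun n => ∫ y, p t x y * c n y ∂ν) atTop (𝓝 (heatMeasure p ν t x).toReal) := by
  have hpm := measurable_kernel hp ht x
  have hi : Integrable (p t x) ν := ⟨hpm.aestronglyMeasurable, by
    rw [hasFiniteIntegral_iff_ofReal (Eventually.of_forall hpos)]
    exact hfin.lt_top⟩
  have h1 : (heatMeasure p ν t x).toReal = ∫ y, p t x y * 1 ∂ν := by
    simp only [mul_one]
    rw [heatMeasure, integral_eq_lintegral_of_nonneg_ae (Eventually.of_forall hpos)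
      hpm.aestronglyMeasurable]
  rw [h1]
  refine tendsto_integral_of_dominated_convergence (p t x)
    (fun n => (hpm.mul (hcc n).measurable).aestronglyMeasurable) hi (fun n => ?_) ?_
  · refine Eventually.of_forall fun y => ?_
    rw [norm_mul, Real.norm_of_nonneg (hpos y), Real.norm_of_nonneg (hcI n y).1]
    exact mul_le_of_le_one_right (hpos y) (hcI n y).2
  · exact Eventually.of_forall fun y => (hc y).const_mul _

end HeatMeasure

namespace DirichletForm

section Existence

variable {X : Type*} [MetricSpace X] [LocallyCompactSpace X] [SecondCountableTopology X]
  [MeasurableSpace X] [BorelSpace X]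
  {μ : Measure X} [μ.Regular] [μ.IsOpenPosMeasure] {E : DirichletForm μ} {p : ℝ → X → X → ℝ}
  {T : EReal} {u : ℝ × X → ℝ}

/-- The part of a solution that is left when the heat flow of its initial measure is removed. -/
noncomputable def residual (p : ℝ → X → X → ℝ) (ν : Measure X) (u : ℝ × X → ℝ) (z : ℝ × X) : ℝ :=
  if z.1 ≤ 0 then 0 else u z - (heatMeasure p ν z.1 z.2).toReal

theorem measurable_residual (hp : E.IsContinuousHeatKernel p) (ν : Measure X) [SFinite ν]
    (hu : Measurable u) : Measurable (residual p ν u) := by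
  have h1 : Measurable fun z : ℝ × X => if z.1 ≤ 0 then (0 : ℝ) else
      u z - ((Ioi (0 : ℝ) ×ˢ univ).indicator (fun z : ℝ × X => heatMeasure p ν z.1 z.2) z).toReal :=
    Measurable.ite (measurableSet_le measurable_fst measurable_const) measurable_const
      (hu.sub (measurable_heatMeasure hp.continuousOn ν).ennreal_toReal)
  convert h1 using 1
  funext z
  by_cases hz : z.1 ≤ 0
  · rw [residual, if_pos hz, if_pos hz]
  · have hz' : z ∈ Ioi (0 : ℝ) ×ˢ (univ : Set X) := ⟨mem_Ioi.2 (not_le.1 hz), trivial⟩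
    rw [residual, if_neg hz, if_neg hz, indicator_of_mem hz']

/-- The times below `T` are exhausted by countably many half-lines. -/
theorem _root_.Widder.ae_restrict_of_forall_Iio (hT : 0 < T) {q : ℝ → Prop}
    (h : ∀ r : ℝ, 0 < r → (r : EReal) < T → ∀ᵐ t ∂volume.restrict (Iio r), q t) :
    ∀ᵐ t ∂volume.restrict (timeIoo ⊥ T), q t := by
  have hm : MeasurableSet (timeIoo ⊥ T) := measurableSet_Ioo.preimage measurable_coe_real_ereal
  rw [ae_restrict_iff' hm]
  have h1 : ∀ r : ℚ, ∀ᵐ t : ℝ, 0 < (r : ℝ) → (((r : ℝ) : EReal) < T) → t ∈ Iio (r : ℝ) → q t := by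
    intro r
    by_cases hr : 0 < (r : ℝ) ∧ ((r : ℝ) : EReal) < T
    · filter_upwards [(ae_restrict_iff' measurableSet_Iio).1 (h r hr.1 hr.2)] with t ht _ _
      exact ht
    · exact Eventually.of_forall fun t h1 h2 => absurd ⟨h1, h2⟩ hr
  filter_upwards [ae_all_iff.2 h1] with t ht htT
  obtain ⟨r, hr1, hr2⟩ := EReal.lt_iff_exists_rat_btwn.1 (max_lt htT.2 hT)
  have h2 := max_lt_iff.1 hr1
  exact ht r (by exact_mod_cast h2.2) (by exact_mod_cast hr2) (by exact_mod_cast h2.1)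

/-- Along cutoffs that are one on larger and larger sets, the limits of the remainders converge to
the residual; the bounds on the flows of the cut-off measures make the heat flow of the whole
measure finite. -/
theorem IsInitialLimit.residual_spec (hH : E.ParabolicHarnack) (hreg : E.IsRegular)
    (hloc : E.IsStrictlyLocal) (hp : E.IsContinuousHeatKernel p)
    (hP : E.IsHeatSemigroup E.semigroup) (hnice : E.HasNiceExhaustion) (hT : 0 < T)
    (hu : E.IsBoundedSolution T u) {σ : ℕ → ℕ} {ν : Measure X} (h : IsInitialLimit μ u σ ν) :
    (∀ t ∈ timeIoo 0 T, ∀ x, heatMeasure p ν t x ≠ ⊤) ∧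
    E.IsWeakSolution (timeIoo ⊥ T) univ (residual p ν u) ∧
    ∀ᵐ t ∂volume.restrict (timeIoo ⊥ T), ∀ᵐ x ∂μ, 0 ≤ residual p ν u (t, x) := by
  have := h.regular
  obtain ⟨U, hU, hUX, hUn⟩ := id hnice
  choose g c hcc hcs hcI hc1 hg using fun n => exists_cutoff hreg (hUn n).2.1
  have hcU : ∀ m n, m ≤ n → ∀ x ∈ U m, c n x = 1 := fun m n hmn x hx =>
    hc1 n x (subset_closure (hU hmn hx))
  have hclim : ∀ x, Tendsto (fun n => c n x) atTop (𝓝 1) := fun x => by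
    obtain ⟨m, hm⟩ := mem_iUnion.1 (show x ∈ ⋃ n, U n by rw [hUX]; trivial)
    refine tendsto_const_nhds.congr' ?_
    filter_upwards [eventually_ge_atTop m] with n hn
    exact (hcU m n hn x hm).symm
  have hpos : ∀ t : ℝ, 0 < t → ∀ x y, 0 ≤ p t x y := fun t ht x y => hp.nonneg hP ht x y
  have hfin : ∀ t : ℝ, 0 < t → (t : EReal) < T → ∀ x, heatMeasure p ν t x ≠ ⊤ := by
    intro t ht0 ht x
    obtain ⟨M, hM⟩ := h.exists_flow_le hreg hp hP hnice hu ht0 ht x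
    exact ne_top_of_le_ne_top ENNReal.ofReal_ne_top (heatMeasure_le_of_tendsto hp.continuousOn hcc
      hcs (fun n x => (hcI n x).1) hclim ht0 (hpos t ht0 x)
      fun n => hM (c n) (g n) (hcc n) (hcs n) (hcI n) (hg n))
  have hlim : ∀ t : ℝ, (t : EReal) < T → ∀ x, Tendsto (fun n => limitRemainder p u (c n) ν (t, x))
      atTop (𝓝 (residual p ν u (t, x))) := by
    intro t ht x
    rcases le_or_gt t 0 with h0 | h0
    · simp only [limitRemainder, residual, if_pos h0]
      exact tendsto_const_nhds
    · simp only [limitRemainder, residual, if_neg (not_le.2 h0)]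
      exact (tendsto_integral_kernel_mul hp.continuousOn hcc hcI hclim h0 (hpos t h0 x)
        (hfin t h0 ht x)).const_sub _
  have hsol : ∀ r : ℝ, 0 < r → (r : EReal) < T → ∀ m,
      E.IsWeakSolution (Iio r) (U m) (residual p ν u) := by
    intro r hr0 hr m
    refine isWeakSolution_of_tendsto hreg hloc hp hP (hUn m).1 (hUn m).2.2.2
      (f := fun n => limitRemainder p u (c n) ν) ?_ (fun K hK hKU a b hab hbr => ?_) ?_
    · filter_upwards [eventually_ge_atTop m] with n hn
      exact h.limitRemainder_isWeakSolution hH hreg hloc hp hP hnice hu (hUn m).1 (hUn m).2.2.1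
        (hUn m).2.2.2 (hUn m).2.1 hr0 hr (hcc n) (hcs n) (hcI n) (hg n) (hcU m n hn)
    · obtain ⟨M, hM, hMu⟩ := h.exists_limitRemainder_le hH hreg hloc hp hP hnice hu (hUn m).1
        (hUn m).2.2.1 (hUn m).2.2.2 hK hKU hab hbr hr0 hr
      refine ⟨M, hM, ?_⟩
      filter_upwards [eventually_ge_atTop m] with n hn
      exact hMu (c n) (g n) (hcc n) (hcs n) (hcI n) (hg n) (hcU m n hn)
    · filter_upwards [ae_restrict_mem measurableSet_Iio] with t ht
      refine Eventually.of_forall fun x _ => hlim t ?_ x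
      exact lt_trans (by exact_mod_cast ht) hr
  refine ⟨fun t ht => hfin t (by exact_mod_cast ht.1) ht.2, ?_, ?_⟩
  · intro ψ A hA hψ a b hab
    obtain ⟨m, hm⟩ := exists_subset_of_exhaustion hU (fun n => (hUn n).1) hUX
      hψ.hasCompactSupport.isCompact
    have hψ' : E.IsNiceCutoff ψ A (U m) :=
      ⟨hψ.mem_Icc, hψ.eq_one, hψ.hasCompactSupport, hm, hψ.mul_mem⟩
    rcases lt_or_ge b a with hba | hba
    · obtain ⟨r, hr1, hr2⟩ := EReal.lt_iff_exists_real_btwn.1 hT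
      exact hsol r (by exact_mod_cast hr1) hr2 m ψ A hA hψ' a b (by simp [Icc_eq_empty_of_lt hba])
    · have hbT : (b : EReal) < T := (hab (right_mem_Icc.2 hba)).2
      obtain ⟨r, hr1, hr2⟩ := EReal.lt_iff_exists_real_btwn.1 (max_lt hbT hT)
      have h2 := max_lt_iff.1 hr1
      have hbr : b < r := by exact_mod_cast h2.1
      exact hsol r (by exact_mod_cast h2.2) hr2 m ψ A hA hψ' a b fun t ht => ht.2.trans_lt hbr
  · refine ae_restrict_of_forall_Iio hT fun r hr0 hr => ?_
    have h1 : ∀ m n : ℕ, ∀ᵐ t ∂volume.restrict (Iio r), ∀ᵐ x ∂μ, x ∈ closure (U m) →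
        0 ≤ limitRemainder p u (c n) ν (t, x) := fun m n =>
      h.limitRemainder_nonneg hreg hp hP hnice hu (hUn m).2.1 hr0 hr (hcc n) (hcs n) (hcI n) (hg n)
    filter_upwards [ae_all_iff.2 fun m => ae_all_iff.2 (h1 m), ae_restrict_mem measurableSet_Iio]
      with t ht htr
    filter_upwards [ae_all_iff.2 fun m => ae_all_iff.2 (ht m)] with x hx
    obtain ⟨m, hm⟩ := mem_iUnion.1 (show x ∈ ⋃ n, U n by rw [hUX]; trivial)
    exact ge_of_tendsto' (hlim t (lt_trans (by exact_mod_cast htr) hr) x)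
      fun n => hx m n (subset_closure hm)

end Existence

end DirichletForm

/-! ### The initial trace -/

section Averages

theorem lintegral_mollifier_sub (j : ℕ) (t : ℝ) :
    ∫⁻ r, ENNReal.ofReal (mollifier j (t - r)) = 1 := by
  rw [← ofReal_integral_eq_lintegral_ofReal
    ((contDiff_mollifier_sub j t).continuous.integrable_of_hasCompactSupport
      (hasCompactSupport_mollifier_sub j t)) (Eventually.of_forall fun r => mollifier_nonneg j _),
    integral_mollifier_sub, ENNReal.ofReal_one]

/-- The mollifier around the time `2 * radius j` only sees the times between `radius j` and `3 *
radius j`, which are positive. -/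
theorem mollifier_two_radius_eq_zero {j : ℕ} {δ r : ℝ} (hδ : 3 * radius j ≤ δ)
    (hr : r ∉ Ioo 0 δ) : mollifier j (2 * radius j - r) = 0 :=
  mollifier_sub_eq_zero (a := radius j) (b := δ) (by linarith) (by linarith) fun h =>
    hr ⟨(radius_pos j).trans h.1, h.2⟩

/-- Averages over short time intervals just after time zero converge to the right limit at
zero. -/
theorem tendsto_lintegral_mollifier {B : ℝ → ℝ≥0∞} {l : ℝ≥0∞} (hB : Tendsto B (𝓝[>] 0) (𝓝 l)) :
    Tendsto (fun j => ∫⁻ r, ENNReal.ofReal (mollifier j (2 * radius j - r)) * B r) atTop (𝓝 l) := by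
  have hm : ∀ j, Measurable fun r => ENNReal.ofReal (mollifier j (2 * radius j - r)) := fun j =>
    (contDiff_mollifier_sub j _).continuous.measurable.ennreal_ofReal
  have hc : ∀ j (a : ℝ≥0∞), ∫⁻ r, ENNReal.ofReal (mollifier j (2 * radius j - r)) * a = a :=
    fun j a => by rw [lintegral_mul_const _ (hm j), lintegral_mollifier_sub, one_mul]
  have hsmall : ∀ δ : ℝ, 0 < δ → ∀ᶠ j in atTop, 3 * radius j ≤ δ := fun δ hδ => by
    filter_upwards [tendsto_radius.eventually (gt_mem_nhds (show 0 < δ / 3 by linarith))] with j hj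
    linarith
  refine tendsto_order.2 ⟨fun a ha => ?_, fun a ha => ?_⟩
  · obtain ⟨a', h1, h2⟩ := exists_between ha
    obtain ⟨δ, hδ, hδB⟩ := mem_nhdsGT_iff_exists_Ioo_subset.1 (hB.eventually (lt_mem_nhds h2))
    filter_upwards [hsmall δ hδ] with j hj
    refine h1.trans_le ?_
    rw [← hc j a']
    refine lintegral_mono fun r => ?_
    by_cases hr : r ∈ Ioo 0 δ
    · exact mul_le_mul_right (hδB hr).le _
    · simp only [mollifier_two_radius_eq_zero hj hr, ENNReal.ofReal_zero, zero_mul, le_refl]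
  · obtain ⟨a', h1, h2⟩ := exists_between ha
    obtain ⟨δ, hδ, hδB⟩ := mem_nhdsGT_iff_exists_Ioo_subset.1 (hB.eventually (gt_mem_nhds h1))
    filter_upwards [hsmall δ hδ] with j hj
    refine lt_of_le_of_lt ?_ h2
    rw [← hc j a']
    refine lintegral_mono fun r => ?_
    by_cases hr : r ∈ Ioo 0 δ
    · exact mul_le_mul_right (le_of_lt (hδB hr)) _
    · simp only [mollifier_two_radius_eq_zero hj hr, ENNReal.ofReal_zero, zero_mul, le_refl]

/-- A smooth function with compact support whose derivative is the difference of the mollifier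
just after time zero and of a fixed mollifier at negative times. -/
theorem exists_primitive_mollifier (j : ℕ) :
    ∃ χ : ℝ → ℝ, ContDiff ℝ ∞ χ ∧ (∀ t, t ∉ Ioo (-3 / 4) (3 * radius j) → χ t = 0) ∧
      (∀ t, |χ t| ≤ 2) ∧
      ∀ t, deriv χ t = mollifier j (2 * radius j - t) - mollifier 3 (-1 / 2 - t) := by
  set q : ℝ → ℝ := fun t => mollifier j (2 * radius j - t) - mollifier 3 (-1 / 2 - t) with hq
  have hqs : ContDiff ℝ ∞ q := (contDiff_mollifier_sub j _).sub (contDiff_mollifier_sub 3 _)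
  have i1 : Integrable fun t => mollifier j (2 * radius j - t) :=
    (contDiff_mollifier_sub j _).continuous.integrable_of_hasCompactSupport
      (hasCompactSupport_mollifier_sub j _)
  have i2 : Integrable fun t => mollifier 3 (-1 / 2 - t) :=
    (contDiff_mollifier_sub 3 _).continuous.integrable_of_hasCompactSupport
      (hasCompactSupport_mollifier_sub 3 _)
  have hr3 : radius 3 = 1 / 4 := by unfold radius; norm_num
  have hrj := radius_pos j
  have hq0 : ∀ t, t ∉ Ioo (-3 / 4) (3 * radius j) → q t = 0 := fun t ht => by
    have e1 : mollifier j (2 * radius j - t) = 0 :=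
      mollifier_two_radius_eq_zero le_rfl fun h => ht ⟨by linarith [h.1], h.2⟩
    have e2 : mollifier 3 (-1 / 2 - t) = 0 :=
      mollifier_sub_eq_zero (a := -3 / 4) (b := -1 / 4) (by rw [hr3]; norm_num)
        (by rw [hr3]; norm_num) fun h => ht ⟨h.1, by linarith [h.2]⟩
    simp only [hq, e1, e2, sub_zero]
  have hd : ∀ t, HasDerivAt (fun t => ∫ s in (-3 / 4 : ℝ)..t, q s) (q t) t := fun t =>
    intervalIntegral.integral_hasDerivAt_right (hqs.continuous.intervalIntegrable _ _)
      (hqs.continuous.stronglyMeasurableAtFilter _ _) hqs.continuous.continuousAt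
  have hd' : deriv (fun t => ∫ s in (-3 / 4 : ℝ)..t, q s) = q := funext fun t => (hd t).deriv
  refine ⟨fun t => ∫ s in (-3 / 4 : ℝ)..t, q s, ?_, fun t ht => ?_, fun t => ?_, fun t => by rw [hd']⟩
  · refine contDiff_infty_iff_deriv.2 ⟨fun t => (hd t).differentiableAt, ?_⟩
    rw [hd']; exact hqs
  · rcases le_or_gt t (-3 / 4) with h | h
    · refine (intervalIntegral.integral_congr (g := fun _ => (0 : ℝ)) fun s hs => ?_).trans (by simp)
      rw [uIcc_of_ge h] at hs
      exact hq0 s fun h' => absurd hs.2 (not_le.2 h'.1)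
    · have h3 : 3 * radius j ≤ t := not_lt.1 fun h' => ht ⟨h, h'⟩
      change ∫ s in (-3 / 4 : ℝ)..t, q s = 0
      rw [intervalIntegral.integral_of_le h.le, setIntegral_eq_integral_of_forall_compl_eq_zero,
        integral_sub i1 i2, integral_mollifier_sub, integral_mollifier_sub, sub_self]
      exact fun s hs => hq0 s fun h' => hs ⟨h'.1, h'.2.le.trans h3⟩
  · have h1 : ∫ s, |q s| ≤ 2 := by
      calc ∫ s, |q s| ≤ ∫ s, (mollifier j (2 * radius j - s) + mollifier 3 (-1 / 2 - s)) := by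
            refine integral_mono (i1.sub i2).abs (i1.add i2) fun s => ?_
            refine (abs_sub _ _).trans ?_
            rw [abs_of_nonneg (mollifier_nonneg _ _), abs_of_nonneg (mollifier_nonneg _ _)]
        _ = 2 := by
            rw [integral_add i1 i2, integral_mollifier_sub, integral_mollifier_sub]; norm_num
    change ‖∫ s in (-3 / 4 : ℝ)..t, q s‖ ≤ 2
    refine (intervalIntegral.norm_integral_le_integral_norm_uIoc).trans (le_trans ?_ h1)
    exact setIntegral_le_integral (i1.sub i2).abs (Eventually.of_forall fun s => abs_nonneg _)

end Averages

namespace DirichletForm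

section InitialTrace

variable {X : Type*} [MetricSpace X] [LocallyCompactSpace X] [MeasurableSpace X] [BorelSpace X]
  {μ : Measure X} {E : DirichletForm μ} {b : ℝ} {V K : Set X} {v : ℝ → E.Dom}

/-- A weak solution that vanishes at negative times has initial value zero. -/
theorem IsWeakCurve.tendsto_zero (hv : E.IsWeakCurve (-1) b V v) (hb : 0 < b)
    (hv0 : ∀ᵐ t ∂volume.restrict (Ioo (-1 : ℝ) 0), v t = 0) (hK : IsCompact K) (hKV : K ⊆ V)
    {g : E.Dom} (hg : g ∈ E.supported K) :
    Tendsto (fun j => ∫ r, mollifier j (2 * radius j - r) * inner ℝ (E.toL2 (v r)) (E.toL2 g))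
      atTop (𝓝 0) := by
  -- Test the equation with a primitive `χ j` of the difference of the mollifier and a fixed one at
  -- negative times. The fixed one contributes nothing, and `χ j` tends to zero at positive times.
  choose χ hχ hχ0 hχb hχd using exists_primitive_mollifier
  have hv0' := (ae_restrict_iff' measurableSet_Ioo).1 hv0
  have hr3 : radius 3 = 1 / 4 := by unfold radius; norm_num
  have hsmall : ∀ᶠ j in atTop, 3 * radius j < b := by
    filter_upwards [tendsto_radius.eventually (gt_mem_nhds (show 0 < b / 3 by linarith))] with j hj
    linarith
  have hts : ∀ j, 3 * radius j < b → tsupport (χ j) ⊆ Ioo (-1) b := fun j hj =>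
    (closure_minimal (t := Icc (-3 / 4) (3 * radius j)) (fun t ht => by
      by_contra h
      exact ht (hχ0 j t fun h' => h (Ioo_subset_Icc_self h'))) isClosed_Icc).trans
      (Icc_subset_Ioo (by norm_num) hj)
  have hcs : ∀ j, HasCompactSupport (χ j) := fun j =>
    HasCompactSupport.intro isCompact_Icc fun t ht => hχ0 j t fun h' => ht (Ioo_subset_Icc_self h')
  have he : Integrable (fun r => E.energy (v r) g) (volume.restrict (Ioo (-1) b)) :=
    ((E.energyL.flip g).comp_memLp' hv.memLp).integrable one_le_two
  have h1 : Tendsto (fun j => ∫ r in Ioo (-1) b, χ j r * E.energy (v r) g) atTop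
      (𝓝 (∫ r in Ioo (-1) b, (0 : ℝ))) := by
    refine tendsto_integral_of_dominated_convergence (fun r => 2 * |E.energy (v r) g|)
      (fun j => (hχ j).continuous.aestronglyMeasurable.mul he.aestronglyMeasurable)
      (he.abs.const_mul 2) (fun j => Eventually.of_forall fun r => ?_) ?_
    · rw [norm_mul]
      exact mul_le_mul_of_nonneg_right (hχb j r) (norm_nonneg _)
    · filter_upwards [ae_restrict_of_ae hv0', ae_restrict_mem measurableSet_Ioo,
        ae_restrict_of_ae (Measure.ae_ne volume (0 : ℝ))] with r hr hrI hr0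
      rcases lt_or_gt_of_ne hr0 with h | h
      · simp only [hr ⟨hrI.1, h⟩, map_zero, LinearMap.zero_apply, mul_zero]
        exact tendsto_const_nhds
      · refine tendsto_const_nhds.congr' ?_
        filter_upwards [tendsto_radius.eventually (gt_mem_nhds (show 0 < r / 3 by linarith))]
          with j hj
        rw [hχ0 j r fun h' => by linarith [h'.2], zero_mul]
  rw [integral_zero] at h1
  refine h1.congr' ?_
  filter_upwards [hsmall] with j hj
  rw [setIntegral_eq_of_tsupport (hts j hj), ← hv.weak _ (hχ j) (hcs j) (hts j hj) K hK hKV g hg]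
  refine integral_congr_ae ?_
  filter_upwards [hv0'] with r hr
  rw [hχd]
  by_cases h : r ∈ Ioo (-1 : ℝ) 0
  · rw [hr h, map_zero, inner_zero_left, mul_zero, mul_zero]
  · rw [mollifier_sub_eq_zero (j := 3) (t := -1 / 2) (a := -1) (b := 0) (by rw [hr3]; norm_num)
      (by rw [hr3]; norm_num) h, sub_zero]

end InitialTrace

end DirichletForm

/-! ### Averaged heat flows -/

section Comparison

variable {X : Type*} [MetricSpace X] [LocallyCompactSpace X] [MeasurableSpace X] [BorelSpace X]

/-- Regular measures are compared on open sets through bump functions, and then on all sets by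
outer regularity. -/
theorem le_of_lintegral_le_on_compactlySupported {ν' ν : Measure X} [ν'.Regular] [ν.Regular]
    (h : ∀ f : X → ℝ, Continuous f → HasCompactSupport f → (∀ x, 0 ≤ f x) →
      ∫⁻ x, ENNReal.ofReal (f x) ∂ν' ≤ ∫⁻ x, ENNReal.ofReal (f x) ∂ν) : ν' ≤ ν := by
  have hO : ∀ O : Set X, IsOpen O → ν' O ≤ ν O := by
    intro O hO
    rw [hO.measure_eq_iSup_isCompact]
    refine iSup₂_le fun K hKO => iSup_le fun hK => ?_
    obtain ⟨f, hf, hfc, hfO, hfI, hf1⟩ := exists_bump_one K hK O hO hKO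
    calc ν' K ≤ ∫⁻ x, ENNReal.ofReal (f x) ∂ν' := by
          rw [← lintegral_indicator_one hK.isClosed.measurableSet]
          refine lintegral_mono fun x => ?_
          by_cases hx : x ∈ K
          · rw [indicator_of_mem hx, hf1 x hx, ENNReal.ofReal_one, Pi.one_apply]
          · rw [indicator_of_notMem hx]
            exact zero_le
      _ ≤ ∫⁻ x, ENNReal.ofReal (f x) ∂ν := h f hf hfc fun x => (hfI x).1
      _ ≤ ν O := by
          rw [← lintegral_indicator_one hO.measurableSet]
          refine lintegral_mono fun x => ?_
          by_cases hx : x ∈ O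
          · rw [indicator_of_mem hx, Pi.one_apply]
            exact ENNReal.ofReal_le_one.2 (hfI x).2
          · rw [image_eq_zero_of_notMem_tsupport fun h' => hx (hfO h'), ENNReal.ofReal_zero]
            exact zero_le
  refine Measure.le_iff'.2 fun S => ?_
  rw [S.measure_eq_iInf_isOpen ν]
  exact le_iInf₂ fun O hSO => le_iInf fun hOo => (measure_mono hSO).trans (hO O hOo)

end Comparison

section AverageFlow

variable {X : Type*} [MetricSpace X] [LocallyCompactSpace X] [SecondCountableTopology X]
  [MeasurableSpace X] [BorelSpace X]
  {μ : Measure X} [μ.Regular] [μ.IsOpenPosMeasure] {p : ℝ → X → X → ℝ}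

/-- The heat kernel as an extended nonnegative number, extended by zero to nonpositive times. -/
noncomputable def posKernel (p : ℝ → X → X → ℝ) (w : ℝ × X × X) : ℝ≥0∞ :=
  (Ioi (0 : ℝ) ×ˢ univ).indicator (fun w => ENNReal.ofReal (p w.1 w.2.1 w.2.2)) w

theorem posKernel_of_pos {t : ℝ} (ht : 0 < t) (x y : X) :
    posKernel p (t, x, y) = ENNReal.ofReal (p t x y) :=
  indicator_of_mem (show (t, x, y) ∈ Ioi (0 : ℝ) ×ˢ univ from ⟨ht, trivial⟩) _

theorem measurable_posKernel
    (hp : ContinuousOn (fun z : ℝ × X × X => p z.1 z.2.1 z.2.2) (Ioi (0 : ℝ) ×ˢ univ)) :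
    Measurable (posKernel p) := by
  classical
  have h := (hp.measurable_piecewise (g := fun _ => 0) continuousOn_const
    (measurableSet_Ioi.prod MeasurableSet.univ)).ennreal_ofReal
  convert h using 1
  funext w
  rw [posKernel]
  by_cases hw : w ∈ Ioi (0 : ℝ) ×ˢ (univ : Set (X × X))
  · rw [indicator_of_mem hw, piecewise_eq_of_mem _ _ _ hw]
  · rw [indicator_of_notMem hw, piecewise_eq_of_notMem _ _ _ hw, ENNReal.ofReal_zero]

/-- The heat flow of `f`, averaged over a short time interval just after time zero. -/
noncomputable def averageFlow (μ : Measure X) (p : ℝ → X → X → ℝ) (f : X → ℝ) (j : ℕ) (y : X) :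
    ℝ≥0∞ :=
  ∫⁻ r, ENNReal.ofReal (mollifier j (2 * radius j - r))
    * ∫⁻ x, ENNReal.ofReal (f x) * posKernel p (r, x, y) ∂μ

theorem measurable_inner_averageFlow
    (hp : ContinuousOn (fun z : ℝ × X × X => p z.1 z.2.1 z.2.2) (Ioi (0 : ℝ) ×ˢ univ))
    {f : X → ℝ} (hf : Measurable f) (j : ℕ) :
    Measurable fun z : ℝ × X => ENNReal.ofReal (mollifier j (2 * radius j - z.1))
      * ∫⁻ x, ENNReal.ofReal (f x) * posKernel p (z.1, x, z.2) ∂μ := by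
  have h1 : Measurable fun w : (ℝ × X) × X => ENNReal.ofReal (f w.2)
      * posKernel p (w.1.1, w.2, w.1.2) :=
    (hf.comp measurable_snd).ennreal_ofReal.mul ((measurable_posKernel hp).comp (by fun_prop))
  exact (((contDiff_mollifier_sub j _).continuous.measurable.comp
    measurable_fst).ennreal_ofReal).mul h1.lintegral_prod_right'

theorem measurable_averageFlow
    (hp : ContinuousOn (fun z : ℝ × X × X => p z.1 z.2.1 z.2.2) (Ioi (0 : ℝ) ×ˢ univ))
    {f : X → ℝ} (hf : Measurable f) (j : ℕ) : Measurable (averageFlow μ p f j) :=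
  (measurable_inner_averageFlow hp hf j).lintegral_prod_left'

/-- Tonelli's theorem moves the average from the test function to the measure. -/
theorem lintegral_averageFlow
    (hp : ContinuousOn (fun z : ℝ × X × X => p z.1 z.2.1 z.2.2) (Ioi (0 : ℝ) ×ˢ univ))
    {f : X → ℝ} (hf : Measurable f) (j : ℕ) (ν : Measure X) [SFinite ν] :
    ∫⁻ y, averageFlow μ p f j y ∂ν = ∫⁻ r, ENNReal.ofReal (mollifier j (2 * radius j - r))
      * ∫⁻ x, ENNReal.ofReal (f x) * ∫⁻ y, posKernel p (r, x, y) ∂ν ∂μ := by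
  have hQ := measurable_posKernel hp
  have hG : Measurable fun w : ℝ × X => ENNReal.ofReal (mollifier j (2 * radius j - w.1))
      * ∫⁻ x, ENNReal.ofReal (f x) * posKernel p (w.1, x, w.2) ∂μ :=
    measurable_inner_averageFlow (μ := μ) hp hf j
  have h0 := lintegral_lintegral_swap (μ := ν) (ν := (volume : Measure ℝ))
    (f := fun (y : X) (r : ℝ) => ENNReal.ofReal (mollifier j (2 * radius j - r))
      * ∫⁻ x, ENNReal.ofReal (f x) * posKernel p (r, x, y) ∂μ)
    (hG.comp measurable_swap).aemeasurable
  refine h0.trans (lintegral_congr fun r => ?_)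
  have hs : Measurable fun w : X × X => (r, w.2, w.1) := by fun_prop
  have h0' : Measurable fun w : X × X => posKernel p (r, w.2, w.1) := hQ.comp hs
  have hf' : Measurable fun w : X × X => ENNReal.ofReal (f w.2) :=
    (hf.comp measurable_snd).ennreal_ofReal
  have h1 : Measurable (Function.uncurry fun y x : X =>
      ENNReal.ofReal (f x) * posKernel p (r, x, y)) := hf'.mul h0'
  have h2 : Measurable fun y : X => ∫⁻ x, ENNReal.ofReal (f x) * posKernel p (r, x, y) ∂μ :=
    h1.lintegral_prod_right'
  have h3 : ∀ x, Measurable fun y : X => posKernel p (r, x, y) := fun x =>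
    hQ.comp (by fun_prop : Measurable fun y : X => (r, x, y))
  rw [lintegral_const_mul _ h2, lintegral_lintegral_swap h1.aemeasurable]
  congr 1
  refine lintegral_congr fun x => ?_
  exact lintegral_const_mul _ (h3 x)

end AverageFlow

namespace DirichletForm

section AverageFlow

variable {X : Type*} [MetricSpace X] [LocallyCompactSpace X] [SecondCountableTopology X]
  [MeasurableSpace X] [BorelSpace X]
  {μ : Measure X} [μ.Regular] [μ.IsOpenPosMeasure] {E : DirichletForm μ} {p : ℝ → X → X → ℝ}
  {T : EReal} {u h : ℝ × X → ℝ} {f : X → ℝ}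

/-- The averaged heat flow of a bounded function is bounded by the sub-Markov property. -/
theorem averageFlow_le (hp : E.IsContinuousHeatKernel p) (hP : E.IsHeatSemigroup E.semigroup)
    {M : ℝ} (hfM : ∀ x, f x ≤ M) (j : ℕ) (y : X) :
    averageFlow μ p f j y ≤ ENNReal.ofReal M := by
  have h1 : ∀ r, ∫⁻ x, ENNReal.ofReal (f x) * posKernel p (r, x, y) ∂μ ≤ ENNReal.ofReal M := by
    intro r
    by_cases hr : 0 < r
    · calc ∫⁻ x, ENNReal.ofReal (f x) * posKernel p (r, x, y) ∂μ
          ≤ ∫⁻ x, ENNReal.ofReal M * ENNReal.ofReal (p r y x) ∂μ := by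
            refine lintegral_mono fun x => ?_
            rw [posKernel_of_pos hr, hp.symm hP hr x y]
            exact mul_le_mul_left (ENNReal.ofReal_le_ofReal (hfM x)) _
        _ = ENNReal.ofReal M * ∫⁻ x, ENNReal.ofReal (p r y x) ∂μ :=
            lintegral_const_mul _ (measurable_kernel hp.continuousOn hr y).ennreal_ofReal
        _ ≤ ENNReal.ofReal M * 1 := mul_le_mul_right (hp.lintegral_le_one hP hr y) _
        _ = ENNReal.ofReal M := mul_one _
    · refine le_of_eq_of_le ?_ zero_le
      refine (lintegral_congr fun x => ?_).trans lintegral_zero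
      rw [posKernel, indicator_of_notMem fun h => hr h.1, mul_zero]
  calc averageFlow μ p f j y
      ≤ ∫⁻ r, ENNReal.ofReal (mollifier j (2 * radius j - r)) * ENNReal.ofReal M :=
        lintegral_mono fun r => mul_le_mul_right (h1 r) _
    _ = ENNReal.ofReal M := by
        rw [lintegral_mul_const _
          (contDiff_mollifier_sub j _).continuous.measurable.ennreal_ofReal,
          lintegral_mollifier_sub, one_mul]

/-- The mollifiers are probability densities which concentrate at time zero. -/
theorem tendsto_averageFlow (hp : E.IsContinuousHeatKernel p)
    (hp0 : ∀ f : X → ℝ, Continuous f → HasCompactSupport f → ∀ x : X,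
      Tendsto (fun t : ℝ => ∫ y, p t x y * f y ∂μ) (𝓝[>] 0) (𝓝 (f x)))
    (hP : E.IsHeatSemigroup E.semigroup) (hf : Continuous f) (hfc : HasCompactSupport f)
    (hf0 : ∀ x, 0 ≤ f x) (y : X) :
    Tendsto (fun j => averageFlow μ p f j y) atTop (𝓝 (ENNReal.ofReal (f y))) := by
  refine tendsto_lintegral_mollifier
    ((ENNReal.tendsto_ofReal (hp0 f hf hfc y)).congr' ?_)
  filter_upwards [self_mem_nhdsWithin] with r hr
  have hpc : Continuous (p r y) := hp.continuousOn.comp_continuous (f := fun x : X => (r, y, x))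
    (by fun_prop) fun x => ⟨hr, trivial⟩
  have hi : Integrable (fun x => p r y x * f x) μ :=
    (hpc.mul hf).integrable_of_hasCompactSupport hfc.mul_left
  rw [ofReal_integral_eq_lintegral_ofReal hi
    (Eventually.of_forall fun x => mul_nonneg (hp.nonneg hP hr _ _) (hf0 x))]
  refine lintegral_congr fun x => ?_
  rw [posKernel_of_pos hr, hp.symm hP hr x y, mul_comm, ENNReal.ofReal_mul (hf0 x)]

/-- Tonelli's theorem moves the mollification in time outside of the space integral. -/
theorem IsBoundedSolution.lintegral_initialMeasure (hu : E.IsBoundedSolution T u) {j : ℕ} {b : ℝ}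
    (hj : 3 * radius j < b) (hb : (b : EReal) < T) (hf : Continuous f) (hfc : HasCompactSupport f) :
    ∫⁻ x, ENNReal.ofReal (f x) ∂initialMeasure μ u j
      = ∫⁻ r, ENNReal.ofReal (mollifier j (2 * radius j - r))
        * ∫⁻ x, ENNReal.ofReal (f x) * ENNReal.ofReal (u (r, x)) ∂μ := by
  have hrj := radius_pos j
  have hum := hu.stronglyMeasurable.measurable
  have hmm : Measurable fun r => ENNReal.ofReal (mollifier j (2 * radius j - r)) :=
    (contDiff_mollifier_sub j _).continuous.measurable.ennreal_ofReal
  obtain ⟨M, hM, hMu⟩ := hu.exists_bound _ hfc.isCompact (radius j / 2) b (by linarith)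
    (by linarith) hb
  have h1 : ∀ᵐ x ∂μ, ENNReal.ofReal (mollify j (fun r => u (r, x)) (2 * radius j))
      * ENNReal.ofReal (f x) = ∫⁻ r, ENNReal.ofReal (mollifier j (2 * radius j - r))
        * (ENNReal.ofReal (f x) * ENNReal.ofReal (u (r, x))) := by
    filter_upwards [ae_ae_le_of_ae_ae_le hum hfc.isCompact.isClosed.measurableSet hMu] with x hx
    by_cases hxf : x ∈ tsupport f
    · have hux : Measurable fun r => u (r, x) := hum.comp (by fun_prop)
      have hi : Integrable fun r => mollifier j (2 * radius j - r) • u (r, x) := by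
        refine (((contDiff_mollifier_sub j (2 * radius j)).continuous.integrable_of_hasCompactSupport
          (hasCompactSupport_mollifier_sub j _)).mul_const M).mono'
          ((contDiff_mollifier_sub j _).continuous.measurable.mul hux).aestronglyMeasurable ?_
        filter_upwards [(ae_restrict_iff' measurableSet_Ioo).1 (hx hxf)] with r hr
        by_cases hr' : r ∈ Ioo (radius j / 2) b
        · rw [norm_smul, Real.norm_of_nonneg (mollifier_nonneg _ _), Real.norm_of_nonneg (hu.nonneg _)]
          exact mul_le_mul_of_nonneg_left (hr hr') (mollifier_nonneg _ _)
        · rw [mollifier_sub_eq_zero (by linarith) (by linarith) hr', zero_smul, zero_mul, norm_zero]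
      have him : Measurable fun r =>
          ENNReal.ofReal (mollifier j (2 * radius j - r) • u (r, x)) :=
        ((contDiff_mollifier_sub j _).continuous.measurable.smul hux).ennreal_ofReal
      rw [mollify, ofReal_integral_eq_lintegral_ofReal hi (Eventually.of_forall fun r =>
        mul_nonneg (mollifier_nonneg _ _) (hu.nonneg _)), ← lintegral_mul_const _ him]
      refine lintegral_congr fun r => ?_
      rw [smul_eq_mul, ENNReal.ofReal_mul (mollifier_nonneg _ _), mul_assoc,
        mul_comm (ENNReal.ofReal (u (r, x)))]
    · simp only [image_eq_zero_of_notMem_tsupport hxf, ENNReal.ofReal_zero, mul_zero, zero_mul,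
        lintegral_zero]
  have h2 : Measurable fun w : X × ℝ => ENNReal.ofReal (f w.1) * ENNReal.ofReal (u (w.2, w.1)) :=
    (hf.measurable.comp measurable_fst).ennreal_ofReal.mul (hum.comp (by fun_prop)).ennreal_ofReal
  rw [initialMeasure, lintegral_withDensity_eq_lintegral_mul _
    (measurable_mollify_slice hu.stronglyMeasurable j _).ennreal_ofReal
    hf.measurable.ennreal_ofReal]
  simp only [Pi.mul_apply]
  rw [lintegral_congr_ae h1, lintegral_lintegral_swap
    (((hmm.comp measurable_snd).mul h2).aemeasurable)]
  refine lintegral_congr fun r => ?_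
  exact lintegral_const_mul _ (h2.comp (by fun_prop : Measurable fun x : X => (x, r)))

/-- The approximate initial measures of `P_t ν + h` are the averaged heat flows of `ν`, up to the
contribution of `h`. -/
theorem IsBoundedSolution.lintegral_initialMeasure_eq (hp : E.IsContinuousHeatKernel p)
    (hu : E.IsBoundedSolution T u) {ν : Measure X} [SFinite ν]
    (hdec : ∀ᵐ t ∂volume.restrict (timeIoo 0 T), ∀ᵐ x ∂μ,
      ENNReal.ofReal (u (t, x)) = heatMeasure p ν t x + ENNReal.ofReal (h (t, x)))
    {j : ℕ} {b : ℝ} (hj : 3 * radius j < b) (hb : (b : EReal) < T) (hf : Continuous f)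
    (hfc : HasCompactSupport f) :
    ∫⁻ x, ENNReal.ofReal (f x) ∂initialMeasure μ u j
      = ∫⁻ y, averageFlow μ p f j y ∂ν
        + ∫⁻ r, ENNReal.ofReal (mollifier j (2 * radius j - r))
          * ∫⁻ x, ENNReal.ofReal (f x) * ENNReal.ofReal (h (r, x)) ∂μ := by
  have hQ := measurable_posKernel hp.continuousOn
  have h1 : Measurable fun z : ℝ × X => ENNReal.ofReal (f z.2) * ∫⁻ y, posKernel p (z.1, z.2, y) ∂ν :=
    (hf.measurable.comp measurable_snd).ennreal_ofReal.mul
      ((hQ.comp (by fun_prop : Measurable fun w : (ℝ × X) × X =>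
        (w.1.1, w.1.2, w.2))).lintegral_prod_right')
  have h2 : Measurable fun r : ℝ => ∫⁻ x, ENNReal.ofReal (f x) * ∫⁻ y, posKernel p (r, x, y) ∂ν ∂μ :=
    h1.lintegral_prod_right'
  have h3 : Measurable fun r : ℝ => ENNReal.ofReal (mollifier j (2 * radius j - r))
      * ∫⁻ x, ENNReal.ofReal (f x) * ∫⁻ y, posKernel p (r, x, y) ∂ν ∂μ :=
    (contDiff_mollifier_sub j _).continuous.measurable.ennreal_ofReal.mul h2
  have hI : MeasurableSet (timeIoo 0 T) := measurableSet_Ioo.preimage measurable_coe_real_ereal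
  rw [hu.lintegral_initialMeasure hj hb hf hfc, lintegral_averageFlow hp.continuousOn hf.measurable,
    ← lintegral_add_left h3]
  refine lintegral_congr_ae ?_
  filter_upwards [(ae_restrict_iff' hI).1 hdec] with r hr
  by_cases hrI : r ∈ Ioo 0 b
  · have h4 : Measurable fun x => ENNReal.ofReal (f x) * ∫⁻ y, posKernel p (r, x, y) ∂ν :=
      h1.comp (by fun_prop : Measurable fun x : X => (r, x))
    rw [← mul_add, ← lintegral_add_left h4]
    congr 1
    refine lintegral_congr_ae ?_
    filter_upwards [hr ⟨by exact_mod_cast hrI.1, lt_trans (by exact_mod_cast hrI.2) hb⟩] with x hx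
    rw [hx, mul_add]
    simp only [heatMeasure, posKernel_of_pos hrI.1]
  · rw [mollifier_two_radius_eq_zero hj.le hrI, ENNReal.ofReal_zero, zero_mul, zero_mul, zero_mul,
      add_zero]

/-- Solutions that vanish for nonpositive times do not contribute to the initial measure. -/
theorem IsWeakSolution.tendsto_lintegral_zero (hreg : E.IsRegular) (hnice : E.HasNiceExhaustion)
    (hT : 0 < T) (hh : E.IsWeakSolution (timeIoo ⊥ T) univ h)
    (hh0 : ∀ᵐ t ∂volume.restrict (timeIoo ⊥ T), ∀ᵐ x ∂μ, 0 ≤ h (t, x))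
    (hhi : ∀ᵐ t ∂volume.restrict (Iic (0 : ℝ)), ∀ᵐ x ∂μ, h (t, x) = 0)
    (hf : Continuous f) (hfc : HasCompactSupport f) :
    Tendsto (fun j => ∫⁻ r, ENNReal.ofReal (mollifier j (2 * radius j - r))
      * ∫⁻ x, ENNReal.ofReal (f x) * ENNReal.ofReal (h (r, x)) ∂μ) atTop (𝓝 0) := by
  obtain ⟨b, hb0, hb⟩ := EReal.lt_iff_exists_real_btwn.1 hT
  have hb0' : 0 < b := by exact_mod_cast hb0
  obtain ⟨C, hC⟩ := hfc.exists_bound_of_continuous hf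
  obtain ⟨g, c, hcc, hcs, hcI, hc1, hg⟩ := exists_cutoff hreg hfc.isCompact
  obtain ⟨A, hA, hcA⟩ := exists_compact_superset hcs.isCompact
  obtain ⟨ψ, hψ⟩ := hnice.isNice_univ A hA (subset_univ _)
  obtain ⟨v, hv, hvh⟩ := hh ψ A hA hψ (-1) b fun t ht =>
    ⟨EReal.bot_lt_coe t, lt_of_le_of_lt (by exact_mod_cast ht.2) hb⟩
  have hIT : Ioo (-1) b ⊆ timeIoo ⊥ T := fun t ht =>
    ⟨EReal.bot_lt_coe t, lt_trans (by exact_mod_cast ht.2) hb⟩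
  have hv0 : ∀ᵐ t ∂volume.restrict (Ioo (-1 : ℝ) 0), v t = 0 := by
    filter_upwards [ae_restrict_of_ae_restrict_of_subset
      (Ioo_subset_Ioo_right hb0'.le) hvh, ae_restrict_of_ae_restrict_of_subset
      (fun t ht => mem_Iic.2 ht.2.le) hhi] with t h1 h2
    refine E.toL2_injective (Lp.ext ?_)
    rw [map_zero]
    filter_upwards [h1, h2, Lp.coeFn_zero ℝ 2 μ] with x h3 h4 h5
    rw [h3, h4, h5, mul_zero, Pi.zero_apply]
  have hgs : g ∈ E.supported (tsupport c) := by
    filter_upwards [hg] with x h1 h2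
    rw [h1, image_eq_zero_of_notMem_tsupport h2]
  have hlim := hv.tendsto_zero hb0' hv0 hcs.isCompact hcA hgs
  have hC0 : 0 ≤ max C 0 := le_max_right _ _
  -- the values are controlled by the pairing with the cutoff function
  have hpair : ∀ᵐ r ∂volume.restrict (Ioo (-1) b), 0 ≤ (inner ℝ (E.toL2 (v r)) (E.toL2 g) : ℝ) ∧
      ∫⁻ x, ENNReal.ofReal (f x) * ENNReal.ofReal (h (r, x)) ∂μ
        ≤ ENNReal.ofReal (max C 0) * ENNReal.ofReal (inner ℝ (E.toL2 (v r)) (E.toL2 g)) := by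
    filter_upwards [hvh, ae_restrict_of_ae_restrict_of_subset hIT hh0] with r h1 h2
    have h3 : ∀ᵐ x ∂μ, E.toL2 (v r) x * E.toL2 g x = c x * h (r, x) := by
      filter_upwards [h1, hg] with x h4 h5
      rw [h4, h5]
      by_cases hx : x ∈ tsupport c
      · rw [hψ.eq_one x (interior_subset (hcA hx)), one_mul, mul_comm]
      · rw [image_eq_zero_of_notMem_tsupport hx, mul_zero, zero_mul]
    have h4 : ∀ᵐ x ∂μ, 0 ≤ E.toL2 (v r) x * E.toL2 g x := by
      filter_upwards [h3, h2] with x h5 h6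
      rw [h5]; exact mul_nonneg (hcI x).1 h6
    rw [inner_eq_integral]
    refine ⟨integral_nonneg_of_ae h4, ?_⟩
    rw [ofReal_integral_eq_lintegral_ofReal (integrable_mul _ _) h4,
      ← lintegral_const_mul' _ _ ENNReal.ofReal_ne_top]
    refine lintegral_mono_ae ?_
    filter_upwards [h3, h2] with x h5 h6
    rw [h5, ENNReal.ofReal_mul (hcI x).1, ← mul_assoc, ← ENNReal.ofReal_mul hC0]
    refine mul_le_mul_left (ENNReal.ofReal_le_ofReal ?_) _
    by_cases hx : x ∈ tsupport f
    · rw [hc1 x hx, mul_one]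
      exact (le_abs_self _).trans ((hC x).trans (le_max_left _ _))
    · rw [image_eq_zero_of_notMem_tsupport hx]
      exact mul_nonneg hC0 (hcI x).1
  have hpair' := (ae_restrict_iff' measurableSet_Ioo).1 hpair
  have hlim2 : Tendsto (fun j => ENNReal.ofReal (max C 0) * ENNReal.ofReal
      (∫ r, mollifier j (2 * radius j - r) * inner ℝ (E.toL2 (v r)) (E.toL2 g))) atTop (𝓝 0) := by
    have := ENNReal.Tendsto.const_mul (ENNReal.tendsto_ofReal hlim)
      (Or.inr (ENNReal.ofReal_ne_top (r := max C 0)))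
    rwa [ENNReal.ofReal_zero, mul_zero] at this
  refine tendsto_of_tendsto_of_tendsto_of_le_of_le' tendsto_const_nhds hlim2
    (Eventually.of_forall fun j => zero_le) ?_
  filter_upwards [tendsto_radius.eventually (gt_mem_nhds (show 0 < b / 3 by linarith))] with j hj
  have hj' : 3 * radius j ≤ b := by linarith
  have hz : ∀ r, r ∉ Ioo (-1) b → mollifier j (2 * radius j - r) = 0 := fun r hr =>
    mollifier_two_radius_eq_zero hj' fun h => hr ⟨by linarith [h.1], h.2⟩
  have hi : Integrable fun r => mollifier j (2 * radius j - r)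
      * (inner ℝ (E.toL2 (v r)) (E.toL2 g) : ℝ) := by
    have h1 := (E.ltwoL.flip g).integrable_comp (integrable_mollifier_smul j hv.integrable
      (2 * radius j))
    refine h1.congr (Eventually.of_forall fun r => ?_)
    by_cases hr : r ∈ Ioo (-1) b
    · simp only [indicator_of_mem hr, map_smul, smul_eq_mul]; rfl
    · simp only [hz r hr, zero_smul, map_zero, zero_mul]
  rw [ofReal_integral_eq_lintegral_ofReal hi (by
      filter_upwards [hpair'] with r hr
      by_cases hrI : r ∈ Ioo (-1) b
      · exact mul_nonneg (mollifier_nonneg _ _) (hr hrI).1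
      · simp only [hz r hrI, zero_mul, Pi.zero_apply, le_refl]),
    ← lintegral_const_mul' _ _ ENNReal.ofReal_ne_top]
  refine lintegral_mono_ae ?_
  filter_upwards [hpair'] with r hr
  by_cases hrI : r ∈ Ioo (-1) b
  · rw [ENNReal.ofReal_mul (mollifier_nonneg _ _), mul_left_comm]
    exact mul_le_mul_right (hr hrI).2 _
  · rw [hz r hrI, ENNReal.ofReal_zero, zero_mul]
    exact zero_le

end AverageFlow

end DirichletForm

/-! ### Uniqueness of the initial measure -/

namespace DirichletForm

section Uniqueness

variable {X : Type*} [MetricSpace X] [LocallyCompactSpace X] [SecondCountableTopology X]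
  [MeasurableSpace X] [BorelSpace X]
  {μ : Measure X} [μ.Regular] [μ.IsOpenPosMeasure] {E : DirichletForm μ} {p : ℝ → X → X → ℝ}
  {T : EReal} {u : ℝ × X → ℝ} {f : X → ℝ} {σ : ℕ → ℕ} {ν : Measure X}

theorem _root_.Widder.lintegral_ofReal_ne_top {m : Measure X} [IsFiniteMeasureOnCompacts m]
    (hf : Continuous f) (hfc : HasCompactSupport f) : ∫⁻ x, ENNReal.ofReal (f x) ∂m ≠ ⊤ :=
  (hf.integrable_of_hasCompactSupport hfc).lintegral_lt_top.ne

theorem IsInitialLimit.tendsto_lintegral (hν : IsInitialLimit μ u σ ν) (hf : Continuous f)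
    (hfc : HasCompactSupport f) (hf0 : ∀ x, 0 ≤ f x) :
    Tendsto (fun k => ∫⁻ x, ENNReal.ofReal (f x) ∂initialMeasure μ u (σ k)) atTop
      (𝓝 (∫⁻ x, ENNReal.ofReal (f x) ∂ν)) := by
  have := hν.regular
  have h := ENNReal.tendsto_ofReal (hν.tendsto_integral f hf hfc)
  rw [ofReal_integral_eq_lintegral_ofReal (hf.integrable_of_hasCompactSupport hfc)
    (Eventually.of_forall hf0)] at h
  refine h.congr fun k => ?_
  have := hν.finite k
  exact ofReal_integral_eq_lintegral_ofReal (hf.integrable_of_hasCompactSupport hfc)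
    (Eventually.of_forall hf0)

/-- Dominated convergence, on the compact support of the weight. -/
theorem tendsto_lintegral_mul_averageFlow (hp : E.IsContinuousHeatKernel p)
    (hp0 : ∀ f : X → ℝ, Continuous f → HasCompactSupport f → ∀ x : X,
      Tendsto (fun t : ℝ => ∫ y, p t x y * f y ∂μ) (𝓝[>] 0) (𝓝 (f x)))
    (hP : E.IsHeatSemigroup E.semigroup) (hf : Continuous f) (hfc : HasCompactSupport f)
    (hf0 : ∀ x, 0 ≤ f x) {c : X → ℝ} (hc : Continuous c) (hcc : HasCompactSupport c)
    (hc1 : ∀ x ∈ tsupport f, c x = 1) (ν : Measure X) [IsFiniteMeasureOnCompacts ν] :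
    Tendsto (fun j => ∫⁻ y, ENNReal.ofReal (c y) * averageFlow μ p f j y ∂ν) atTop
      (𝓝 (∫⁻ y, ENNReal.ofReal (f y) ∂ν)) := by
  obtain ⟨M, hM⟩ := hfc.exists_bound_of_continuous hf
  have hcm : Measurable fun y => ENNReal.ofReal (c y) := hc.measurable.ennreal_ofReal
  have h1 : ∀ y, ENNReal.ofReal (f y) = ENNReal.ofReal (c y) * ENNReal.ofReal (f y) := by
    intro y
    by_cases hy : y ∈ tsupport f
    · rw [hc1 y hy, ENNReal.ofReal_one, one_mul]
    · rw [image_eq_zero_of_notMem_tsupport hy, ENNReal.ofReal_zero, mul_zero]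
  rw [lintegral_congr h1]
  refine tendsto_lintegral_of_dominated_convergence
    (fun y => ENNReal.ofReal (c y) * ENNReal.ofReal M)
    (fun j => hcm.mul (measurable_averageFlow hp.continuousOn hf.measurable j))
    (fun j => Eventually.of_forall fun y => mul_le_mul_right
      (averageFlow_le hp hP (fun x => (le_abs_self _).trans (hM x)) j y) _) ?_
    (Eventually.of_forall fun y => ENNReal.Tendsto.const_mul
      (tendsto_averageFlow hp hp0 hP hf hfc hf0 y) (Or.inr ENNReal.ofReal_ne_top))
  rw [lintegral_mul_const _ hcm]
  exact ENNReal.mul_ne_top (lintegral_ofReal_ne_top hc hcc) ENNReal.ofReal_ne_top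

/-- Fatou's lemma for the averaged heat flows, which converge to the test function. -/
theorem IsInitialLimit.le_of_averageFlow_le (hp : E.IsContinuousHeatKernel p)
    (hp0 : ∀ f : X → ℝ, Continuous f → HasCompactSupport f → ∀ x : X,
      Tendsto (fun t : ℝ => ∫ y, p t x y * f y ∂μ) (𝓝[>] 0) (𝓝 (f x)))
    (hP : E.IsHeatSemigroup E.semigroup) (hν : IsInitialLimit μ u σ ν) {ν' : Measure X}
    [ν'.Regular]
    (h : ∀ f : X → ℝ, Continuous f → HasCompactSupport f → ∀ᶠ j in atTop,
      ∫⁻ y, averageFlow μ p f j y ∂ν' ≤ ∫⁻ x, ENNReal.ofReal (f x) ∂initialMeasure μ u j) :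
    ν' ≤ ν := by
  have := hν.regular
  refine le_of_lintegral_le_on_compactlySupported fun f hf hfc hf0 => ?_
  calc ∫⁻ y, ENNReal.ofReal (f y) ∂ν'
      = ∫⁻ y, liminf (fun k => averageFlow μ p f (σ k) y) atTop ∂ν' :=
        lintegral_congr fun y =>
          (((tendsto_averageFlow hp hp0 hP hf hfc hf0 y).comp hν.tendsto).liminf_eq).symm
    _ ≤ liminf (fun k => ∫⁻ y, averageFlow μ p f (σ k) y ∂ν') atTop :=
        lintegral_liminf_le fun k => measurable_averageFlow hp.continuousOn hf.measurable _
    _ ≤ liminf (fun k => ∫⁻ x, ENNReal.ofReal (f x) ∂initialMeasure μ u (σ k)) atTop :=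
        liminf_le_liminf (hν.tendsto.eventually (h f hf hfc))
    _ = ∫⁻ x, ENNReal.ofReal (f x) ∂ν := (hν.tendsto_lintegral hf hfc hf0).liminf_eq

/-- The contribution of the far part of `ν'` to the approximate initial measures is at most that of
the far part of `ν`, so that the local parts compare the other way round. -/
theorem IsInitialLimit.ge_of_averageFlow_add (hp : E.IsContinuousHeatKernel p)
    (hp0 : ∀ f : X → ℝ, Continuous f → HasCompactSupport f → ∀ x : X,
      Tendsto (fun t : ℝ => ∫ y, p t x y * f y ∂μ) (𝓝[>] 0) (𝓝 (f x)))
    (hP : E.IsHeatSemigroup E.semigroup) (hν : IsInitialLimit μ u σ ν) {ν' : Measure X}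
    [ν'.Regular] (hle : ν' ≤ ν)
    (h : ∀ f : X → ℝ, Continuous f → HasCompactSupport f → ∀ᶠ j in atTop,
      ∫⁻ y, averageFlow μ p f j y ∂ν ≤ ∫⁻ x, ENNReal.ofReal (f x) ∂initialMeasure μ u j)
    (h' : ∀ f : X → ℝ, Continuous f → HasCompactSupport f → ∃ R : ℕ → ℝ≥0∞,
      Tendsto R atTop (𝓝 0) ∧ ∀ᶠ j in atTop, ∫⁻ x, ENNReal.ofReal (f x) ∂initialMeasure μ u j
        = ∫⁻ y, averageFlow μ p f j y ∂ν' + R j) :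
    ν ≤ ν' := by
  have := hν.regular
  refine le_of_lintegral_le_on_compactlySupported fun f hf hfc hf0 => ?_
  obtain ⟨c, hc, hcc, -, hcI, hc1⟩ := exists_bump_one (tsupport f) hfc.isCompact univ isOpen_univ
    (subset_univ _)
  obtain ⟨R, hR, hdec⟩ := h' f hf hfc
  have hlim := (tendsto_lintegral_mul_averageFlow hp hp0 hP hf hfc hf0 hc hcc hc1 ν).comp hν.tendsto
  have hlim' := ((tendsto_lintegral_mul_averageFlow hp hp0 hP hf hfc hf0 hc hcc hc1 ν').comp
    hν.tendsto).add (hR.comp hν.tendsto)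
  rw [add_zero] at hlim'
  refine le_of_tendsto_of_tendsto hlim hlim' ?_
  filter_upwards [hν.tendsto.eventually (h f hf hfc), hν.tendsto.eventually hdec] with k h1 h2
  set A := averageFlow μ p f (σ k) with hA
  have hAm : Measurable A := measurable_averageFlow hp.continuousOn hf.measurable _
  have hsplit : ∀ m : Measure X, ∫⁻ y, A y ∂m = ∫⁻ y, ENNReal.ofReal (c y) * A y ∂m
      + ∫⁻ y, ENNReal.ofReal (1 - c y) * A y ∂m := by
    intro m
    have hm : Measurable fun y => ENNReal.ofReal (c y) * A y :=
      hc.measurable.ennreal_ofReal.mul hAm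
    rw [← lintegral_add_left hm]
    refine lintegral_congr fun y => ?_
    rw [← add_mul, ← ENNReal.ofReal_add (hcI y).1 (sub_nonneg.2 (hcI y).2), add_sub_cancel,
      ENNReal.ofReal_one, one_mul]
  have := hν.finite k
  have hI : ∫⁻ x, ENNReal.ofReal (f x) ∂initialMeasure μ u (σ k) ≠ ⊤ :=
    lintegral_ofReal_ne_top hf hfc
  have hN : ∫⁻ y, ENNReal.ofReal (1 - c y) * A y ∂ν' ≤ ∫⁻ y, ENNReal.ofReal (1 - c y) * A y ∂ν :=
    lintegral_mono' hle le_rfl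
  simp only [Function.comp_apply]
  rw [hsplit] at h1 h2
  -- the finite integral of `f` can be cancelled
  refine (ENNReal.add_le_add_iff_right hI).1 ?_
  calc ∫⁻ y, ENNReal.ofReal (c y) * A y ∂ν
        + ∫⁻ x, ENNReal.ofReal (f x) ∂initialMeasure μ u (σ k)
      ≤ ∫⁻ y, ENNReal.ofReal (c y) * A y ∂ν + (∫⁻ y, ENNReal.ofReal (c y) * A y ∂ν'
        + ∫⁻ y, ENNReal.ofReal (1 - c y) * A y ∂ν + R (σ k)) := by
        rw [h2]
        gcongr
    _ = ∫⁻ y, ENNReal.ofReal (c y) * A y ∂ν' + R (σ k) + (∫⁻ y, ENNReal.ofReal (c y) * A y ∂ν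
        + ∫⁻ y, ENNReal.ofReal (1 - c y) * A y ∂ν) := by ring
    _ ≤ _ := by gcongr

/-- The initial measure of a Widder decomposition is determined by the solution. -/
theorem IsInitialLimit.eq_of_decomposition (hreg : E.IsRegular) (hp : E.IsContinuousHeatKernel p)
    (hp0 : ∀ f : X → ℝ, Continuous f → HasCompactSupport f → ∀ x : X,
      Tendsto (fun t : ℝ => ∫ y, p t x y * f y ∂μ) (𝓝[>] 0) (𝓝 (f x)))
    (hP : E.IsHeatSemigroup E.semigroup) (hnice : E.HasNiceExhaustion) (hT : 0 < T)
    (hu : E.IsBoundedSolution T u) (hν : IsInitialLimit μ u σ ν) {h : ℝ × X → ℝ}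
    (hdec : ∀ᵐ t ∂volume.restrict (timeIoo 0 T), ∀ᵐ x ∂μ,
      ENNReal.ofReal (u (t, x)) = heatMeasure p ν t x + ENNReal.ofReal (h (t, x)))
    {ν' : Measure X} [ν'.Regular] {h' : ℝ × X → ℝ}
    (hh : E.IsWeakSolution (timeIoo ⊥ T) univ h')
    (hh0 : ∀ᵐ t ∂volume.restrict (timeIoo ⊥ T), ∀ᵐ x ∂μ, 0 ≤ h' (t, x))
    (hhi : ∀ᵐ t ∂volume.restrict (Iic (0 : ℝ)), ∀ᵐ x ∂μ, h' (t, x) = 0)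
    (hdec' : ∀ᵐ t ∂volume.restrict (timeIoo 0 T), ∀ᵐ x ∂μ,
      ENNReal.ofReal (u (t, x)) = heatMeasure p ν' t x + ENNReal.ofReal (h' (t, x))) :
    ν' = ν := by
  have := hν.regular
  obtain ⟨b, hb0, hb⟩ := EReal.lt_iff_exists_real_btwn.1 hT
  have hb0' : 0 < b := by exact_mod_cast hb0
  have hj : ∀ᶠ j in atTop, 3 * radius j < b := by
    filter_upwards [tendsto_radius.eventually (gt_mem_nhds (show 0 < b / 3 by linarith))] with j hj
    linarith
  have hle : ν' ≤ ν := hν.le_of_averageFlow_le hp hp0 hP fun f hf hfc => by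
    filter_upwards [hj] with j hj
    rw [hu.lintegral_initialMeasure_eq hp hdec' hj hb hf hfc]
    exact le_self_add
  refine le_antisymm hle (hν.ge_of_averageFlow_add hp hp0 hP hle (fun f hf hfc => ?_)
    fun f hf hfc => ⟨_, hh.tendsto_lintegral_zero hreg hnice hT hh0 hhi hf hfc, ?_⟩)
  · filter_upwards [hj] with j hj
    rw [hu.lintegral_initialMeasure_eq hp hdec hj hb hf hfc]
    exact le_self_add
  · filter_upwards [hj] with j hj
    exact hu.lintegral_initialMeasure_eq hp hdec' hj hb hf hfc

end Uniqueness

end DirichletForm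

/-! ### The decomposition -/

section Assembly

variable {X : Type*} [MetricSpace X] [LocallyCompactSpace X] [SecondCountableTopology X]
  [MeasurableSpace X] [BorelSpace X] {μ : Measure X} [μ.Regular]

theorem measurableSet_timeIoo (a b : EReal) : MeasurableSet (timeIoo a b) :=
  measurableSet_Ioo.preimage measurable_coe_real_ereal

/-- No measurability of `P` is needed. -/
theorem ae_restrict_prod_iff {I : Set ℝ} (hI : MeasurableSet I) {P : ℝ × X → Prop} :
    (∀ᵐ z ∂(volume.restrict I).prod μ, P z) ↔
      ∀ᵐ z ∂(volume : Measure ℝ).prod μ, z.1 ∈ I → P z := by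
  have h : (volume.restrict I).prod μ
      = ((volume : Measure ℝ).prod μ).restrict (Prod.fst ⁻¹' I) := by
    rw [← prod_univ, ← Measure.prod_restrict, Measure.restrict_univ]
  rw [h, ae_restrict_iff' (hI.preimage measurable_fst)]
  rfl

namespace DirichletForm

variable [μ.IsOpenPosMeasure] {E : DirichletForm μ} {p : ℝ → X → X → ℝ} {T : EReal}
  {u : ℝ × X → ℝ}

/-- By the parabolic Harnack inequality, a nonnegative local weak solution has a nonnegative
measurable representative that is locally bounded. -/
theorem IsLocalWeakSolution.exists_isBoundedSolution (hH : E.ParabolicHarnack)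
    (hreg : E.IsRegular) (hloc : E.IsStrictlyLocal) (hnice : E.HasNiceExhaustion)
    (hu : E.IsLocalWeakSolution (timeIoo 0 T) univ u)
    (hu0 : ∀ᵐ z ∂(volume.restrict (timeIoo 0 T)).prod μ, 0 ≤ u z) :
    ∃ w, E.IsBoundedSolution T w ∧
      ∀ᵐ z ∂(volume.restrict (timeIoo 0 T)).prod μ, u z = w z := by
  have hum : AEStronglyMeasurable u ((volume.restrict (timeIoo 0 T)).prod μ) := by
    simpa only [Measure.restrict_univ] using hu.aestronglyMeasurable
  have hw : StronglyMeasurable fun z => max (hum.mk u z) 0 :=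
    hum.stronglyMeasurable_mk.sup stronglyMeasurable_const
  have hw0 : ∀ z, 0 ≤ max (hum.mk u z) 0 := fun z => le_max_right _ _
  have huw : ∀ᵐ z ∂(volume.restrict (timeIoo 0 T)).prod μ, u z = max (hum.mk u z) 0 := by
    filter_upwards [hum.ae_eq_mk, hu0] with z h1 h2
    rw [← h1, max_eq_left h2]
  have hws : E.IsWeakSolution (timeIoo 0 T) univ fun z => max (hum.mk u z) 0 := by
    refine (hu.isWeakSolution hreg hloc).congr ?_
    filter_upwards [Measure.ae_ae_of_ae_prod huw] with t ht
    filter_upwards [ht] with x hx _ using hx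
  refine ⟨_, ⟨hw, hw0, hws, fun K hK a b ha hab hb => ?_⟩, huw⟩
  obtain ⟨U, hU, hUX, hUn⟩ := id hnice
  obtain ⟨n, hn⟩ := exists_subset_of_exhaustion hU (fun n => (hUn n).1) hUX hK
  obtain ⟨r, hbr, hr⟩ := EReal.lt_iff_exists_real_btwn.1 hb
  have hJ : Ioo (a / 2) r ⊆ timeIoo 0 T := fun t ht =>
    ⟨by exact_mod_cast (half_pos ha).trans ht.1, lt_trans (by exact_mod_cast ht.2) hr⟩
  obtain ⟨M, hM⟩ := hH.exists_local_bound hreg hloc (hUn n).1 (hUn n).2.2.1 (hUn n).2.2.2 hK hn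
    (half_lt_self ha) hab (by exact_mod_cast hbr) hw
    (hws.mono hJ (subset_univ _))
    (Eventually.of_forall fun t => Eventually.of_forall fun x _ => hw0 _)
  exact ⟨M, M.2, ae_restrict_of_ae_restrict_of_subset Ioo_subset_Icc_self hM⟩

/-- The initial limit and the residual form a decomposition. -/
theorem IsInitialLimit.isWidderDecomposition (hH : E.ParabolicHarnack) (hreg : E.IsRegular)
    (hloc : E.IsStrictlyLocal) (hp : E.IsContinuousHeatKernel p)
    (hP : E.IsHeatSemigroup E.semigroup) (hnice : E.HasNiceExhaustion) (hT : 0 < T)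
    {w : ℝ × X → ℝ} (hw : E.IsBoundedSolution T w)
    (huw : ∀ᵐ z ∂(volume.restrict (timeIoo 0 T)).prod μ, u z = w z)
    {σ : ℕ → ℕ} {ν : Measure X} (hν : IsInitialLimit μ w σ ν) :
    E.IsWidderDecomposition p T u ν (residual p ν u) := by
  have := hν.regular
  obtain ⟨hfin, hsol, hpos⟩ := hν.residual_spec hH hreg hloc hp hP hnice hT hw
  have hrm : Measurable (residual p ν w) := measurable_residual hp ν hw.stronglyMeasurable.measurable
  have huw' := (ae_restrict_prod_iff (measurableSet_timeIoo 0 T)).1 huw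
  have hr : ∀ᵐ z ∂(volume.restrict (timeIoo ⊥ T)).prod μ, residual p ν w z = residual p ν u z := by
    rw [ae_restrict_prod_iff (measurableSet_timeIoo ⊥ T)]
    filter_upwards [huw'] with z hz hzT
    rw [residual, residual]
    split_ifs with h0
    · rfl
    · rw [hz ⟨by exact_mod_cast not_le.1 h0, hzT.2⟩]
  have hpos' : ∀ᵐ z ∂(volume.restrict (timeIoo ⊥ T)).prod μ, 0 ≤ residual p ν w z :=
    (Measure.ae_prod_iff_ae_ae (measurableSet_le measurable_const hrm)).2 hpos
  have hposu : ∀ᵐ z ∂(volume.restrict (timeIoo ⊥ T)).prod μ, 0 ≤ residual p ν u z := by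
    filter_upwards [hr, hpos'] with z h1 h2
    rwa [← h1]
  refine ⟨hν.regular, ?_, hposu, ?_, ?_⟩
  · have hI : timeIoo ⊥ T = ((↑) : ℝ → EReal) ⁻¹' Ioo ⊥ T := rfl
    refine (hsol.congr ?_).isLocalWeakSolution hreg hloc
      (isOpen_Ioo.preimage continuous_coe_real_ereal)
      (ordConnected_Ioo.preimage_mono fun _ _ h => EReal.coe_le_coe_iff.2 h)
      ⟨0, EReal.bot_lt_coe 0, hT⟩ isOpen_univ hnice.isNice_univ ?_
    · filter_upwards [Measure.ae_ae_of_ae_prod hr] with t ht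
      filter_upwards [ht] with x hx _ using hx
    · rw [Measure.restrict_univ]
      exact hrm.aestronglyMeasurable.congr hr
  · rw [ae_restrict_prod_iff measurableSet_Iic]
    exact Eventually.of_forall fun z hz => if_pos hz
  · rw [ae_restrict_prod_iff (measurableSet_timeIoo 0 T)]
    filter_upwards [(ae_restrict_prod_iff (measurableSet_timeIoo ⊥ T)).1 hposu] with z h1 hz
    have h2 := h1 ⟨EReal.bot_lt_coe _, hz.2⟩
    rw [← ENNReal.ofReal_toReal (hfin z.1 hz z.2), ← ENNReal.ofReal_add ENNReal.toReal_nonneg h2,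
      residual, if_neg (not_le.2 (by exact_mod_cast hz.1)), add_sub_cancel]

/-- The heat flow of the common measure is finite, so it can be subtracted. -/
theorem IsWidderDecomposition.ae_eq {ν : Measure X} {h h' : ℝ × X → ℝ}
    (hd : E.IsWidderDecomposition p T u ν h) (hd' : E.IsWidderDecomposition p T u ν h')
    (hfin : ∀ t ∈ timeIoo 0 T, ∀ x, heatMeasure p ν t x ≠ ⊤) :
    h' =ᵐ[(volume.restrict (timeIoo ⊥ T)).prod μ] h := by
  have hI := measurableSet_timeIoo
  rw [EventuallyEq, ae_restrict_prod_iff (hI ⊥ T)]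
  filter_upwards [(ae_restrict_prod_iff (hI ⊥ T)).1 hd.nonneg,
    (ae_restrict_prod_iff (hI ⊥ T)).1 hd'.nonneg,
    (ae_restrict_prod_iff measurableSet_Iic).1 hd.initial,
    (ae_restrict_prod_iff measurableSet_Iic).1 hd'.initial,
    (ae_restrict_prod_iff (hI 0 T)).1 hd.eq_add,
    (ae_restrict_prod_iff (hI 0 T)).1 hd'.eq_add] with z h1 h2 h3 h4 h5 h6 hz
  rcases le_or_gt z.1 0 with h0 | h0
  · rw [h3 h0, h4 h0]
  · have hz' : z.1 ∈ timeIoo 0 T := ⟨by exact_mod_cast h0, hz.2⟩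
    have h7 := (h6 hz').symm.trans (h5 hz')
    rwa [ENNReal.add_right_inj (hfin z.1 hz' z.2), ENNReal.ofReal_eq_ofReal_iff (h2 hz) (h1 hz)]
      at h7

theorem IsWidderDecomposition.ae_ae_eq_add {ν : Measure X} {h w : ℝ × X → ℝ}
    (hd : E.IsWidderDecomposition p T u ν h)
    (huw : ∀ᵐ z ∂(volume.restrict (timeIoo 0 T)).prod μ, u z = w z) :
    ∀ᵐ t ∂volume.restrict (timeIoo 0 T), ∀ᵐ x ∂μ,
      ENNReal.ofReal (w (t, x)) = heatMeasure p ν t x + ENNReal.ofReal (h (t, x)) := by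
  filter_upwards [Measure.ae_ae_of_ae_prod hd.eq_add, Measure.ae_ae_of_ae_prod huw] with t h1 h2
  filter_upwards [h1, h2] with x h3 h4
  rw [← h4, h3]

end DirichletForm

end Assembly

end Widder

theorem theorem6p2 {X : Type*} [MetricSpace X] [TopologicalSpace.SeparableSpace X]
    [LocallyCompactSpace X] [ConnectedSpace X] [LocallyConnectedSpace X]
    [MeasurableSpace X] [BorelSpace X]
    (μ : Measure X) [μ.Regular] [μ.IsOpenPosMeasure]
    (E : Widder.DirichletForm μ) (hreg : E.IsRegular) (hloc : E.IsStrictlyLocal)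
    (hharnack : E.ParabolicHarnack)
    (p : ℝ → X → X → ℝ) (hp : E.IsContinuousHeatKernel p)
    (hp_zero : ∀ f : X → ℝ, Continuous f → HasCompactSupport f → ∀ x : X,
      Tendsto (fun t : ℝ => ∫ y, p t x y * f y ∂μ) (𝓝[>] 0) (𝓝 (f x)))
    (hnice : E.HasNiceExhaustion)
    (T : EReal) (hT : 0 < T)
    (u : ℝ × X → ℝ) (hu : E.IsLocalWeakSolution (Widder.timeIoo 0 T) univ u)
    (hu_nonneg : ∀ᵐ z ∂(volume.restrict (Widder.timeIoo 0 T)).prod μ, 0 ≤ u z) :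
    ∃ (ν : Measure X) (h : ℝ × X → ℝ),
      E.IsWidderDecomposition p T u ν h ∧
      (∀ t : ℝ, t ≤ 0 → ∀ x : X, h (t, x) = 0) ∧
      (∀ t ∈ Widder.timeIoo 0 T, ∀ x : X,
        Widder.heatMeasure p ν t x ≠ ⊤ ∧
          u (t, x) = (Widder.heatMeasure p ν t x).toReal + h (t, x)) ∧
      ∀ (ν' : Measure X) (h' : ℝ × X → ℝ), E.IsWidderDecomposition p T u ν' h' →
        ν' = ν ∧ h' =ᵐ[(volume.restrict (Widder.timeIoo ⊥ T)).prod μ] h := by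
  have : SecondCountableTopology X := UniformSpace.secondCountable_of_separable X
  have hP := hp.isHeatSemigroup hp_zero
  obtain ⟨w, hw, huw⟩ := hu.exists_isBoundedSolution hharnack hreg hloc hnice hu_nonneg
  obtain ⟨σ, ν, hν⟩ := hw.exists_isInitialLimit hreg hp hp_zero hP hnice hT
  have hfin := (hν.residual_spec hharnack hreg hloc hp hP hnice hT hw).1
  have hd := hν.isWidderDecomposition hharnack hreg hloc hp hP hnice hT hw huw
  refine ⟨ν, Widder.DirichletForm.residual p ν u, hd, fun t ht x => if_pos ht, fun t ht x => ⟨hfin t ht x, ?_⟩,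
    fun ν' h' hd' => ?_⟩
  · rw [Widder.DirichletForm.residual, if_neg (not_le.2 (by exact_mod_cast ht.1)), add_sub_cancel]
  · have := hd'.regular
    obtain rfl : ν' = ν := hν.eq_of_decomposition hreg hp hp_zero hP hnice hT hw
      (hd.ae_ae_eq_add huw) (hd'.solution.isWeakSolution hreg hloc)
      (Measure.ae_ae_of_ae_prod hd'.nonneg) (Measure.ae_ae_of_ae_prod hd'.initial)
      (hd'.ae_ae_eq_add huw)
    exact ⟨rfl, hd.ae_eq hd' hfin⟩
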